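/- Let $k$ be a field of characteristic $0$. A dGBV algebra $(A,\circ,d,\Delta)$ over $k$ is a unital supercommutative $k$-algebra with two odd operators $d,\Delta$ such that $d^2=\Delta^2=d\Delta+\Delta d=0$, $d$ is a derivation and $\Delta$ is a differential operator of order two, i.e. for homogeneous $a,b,c$ $$\Delta(abc)=\Delta(ab)c+(-1)^{\tilde b(\tilde a+1)}b\Delta(ac)+(-1)^{\tilde a}a\Delta(bc)-\Delta(a)bc-(-1)^{\tilde a}a\Delta(b)c-(-1)^{\tilde a+\tilde b}ab\Delta(c).$$ Put $[a\bullet b]=(-1)^{\tilde a}\Delta(ab)-(-1)^{\tilde a}\Delta(a)b-a\Delta(b)$, $\ a\bullet b=(-1)^{\tilde a}\Delta(ab)-a\Delta(b)$, and let $\mathfrak g=(A,[\,\bullet\,],d)$ be the associated differential (odd) Lie superalgebra. For a dg Artin superalgebra $(B,d_B)$ with residue field $k$ and maximal ideal $\mathfrak m_B$, let $\mathrm{Def}_{\mathfrak g}(B)$ be the set of even $\gamma\in \mathfrak g\otimes\mathfrak m_B$ with $d\gamma+d_B\gamma+\frac12[\gamma\bullet\gamma]=0$, modulo the gauge action $\gamma\mapsto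 e^{\mathrm{ad}_g}\gamma-\frac{e^{\mathrm{ad}_g}-1}{\mathrm{ad}_g}(d+d_B)g$ of odd $g\in\mathfrak g\otimes\mathfrak m_B$. A formal pointed supermanifold $(V,0)$ is given by its points $(V\otimes\mathfrak m_B)_{\tilde 0}$, naturally in $B$. A mini-versal dg manifold for $\mathrm{Def}_{\mathfrak g}$ is a formal pointed supermanifold $M$ with an odd homological vector field $\eth$ vanishing at the base point $*$ and a morphism of pointed dg manifolds $\Gamma:(M,*,\eth)\to(\mathfrak g,0,Q_{\mathfrak g})$, where $Q_{\mathfrak g}(\gamma)=d\gamma+\frac12[\gamma\bullet\gamma]$, whose differential at $*$ takes values in $\mathrm{Ker}\,d$ and induces an isomorphism $T_*M\cong H(A,d)$. Assume that $$\mathrm{Im}\,d\cap\mathrm{Ker}\,\Delta=\mathrm{Im}\,\Delta\cap\mathrm{Ker}\,d=\mathrm{Im}\,d\cap\mathrm{Im}\,\Delta .$$ (i) $\mathrm{Def}_{\mathfrak g}$ is non-obstructed: there is a mini-versal dg manifold modelled on $(H(A,d),0)$ with $\eth=0$, and every mini-versal dg manifold $(M,*,\eth,\Gamma)$ has $\eth=0$.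 Moreover, $\Gamma$ then identifies $\mathrm{Def}_{\mathfrak g}$ with the functor defined by $(M,*)\cong(H(A,d),0)$: for every dg Artin superalgebra $B$ the map $x\mapsto[\Gamma(x)]$ from the $d_B$-closed $B$-points of $M$ to $\mathrm{Def}_{\mathfrak g}(B)$ is defined, natural in $B$ and surjective, and two points have the same image if and only if they differ by $d_Bh$ for an odd $h\in T_*M\otimes\mathfrak m_B$. In particular, on Artin superalgebras with $d_B=0$ it is a natural bijection from the $B$-points of $M$ to $\mathrm{Def}_{\mathfrak g}(B)$. (ii) Let $E_\hbar\to M$ be the local system defined by $\mathfrak m_\hbar=(A((\hbar)),\,d+\hbar\Delta,\,\bullet)$, whose fibre over a $B$-point $x$ of $M$ (for an Artin superalgebra $B$) is the cohomology of $d+\hbar\Delta+\Gamma(x)\,\bullet$ on $B\otimes A((\hbar))$. This fibre is isomorphic to $B\otimes H(A,d)((\hbar))$ by an even isomorphism linear over $B$ and over $k[\hbar,\hbar^{-1}]$; in particular, the fibre over the base point is isomorphic to $H(A,d)((\hbar))$. If moreover $\mathrm{Im}\,d\cap\mathrm{Im}\,\Delta=\mathrm{Im}\,d\Delta$, the same holds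 with the Laurent series $V((\hbar))$ replaced by the space $V[[\hbar,\hbar^{-1}]]$ of all formal series $\sum_{n\in\mathbb Z}v_n\hbar^n$ (for $V=A$ and $V=H(A,d)$). -/

import Mathlib

open scoped TensorProduct

universe u v w

noncomputable section

namespace SemiInf

/-! ### Super vector spaces

A super vector space is a `k`-module `V` with a decomposition `𝒱 : ZMod 2 → Submodule k V`. -/

section Super

variable {k : Type u} [Field k] {V : Type v} [AddCommGroup V] [Module k V]

/-- The projection of a super vector space onto its part of parity `i`. -/
def proj (𝒱 : ZMod 2 → Submodule k V) [DirectSum.Decomposition 𝒱] (i : ZMod 2) : V →ₗ[k] V :=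
  (𝒱 i).subtype ∘ₗ DirectSum.component k (ZMod 2) (fun j => 𝒱 j) i ∘ₗ
    (DirectSum.decomposeLinearEquiv 𝒱).toLinearMap

/-- The parity involution `a ↦ (-1)^ã a`. -/
def par (𝒱 : ZMod 2 → Submodule k V) [DirectSum.Decomposition 𝒱] : V →ₗ[k] V :=
  proj 𝒱 0 - proj 𝒱 1

theorem proj_of_mem (𝒱 : ZMod 2 → Submodule k V) [DirectSum.Decomposition 𝒱]
    {i j : ZMod 2} {x : V} (hx : x ∈ 𝒱 i) : proj 𝒱 j x = if i = j then x else 0 := by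
  have h : proj 𝒱 j x = ((DirectSum.decompose 𝒱 x) j : V) := rfl
  rw [h]
  split_ifs with hij
  · subst hij
    exact DirectSum.decompose_of_mem_same 𝒱 hx
  · exact DirectSum.decompose_of_mem_ne 𝒱 hx hij

theorem proj_mem (𝒱 : ZMod 2 → Submodule k V) [DirectSum.Decomposition 𝒱]
    (i : ZMod 2) (x : V) : proj 𝒱 i x ∈ 𝒱 i :=
  ((DirectSum.decompose 𝒱 x) i).2

theorem proj_add_proj (𝒱 : ZMod 2 → Submodule k V) [DirectSum.Decomposition 𝒱] (x : V) :
    proj 𝒱 0 x + proj 𝒱 1 x = x := by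
  classical
  have h := DirectSum.sum_support_decompose 𝒱 x
  have h2 : ∑ i : ZMod 2, ((DirectSum.decompose 𝒱 x) i : V) = x := by
    rw [← h]
    symm
    rw [h]
    conv_lhs => rw [← h]
    refine Finset.sum_subset (Finset.subset_univ _) ?_
    intro i _ hi
    simpa using hi
  have h3 : (Finset.univ : Finset (ZMod 2)) = {0, 1} := by decide
  rw [h3, Finset.sum_pair (by decide)] at h2
  exact h2

/-- The cohomology `Ker D / Im D` of an endomorphism `D` (with `D ∘ D = 0`). -/
abbrev Coh (D : V →ₗ[k] V) : Type v :=
  (LinearMap.ker D) ⧸ (LinearMap.range D).comap (LinearMap.ker D).subtype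

/-- The cohomology of `D` on a `D`-stable subspace `L`. -/
abbrev CohOn (L : Submodule k V) (D : V →ₗ[k] V) : Type v :=
  (LinearMap.ker D ⊓ L : Submodule k V) ⧸
    (L.map D).comap (LinearMap.ker D ⊓ L : Submodule k V).subtype

/-- The class in `H(V, D)` of a cocycle. -/
def Coh.mk (D : V →ₗ[k] V) (x : V) (hx : D x = 0) : Coh D :=
  Submodule.Quotient.mk (⟨x, hx⟩ : LinearMap.ker D)

/-- The induced grading of `H(V, D)`: classes of homogeneous cocycles. -/
def cohGr (𝒱 : ZMod 2 → Submodule k V) (D : V →ₗ[k] V) (i : ZMod 2) : Submodule k (Coh D) :=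
  ((𝒱 i).comap (LinearMap.ker D).subtype).map
    ((LinearMap.range D).comap (LinearMap.ker D).subtype).mkQ

end Super

/-! ### Artin superalgebras and dg Artin superalgebras -/

/-- An Artin superalgebra over `k`: a finite-dimensional supercommutative unital `k`-algebra
that is local with residue field `k`; the maximal ideal is the (nilpotent) kernel of `aug`. -/
structure ArtinSuperalgebra (k : Type u) [Field k] where
  carrier : Type u
  [ring : Ring carrier]
  [algebra : Algebra k carrier]
  gr : ZMod 2 → Submodule k carrier
  [graded : GradedAlgebra gr]
  [finite : FiniteDimensional k carrier]
  supercomm : ∀ i j : ZMod 2, ∀ a ∈ gr i, ∀ b ∈ gr j,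
    a * b = (-1 : k) ^ (i.val * j.val) • (b * a)
  aug : carrier →ₐ[k] k
  nilpotent : ∃ n : ℕ, (LinearMap.ker aug.toLinearMap) ^ n = ⊥

attribute [instance] ArtinSuperalgebra.ring ArtinSuperalgebra.algebra
  ArtinSuperalgebra.graded ArtinSuperalgebra.finite

section Artin

variable {k : Type u} [Field k]

/-- The maximal ideal. -/
def ArtinSuperalgebra.maxIdeal (B : ArtinSuperalgebra k) : Submodule k B.carrier :=
  LinearMap.ker B.aug.toLinearMap

/-- Morphisms of Artin superalgebras: even unital local algebra homomorphisms. -/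
structure ArtinSuperalgebra.Hom (B C : ArtinSuperalgebra k) where
  toAlgHom : B.carrier →ₐ[k] C.carrier
  map_gr : ∀ i, ∀ b ∈ B.gr i, toAlgHom b ∈ C.gr i
  map_aug : ∀ b, C.aug (toAlgHom b) = B.aug b

end Artin

/-- A dg Artin superalgebra: an Artin superalgebra with an odd derivation of square zero
which preserves the maximal ideal. -/
structure DGArtin (k : Type u) [Field k] extends ArtinSuperalgebra k where
  diff : carrier →ₗ[k] carrier
  diff_odd : ∀ i, ∀ b ∈ gr i, diff b ∈ gr (i + 1)
  diff_sq : ∀ b, diff (diff b) = 0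
  leibniz : ∀ a b, diff (a * b) = diff a * b + par gr a * diff b
  diff_aug : ∀ b, aug (diff b) = 0

/-- Morphisms of dg Artin superalgebras. -/
structure DGArtin.Hom {k : Type u} [Field k] (B C : DGArtin k) extends
    ArtinSuperalgebra.Hom B.toArtinSuperalgebra C.toArtinSuperalgebra where
  map_diff : ∀ b, toAlgHom (B.diff b) = C.diff (toAlgHom b)

/-! ### Tensoring with an Artin superalgebra

We write `B ⊗ V` with the coefficients on the left; signs are given by the Koszul rule. -/

section Points

variable {k : Type u} [Field k]
variable {U : Type v} [AddCommGroup U] [Module k U]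
variable {V : Type v} [AddCommGroup V] [Module k V]
variable {W : Type v} [AddCommGroup W] [Module k W]

/-- The part of parity `i` of `m_B ⊗ V`. For `i = 0` these are the `B`-points of the formal
pointed supermanifold `(V, 0)`. -/
def pts (𝒱 : ZMod 2 → Submodule k V) (B : ArtinSuperalgebra k) (i : ZMod 2) :
    Submodule k (B.carrier ⊗[k] V) :=
  Submodule.span k {t | ∃ (p q : ZMod 2) (β : B.carrier) (x : V), p + q = i ∧ β ∈ B.gr p ∧
    β ∈ B.maxIdeal ∧ x ∈ 𝒱 q ∧ t = β ⊗ₜ[k] x}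

/-- The part of parity `i` of `B ⊗ V`. -/
def tensorGr (𝒱 : ZMod 2 → Submodule k V) (B : ArtinSuperalgebra k) (i : ZMod 2) :
    Submodule k (B.carrier ⊗[k] V) :=
  Submodule.span k {t | ∃ (p q : ZMod 2) (β : B.carrier) (x : V), p + q = i ∧ β ∈ B.gr p ∧
    x ∈ 𝒱 q ∧ t = β ⊗ₜ[k] x}

/-- Base change `B ⊗ V → C ⊗ V`. -/
def baseMap (V : Type v) [AddCommGroup V] [Module k V] {B C : ArtinSuperalgebra k}
    (f : B.Hom C) : B.carrier ⊗[k] V →ₗ[k] C.carrier ⊗[k] V :=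
  LinearMap.rTensor V f.toAlgHom.toLinearMap

/-- Left multiplication by `β ∈ B` on `B ⊗ V`. -/
def lmul (V : Type v) [AddCommGroup V] [Module k V] (B : ArtinSuperalgebra k)
    (β : B.carrier) : B.carrier ⊗[k] V →ₗ[k] B.carrier ⊗[k] V :=
  LinearMap.rTensor V (LinearMap.mulLeft k β)

/-- The extension of an odd linear map: `β ⊗ x ↦ (-1)^β̃ β ⊗ T x`. -/
def oddExt (B : ArtinSuperalgebra k) (T : V →ₗ[k] W) :
    B.carrier ⊗[k] V →ₗ[k] B.carrier ⊗[k] W :=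
  TensorProduct.map (par B.gr) T

/-- The extension of an odd bilinear operation:
`(β ⊗ a, β' ⊗ b) ↦ (-1)^{(ã + 1) β̃'} β β' ⊗ op a b`. -/
def oddExt₂ (B : ArtinSuperalgebra k) (𝒰 : ZMod 2 → Submodule k U)
    [DirectSum.Decomposition 𝒰] (op : U →ₗ[k] V →ₗ[k] W) :
    B.carrier ⊗[k] U →ₗ[k] B.carrier ⊗[k] V →ₗ[k] B.carrier ⊗[k] W :=
  TensorProduct.map₂ ((LinearMap.mul k B.carrier).compl₂ (proj B.gr 0)) op +
    TensorProduct.map₂ ((LinearMap.mul k B.carrier).compl₂ (proj B.gr 1))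
      (op ∘ₗ (proj 𝒰 1 - proj 𝒰 0))

theorem baseMap_mem_pts (𝒱 : ZMod 2 → Submodule k V) {B C : ArtinSuperalgebra k}
    (f : B.Hom C) (i : ZMod 2) {x : B.carrier ⊗[k] V} (hx : x ∈ pts 𝒱 B i) :
    baseMap V f x ∈ pts 𝒱 C i := by
  induction hx using Submodule.span_induction with
  | mem t ht =>
    obtain ⟨p, q, β, y, hpq, hβ, hm, hy, rfl⟩ := ht
    refine Submodule.subset_span ⟨p, q, f.toAlgHom β, y, hpq, f.map_gr p β hβ, ?_, hy, ?_⟩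
    · have : B.aug β = 0 := hm
      change C.aug (f.toAlgHom β) = 0
      rw [f.map_aug, this]
    · simp [baseMap]
  | zero => simp
  | add a b _ _ ha hb => rw [map_add]; exact Submodule.add_mem _ ha hb
  | smul c a _ ha => rw [map_smul]; exact Submodule.smul_mem _ c ha

theorem map_proj {B C : ArtinSuperalgebra k} (f : B.Hom C) (i : ZMod 2) (b : B.carrier) :
    f.toAlgHom (proj B.gr i b) = proj C.gr i (f.toAlgHom b) := by
  conv_rhs => rw [← proj_add_proj B.gr b, map_add, map_add]
  have h0 := f.map_gr 0 _ (proj_mem B.gr 0 b)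
  have h1 := f.map_gr 1 _ (proj_mem B.gr 1 b)
  rw [proj_of_mem C.gr h0, proj_of_mem C.gr h1]
  have hi : i = 0 ∨ i = 1 := by revert i; decide
  rcases hi with rfl | rfl <;> simp

theorem baseMap_oddExt {B C : ArtinSuperalgebra k} (f : B.Hom C) (T : V →ₗ[k] W)
    (x : B.carrier ⊗[k] V) : baseMap W f (oddExt B T x) = oddExt C T (baseMap V f x) := by
  induction x using TensorProduct.induction_on with
  | zero => simp
  | tmul β x => simp [baseMap, oddExt, par, map_proj]
  | add a b ha hb => simp only [map_add, ha, hb]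

theorem baseMap_oddExt₂ {B C : ArtinSuperalgebra k} (f : B.Hom C)
    (𝒰 : ZMod 2 → Submodule k U) [DirectSum.Decomposition 𝒰] (op : U →ₗ[k] V →ₗ[k] W)
    (x : B.carrier ⊗[k] U) (y : B.carrier ⊗[k] V) :
    baseMap W f (oddExt₂ B 𝒰 op x y) = oddExt₂ C 𝒰 op (baseMap U f x) (baseMap V f y) := by
  induction x using TensorProduct.induction_on with
  | zero => simp
  | add a b ha hb => simp only [map_add, LinearMap.add_apply, ha, hb]
  | tmul β x =>
    induction y using TensorProduct.induction_on with
    | zero => simp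
    | add a b ha hb => simp only [map_add, ha, hb]
    | tmul β' y => simp [baseMap, oddExt₂, map_proj]

/-- The action of a morphism of Artin superalgebras on points. -/
def ptsMap (𝒱 : ZMod 2 → Submodule k V) {B C : ArtinSuperalgebra k} (f : B.Hom C)
    (i : ZMod 2) (x : pts 𝒱 B i) : pts 𝒱 C i :=
  ⟨baseMap V f x, baseMap_mem_pts 𝒱 f i x.2⟩

/-- A formal `W`-valued function of parity `p` on the formal pointed supermanifold `(V, 0)`
which vanishes at the base point, given through its values on `B`-points, naturally in the
Artin superalgebra `B`. For `p = 0` this is a morphism of formal pointed supermanifolds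
`(V, 0) → (W, 0)`; for `W = V` and `p = 1` it is an odd vector field on `(V, 0)` vanishing at
the base point. -/
structure FormalMap (𝒱 : ZMod 2 → Submodule k V) (𝒲 : ZMod 2 → Submodule k W)
    (p : ZMod 2) where
  app : ∀ B : ArtinSuperalgebra k, pts 𝒱 B 0 → pts 𝒲 B p
  natural : ∀ (B C : ArtinSuperalgebra k) (f : B.Hom C) (x : pts 𝒱 B 0),
    app C (ptsMap 𝒱 f 0 x) = ptsMap 𝒲 f p (app B x)

/-- The zero vector field (or map). -/
def FormalMap.zero (𝒱 : ZMod 2 → Submodule k V) (𝒲 : ZMod 2 → Submodule k W)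
    (p : ZMod 2) : FormalMap 𝒱 𝒲 p where
  app _ _ := 0
  natural _ _ f _ := by
    apply Subtype.ext
    simp [ptsMap]

end Points

/-! ### The deformation functor of a differential (odd) Lie superalgebra -/

section Deformation

variable {k : Type u} [Field k]
variable {G : Type v} [AddCommGroup G] [Module k G]

/-- `dγ + ½[γ • γ]` on `B ⊗ G`: the value at `γ` of the homological vector field of `G`. -/
def curv (𝒢 : ZMod 2 → Submodule k G) [DirectSum.Decomposition 𝒢] (d : G →ₗ[k] G)
    (br : G →ₗ[k] G →ₗ[k] G) (B : ArtinSuperalgebra k) (γ : B.carrier ⊗[k] G) :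
    B.carrier ⊗[k] G :=
  oddExt B d γ + (2 : k)⁻¹ • oddExt₂ B 𝒢 br γ γ

/-- The differential `d_B` of a dg Artin superalgebra on `B ⊗ V`. -/
def coeffDiff (V : Type v) [AddCommGroup V] [Module k V] (B : DGArtin k) :
    B.carrier ⊗[k] V →ₗ[k] B.carrier ⊗[k] V :=
  LinearMap.rTensor V B.diff

/-- Solutions of the Maurer-Cartan equation `dγ + d_B γ + ½[γ • γ] = 0` in the even part of
`m_B ⊗ G`. -/
def MC (𝒢 : ZMod 2 → Submodule k G) [DirectSum.Decomposition 𝒢] (d : G →ₗ[k] G)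
    (br : G →ₗ[k] G →ₗ[k] G) (B : DGArtin k) : Type (max u v) :=
  {γ : pts 𝒢 B.toArtinSuperalgebra 0 //
    coeffDiff G B γ + curv 𝒢 d br B.toArtinSuperalgebra γ = 0}

/-- The `N`-th partial sum of
`e^{ad_g} γ - ((e^{ad_g} - 1) / ad_g) (d + d_B) g`. -/
def gaugeSum (𝒢 : ZMod 2 → Submodule k G) [DirectSum.Decomposition 𝒢] (d : G →ₗ[k] G)
    (br : G →ₗ[k] G →ₗ[k] G) (B : DGArtin k) (g γ : B.carrier ⊗[k] G) (N : ℕ) :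
    B.carrier ⊗[k] G :=
  ∑ i ∈ Finset.range N, ((i.factorial : k)⁻¹ •
      ((oddExt₂ B.toArtinSuperalgebra 𝒢 br g) ^ i) γ -
    ((i + 1).factorial : k)⁻¹ • ((oddExt₂ B.toArtinSuperalgebra 𝒢 br g) ^ i)
      (oddExt B.toArtinSuperalgebra d g + coeffDiff G B g))

/-- Gauge equivalence: `γ'` is obtained from `γ` by the gauge transformation of an odd element
`g` of `m_B ⊗ G`. As `ad_g` is nilpotent, the series terminates; `γ'` is its value. -/
def GaugeRel (𝒢 : ZMod 2 → Submodule k G) [DirectSum.Decomposition 𝒢] (d : G →ₗ[k] G)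
    (br : G →ₗ[k] G →ₗ[k] G) (B : DGArtin k) (γ γ' : MC 𝒢 d br B) : Prop :=
  ∃ g : pts 𝒢 B.toArtinSuperalgebra 1, ∀ᶠ N in Filter.atTop,
    (γ'.1 : B.carrier ⊗[k] G) = gaugeSum 𝒢 d br B g γ.1 N

/-- The deformation functor on dg Artin superalgebras: Maurer-Cartan solutions modulo gauge. -/
def Def (𝒢 : ZMod 2 → Submodule k G) [DirectSum.Decomposition 𝒢] (d : G →ₗ[k] G)
    (br : G →ₗ[k] G →ₗ[k] G) (B : DGArtin k) : Type (max u v) :=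
  Quot (GaugeRel 𝒢 d br B)

theorem baseMap_coeffDiff {B C : DGArtin k} (f : B.Hom C) (x : B.carrier ⊗[k] G) :
    baseMap G f.toHom (coeffDiff G B x) = coeffDiff G C (baseMap G f.toHom x) := by
  induction x using TensorProduct.induction_on with
  | zero => simp
  | tmul β x => simp [baseMap, coeffDiff, f.map_diff]
  | add a b ha hb => simp only [map_add, ha, hb]

/-- Functoriality of Maurer-Cartan solutions. -/
def MC.map (𝒢 : ZMod 2 → Submodule k G) [DirectSum.Decomposition 𝒢] (d : G →ₗ[k] G)
    (br : G →ₗ[k] G →ₗ[k] G) {B C : DGArtin k} (f : B.Hom C) (γ : MC 𝒢 d br B) :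
    MC 𝒢 d br C :=
  ⟨ptsMap 𝒢 f.toHom 0 γ.1, by
    have h := congrArg (baseMap G f.toHom) γ.2
    simp only [curv, map_add, map_smul, map_zero, baseMap_coeffDiff, baseMap_oddExt,
      baseMap_oddExt₂] at h
    exact h⟩

theorem baseMap_gaugeSum (𝒢 : ZMod 2 → Submodule k G) [DirectSum.Decomposition 𝒢]
    (d : G →ₗ[k] G) (br : G →ₗ[k] G →ₗ[k] G) {B C : DGArtin k} (f : B.Hom C)
    (g γ : B.carrier ⊗[k] G) (N : ℕ) :
    baseMap G f.toHom (gaugeSum 𝒢 d br B g γ N) =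
      gaugeSum 𝒢 d br C (baseMap G f.toHom g) (baseMap G f.toHom γ) N := by
  have hpow : ∀ (i : ℕ) (x : B.carrier ⊗[k] G),
      baseMap G f.toHom (((oddExt₂ B.toArtinSuperalgebra 𝒢 br g) ^ i) x) =
        ((oddExt₂ C.toArtinSuperalgebra 𝒢 br (baseMap G f.toHom g)) ^ i)
          (baseMap G f.toHom x) := by
    intro i
    induction i with
    | zero => intro x; simp
    | succ n ih => intro x; rw [pow_succ, pow_succ, Module.End.mul_apply,
        Module.End.mul_apply, ih, baseMap_oddExt₂]
  simp only [gaugeSum, map_sum, map_sub, map_smul, hpow, map_add, baseMap_oddExt,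
    baseMap_coeffDiff]

/-- Functoriality of `Def`. -/
def Def.map (𝒢 : ZMod 2 → Submodule k G) [DirectSum.Decomposition 𝒢] (d : G →ₗ[k] G)
    (br : G →ₗ[k] G →ₗ[k] G) {B C : DGArtin k} (f : B.Hom C) :
    Def 𝒢 d br B → Def 𝒢 d br C :=
  Quot.map (MC.map 𝒢 d br f) (by
    rintro γ γ' ⟨g, hg⟩
    refine ⟨ptsMap 𝒢 f.toHom 1 g, ?_⟩
    filter_upwards [hg] with N hN
    have h := congrArg (baseMap G f.toHom) hN
    rw [baseMap_gaugeSum] at h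
    exact h)

variable {V : Type v} [AddCommGroup V] [Module k V]

/-- The odd vector field `Q` on `(V, 0)` is homological, `[Q, Q] = 0`: for every odd constant
`η` one has `Q(x + η Q(x)) = Q(x)`. -/
def IsHomological (𝒱 : ZMod 2 → Submodule k V) (Q : FormalMap 𝒱 𝒱 1) : Prop :=
  ∀ (B : ArtinSuperalgebra k), ∀ η ∈ B.gr 1, ∀ x y : pts 𝒱 B 0,
    (y : B.carrier ⊗[k] V) = x + lmul V B η (Q.app B x) →
      (Q.app B y : B.carrier ⊗[k] V) = Q.app B x

/-- `Γ : (V, 0, Q) → (G, 0, Q_G)` is a morphism of pointed dg manifolds, where `Q_G` is the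
homological vector field `γ ↦ dγ + ½[γ • γ]`: for every odd constant `η` one has
`Γ(x + η Q(x)) = Γ(x) + η Q_G(Γ(x))`. -/
def IsDGMap (𝒱 : ZMod 2 → Submodule k V) (𝒢 : ZMod 2 → Submodule k G)
    [DirectSum.Decomposition 𝒢] (d : G →ₗ[k] G) (br : G →ₗ[k] G →ₗ[k] G)
    (Q : FormalMap 𝒱 𝒱 1) (Γ : FormalMap 𝒱 𝒢 0) : Prop :=
  ∀ (B : ArtinSuperalgebra k), ∀ η ∈ B.gr 1, ∀ x y : pts 𝒱 B 0,
    (y : B.carrier ⊗[k] V) = x + lmul V B η (Q.app B x) →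
      (Γ.app B y : B.carrier ⊗[k] G) =
        Γ.app B x + lmul G B η (curv 𝒢 d br B (Γ.app B x))

/-- The formal pointed dg manifold `(V, 0, Q)` together with `Γ : (V, 0, Q) → (G, 0, Q_G)` is
mini-versal for the deformation functor of `G`: `Q` is homological, `Γ` is a morphism of
pointed dg manifolds, and its differential `s : V → G` at the base point (which is read off on
Artin superalgebras with `m_B² = 0`) takes values in cocycles and identifies `V` with the
cohomology `H(G, d)`. -/
def IsMiniVersal (𝒱 : ZMod 2 → Submodule k V) (𝒢 : ZMod 2 → Submodule k G)
    [DirectSum.Decomposition 𝒢] (d : G →ₗ[k] G) (br : G →ₗ[k] G →ₗ[k] G)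
    (Q : FormalMap 𝒱 𝒱 1) (Γ : FormalMap 𝒱 𝒢 0) : Prop :=
  IsHomological 𝒱 Q ∧ IsDGMap 𝒱 𝒢 d br Q Γ ∧
  ∃ (s : V →ₗ[k] G) (hs : ∀ x, d (s x) = 0),
    (∀ B : ArtinSuperalgebra k, B.maxIdeal ^ 2 = ⊥ → ∀ x : pts 𝒱 B 0,
      (Γ.app B x : B.carrier ⊗[k] G) = LinearMap.lTensor B.carrier s x) ∧
    Function.Bijective (fun x => Coh.mk d (s x) (hs x))

/-- `Γ` identifies the deformation functor of `G` with the functor represented by the formal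
pointed supermanifold `(V, 0)` with the zero vector field: on a dg Artin superalgebra `B`, the
morphisms to `(V, 0)` are the `d_B`-closed `B`-points, homotopic morphisms differ by a
`d_B`-exact point, and `x ↦ [Γ(x)]` is natural in `B`, surjective onto `Def(B)`, and injective
up to homotopy. If `d_B = 0` this is a natural bijection between all `B`-points of `(V, 0)`
and `Def(B)`. -/
def Classifies (𝒱 : ZMod 2 → Submodule k V) (𝒢 : ZMod 2 → Submodule k G)
    [DirectSum.Decomposition 𝒢] (d : G →ₗ[k] G) (br : G →ₗ[k] G →ₗ[k] G)
    (Γ : FormalMap 𝒱 𝒢 0) : Prop :=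
  ∃ φ : ∀ B : DGArtin k,
      {x : pts 𝒱 B.toArtinSuperalgebra 0 // coeffDiff V B x = 0} → Def 𝒢 d br B,
    (∀ B x, ∃ γ : MC 𝒢 d br B, γ.1 = Γ.app B.toArtinSuperalgebra x.1 ∧
      φ B x = Quot.mk _ γ) ∧
    (∀ (B C : DGArtin k) (f : B.Hom C) x y, y.1 = ptsMap 𝒱 f.toHom 0 x.1 →
      Def.map 𝒢 d br f (φ B x) = φ C y) ∧
    (∀ B, Function.Surjective (φ B)) ∧
    (∀ B x y, φ B x = φ B y ↔ ∃ h : pts 𝒱 B.toArtinSuperalgebra 1,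
      (x.1 : B.carrier ⊗[k] V) - y.1 = coeffDiff V B h)

end Deformation

/-! ### dGBV algebras -/

section DGBV

variable {k : Type u} [Field k] {A : Type v} [Ring A] [Algebra k A]

/-- A dGBV algebra structure on the unital superalgebra `A`: supercommutativity, and two
supercommuting odd operators of square zero, `d` a derivation and `Δ` of order two. -/
structure DGBV (𝒜 : ZMod 2 → Submodule k A) [GradedAlgebra 𝒜] where
  supercomm : ∀ i j : ZMod 2, ∀ a ∈ 𝒜 i, ∀ b ∈ 𝒜 j,
    a * b = (-1 : k) ^ (i.val * j.val) • (b * a)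
  d : A →ₗ[k] A
  Δ : A →ₗ[k] A
  d_odd : ∀ i, ∀ a ∈ 𝒜 i, d a ∈ 𝒜 (i + 1)
  Δ_odd : ∀ i, ∀ a ∈ 𝒜 i, Δ a ∈ 𝒜 (i + 1)
  d_sq : ∀ a, d (d a) = 0
  Δ_sq : ∀ a, Δ (Δ a) = 0
  d_Δ : ∀ a, d (Δ a) + Δ (d a) = 0
  d_leibniz : ∀ i, ∀ a ∈ 𝒜 i, ∀ b, d (a * b) = d a * b + (-1 : k) ^ i.val • (a * d b)
  Δ_order : ∀ i j : ZMod 2, ∀ a ∈ 𝒜 i, ∀ b ∈ 𝒜 j, ∀ c,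
    Δ (a * b * c) = Δ (a * b) * c + (-1 : k) ^ (j.val * (i.val + 1)) • (b * Δ (a * c))
      + (-1 : k) ^ i.val • (a * Δ (b * c)) - Δ a * b * c
      - (-1 : k) ^ i.val • (a * Δ b * c) - (-1 : k) ^ (i.val + j.val) • (a * b * Δ c)

variable {𝒜 : ZMod 2 → Submodule k A} [GradedAlgebra 𝒜]

/-- The odd Lie bracket `[a • b] = (-1)^ã Δ(ab) - (-1)^ã Δ(a) b - a Δ(b)`. -/
def DGBV.br (X : DGBV 𝒜) : A →ₗ[k] A →ₗ[k] A :=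
  (LinearMap.mul k A).compr₂ X.Δ ∘ₗ par 𝒜 - LinearMap.mul k A ∘ₗ X.Δ ∘ₗ par 𝒜
    - (LinearMap.mul k A).compl₂ X.Δ

theorem DGBV.br_apply (X : DGBV 𝒜) (a b : A) :
    X.br a b = X.Δ (par 𝒜 a * b) - X.Δ (par 𝒜 a) * b - a * X.Δ b := rfl

/-- The action `a • b = -[l_a, Δ] b = (-1)^ã Δ(ab) - a Δ(b)`. -/
def DGBV.act (X : DGBV 𝒜) : A →ₗ[k] A →ₗ[k] A :=
  (LinearMap.mul k A).compr₂ X.Δ ∘ₗ par 𝒜 - (LinearMap.mul k A).compl₂ X.Δ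

theorem DGBV.act_apply (X : DGBV 𝒜) (a b : A) :
    X.act a b = X.Δ (par 𝒜 a * b) - a * X.Δ b := rfl

/-! ### The `ħ`-extended local system

A formal series `∑ₙ fₙ ħⁿ` in `ħ`, `ħ⁻¹` is the function `n ↦ fₙ` on `ℤ`. -/

/-- The Laurent series: finitely many negative powers of `ħ`. -/
def laurent (k : Type u) [Field k] (V : Type v) [AddCommGroup V] [Module k V] :
    Submodule k (ℤ → V) where
  carrier := {f | ∃ N : ℤ, ∀ n < N, f n = 0}
  add_mem' := by
    rintro a b ⟨N, hN⟩ ⟨M, hM⟩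
    refine ⟨min N M, fun n hn => ?_⟩
    simp [hN n (lt_of_lt_of_le hn (min_le_left _ _)),
      hM n (lt_of_lt_of_le hn (min_le_right _ _))]
  zero_mem' := ⟨0, fun _ _ => rfl⟩
  smul_mem' := by
    rintro c a ⟨N, hN⟩
    exact ⟨N, fun n hn => by simp [hN n hn]⟩

/-- The operator `d + ħ Δ + γ •` on formal series in `ħ^{±1}` with coefficients in `B ⊗ A`.
If `γ` is the value of the mini-versal map at a `B`-point of the moduli space, its cohomology
is the fibre of the local system over that point. -/
def DGBV.twisted (X : DGBV 𝒜) (B : ArtinSuperalgebra k) (γ : B.carrier ⊗[k] A) :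
    (ℤ → B.carrier ⊗[k] A) →ₗ[k] (ℤ → B.carrier ⊗[k] A) where
  toFun f n := oddExt B X.d (f n) + oddExt B X.Δ (f (n - 1)) + oddExt₂ B 𝒜 X.act γ (f n)
  map_add' f g := by
    funext n
    simp only [Pi.add_apply, map_add]
    abel
  map_smul' c f := by
    funext n
    simp only [Pi.smul_apply, map_smul, RingHom.id_apply, smul_add]

/-- The space `L` of series with coefficients in `B ⊗ A` being given, the fibre over a
`B`-point, i.e. the cohomology of `d + ħ Δ + γ •` on `L`, is isomorphic to the space `L'` of
series with coefficients in `B ⊗ H(A, d)`, by an even isomorphism linear over `B` and over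
`k[ħ, ħ⁻¹]`. -/
def DGBV.FibreIso (X : DGBV 𝒜) (B : ArtinSuperalgebra k) (γ : B.carrier ⊗[k] A)
    (L : Submodule k (ℤ → B.carrier ⊗[k] A))
    (L' : Submodule k (ℤ → B.carrier ⊗[k] Coh X.d)) : Prop :=
  ∃ e : CohOn L (X.twisted B γ) ≃ₗ[k] L',
    (∀ z z' : (LinearMap.ker (X.twisted B γ) ⊓ L : Submodule k (ℤ → B.carrier ⊗[k] A)),
      (∀ n, z'.1 n = z.1 (n - 1)) →
        ∀ n, (e (Submodule.Quotient.mk z')).1 n = (e (Submodule.Quotient.mk z)).1 (n - 1)) ∧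
    (∀ (β : B.carrier)
      (z z' : (LinearMap.ker (X.twisted B γ) ⊓ L : Submodule k (ℤ → B.carrier ⊗[k] A))),
      (∀ n, z'.1 n = lmul A B β (z.1 n)) →
        ∀ n, (e (Submodule.Quotient.mk z')).1 n =
          lmul (Coh X.d) B β ((e (Submodule.Quotient.mk z)).1 n)) ∧
    (∀ (i : ZMod 2)
      (z : (LinearMap.ker (X.twisted B γ) ⊓ L : Submodule k (ℤ → B.carrier ⊗[k] A))),
      (∀ n, z.1 n ∈ tensorGr 𝒜 B i) →
        ∀ n, (e (Submodule.Quotient.mk z)).1 n ∈ tensorGr (cohGr 𝒜 X.d) B i)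

end DGBV

end SemiInf

end

/-!
# Deformations of dGBV algebras with `Im d ∩ Ker Δ = Im Δ ∩ Ker d = Im d ∩ Im Δ`

The hypothesis enters through `Im Δ ∩ Ker d ⊆ Im d`. Choose a contraction `(s, p, h)` of the complex
`(A, d)` onto its cohomology (`exists_contraction`). By homological perturbation the inclusion
`s p` extends to `(1 + ħ h Δ)⁻¹ s p`; the inclusion `Im Δ ∩ Ker d ⊆ Im d` ensures that its values
are closed for `d + ħ Δ`, so that on Laurent series `d + ħ Δ` is conjugate to `d` by operators
congruent to `1` modulo `ħ` (`perturbation`, `exists_intertwiner`). On the other hand, as `Δ` has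
order two, conjugation by `e^{γ / ħ}` turns `d + ħ Δ` into `d + ħ Δ + γ • + ħ⁻¹ F`, where
`F = dγ + ½ [γ • γ]` (`hdiff_nexp`). Everything follows from the comparison of these two facts.

*No obstructions.* If `F` lies in `m ^ n ⊗ A`, then `F` is `d`-exact modulo `m ^ (n + 1)`
(`exists_curv_sub_mem`). By induction on `n`, the fixed point `γ = s x - ½ h [γ • γ]` satisfies the
Maurer-Cartan equation (`curv_kuranishiMap`), which gives a mini-versal family over `H(A, d)` with
zero vector field (`isMiniVersal_kuranishiMap`). For an arbitrary mini-versal family `(Q, Γ)`, the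
dg map property says that `F(Γ(x))` and `Q(x)` have, to lowest order, the same cohomology class, so
`Q = 0` (`vectorField_eq_zero`). This uses that a formal map, which is only a natural family of maps
on points, is determined to first order by its differential at the base point
(`HasLinearPart.sub_mem`); it is proved by naturality, along morphisms to Artin superalgebras with
square-zero maximal ideal.

*Classification.* With `Q = 0` the values of `Γ` at `d_B`-closed points solve the Maurer-Cartan
equation. A solution congruent modulo an ideal `J` to a value of `Γ` is corrected, modulo `m J`,
`m² J` and so on, by gauge transformations and by changes of the point (`exists_closed_point`).
For `J = m` this is surjectivity. For injectivity the same statement is applied over the path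
algebra `DGArtin.path B`, a dg Artin subalgebra of the polynomial differential forms on the line
with values in `B`. Two solutions are gauge equivalent if and only if they are the ends of a
solution over the path algebra (`MC.homotopic_of_eq`, `MC.Homotopic.mk_eq`), and the statement for
the ideal `J` of paths vanishing at both ends replaces such a homotopy by a closed path in the base,
whose ends differ by `d_B` of its integral. Conversely, points with exact difference are joined
by a closed path.

*Fibres.* At a Maurer-Cartan element `γ` the operator `d + ħ Δ + γ •` is conjugate to `d + ħ Δ`, hence
to `d`, on Laurent series (`fibreIso_laurent`). On series infinite in both directions the inverse of
`1 + ħ h Δ` need not exist; but if `Im d ∩ Im Δ = Im dΔ`, the contraction can be chosen so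
that `1 - ħ Δ h` does the job, `Δ h` having square zero (`exists_contraction_compat`,
`fibreIso_top`).
-/

set_option linter.unusedSectionVars false
set_option linter.unusedSimpArgs false

noncomputable section

namespace SemiInf

/-! ### Gauge transformations in a differential odd Lie superalgebra -/

section Gauge

open Module.End
open IsNilpotent (exp exp_eq_sum exp_add_of_commute exp_neg_mul_exp_self)

/-- The exponential of a nilpotent operator which is a derivation for a bilinear map `μ`
intertwines `μ`. -/
theorem exp_apply_bilin {k L P : Type*} [Field k] [AddCommGroup L] [Module k L]
    [AddCommGroup P] [Module k P] [Module ℚ L] [Module ℚ P] (μ : L →ₗ[k] L →ₗ[k] P)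
    (D₁ : Module.End k L) (D₂ : Module.End k P) (h₁ : IsNilpotent D₁) (h₂ : IsNilpotent D₂)
    (h : ∀ x y, D₂ (μ x y) = μ (D₁ x) y + μ x (D₁ y)) (x y : L) :
    exp D₂ (μ x y) = μ (exp D₁ x) (exp D₁ y) := by
  let DL : Module.End k (L ⊗[k] L) := D₁.lTensor L
  let DR : Module.End k (L ⊗[k] L) := D₁.rTensor L
  have h_nilL : IsNilpotent DL := h₁.map <| lTensorAlgHom k L L
  have h_nilR : IsNilpotent DR := h₁.map <| rTensorAlgHom k L L
  have h_comm : Commute DL DR := by ext; simp [DL, DR]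
  have hE : exp D₂ (μ x y) = TensorProduct.lift μ (exp (DL + DR) (x ⊗ₜ[k] y)) := by
    suffices exp D₂ ∘ₗ TensorProduct.lift μ = TensorProduct.lift μ ∘ₗ exp (DL + DR) by
      simpa using! LinearMap.congr_fun this (x ⊗ₜ[k] y)
    apply commute_exp_left_of_commute (h_comm.isNilpotent_add h_nilL h_nilR) h₂
    ext a b
    simp [DL, DR, h, add_comm]
  have e₂ : exp DL = (exp D₁).lTensor L := (h₁.map_exp (lTensorAlgHom k L L)).symm
  have e₃ : exp DR = (exp D₁).rTensor L := (h₁.map_exp (rTensorAlgHom k L L)).symm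
  simp [hE, exp_add_of_commute h_comm h_nilL h_nilR, e₂, e₃]

set_option linter.style.haveILetI false

variable {k : Type*} [Field k] [CharZero k] {R : Type*} [AddCommGroup R] [Module k R]

/-- The partial sum of `e^{ad} γ - ((e^{ad} - 1) / ad) e` for an operator `ad` and an element
`e`. -/
def affineExp (ad : Module.End k R) (e γ : R) (N : ℕ) : R :=
  ∑ i ∈ Finset.range N, ((i.factorial : k)⁻¹ • (ad ^ i) γ - ((i + 1).factorial : k)⁻¹ • (ad ^ i) e)

/-- The operator `(c, a) ↦ (0, ad a - c e)`, the adjoint action on the extension of the even part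
by the differential: the affine gauge action becomes linear on this extension. -/
def extAd (ev : Submodule k R) (ad : Module.End k R) (hev : ∀ a ∈ ev, ad a ∈ ev) (e : ev) :
    Module.End k (k × ev) :=
  (LinearMap.inr k k ev) ∘ₗ
    ((ad.restrict hev) ∘ₗ LinearMap.snd k k ev - (LinearMap.toSpanSingleton k ev e) ∘ₗ
      LinearMap.fst k k ev)

theorem extAd_pow (ev : Submodule k R) (ad : Module.End k R) (hev : ∀ a ∈ ev, ad a ∈ ev) (e : ev)
    (i : ℕ) (c : k) (a : ev) : (extAd ev ad hev e ^ (i + 1)) (c, a) =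
      (0, (ad.restrict hev ^ (i + 1)) a - c • (ad.restrict hev ^ i) e) := by
  induction i generalizing c a with
  | zero => simp [extAd]
  | succ i ih =>
    rw [pow_succ, Module.End.mul_apply]
    have : extAd ev ad hev e (c, a) = (0, ad.restrict hev a - c • e) := by simp [extAd]
    rw [this, ih, pow_succ _ (i + 1)]
    simp [pow_succ]

theorem restrict_pow_coe (ev : Submodule k R) (ad : Module.End k R) (hev : ∀ a ∈ ev, ad a ∈ ev)
    (i : ℕ) (a : ev) : ((ad.restrict hev ^ i) a : R) = (ad ^ i) a := by
  induction i generalizing a with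
  | zero => simp
  | succ i ih => rw [pow_succ, pow_succ, Module.End.mul_apply, Module.End.mul_apply, ih]; rfl

theorem extAd_nilpotent (ev : Submodule k R) (ad : Module.End k R) (hev : ∀ a ∈ ev, ad a ∈ ev)
    (e : ev) {N : ℕ} (hN : ad ^ N = 0) : extAd ev ad hev e ^ (N + 1) = 0 := by
  have h0 : (ad.restrict hev) ^ N = 0 := by
    ext a; rw [restrict_pow_coe, hN]; simp
  refine LinearMap.ext fun ⟨c, a⟩ => ?_
  rw [extAd_pow, pow_succ, h0]
  simp

/-- Restriction of scalars to `ℚ`, needed for the exponential of nilpotent operators. -/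
abbrev ratModule (k : Type*) [Field k] [CharZero k] (M : Type*) [AddCommGroup M] [Module k M] :
    Module ℚ M := Module.compHom M (algebraMap ℚ k)

theorem affineExp_eq_of_le (ad : Module.End k R) (e γ : R) {N n : ℕ} (hN : ad ^ N = 0)
    (h : N ≤ n) : affineExp ad e γ n = affineExp ad e γ N := by
  unfold affineExp
  symm
  refine Finset.sum_subset (Finset.range_mono h) ?_
  intro i _ hi
  have : ad ^ i = 0 := pow_eq_zero_of_le (by simpa using hi) hN
  simp [this]

theorem exp_extAd (ev : Submodule k R) (ad : Module.End k R) (hev : ∀ a ∈ ev, ad a ∈ ev)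
    (e γ : ev) {N : ℕ} (hN : ad ^ N = 0) (γ' : ev) (hγ' : (γ' : R) = affineExp ad e γ N) :
    letI := ratModule k (k × ev)
    exp (extAd ev ad hev e) (1, γ) = (1, γ') := by
  letI := ratModule k (k × ev)
  have h0 : (ad.restrict hev) ^ N = 0 := by
    ext a; rw [restrict_pow_coe, hN]; simp
  have hs : ∀ (n : ℕ) (f : Module.End k (k × ev)) (x : k × ev),
      ((n : ℚ)⁻¹ • f) x = (n : k)⁻¹ • f x := by
    intro n f x
    have : ((n : ℚ)⁻¹ • f) x = (algebraMap ℚ k (n : ℚ)⁻¹) • f x := rfl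
    rw [this]; simp
  rw [exp_eq_sum (extAd_nilpotent ev ad hev e hN), Finset.sum_range_succ', LinearMap.add_apply,
    LinearMap.sum_apply]
  simp only [hs, extAd_pow]
  have h1 : γ' = γ + ∑ i ∈ Finset.range N, ((i + 1).factorial : k)⁻¹ •
      ((ad.restrict hev ^ (i + 1)) γ - (ad.restrict hev ^ i) e) := by
    apply Subtype.ext
    rw [hγ', affineExp]
    simp only [smul_sub, Submodule.coe_add, Submodule.coe_sum, Submodule.coe_sub,
      Submodule.coe_smul, restrict_pow_coe, Finset.sum_sub_distrib]
    rw [← add_sub_assoc]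
    congr 1
    have := Finset.sum_range_succ' (fun i => ((i.factorial : k)⁻¹ • (ad ^ i) (γ : R))) N
    rw [Finset.sum_range_succ, hN] at this
    simp only [LinearMap.zero_apply, smul_zero, add_zero] at this
    rw [this]
    simp [add_comm]
  rw [h1]
  ext
  · simp [Prod.fst_sum]
  · simp [Prod.snd_sum, add_comm]

/-- The gauge action multiplies the curvature `D γ + ½ [γ, γ]` by `e^{ad}`, so it preserves the
solutions of the Maurer-Cartan equation. -/
theorem curvature_affineExp (ev : Submodule k R) (D ad : Module.End k R)
    (br : R →ₗ[k] R →ₗ[k] R) (e γ : R) (he : e ∈ ev) (hγ : γ ∈ ev)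
    (hev : ∀ a ∈ ev, ad a ∈ ev)
    (hsymm : ∀ a ∈ ev, ∀ b ∈ ev, br a b = br b a)
    (hder : ∀ a ∈ ev, ∀ b ∈ ev, ad (br a b) = br (ad a) b + br a (ad b))
    (hd : ∀ b ∈ ev, D (ad b) = ad (D b) + br e b) (hde : D e = 0)
    {N : ℕ} (hN : ad ^ N = 0) (h0 : D γ + (2 : k)⁻¹ • br γ γ = 0) :
    affineExp ad e γ N ∈ ev ∧
      D (affineExp ad e γ N) + (2 : k)⁻¹ • br (affineExp ad e γ N) (affineExp ad e γ N) = 0 := by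
  have hpow : ∀ i, ∀ a ∈ ev, (ad ^ i) a ∈ ev := by
    intro i
    induction i with
    | zero => intro a ha; simpa using ha
    | succ i ih => intro a ha; rw [pow_succ, Module.End.mul_apply]; exact ih _ (hev a ha)
  have hmem : affineExp ad e γ N ∈ ev := by
    refine Submodule.sum_mem _ fun i _ => Submodule.sub_mem _ ?_ ?_
    · exact Submodule.smul_mem _ _ (hpow i γ hγ)
    · exact Submodule.smul_mem _ _ (hpow i e he)
  refine ⟨hmem, ?_⟩
  letI := ratModule k (k × ev)
  letI := ratModule k R
  -- `μ` is the polarization of the quadratic form `(c, a) ↦ 2 c D a + [a, a]`, twice the curvature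
  -- at `c = 1`
  let fs := LinearMap.fst k k ev
  let sn := ev.subtype ∘ₗ LinearMap.snd k k ev
  let μ : (k × ev) →ₗ[k] (k × ev) →ₗ[k] R :=
    (LinearMap.lsmul k R).compl₁₂ fs (D ∘ₗ sn) + ((LinearMap.lsmul k R).compl₁₂ fs (D ∘ₗ sn)).flip
      + br.compl₁₂ sn sn
  have hμ : ∀ c a c' b, μ (c, a) (c', b) = c • D b + c' • D a + br a b := by
    intro c a c' b; simp [μ, fs, sn]
  have key := exp_apply_bilin μ (extAd ev ad hev ⟨e, he⟩) ad
    ⟨N + 1, extAd_nilpotent ev ad hev _ hN⟩ ⟨N, hN⟩ (by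
      rintro ⟨c, a⟩ ⟨c', b⟩
      have h1 : ∀ (c : k) (a : ev), extAd ev ad hev ⟨e, he⟩ (c, a) =
          (0, ⟨ad a - c • e, Submodule.sub_mem _ (hev a a.2) (Submodule.smul_mem _ _ he)⟩) := by
        intro c a
        ext <;> simp [extAd]
      rw [h1, h1, hμ, hμ, hμ]
      simp only [map_add, map_smul, map_sub, LinearMap.sub_apply, LinearMap.smul_apply, zero_smul,
        zero_add, add_zero, hder a a.2 b b.2, hd a a.2, hd b b.2, hde, smul_zero, sub_zero]
      rw [hsymm a a.2 e he]
      simp only [smul_add]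
      abel) (1, ⟨γ, hγ⟩) (1, ⟨γ, hγ⟩)
  rw [exp_extAd ev ad hev ⟨e, he⟩ ⟨γ, hγ⟩ hN ⟨_, hmem⟩ rfl, hμ, hμ] at key
  have two : ∀ x y : R, x + (2 : k)⁻¹ • y = (2 : k)⁻¹ • ((1 : k) • x + (1 : k) • x + y) := by
    intro x y
    rw [one_smul, smul_add, ← two_smul k x, smul_smul]
    simp
  rw [two] at h0 ⊢
  have h2 : (1 : k) • D γ + (1 : k) • D γ + br γ γ = 0 := by
    rcases smul_eq_zero.1 h0 with h | h
    · simp at h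
    · exact h
  rw [h2, map_zero] at key
  rw [← key, smul_zero]

/-- The gauge transformation by `-g` is inverse to the one by `g`. -/
theorem affineExp_neg (ev : Submodule k R) (ad : Module.End k R) (e γ : R) (he : e ∈ ev)
    (hγ : γ ∈ ev) (hev : ∀ a ∈ ev, ad a ∈ ev) {N : ℕ} (hN : ad ^ N = 0) :
    affineExp (-ad) (-e) (affineExp ad e γ N) N = γ := by
  have hpow : ∀ (ad : Module.End k R) (_ : ∀ a ∈ ev, ad a ∈ ev),
      ∀ i, ∀ a ∈ ev, (ad ^ i) a ∈ ev := by
    intro ad hev i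
    induction i with
    | zero => intro a ha; simpa using ha
    | succ i ih => intro a ha; rw [pow_succ, Module.End.mul_apply]; exact ih _ (hev a ha)
  have hm : ∀ (ad : Module.End k R) (_ : ∀ a ∈ ev, ad a ∈ ev) (e γ : R), e ∈ ev → γ ∈ ev →
      affineExp ad e γ N ∈ ev := fun ad hev e γ he hγ =>
    Submodule.sum_mem _ fun i _ => Submodule.sub_mem _
      (Submodule.smul_mem _ _ (hpow ad hev i γ hγ)) (Submodule.smul_mem _ _ (hpow ad hev i e he))
  have hev' : ∀ a ∈ ev, (-ad) a ∈ ev := fun a ha => Submodule.neg_mem _ (hev a ha)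
  have hN' : (-ad) ^ N = 0 := by rw [neg_pow, hN, mul_zero]
  have m1 := hm ad hev e γ he hγ
  have m2 := hm (-ad) hev' (-e) _ (Submodule.neg_mem _ he) m1
  letI := ratModule k (k × ev)
  have h1 := exp_extAd ev ad hev ⟨e, he⟩ ⟨γ, hγ⟩ hN ⟨_, m1⟩ rfl
  have h2 := exp_extAd ev (-ad) hev' ⟨-e, Submodule.neg_mem _ he⟩ ⟨_, m1⟩ hN' ⟨_, m2⟩ rfl
  have hneg : extAd ev (-ad) hev' ⟨-e, Submodule.neg_mem _ he⟩ = -extAd ev ad hev ⟨e, he⟩ := by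
    refine LinearMap.ext fun ⟨c, a⟩ => ?_
    ext <;> simp [extAd]
    abel
  have h3 := exp_neg_mul_exp_self (a := extAd ev ad hev ⟨e, he⟩)
    ⟨N + 1, extAd_nilpotent ev ad hev _ hN⟩
  have h4 := LinearMap.congr_fun h3 (1, ⟨γ, hγ⟩)
  rw [Module.End.mul_apply, h1, ← hneg, h2] at h4
  have := congrArg (fun z : k × ev => (z.2 : R)) h4
  simpa using this

/-- To first order, the gauge action is `γ ↦ γ - e`. -/
theorem affineExp_sub_mem (K : Submodule k R) (ad : Module.End k R) (e γ : R)
    (hK : ∀ a ∈ K, ad a ∈ K) (h1 : ad γ ∈ K) (h2 : ad e ∈ K) (N : ℕ) :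
    affineExp ad e γ (N + 1) - (γ - e) ∈ K := by
  have hpow : ∀ i a, ad a ∈ K → (ad ^ (i + 1)) a ∈ K := by
    intro i
    induction i with
    | zero => intro a ha; simpa using ha
    | succ i ih =>
      intro a ha; rw [pow_succ, Module.End.mul_apply]; exact ih _ (hK _ ha)
  rw [affineExp, Finset.sum_range_succ']
  simp only [pow_zero, Module.End.one_apply, zero_add, Nat.factorial_zero, Nat.factorial_one,
    Nat.cast_one, inv_one, one_smul, add_sub_cancel_right]
  exact Submodule.sum_mem _ fun i _ => Submodule.sub_mem _
    (Submodule.smul_mem _ _ (hpow i γ h1)) (Submodule.smul_mem _ _ (hpow i e h2))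

end Gauge

/-! ### Parity and coefficient ideals in `B ⊗ V` -/

section Parity

theorem zmod2_cases (i : ZMod 2) : i = 0 ∨ i = 1 := by revert i; decide

theorem zmod2_val_one : (1 : ZMod 2).val = 1 := rfl

variable {k : Type u} [Field k] {V : Type v} [AddCommGroup V] [Module k V]
variable (𝒱 : ZMod 2 → Submodule k V) [DirectSum.Decomposition 𝒱]

theorem par_of_mem {i : ZMod 2} {x : V} (hx : x ∈ 𝒱 i) : par 𝒱 x = (-1 : k) ^ i.val • x := by
  rcases zmod2_cases i with rfl | rfl <;>
    simp [par, proj_of_mem 𝒱 hx, zmod2_val_one]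

theorem par_par (x : V) : par 𝒱 (par 𝒱 x) = x := by
  conv_rhs => rw [← proj_add_proj 𝒱 x]
  have h0 := proj_mem 𝒱 0 x
  have h1 := proj_mem 𝒱 1 x
  simp [par, proj_of_mem 𝒱 h0, proj_of_mem 𝒱 h1]

theorem par_mem {i : ZMod 2} {x : V} (hx : x ∈ 𝒱 i) : par 𝒱 x ∈ 𝒱 i := by
  rw [par_of_mem 𝒱 hx]; exact Submodule.smul_mem _ _ hx

theorem par_eq_smul (x : V) (i : ZMod 2) :
    proj 𝒱 i x + proj 𝒱 i x = x + (-1 : k) ^ i.val • par 𝒱 x := by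
  conv_rhs => rw [← proj_add_proj 𝒱 x]
  have h0 := proj_mem 𝒱 0 x
  have h1 := proj_mem 𝒱 1 x
  rcases zmod2_cases i with rfl | rfl <;>
    simp [par, proj_of_mem 𝒱 h0, proj_of_mem 𝒱 h1, zmod2_val_one]; abel

theorem mem_of_par [CharZero k] {i : ZMod 2} {x : V} (hx : par 𝒱 x = (-1 : k) ^ i.val • x) :
    x ∈ 𝒱 i := by
  have h := par_eq_smul 𝒱 x i
  rw [hx, smul_smul, ← mul_pow] at h
  simp only [mul_neg, mul_one, neg_neg, one_pow, one_smul, ← two_smul k] at h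
  rw [← smul_right_injective V (two_ne_zero' k) h]
  exact proj_mem 𝒱 i x

/-- A linear map which preserves (`c = 0`) or changes (`c = 1`) parity commutes with the parity
involution up to sign. -/
theorem par_comm {W : Type w} [AddCommGroup W] [Module k W] (𝒲 : ZMod 2 → Submodule k W)
    [DirectSum.Decomposition 𝒲] (T : V →ₗ[k] W) (c : ZMod 2)
    (hT : ∀ i, ∀ x ∈ 𝒱 i, T x ∈ 𝒲 (i + c)) (x : V) :
    par 𝒲 (T x) = (-1 : k) ^ c.val • T (par 𝒱 x) := by
  conv_lhs => rw [← proj_add_proj 𝒱 x]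
  conv_rhs => rw [← proj_add_proj 𝒱 x]
  have h0 := proj_mem 𝒱 0 x
  have h1 := proj_mem 𝒱 1 x
  simp only [map_add, par_of_mem 𝒱 h0, par_of_mem 𝒱 h1, par_of_mem 𝒲 (hT _ _ h0),
    par_of_mem 𝒲 (hT _ _ h1), map_smul, smul_add, smul_smul]
  rcases zmod2_cases c with rfl | rfl
  · simp [zmod2_val_one]
  · simp [zmod2_val_one, show (1 + 1 : ZMod 2) = 0 from rfl]

end Parity

section Coefficients

variable {k : Type u} [Field k]

/-- The image of `I ⊗ V` in `N ⊗ V`: the elements of `N ⊗ V` with coefficients in `I`. -/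
def tens {N : Type w} [AddCommGroup N] [Module k N] (I : Submodule k N)
    (V : Type v) [AddCommGroup V] [Module k V] : Submodule k (N ⊗[k] V) :=
  LinearMap.range (I.subtype.rTensor V)

section

variable {N : Type w} [AddCommGroup N] [Module k N] {N' : Type*} [AddCommGroup N'] [Module k N']
variable {V : Type v} [AddCommGroup V] [Module k V] {W : Type*} [AddCommGroup W] [Module k W]

theorem tmul_mem_tens {I : Submodule k N} {β : N} (hβ : β ∈ I) (x : V) :
    β ⊗ₜ[k] x ∈ tens I V := ⟨(⟨β, hβ⟩ : I) ⊗ₜ x, by simp⟩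

theorem tens_le {I : Submodule k N} {K : Submodule k (N ⊗[k] V)}
    (h : ∀ β ∈ I, ∀ x : V, β ⊗ₜ[k] x ∈ K) : tens I V ≤ K := by
  rintro _ ⟨t, rfl⟩
  induction t using TensorProduct.induction_on with
  | zero => simp
  | tmul β x => simpa using h β β.2 x
  | add a b ha hb => rw [map_add]; exact K.add_mem ha hb

theorem tens_mono {I J : Submodule k N} (h : I ≤ J) : tens I V ≤ tens J V :=
  tens_le fun _ hβ x => tmul_mem_tens (h hβ) x

theorem tens_bot : tens (⊥ : Submodule k N) V = ⊥ := by
  refine le_bot_iff.1 (tens_le fun β hβ x => ?_)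
  rw [(Submodule.mem_bot k).1 hβ]; simp

theorem tens_top : tens (⊤ : Submodule k N) V = ⊤ := by
  refine top_le_iff.1 fun x _ => ?_
  induction x using TensorProduct.induction_on with
  | zero => exact Submodule.zero_mem _
  | tmul β x => exact tmul_mem_tens Submodule.mem_top x
  | add a b ha hb => exact Submodule.add_mem _ (ha trivial) (hb trivial)

theorem map_mem_tens {I : Submodule k N} {J : Submodule k N'} (f : N →ₗ[k] N') (T : V →ₗ[k] W)
    (hf : ∀ β ∈ I, f β ∈ J) {x : N ⊗[k] V} (hx : x ∈ tens I V) :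
    TensorProduct.map f T x ∈ tens J W :=
  (tens_le (K := (tens J W).comap (TensorProduct.map f T))
    fun β hβ y => by simpa using tmul_mem_tens (hf β hβ) (T y)) hx

theorem rTensor_mem_tens {I : Submodule k N} {J : Submodule k N'} (f : N →ₗ[k] N')
    (hf : ∀ β ∈ I, f β ∈ J) {x : N ⊗[k] V} (hx : x ∈ tens I V) : f.rTensor V x ∈ tens J V :=
  map_mem_tens f LinearMap.id hf hx

theorem lTensor_mem_tens {I : Submodule k N} (T : V →ₗ[k] W)
    {x : N ⊗[k] V} (hx : x ∈ tens I V) : T.lTensor N x ∈ tens I W :=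
  map_mem_tens LinearMap.id T (fun _ h => h) hx

theorem mem_tens_iff_mkQ {I : Submodule k N} {x : N ⊗[k] V} :
    x ∈ tens I V ↔ I.mkQ.rTensor V x = 0 := by
  have := rTensor_exact V (f := I.subtype) (g := I.mkQ)
    (by rw [LinearMap.exact_iff]; simp) (Submodule.mkQ_surjective I)
  exact (this x).symm

/-- A linear map which is injective on coefficients reflects membership in `tens`. -/
theorem mem_tens_of_rTensor {I : Submodule k N} {J : Submodule k N'} (f : N →ₗ[k] N')
    (hf : ∀ β, f β ∈ J → β ∈ I) {x : N ⊗[k] V} (hx : f.rTensor V x ∈ tens J V) :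
    x ∈ tens I V := by
  let g : N ⧸ (J.comap f) →ₗ[k] N' ⧸ J := (J.comap f).liftQ (J.mkQ ∘ₗ f) (by
    intro a ha; simpa using ha)
  have hg : Function.Injective g := by
    rw [← LinearMap.ker_eq_bot]
    apply Submodule.ker_liftQ_eq_bot
    intro a ha; simpa using ha
  have h1 : x ∈ tens (J.comap f) V := by
    rw [mem_tens_iff_mkQ] at hx ⊢
    have hinj : Function.Injective (g.rTensor V) :=
      Module.Flat.rTensor_preserves_injective_linearMap g hg
    apply hinj
    rw [map_zero, ← LinearMap.comp_apply, ← LinearMap.rTensor_comp]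
    have : g ∘ₗ (J.comap f).mkQ = J.mkQ ∘ₗ f := by ext a; simp [g]
    rw [this, LinearMap.rTensor_comp]
    exact hx
  exact tens_mono (fun β hβ => hf β hβ) h1

end

variable {V : Type v} [AddCommGroup V] [Module k V] {W : Type v} [AddCommGroup W] [Module k W]

/-- The subspace `I` is homogeneous: it contains the homogeneous components of its elements. -/
def Homog (B : ArtinSuperalgebra k) (I : Submodule k B.carrier) : Prop :=
  ∀ b ∈ I, ∀ i, proj B.gr i b ∈ I

theorem Homog.par_mem {B : ArtinSuperalgebra k} {I : Submodule k B.carrier} (h : Homog B I)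
    {b : B.carrier} (hb : b ∈ I) : par B.gr b ∈ I :=
  I.sub_mem (h b hb 0) (h b hb 1)

/-- The part of parity `i` of the image of `I ⊗ V` in `B ⊗ V`. For the maximal ideal these are the
points `pts` of the formal supermanifold `V`. -/
def gpts (𝒱 : ZMod 2 → Submodule k V) (B : ArtinSuperalgebra k) (I : Submodule k B.carrier)
    (i : ZMod 2) : Submodule k (B.carrier ⊗[k] V) :=
  Submodule.span k {t | ∃ (p q : ZMod 2) (β : B.carrier) (x : V), p + q = i ∧ β ∈ B.gr p ∧
    β ∈ I ∧ x ∈ 𝒱 q ∧ t = β ⊗ₜ[k] x}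

theorem tmul_mem_gpts {𝒱 : ZMod 2 → Submodule k V} {B : ArtinSuperalgebra k}
    {I : Submodule k B.carrier} {p q i : ZMod 2} (hi : p + q = i) {β : B.carrier} {x : V}
    (hβ : β ∈ B.gr p) (hI : β ∈ I) (hx : x ∈ 𝒱 q) : β ⊗ₜ[k] x ∈ gpts 𝒱 B I i :=
  Submodule.subset_span ⟨p, q, β, x, hi, hβ, hI, hx, rfl⟩

theorem gpts_le {𝒱 : ZMod 2 → Submodule k V} {B : ArtinSuperalgebra k}
    {I : Submodule k B.carrier} {i : ZMod 2} {K : Submodule k (B.carrier ⊗[k] V)}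
    (h : ∀ p q, p + q = i → ∀ β ∈ B.gr p, β ∈ I → ∀ x ∈ 𝒱 q, β ⊗ₜ[k] x ∈ K) :
    gpts 𝒱 B I i ≤ K := by
  refine Submodule.span_le.2 ?_
  rintro _ ⟨p, q, β, x, hi, hβ, hI, hx, rfl⟩
  exact h p q hi β hβ hI x hx

theorem tensorGr_eq_gpts (𝒱 : ZMod 2 → Submodule k V) (B : ArtinSuperalgebra k) (i : ZMod 2) :
    tensorGr 𝒱 B i = gpts 𝒱 B ⊤ i := by
  simp [tensorGr, gpts]

theorem gpts_mono {𝒱 : ZMod 2 → Submodule k V} {B : ArtinSuperalgebra k}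
    {I J : Submodule k B.carrier} (h : I ≤ J) (i : ZMod 2) : gpts 𝒱 B I i ≤ gpts 𝒱 B J i :=
  gpts_le fun _ _ hi _ hβ hI _ hx => tmul_mem_gpts hi hβ (h hI) hx

theorem pts_le_even {𝒱 : ZMod 2 → Submodule k V} (B : ArtinSuperalgebra k) (i : ZMod 2) :
    pts 𝒱 B i ≤ gpts 𝒱 B ⊤ i :=
  gpts_mono le_top i

theorem gpts_le_tens {𝒱 : ZMod 2 → Submodule k V} {B : ArtinSuperalgebra k}
    {I : Submodule k B.carrier} {i : ZMod 2} : gpts 𝒱 B I i ≤ tens I V :=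
  gpts_le fun _ _ _ _ _ hI x _ => tmul_mem_tens hI x

theorem map_mem_gpts {𝒱 : ZMod 2 → Submodule k V} {𝒲 : ZMod 2 → Submodule k W}
    {B C : ArtinSuperalgebra k} {I : Submodule k B.carrier} {J : Submodule k C.carrier}
    (f : B.carrier →ₗ[k] C.carrier) (T : V →ₗ[k] W) {c e i j : ZMod 2} (hj : i + c + e = j)
    (hf : ∀ p, ∀ β ∈ B.gr p, β ∈ I → f β ∈ C.gr (p + c) ∧ f β ∈ J)
    (hT : ∀ q, ∀ x ∈ 𝒱 q, T x ∈ 𝒲 (q + e)) {x : B.carrier ⊗[k] V} (hx : x ∈ gpts 𝒱 B I i) :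
    TensorProduct.map f T x ∈ gpts 𝒲 C J j :=
  (gpts_le (K := (gpts 𝒲 C J j).comap (TensorProduct.map f T))
    fun p q hi β hβ hI y hy => by
      have h := hf p β hβ hI
      simpa using tmul_mem_gpts (by rw [← hj, ← hi]; ring) h.1 h.2 (hT q y hy)) hx

theorem rTensor_mem_gpts {𝒱 : ZMod 2 → Submodule k V}
    {B C : ArtinSuperalgebra k} {I : Submodule k B.carrier} {J : Submodule k C.carrier}
    (f : B.carrier →ₗ[k] C.carrier) {c i j : ZMod 2} (hj : i + c = j)
    (hf : ∀ p, ∀ β ∈ B.gr p, β ∈ I → f β ∈ C.gr (p + c) ∧ f β ∈ J)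
    {x : B.carrier ⊗[k] V} (hx : x ∈ gpts 𝒱 B I i) :
    f.rTensor V x ∈ gpts 𝒱 C J j :=
  map_mem_gpts f LinearMap.id (e := 0) (by rw [← hj, add_zero]) hf
    (fun q x hx => by simpa using hx) hx

theorem lTensor_mem_gpts {𝒱 : ZMod 2 → Submodule k V} {𝒲 : ZMod 2 → Submodule k W}
    {B : ArtinSuperalgebra k} {I : Submodule k B.carrier} (T : V →ₗ[k] W) {i : ZMod 2}
    (hT : ∀ q, ∀ x ∈ 𝒱 q, T x ∈ 𝒲 q) {x : B.carrier ⊗[k] V} (hx : x ∈ gpts 𝒱 B I i) :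
    T.lTensor B.carrier x ∈ gpts 𝒲 B I i :=
  map_mem_gpts LinearMap.id T (c := 0) (e := 0) (by simp)
    (fun p β h1 h2 => by simpa using ⟨h1, h2⟩) (fun q x hx => by simpa using hT q x hx) hx

theorem oddExt_mem_gpts {𝒱 : ZMod 2 → Submodule k V} {𝒲 : ZMod 2 → Submodule k W}
    {B : ArtinSuperalgebra k} {I : Submodule k B.carrier} (T : V →ₗ[k] W) {i j : ZMod 2}
    (hj : i + 1 = j)
    (hT : ∀ q, ∀ x ∈ 𝒱 q, T x ∈ 𝒲 (q + 1)) {x : B.carrier ⊗[k] V} (hx : x ∈ gpts 𝒱 B I i) :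
    oddExt B T x ∈ gpts 𝒲 B I j :=
  map_mem_gpts (par B.gr) T (c := 0) (e := 1) (by simpa using hj)
    (fun p β h1 h2 => by
      rw [par_of_mem _ h1, add_zero]
      exact ⟨Submodule.smul_mem _ _ h1, Submodule.smul_mem _ _ h2⟩) hT hx

theorem oddExt_mem_tens {B : ArtinSuperalgebra k} {I : Submodule k B.carrier} (hI : Homog B I)
    (T : V →ₗ[k] W) {x : B.carrier ⊗[k] V} (hx : x ∈ tens I V) : oddExt B T x ∈ tens I W :=
  map_mem_tens _ T (fun _ hβ => hI.par_mem hβ) hx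

theorem oddExt_oddExt {U : Type v} [AddCommGroup U] [Module k U] (B : ArtinSuperalgebra k)
    (S : W →ₗ[k] U) (T : V →ₗ[k] W) (x : B.carrier ⊗[k] V) :
    oddExt B S (oddExt B T x) = (S ∘ₗ T).lTensor B.carrier x := by
  rw [oddExt, oddExt, ← LinearMap.comp_apply, ← TensorProduct.map_comp]
  have : par B.gr ∘ₗ par B.gr = LinearMap.id := by ext b; exact par_par B.gr b
  rw [this]; rfl

theorem oddExt_lTensor {U : Type v} [AddCommGroup U] [Module k U] (B : ArtinSuperalgebra k)
    (S : W →ₗ[k] U) (T : V →ₗ[k] W) (x : B.carrier ⊗[k] V) :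
    oddExt B S (T.lTensor B.carrier x) = oddExt B (S ∘ₗ T) x := by
  rw [oddExt, LinearMap.lTensor, ← LinearMap.comp_apply, ← TensorProduct.map_comp]; rfl

theorem lTensor_oddExt {U : Type v} [AddCommGroup U] [Module k U] (B : ArtinSuperalgebra k)
    (S : W →ₗ[k] U) (T : V →ₗ[k] W) (x : B.carrier ⊗[k] V) :
    S.lTensor B.carrier (oddExt B T x) = oddExt B (S ∘ₗ T) x := by
  rw [oddExt, LinearMap.lTensor, ← LinearMap.comp_apply, ← TensorProduct.map_comp]; rfl

/-- Two linear maps on `B ⊗ V` agree if they agree on homogeneous pure tensors. -/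
theorem ext_homog (𝒱 : ZMod 2 → Submodule k V) [DirectSum.Decomposition 𝒱]
    (B : ArtinSuperalgebra k) {P : Type*} [AddCommGroup P] [Module k P]
    {f g : B.carrier ⊗[k] V →ₗ[k] P}
    (h : ∀ p q, ∀ β ∈ B.gr p, ∀ x ∈ 𝒱 q, f (β ⊗ₜ[k] x) = g (β ⊗ₜ[k] x)) : f = g := by
  refine TensorProduct.ext' fun β x => ?_
  rw [← proj_add_proj B.gr β, ← proj_add_proj 𝒱 x]
  simp only [TensorProduct.add_tmul, TensorProduct.tmul_add, map_add]
  rw [h _ _ _ (proj_mem B.gr 0 β) _ (proj_mem 𝒱 0 x),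
    h _ _ _ (proj_mem B.gr 1 β) _ (proj_mem 𝒱 0 x),
    h _ _ _ (proj_mem B.gr 0 β) _ (proj_mem 𝒱 1 x), h _ _ _ (proj_mem B.gr 1 β) _ (proj_mem 𝒱 1 x)]

/-- The parity involution of `B ⊗ V`. -/
def parT (𝒱 : ZMod 2 → Submodule k V) [DirectSum.Decomposition 𝒱] (B : ArtinSuperalgebra k) :
    B.carrier ⊗[k] V →ₗ[k] B.carrier ⊗[k] V :=
  TensorProduct.map (par B.gr) (par 𝒱)

theorem parT_of_mem {𝒱 : ZMod 2 → Submodule k V} [DirectSum.Decomposition 𝒱]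
    {B : ArtinSuperalgebra k} {I : Submodule k B.carrier} {i : ZMod 2} {x : B.carrier ⊗[k] V}
    (hx : x ∈ gpts 𝒱 B I i) : parT 𝒱 B x = (-1 : k) ^ i.val • x := by
  have h : gpts 𝒱 B I i ≤ LinearMap.ker (parT 𝒱 B - (-1 : k) ^ i.val • LinearMap.id) := by
    refine gpts_le ?_
    intro p q hi β hβ _ y hy
    rw [LinearMap.mem_ker, LinearMap.sub_apply, sub_eq_zero]
    simp only [parT, TensorProduct.map_tmul, par_of_mem _ hβ, par_of_mem _ hy, LinearMap.smul_apply,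
      LinearMap.id_apply, TensorProduct.smul_tmul', TensorProduct.tmul_smul, smul_smul]
    congr 2
    subst hi
    rcases zmod2_cases p with rfl | rfl <;> rcases zmod2_cases q with rfl | rfl <;>
      simp [zmod2_val_one, show (1 + 1 : ZMod 2) = 0 from rfl]
  simpa [sub_eq_zero] using h hx

theorem mem_gpts_of_parT [CharZero k] {𝒱 : ZMod 2 → Submodule k V} [DirectSum.Decomposition 𝒱]
    {B : ArtinSuperalgebra k} {I : Submodule k B.carrier} (hI : Homog B I) {i : ZMod 2}
    {x : B.carrier ⊗[k] V} (hx : x ∈ tens I V) (hp : parT 𝒱 B x = (-1 : k) ^ i.val • x) :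
    x ∈ gpts 𝒱 B I i := by
  have key : ∀ x ∈ tens I V, x + (-1 : k) ^ i.val • parT 𝒱 B x ∈ gpts 𝒱 B I i := by
    intro x hx
    refine tens_le (K := (gpts 𝒱 B I i).comap
      (LinearMap.id + (-1 : k) ^ i.val • parT 𝒱 B)) ?_ hx
    intro β hβ y
    have hm : ∀ p q, proj B.gr p β ⊗ₜ[k] proj 𝒱 q y ∈ gpts 𝒱 B I (p + q) := fun p q =>
      tmul_mem_gpts rfl (proj_mem _ _ _) (hI β hβ p) (proj_mem _ _ _)
    have e : β ⊗ₜ[k] y = proj B.gr 0 β ⊗ₜ[k] proj 𝒱 0 y + proj B.gr 1 β ⊗ₜ[k] proj 𝒱 1 y +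
        (proj B.gr 0 β ⊗ₜ[k] proj 𝒱 1 y + proj B.gr 1 β ⊗ₜ[k] proj 𝒱 0 y) := by
      conv_lhs => rw [← proj_add_proj B.gr β, ← proj_add_proj 𝒱 y]
      simp only [TensorProduct.add_tmul, TensorProduct.tmul_add]
      abel
    rw [Submodule.mem_comap, e, map_add]
    have h0 := Submodule.add_mem _ (hm 0 0) (hm 1 1)
    have h1 := Submodule.add_mem _ (hm 0 1) (hm 1 0)
    simp only [add_zero, zero_add] at h0 h1
    simp only [LinearMap.add_apply, LinearMap.id_apply, LinearMap.smul_apply, parT_of_mem h0,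
      parT_of_mem h1, ZMod.val_zero, zmod2_val_one, pow_zero, pow_one, one_smul]
    rcases zmod2_cases i with rfl | rfl
    · convert Submodule.add_mem _ h0 h0 using 1
      simp only [ZMod.val_zero, pow_zero, one_smul]
      module
    · convert Submodule.add_mem _ h1 h1 using 1
      simp only [zmod2_val_one, pow_one]
      module
  have h := key x hx
  rw [hp, smul_smul, ← mul_pow] at h
  simp only [mul_neg, mul_one, neg_neg, one_pow, one_smul, ← two_smul k] at h
  exact (Submodule.smul_mem_iff _ (two_ne_zero' k)).1 h

theorem gpts_of_tens [CharZero k] {𝒱 : ZMod 2 → Submodule k V} [DirectSum.Decomposition 𝒱]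
    {B : ArtinSuperalgebra k} {I J : Submodule k B.carrier} (hI : Homog B I) {i : ZMod 2}
    {x : B.carrier ⊗[k] V} (hx : x ∈ tens I V) (hp : x ∈ gpts 𝒱 B J i) :
    x ∈ gpts 𝒱 B I i :=
  mem_gpts_of_parT hI hx (parT_of_mem hp)

theorem homog_top (B : ArtinSuperalgebra k) : Homog B ⊤ := fun _ _ _ => trivial

theorem aug_odd [CharZero k] (B : ArtinSuperalgebra k) {b : B.carrier} (hb : b ∈ B.gr 1) :
    B.aug b = 0 := by
  have h := B.supercomm 1 1 b hb b hb
  simp only [zmod2_val_one, mul_one, pow_one, neg_smul, one_smul] at h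
  have h2 := congrArg B.aug h
  simp only [map_mul, map_neg] at h2
  have h3 : B.aug b * B.aug b = 0 := self_eq_neg.1 h2
  exact mul_self_eq_zero.1 h3

theorem homog_maxIdeal [CharZero k] (B : ArtinSuperalgebra k) : Homog B B.maxIdeal := by
  intro b hb i
  have hb : B.aug b = 0 := hb
  have h1 := aug_odd B (proj_mem B.gr 1 b)
  have h0 : B.aug (proj B.gr 0 b) = 0 := by
    have := congrArg B.aug (proj_add_proj B.gr b)
    rwa [map_add, h1, add_zero, hb] at this
  rcases zmod2_cases i with rfl | rfl
  · exact h0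
  · exact h1

theorem proj_mul_homog (B : ArtinSuperalgebra k) {p : ZMod 2} {a : B.carrier} (ha : a ∈ B.gr p)
    (b : B.carrier) (i : ZMod 2) : proj B.gr i (a * b) = a * proj B.gr (i - p) b := by
  conv_lhs => rw [← proj_add_proj B.gr b, mul_add, map_add]
  have h0 := proj_mem B.gr 0 b
  have h1 := proj_mem B.gr 1 b
  rw [proj_of_mem B.gr (SetLike.mul_mem_graded ha h0),
    proj_of_mem B.gr (SetLike.mul_mem_graded ha h1)]
  rcases zmod2_cases i with rfl | rfl <;> rcases zmod2_cases p with rfl | rfl <;>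
    simp [show (1 + 1 : ZMod 2) = 0 from rfl, show (-1 : ZMod 2) = 1 from rfl]

theorem Homog.mul {B : ArtinSuperalgebra k} {I J : Submodule k B.carrier} (hI : Homog B I)
    (hJ : Homog B J) : Homog B (I * J) := by
  intro b hb i
  refine (Submodule.mul_le (P := (I * J).comap (proj B.gr i))).2 ?_ hb
  intro m hm n hn
  rw [Submodule.mem_comap]
  rw [← proj_add_proj B.gr m, add_mul, map_add]
  rw [proj_mul_homog B (proj_mem B.gr 0 m), proj_mul_homog B (proj_mem B.gr 1 m)]
  exact Submodule.add_mem _ (Submodule.mul_mem_mul (hI m hm _) (hJ n hn _))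
    (Submodule.mul_mem_mul (hI m hm _) (hJ n hn _))

theorem homog_pow [CharZero k] (B : ArtinSuperalgebra k) (n : ℕ) : Homog B (B.maxIdeal ^ n) := by
  induction n with
  | zero =>
    rw [pow_zero]
    intro b hb i
    obtain ⟨c, rfl⟩ := Submodule.mem_one.1 hb
    rw [Algebra.algebraMap_eq_smul_one, map_smul, proj_of_mem B.gr SetLike.GradedOne.one_mem]
    refine Submodule.smul_mem _ _ ?_
    split_ifs
    · exact Submodule.one_le.1 le_rfl
    · exact Submodule.zero_mem _
  | succ n ih => rw [pow_succ]; exact ih.mul (homog_maxIdeal B)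

theorem oddExt₂_mem_tens {U : Type v} [AddCommGroup U] [Module k U] {B : ArtinSuperalgebra k}
    (𝒰 : ZMod 2 → Submodule k U) [DirectSum.Decomposition 𝒰] (op : U →ₗ[k] V →ₗ[k] W)
    {I J K : Submodule k B.carrier} (hJ : Homog B J) (hK : I * J ≤ K) {x : B.carrier ⊗[k] U}
    {y : B.carrier ⊗[k] V} (hx : x ∈ tens I U) (hy : y ∈ tens J V) :
    oddExt₂ B 𝒰 op x y ∈ tens K W := by
  refine tens_le (K := (tens K W).comap ((oddExt₂ B 𝒰 op).flip y)) (fun β hβ a => ?_) hx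
  rw [Submodule.mem_comap, LinearMap.flip_apply]
  refine tens_le (K := (tens K W).comap (oddExt₂ B 𝒰 op (β ⊗ₜ a))) (fun β' hβ' b => ?_) hy
  rw [Submodule.mem_comap]
  simp only [oddExt₂, LinearMap.add_apply, TensorProduct.map₂_apply_tmul]
  exact Submodule.add_mem _ (tmul_mem_tens (hK (Submodule.mul_mem_mul hβ (hJ _ hβ' _))) _)
    (tmul_mem_tens (hK (Submodule.mul_mem_mul hβ (hJ _ hβ' _))) _)

theorem oddExt₂_tmul {U : Type v} [AddCommGroup U] [Module k U] {B : ArtinSuperalgebra k}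
    (𝒰 : ZMod 2 → Submodule k U) [DirectSum.Decomposition 𝒰] (op : U →ₗ[k] V →ₗ[k] W)
    {i q : ZMod 2} {a : U} (ha : a ∈ 𝒰 i) {β' : B.carrier} (hβ' : β' ∈ B.gr q) (β : B.carrier)
    (b : V) : oddExt₂ B 𝒰 op (β ⊗ₜ a) (β' ⊗ₜ b) =
      (-1 : k) ^ ((i.val + 1) * q.val) • ((β * β') ⊗ₜ[k] op a b) := by
  rcases zmod2_cases i with rfl | rfl <;> rcases zmod2_cases q with rfl | rfl <;>
    simp [oddExt₂, proj_of_mem _ hβ', proj_of_mem _ ha, zmod2_val_one, TensorProduct.tmul_neg,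
      -smul_eq_mul]; module

theorem oddExt_tmul {B : ArtinSuperalgebra k} (T : V →ₗ[k] W) {p : ZMod 2} {β : B.carrier}
    (hβ : β ∈ B.gr p) (x : V) : oddExt B T (β ⊗ₜ x) = (-1 : k) ^ p.val • (β ⊗ₜ[k] T x) := by
  simp [oddExt, par_of_mem _ hβ, TensorProduct.smul_tmul']

end Coefficients

/-! ### The supercommutative product and the second-order operator on `B ⊗ A` -/

section Product

variable {k : Type u} [Field k]

theorem gpts_eq {V : Type v} [AddCommGroup V] [Module k V] {𝒱 : ZMod 2 → Submodule k V}
    {B : ArtinSuperalgebra k} {I : Submodule k B.carrier} {i : ZMod 2} {P : Type*}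
    [AddCommGroup P] [Module k P] (f g : B.carrier ⊗[k] V →ₗ[k] P)
    (h : ∀ p q, p + q = i → ∀ β ∈ B.gr p, ∀ x ∈ 𝒱 q, f (β ⊗ₜ x) = g (β ⊗ₜ x))
    {x : B.carrier ⊗[k] V} (hx : x ∈ gpts 𝒱 B I i) : f x = g x := by
  have h : gpts 𝒱 B I i ≤ LinearMap.ker (f - g) :=
    gpts_le fun p q hi β hβ _ x hx => by simp [h p q hi β hβ x hx]
  simpa [sub_eq_zero] using h hx

variable {A : Type v} [Ring A] [Algebra k A] (𝒜 : ZMod 2 → Submodule k A) [GradedAlgebra 𝒜]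

/-- The product of the graded tensor product:
`(β ⊗ a) (β' ⊗ b) = (-1)^{ã β̃'} β β' ⊗ a b`. -/
def bmul (B : ArtinSuperalgebra k) :
    B.carrier ⊗[k] A →ₗ[k] Module.End k (B.carrier ⊗[k] A) :=
  TensorProduct.map₂ ((LinearMap.mul k B.carrier).compl₂ (proj B.gr 0)) (LinearMap.mul k A) +
    TensorProduct.map₂ ((LinearMap.mul k B.carrier).compl₂ (proj B.gr 1))
      (LinearMap.mul k A ∘ₗ par 𝒜)

theorem bmul_tmul {B : ArtinSuperalgebra k} {i q : ZMod 2} {a : A} (ha : a ∈ 𝒜 i)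
    {β' : B.carrier} (hβ' : β' ∈ B.gr q) (β : B.carrier) (b : A) :
    bmul 𝒜 B (β ⊗ₜ a) (β' ⊗ₜ b) = (-1 : k) ^ (i.val * q.val) • ((β * β') ⊗ₜ[k] (a * b)) := by
  rcases zmod2_cases i with rfl | rfl <;> rcases zmod2_cases q with rfl | rfl <;>
    simp [bmul, proj_of_mem _ hβ', par_of_mem _ ha, zmod2_val_one, TensorProduct.tmul_neg,
      -smul_eq_mul]

theorem bmul_one (B : ArtinSuperalgebra k) (x : B.carrier ⊗[k] A) :
    bmul 𝒜 B x (1 ⊗ₜ 1) = x := by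
  have : (bmul 𝒜 B).flip (1 ⊗ₜ 1) = LinearMap.id := by
    refine ext_homog 𝒜 B fun p q β _ a ha => ?_
    rw [LinearMap.flip_apply, bmul_tmul 𝒜 ha (SetLike.GradedOne.one_mem : (1 : B.carrier) ∈ B.gr 0)]
    simp
  exact LinearMap.congr_fun this x

theorem bmul_mem_tens {B : ArtinSuperalgebra k}
    {I J K : Submodule k B.carrier} (hJ : Homog B J) (hK : I * J ≤ K) {x : B.carrier ⊗[k] A}
    {y : B.carrier ⊗[k] A} (hx : x ∈ tens I A) (hy : y ∈ tens J A) :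
    bmul 𝒜 B x y ∈ tens K A := by
  refine tens_le (K := (tens K A).comap ((bmul 𝒜 B).flip y)) (fun β hβ a => ?_) hx
  rw [Submodule.mem_comap, LinearMap.flip_apply]
  refine tens_le (K := (tens K A).comap (bmul 𝒜 B (β ⊗ₜ a))) (fun β' hβ' b => ?_) hy
  rw [Submodule.mem_comap]
  simp only [bmul, LinearMap.add_apply, TensorProduct.map₂_apply_tmul]
  exact Submodule.add_mem _ (tmul_mem_tens (hK (Submodule.mul_mem_mul hβ (hJ _ hβ' _))) _)
    (tmul_mem_tens (hK (Submodule.mul_mem_mul hβ (hJ _ hβ' _))) _)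

theorem bmul_mem_gpts {B : ArtinSuperalgebra k} {i j l : ZMod 2} (hl : i + j = l)
    {x y : B.carrier ⊗[k] A} (hx : x ∈ gpts 𝒜 B ⊤ i) (hy : y ∈ gpts 𝒜 B ⊤ j) :
    bmul 𝒜 B x y ∈ gpts 𝒜 B ⊤ l := by
  refine gpts_le (K := (gpts 𝒜 B ⊤ l).comap ((bmul 𝒜 B).flip y)) (fun p q hi β hβ _ a ha => ?_) hx
  rw [Submodule.mem_comap, LinearMap.flip_apply]
  refine gpts_le (K := (gpts 𝒜 B ⊤ l).comap (bmul 𝒜 B (β ⊗ₜ a)))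
    (fun p' q' hi' β' hβ' _ b hb => ?_) hy
  rw [Submodule.mem_comap, bmul_tmul 𝒜 ha hβ']
  exact Submodule.smul_mem _ _ (tmul_mem_gpts (by rw [← hl, ← hi, ← hi']; ring)
    (SetLike.mul_mem_graded hβ hβ') Submodule.mem_top (SetLike.mul_mem_graded ha hb))

theorem oddExt₂_mem_gpts (op : A →ₗ[k] A →ₗ[k] A)
    (hop : ∀ i j, ∀ a ∈ 𝒜 i, ∀ b ∈ 𝒜 j, op a b ∈ 𝒜 (i + j + 1)) {B : ArtinSuperalgebra k}
    {i j l : ZMod 2} (hl : i + j + 1 = l)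
    {x y : B.carrier ⊗[k] A} (hx : x ∈ gpts 𝒜 B ⊤ i) (hy : y ∈ gpts 𝒜 B ⊤ j) :
    oddExt₂ B 𝒜 op x y ∈ gpts 𝒜 B ⊤ l := by
  refine gpts_le (K := (gpts 𝒜 B ⊤ l).comap ((oddExt₂ B 𝒜 op).flip y))
    (fun p q hi β hβ _ a ha => ?_) hx
  rw [Submodule.mem_comap, LinearMap.flip_apply]
  refine gpts_le (K := (gpts 𝒜 B ⊤ l).comap (oddExt₂ B 𝒜 op (β ⊗ₜ a)))
    (fun p' q' hi' β' hβ' _ b hb => ?_) hy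
  rw [Submodule.mem_comap, oddExt₂_tmul 𝒜 op ha hβ']
  exact Submodule.smul_mem _ _ (tmul_mem_gpts (by rw [← hl, ← hi, ← hi']; ring)
    (SetLike.mul_mem_graded hβ hβ') Submodule.mem_top (hop _ _ _ ha _ hb))

variable {𝒜} (X : DGBV 𝒜) {B : ArtinSuperalgebra k}

theorem zmod2_eq_of_add {p q : ZMod 2} (h : p + q = 0) : p = q := by
  revert p q; decide

theorem zmod2_eq_of_add_one {p q : ZMod 2} (h : p + q = 1) : p + 1 = q := by
  revert p q; decide

/-- Even elements are central. -/
theorem bmul_comm (X : DGBV 𝒜) {b : B.carrier ⊗[k] A} (hb : b ∈ gpts 𝒜 B ⊤ 0)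
    (x : B.carrier ⊗[k] A) :
    bmul 𝒜 B x * bmul 𝒜 B b = bmul 𝒜 B b * bmul 𝒜 B x := by
  have h : ∀ z, bmul 𝒜 B x (bmul 𝒜 B b z) = bmul 𝒜 B b (bmul 𝒜 B x z) := by
    intro z
    refine gpts_eq (bmul 𝒜 B x ∘ₗ (bmul 𝒜 B).flip z) ((bmul 𝒜 B).flip (bmul 𝒜 B x z)) ?_ hb
    intro q q' hq β' hβ' b' hb'
    obtain rfl := zmod2_eq_of_add hq
    simp only [LinearMap.comp_apply, LinearMap.flip_apply]
    refine LinearMap.congr_fun (f := (bmul 𝒜 B).flip (bmul 𝒜 B (β' ⊗ₜ b') z))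
      (g := bmul 𝒜 B (β' ⊗ₜ b') ∘ₗ (bmul 𝒜 B).flip z) (ext_homog 𝒜 B ?_) x
    intro p i β hβ a ha
    simp only [LinearMap.comp_apply, LinearMap.flip_apply]
    refine LinearMap.congr_fun (f := bmul 𝒜 B (β ⊗ₜ a) ∘ₗ bmul 𝒜 B (β' ⊗ₜ b'))
      (g := bmul 𝒜 B (β' ⊗ₜ b') ∘ₗ bmul 𝒜 B (β ⊗ₜ a)) (ext_homog 𝒜 B ?_) z
    intro r j β'' hβ'' c hc
    simp only [LinearMap.comp_apply]
    rw [bmul_tmul 𝒜 hb' hβ'', bmul_tmul 𝒜 ha hβ'', map_smul, map_smul,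
      bmul_tmul 𝒜 ha (SetLike.mul_mem_graded hβ' hβ''),
      bmul_tmul 𝒜 hb' (SetLike.mul_mem_graded hβ hβ''), ← mul_assoc, ← mul_assoc, ← mul_assoc,
      ← mul_assoc, B.supercomm _ _ β hβ β' hβ', X.supercomm _ _ a ha b' hb']
    simp only [smul_mul_assoc, ← TensorProduct.smul_tmul', TensorProduct.tmul_smul, smul_smul]
    congr 1
    rcases zmod2_cases p with rfl | rfl <;> rcases zmod2_cases i with rfl | rfl <;>
      rcases zmod2_cases q with rfl | rfl <;> rcases zmod2_cases r with rfl | rfl <;>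
      simp [zmod2_val_one, show (1 + 1 : ZMod 2) = 0 from rfl]
  exact LinearMap.ext h

theorem bmul_comm' (X : DGBV 𝒜) {b : B.carrier ⊗[k] A} (hb : b ∈ gpts 𝒜 B ⊤ 0)
    (x : B.carrier ⊗[k] A) :
    bmul 𝒜 B x b = bmul 𝒜 B b x := by
  have h := LinearMap.congr_fun (bmul_comm X hb x) (1 ⊗ₜ 1)
  simpa only [Module.End.mul_apply, bmul_one] using h

theorem DGBV.Δ_one : X.Δ 1 = 0 := by
  have h1 : (1 : A) ∈ 𝒜 0 := SetLike.GradedOne.one_mem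
  have h := X.Δ_order 0 0 1 h1 1 h1 1
  simp only [mul_one, one_mul, ZMod.val_zero, pow_zero, one_smul, zero_mul, add_zero] at h
  simpa using h

theorem DGBV.d_one : X.d 1 = 0 := by
  have h1 : (1 : A) ∈ 𝒜 0 := SetLike.GradedOne.one_mem
  have h := X.d_leibniz 0 1 h1 1
  simpa using h

theorem Δ_unit (B : ArtinSuperalgebra k) : oddExt B X.Δ (1 ⊗ₜ 1) = 0 := by simp [oddExt, X.Δ_one]

theorem d_unit (B : ArtinSuperalgebra k) : oddExt B X.d (1 ⊗ₜ 1) = 0 := by simp [oddExt, X.d_one]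

/-- `Δ` is an operator of second order: its iterated commutator with the multiplications by two
even elements is the multiplication by their bracket. -/
theorem Δ_comm_even {x y : B.carrier ⊗[k] A} (hx : x ∈ gpts 𝒜 B ⊤ 0) (hy : y ∈ gpts 𝒜 B ⊤ 0) :
    (oddExt B X.Δ * bmul 𝒜 B x - bmul 𝒜 B x * oddExt B X.Δ) * bmul 𝒜 B y -
      bmul 𝒜 B y * (oddExt B X.Δ * bmul 𝒜 B x - bmul 𝒜 B x * oddExt B X.Δ) =
    bmul 𝒜 B (oddExt B X.Δ (bmul 𝒜 B x y) - bmul 𝒜 B (oddExt B X.Δ x) y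
      - bmul 𝒜 B x (oddExt B X.Δ y)) := by
  let D : Module.End k (B.carrier ⊗[k] A) := oddExt B X.Δ
  let L := bmul 𝒜 B
  refine gpts_eq (I := ⊤)
    (LinearMap.mulLeft k (D * L x - L x * D) ∘ₗ L - LinearMap.mulRight k (D * L x - L x * D) ∘ₗ L)
    (L ∘ₗ (D ∘ₗ L x - L (D x) - L x ∘ₗ D)) ?_ hy
  intro q q' hq β' hβ' b hb
  obtain rfl := zmod2_eq_of_add hq
  simp only [LinearMap.sub_apply, LinearMap.comp_apply, LinearMap.mulLeft_apply,
    LinearMap.mulRight_apply]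
  set y := β' ⊗ₜ[k] b with hy
  let c : Module.End k (B.carrier ⊗[k] A) →ₗ[k] Module.End k (B.carrier ⊗[k] A) :=
    LinearMap.mulLeft k D - LinearMap.mulRight k D
  refine gpts_eq (I := ⊤)
    ((LinearMap.mulRight k (L y) - LinearMap.mulLeft k (L y)) ∘ₗ c ∘ₗ L)
    (L ∘ₗ (D ∘ₗ L.flip y - L.flip y ∘ₗ D - L.flip (D y))) ?_ hx
  intro p p' hp β hβ a ha
  obtain rfl := zmod2_eq_of_add hp
  refine ext_homog 𝒜 B fun r j β'' hβ'' c' _ => ?_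
  have key := congrArg (TensorProduct.mk k B.carrier A (β * β' * β''))
    (X.Δ_order p q a ha b hb c')
  have hba : b * a = (-1 : k) ^ (q.val * p.val) • (a * b) := X.supercomm q p b hb a ha
  have hba' : b * (a * X.Δ c') = (-1 : k) ^ (q.val * p.val) • (a * (b * X.Δ c')) := by
    rw [← mul_assoc, hba, smul_mul_assoc, mul_assoc]
  have hβ1 : β' * β = (-1 : k) ^ (q.val * p.val) • (β * β') := B.supercomm q p β' hβ' β hβ
  have hβ2 : β' * (β * β'') = (-1 : k) ^ (q.val * p.val) • (β * (β' * β'')) := by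
    rw [← mul_assoc, hβ1, smul_mul_assoc, mul_assoc]
  have hΔa := X.Δ_odd p a ha
  have hΔb := X.Δ_odd q b hb
  have hΔab := X.Δ_odd _ _ (SetLike.mul_mem_graded ha hb)
  simp only [map_add, map_sub, map_smul, TensorProduct.mk_apply] at key
  simp only [c, D, L, hy, LinearMap.sub_apply, LinearMap.comp_apply, LinearMap.mulLeft_apply,
    LinearMap.mulRight_apply, Module.End.mul_apply, LinearMap.flip_apply, map_sub, map_smul,
    LinearMap.smul_apply,
    oddExt_tmul _ hβ, oddExt_tmul _ hβ', oddExt_tmul _ hβ'',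
    bmul_tmul 𝒜 ha hβ', bmul_tmul 𝒜 ha hβ'', bmul_tmul 𝒜 hb hβ'', bmul_tmul 𝒜 hΔa hβ',
    bmul_tmul 𝒜 hb hβ,
    oddExt_tmul _ (SetLike.mul_mem_graded hβ hβ'), oddExt_tmul _ (SetLike.mul_mem_graded hβ hβ''),
    oddExt_tmul _ (SetLike.mul_mem_graded hβ' hβ''),
    oddExt_tmul _ (SetLike.mul_mem_graded hβ (SetLike.mul_mem_graded hβ' hβ'')),
    bmul_tmul 𝒜 ha (SetLike.mul_mem_graded hβ' hβ''),
    bmul_tmul 𝒜 hb (SetLike.mul_mem_graded hβ hβ''),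
    bmul_tmul 𝒜 hΔab hβ'', bmul_tmul 𝒜 (SetLike.mul_mem_graded hΔa hb) hβ'',
    bmul_tmul 𝒜 (SetLike.mul_mem_graded ha hΔb) hβ'', hβ2, hba', mul_assoc,
    ← TensorProduct.smul_tmul', TensorProduct.tmul_smul, smul_smul] at key ⊢
  rcases zmod2_cases p with rfl | rfl <;>
    rcases zmod2_cases q with rfl | rfl <;> rcases zmod2_cases r with rfl | rfl <;>
    simp only [zmod2_val_one, ZMod.val_zero, show (1 + 1 : ZMod 2) = 0 from rfl, add_zero, zero_add,
      mul_zero, zero_mul, mul_one, pow_zero, pow_one, one_smul, show 1 + 1 = 2 from rfl,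
      neg_one_sq, neg_mul, one_mul, neg_neg, mul_neg, neg_smul] at key ⊢ <;>
    rw [key] <;> abel

/-- For odd `x` the operator `[Δ, x]` is a derivation with respect to multiplication by even
elements. -/
theorem Δ_comm_odd {x y : B.carrier ⊗[k] A} (hx : x ∈ gpts 𝒜 B ⊤ 1) (hy : y ∈ gpts 𝒜 B ⊤ 0) :
    (oddExt B X.Δ * bmul 𝒜 B x + bmul 𝒜 B x * oddExt B X.Δ) * bmul 𝒜 B y -
      bmul 𝒜 B y * (oddExt B X.Δ * bmul 𝒜 B x + bmul 𝒜 B x * oddExt B X.Δ) =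
    bmul 𝒜 B (oddExt B X.Δ (bmul 𝒜 B x y) - bmul 𝒜 B (oddExt B X.Δ x) y
      + bmul 𝒜 B x (oddExt B X.Δ y)) := by
  let D : Module.End k (B.carrier ⊗[k] A) := oddExt B X.Δ
  let L := bmul 𝒜 B
  refine gpts_eq (I := ⊤)
    (LinearMap.mulLeft k (D * L x + L x * D) ∘ₗ L - LinearMap.mulRight k (D * L x + L x * D) ∘ₗ L)
    (L ∘ₗ (D ∘ₗ L x - L (D x) + L x ∘ₗ D)) ?_ hy
  intro q q' hq β' hβ' b hb
  obtain rfl := zmod2_eq_of_add hq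
  simp only [LinearMap.sub_apply, LinearMap.add_apply, LinearMap.comp_apply,
    LinearMap.mulLeft_apply, LinearMap.mulRight_apply]
  set y := β' ⊗ₜ[k] b with hy
  let c : Module.End k (B.carrier ⊗[k] A) →ₗ[k] Module.End k (B.carrier ⊗[k] A) :=
    LinearMap.mulLeft k D + LinearMap.mulRight k D
  refine gpts_eq (I := ⊤)
    ((LinearMap.mulRight k (L y) - LinearMap.mulLeft k (L y)) ∘ₗ c ∘ₗ L)
    (L ∘ₗ (D ∘ₗ L.flip y - L.flip y ∘ₗ D + L.flip (D y))) ?_ hx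
  intro p p' hp β hβ a ha
  obtain rfl := zmod2_eq_of_add_one hp
  refine ext_homog 𝒜 B fun r j β'' hβ'' c' _ => ?_
  have key := congrArg (TensorProduct.mk k B.carrier A (β * β' * β''))
    (X.Δ_order (p + 1) q a ha b hb c')
  have hba : b * a = (-1 : k) ^ (q.val * (p + 1).val) • (a * b) := X.supercomm q (p + 1) b hb a ha
  have hba' : b * (a * X.Δ c') = (-1 : k) ^ (q.val * (p + 1).val) • (a * (b * X.Δ c')) := by
    rw [← mul_assoc, hba, smul_mul_assoc, mul_assoc]
  have hβ1 : β' * β = (-1 : k) ^ (q.val * p.val) • (β * β') := B.supercomm q p β' hβ' β hβ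
  have hβ2 : β' * (β * β'') = (-1 : k) ^ (q.val * p.val) • (β * (β' * β'')) := by
    rw [← mul_assoc, hβ1, smul_mul_assoc, mul_assoc]
  have hΔa := X.Δ_odd (p + 1) a ha
  have hΔb := X.Δ_odd q b hb
  have hΔab := X.Δ_odd _ _ (SetLike.mul_mem_graded ha hb)
  simp only [map_add, map_sub, map_smul, TensorProduct.mk_apply] at key
  simp only [c, D, L, hy, LinearMap.sub_apply, LinearMap.add_apply, LinearMap.comp_apply,
    LinearMap.mulLeft_apply,
    LinearMap.mulRight_apply, Module.End.mul_apply, LinearMap.flip_apply, map_sub, map_add,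
    map_smul,
    LinearMap.smul_apply,
    oddExt_tmul _ hβ, oddExt_tmul _ hβ', oddExt_tmul _ hβ'',
    bmul_tmul 𝒜 ha hβ', bmul_tmul 𝒜 ha hβ'', bmul_tmul 𝒜 hb hβ'', bmul_tmul 𝒜 hΔa hβ',
    bmul_tmul 𝒜 hb hβ,
    oddExt_tmul _ (SetLike.mul_mem_graded hβ hβ'), oddExt_tmul _ (SetLike.mul_mem_graded hβ hβ''),
    oddExt_tmul _ (SetLike.mul_mem_graded hβ' hβ''),
    oddExt_tmul _ (SetLike.mul_mem_graded hβ (SetLike.mul_mem_graded hβ' hβ'')),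
    bmul_tmul 𝒜 ha (SetLike.mul_mem_graded hβ' hβ''),
    bmul_tmul 𝒜 hb (SetLike.mul_mem_graded hβ hβ''),
    bmul_tmul 𝒜 hΔab hβ'', bmul_tmul 𝒜 (SetLike.mul_mem_graded hΔa hb) hβ'',
    bmul_tmul 𝒜 (SetLike.mul_mem_graded ha hΔb) hβ'', hβ2, hba', mul_assoc,
    ← TensorProduct.smul_tmul', TensorProduct.tmul_smul, smul_smul] at key ⊢
  rcases zmod2_cases p with rfl | rfl <;>
    rcases zmod2_cases q with rfl | rfl <;> rcases zmod2_cases r with rfl | rfl <;>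
    simp only [zmod2_val_one, ZMod.val_zero, show (1 + 1 : ZMod 2) = 0 from rfl, add_zero, zero_add,
      mul_zero, zero_mul, mul_one, pow_zero, pow_one, one_smul, show 1 + 1 = 2 from rfl,
      neg_one_sq, neg_mul, one_mul, neg_neg, mul_neg, neg_smul] at key ⊢ <;>
    rw [key] <;> abel

/-- The commutator of the differential with the multiplication by an even element. -/
theorem d_comm_even {x : B.carrier ⊗[k] A} (hx : x ∈ gpts 𝒜 B ⊤ 0) :
    oddExt B X.d * bmul 𝒜 B x - bmul 𝒜 B x * oddExt B X.d = bmul 𝒜 B (oddExt B X.d x) := by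
  let D : Module.End k (B.carrier ⊗[k] A) := oddExt B X.d
  let L := bmul 𝒜 B
  refine gpts_eq (I := ⊤) ((LinearMap.mulLeft k D - LinearMap.mulRight k D) ∘ₗ L) (L ∘ₗ D) ?_ hx
  intro p p' hp β hβ a ha
  obtain rfl := zmod2_eq_of_add hp
  refine ext_homog 𝒜 B fun r j β'' hβ'' c' _ => ?_
  simp only [D, L, LinearMap.sub_apply, LinearMap.comp_apply, LinearMap.mulLeft_apply,
    LinearMap.mulRight_apply, Module.End.mul_apply, map_smul, LinearMap.smul_apply,
    oddExt_tmul _ hβ, oddExt_tmul _ hβ'', bmul_tmul 𝒜 ha hβ'', bmul_tmul 𝒜 (X.d_odd p a ha) hβ'',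
    oddExt_tmul _ (SetLike.mul_mem_graded hβ hβ''), X.d_leibniz p a ha, TensorProduct.tmul_add,
    TensorProduct.tmul_smul, smul_add, smul_smul]
  rcases zmod2_cases p with rfl | rfl <;> rcases zmod2_cases r with rfl | rfl <;>
    simp [zmod2_val_one, show (1 + 1 : ZMod 2) = 0 from rfl]

theorem d_comm_odd {x : B.carrier ⊗[k] A} (hx : x ∈ gpts 𝒜 B ⊤ 1) :
    oddExt B X.d * bmul 𝒜 B x + bmul 𝒜 B x * oddExt B X.d = bmul 𝒜 B (oddExt B X.d x) := by
  let D : Module.End k (B.carrier ⊗[k] A) := oddExt B X.d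
  let L := bmul 𝒜 B
  refine gpts_eq (I := ⊤) ((LinearMap.mulLeft k D + LinearMap.mulRight k D) ∘ₗ L) (L ∘ₗ D) ?_ hx
  intro p p' hp β hβ a ha
  obtain rfl := zmod2_eq_of_add_one hp
  refine ext_homog 𝒜 B fun r j β'' hβ'' c' _ => ?_
  simp only [D, L, LinearMap.add_apply, LinearMap.comp_apply, LinearMap.mulLeft_apply,
    LinearMap.mulRight_apply, Module.End.mul_apply, map_smul, LinearMap.smul_apply,
    oddExt_tmul _ hβ, oddExt_tmul _ hβ'', bmul_tmul 𝒜 ha hβ'', bmul_tmul 𝒜 (X.d_odd _ a ha) hβ'',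
    oddExt_tmul _ (SetLike.mul_mem_graded hβ hβ''), X.d_leibniz _ a ha, TensorProduct.tmul_add,
    TensorProduct.tmul_smul, smul_add, smul_smul]
  rcases zmod2_cases p with rfl | rfl <;> rcases zmod2_cases r with rfl | rfl <;>
    simp [zmod2_val_one, show (1 + 1 : ZMod 2) = 0 from rfl]

theorem coeffDiff_comm_even {B : DGArtin k} {x : B.carrier ⊗[k] A}
    (hx : x ∈ gpts 𝒜 B.toArtinSuperalgebra ⊤ 0) :
    coeffDiff A B * bmul 𝒜 B.toArtinSuperalgebra x - bmul 𝒜 B.toArtinSuperalgebra x * coeffDiff A B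
      = bmul 𝒜 B.toArtinSuperalgebra (coeffDiff A B x) := by
  let D : Module.End k (B.carrier ⊗[k] A) := coeffDiff A B
  let L := bmul 𝒜 B.toArtinSuperalgebra
  refine gpts_eq (I := ⊤) ((LinearMap.mulLeft k D - LinearMap.mulRight k D) ∘ₗ L) (L ∘ₗ D) ?_ hx
  intro p p' hp β hβ a ha
  obtain rfl := zmod2_eq_of_add hp
  refine ext_homog 𝒜 B.toArtinSuperalgebra fun r j β'' hβ'' c' _ => ?_
  simp only [D, L, LinearMap.sub_apply, LinearMap.comp_apply, LinearMap.mulLeft_apply,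
    LinearMap.mulRight_apply, Module.End.mul_apply, coeffDiff, LinearMap.rTensor_tmul,
    bmul_tmul 𝒜 ha hβ'', bmul_tmul 𝒜 ha (B.diff_odd _ _ hβ''), map_smul,
    B.leibniz, par_of_mem _ hβ, TensorProduct.add_tmul, smul_mul_assoc,
    ← TensorProduct.smul_tmul', smul_add, smul_smul]
  rcases zmod2_cases p with rfl | rfl <;> rcases zmod2_cases r with rfl | rfl <;>
    simp [zmod2_val_one, show (1 + 1 : ZMod 2) = 0 from rfl]

theorem coeffDiff_comm_odd {B : DGArtin k} {x : B.carrier ⊗[k] A}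
    (hx : x ∈ gpts 𝒜 B.toArtinSuperalgebra ⊤ 1) :
    coeffDiff A B * bmul 𝒜 B.toArtinSuperalgebra x + bmul 𝒜 B.toArtinSuperalgebra x * coeffDiff A B
      = bmul 𝒜 B.toArtinSuperalgebra (coeffDiff A B x) := by
  let D : Module.End k (B.carrier ⊗[k] A) := coeffDiff A B
  let L := bmul 𝒜 B.toArtinSuperalgebra
  refine gpts_eq (I := ⊤) ((LinearMap.mulLeft k D + LinearMap.mulRight k D) ∘ₗ L) (L ∘ₗ D) ?_ hx
  intro p p' hp β hβ a ha
  obtain rfl := zmod2_eq_of_add_one hp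
  refine ext_homog 𝒜 B.toArtinSuperalgebra fun r j β'' hβ'' c' _ => ?_
  simp only [D, L, LinearMap.add_apply, LinearMap.comp_apply, LinearMap.mulLeft_apply,
    LinearMap.mulRight_apply, Module.End.mul_apply, coeffDiff, LinearMap.rTensor_tmul,
    bmul_tmul 𝒜 ha hβ'', bmul_tmul 𝒜 ha (B.diff_odd _ _ hβ''), map_smul,
    B.leibniz, par_of_mem _ hβ, TensorProduct.add_tmul, smul_mul_assoc,
    ← TensorProduct.smul_tmul', smul_add, smul_smul]
  rcases zmod2_cases p with rfl | rfl <;> rcases zmod2_cases r with rfl | rfl <;>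
    simp [zmod2_val_one, show (1 + 1 : ZMod 2) = 0 from rfl]

/-- The bracket on `B ⊗ A` in terms of the product. -/
theorem br_even {x : B.carrier ⊗[k] A} (hx : x ∈ gpts 𝒜 B ⊤ 0) (y : B.carrier ⊗[k] A) :
    oddExt₂ B 𝒜 X.br x y = oddExt B X.Δ (bmul 𝒜 B x y) - bmul 𝒜 B (oddExt B X.Δ x) y
      - bmul 𝒜 B x (oddExt B X.Δ y) := by
  let D : Module.End k (B.carrier ⊗[k] A) := oddExt B X.Δ
  let L := bmul 𝒜 B
  have h : oddExt₂ B 𝒜 X.br x = D * L x - L (D x) - L x * D := by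
    refine gpts_eq (I := ⊤) (P := Module.End k (B.carrier ⊗[k] A)) (oddExt₂ B 𝒜 X.br)
      (LinearMap.mulLeft k D ∘ₗ L - L ∘ₗ D - LinearMap.mulRight k D ∘ₗ L) ?_ hx
    intro p p' hp β hβ a ha
    obtain rfl := zmod2_eq_of_add hp
    refine ext_homog 𝒜 B fun r j β'' hβ'' c' _ => ?_
    simp only [D, L, LinearMap.sub_apply, LinearMap.comp_apply, LinearMap.mulLeft_apply,
      LinearMap.mulRight_apply, Module.End.mul_apply, map_smul, LinearMap.smul_apply,
      oddExt_tmul _ hβ, oddExt_tmul _ hβ'', bmul_tmul 𝒜 ha hβ'', bmul_tmul 𝒜 (X.Δ_odd p a ha) hβ'',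
      oddExt_tmul _ (SetLike.mul_mem_graded hβ hβ''), oddExt₂_tmul 𝒜 X.br ha hβ'', X.br_apply,
      par_of_mem _ ha, TensorProduct.tmul_sub, smul_mul_assoc,
      TensorProduct.tmul_smul, smul_sub, smul_smul]
    rcases zmod2_cases p with rfl | rfl <;> rcases zmod2_cases r with rfl | rfl <;>
      simp [zmod2_val_one, show (1 + 1 : ZMod 2) = 0 from rfl]
  exact LinearMap.congr_fun h y

theorem br_odd {x : B.carrier ⊗[k] A} (hx : x ∈ gpts 𝒜 B ⊤ 1) (y : B.carrier ⊗[k] A) :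
    oddExt₂ B 𝒜 X.br x y = bmul 𝒜 B (oddExt B X.Δ x) y - oddExt B X.Δ (bmul 𝒜 B x y)
      - bmul 𝒜 B x (oddExt B X.Δ y) := by
  let D : Module.End k (B.carrier ⊗[k] A) := oddExt B X.Δ
  let L := bmul 𝒜 B
  have h : oddExt₂ B 𝒜 X.br x = L (D x) - D * L x - L x * D := by
    refine gpts_eq (I := ⊤) (P := Module.End k (B.carrier ⊗[k] A)) (oddExt₂ B 𝒜 X.br)
      (L ∘ₗ D - LinearMap.mulLeft k D ∘ₗ L - LinearMap.mulRight k D ∘ₗ L) ?_ hx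
    intro p p' hp β hβ a ha
    obtain rfl := zmod2_eq_of_add_one hp
    refine ext_homog 𝒜 B fun r j β'' hβ'' c' _ => ?_
    simp only [D, L, LinearMap.sub_apply, LinearMap.comp_apply, LinearMap.mulLeft_apply,
      LinearMap.mulRight_apply, Module.End.mul_apply, map_smul, LinearMap.smul_apply,
      oddExt_tmul _ hβ, oddExt_tmul _ hβ'', bmul_tmul 𝒜 ha hβ'', bmul_tmul 𝒜 (X.Δ_odd _ a ha) hβ'',
      oddExt_tmul _ (SetLike.mul_mem_graded hβ hβ''), oddExt₂_tmul 𝒜 X.br ha hβ'', X.br_apply,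
      par_of_mem _ ha, TensorProduct.tmul_sub, smul_mul_assoc,
      TensorProduct.tmul_smul, smul_sub, smul_smul]
    rcases zmod2_cases p with rfl | rfl <;> rcases zmod2_cases r with rfl | rfl <;>
      simp [zmod2_val_one, show (1 + 1 : ZMod 2) = 0 from rfl] <;> abel
  exact LinearMap.congr_fun h y

/-- The action `x • y` on `B ⊗ A` of an even element is the commutator of `Δ` with `x`. -/
theorem act_even {x : B.carrier ⊗[k] A} (hx : x ∈ gpts 𝒜 B ⊤ 0) (y : B.carrier ⊗[k] A) :
    oddExt₂ B 𝒜 X.act x y = oddExt B X.Δ (bmul 𝒜 B x y) - bmul 𝒜 B x (oddExt B X.Δ y) := by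
  let D : Module.End k (B.carrier ⊗[k] A) := oddExt B X.Δ
  let L := bmul 𝒜 B
  have h : oddExt₂ B 𝒜 X.act x = D * L x - L x * D := by
    refine gpts_eq (I := ⊤) (P := Module.End k (B.carrier ⊗[k] A)) (oddExt₂ B 𝒜 X.act)
      (LinearMap.mulLeft k D ∘ₗ L - LinearMap.mulRight k D ∘ₗ L) ?_ hx
    intro p p' hp β hβ a ha
    obtain rfl := zmod2_eq_of_add hp
    refine ext_homog 𝒜 B fun r j β'' hβ'' c' _ => ?_
    simp only [D, L, LinearMap.sub_apply, LinearMap.comp_apply, LinearMap.mulLeft_apply,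
      LinearMap.mulRight_apply, Module.End.mul_apply, map_smul, LinearMap.smul_apply,
      oddExt_tmul _ hβ, oddExt_tmul _ hβ'', bmul_tmul 𝒜 ha hβ'', bmul_tmul 𝒜 (X.Δ_odd p a ha) hβ'',
      oddExt_tmul _ (SetLike.mul_mem_graded hβ hβ''), oddExt₂_tmul 𝒜 X.act ha hβ'', X.act_apply,
      par_of_mem _ ha, TensorProduct.tmul_sub, smul_mul_assoc,
      TensorProduct.tmul_smul, smul_sub, smul_smul]
    rcases zmod2_cases p with rfl | rfl <;> rcases zmod2_cases r with rfl | rfl <;>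
      simp [zmod2_val_one, show (1 + 1 : ZMod 2) = 0 from rfl]
  exact LinearMap.congr_fun h y

end Product

/-! ### Gauge transformations of Maurer-Cartan elements in `B ⊗ A` -/

section MaurerCartan

theorem commutator_bracket {E : Type*} [Ring E] (s D a b : E) :
    s * ((D * a - a * D) * b - b * (D * a - a * D)) -
      ((D * a - a * D) * b - b * (D * a - a * D)) * s =
    (((s * D - D * s) * a - a * (s * D - D * s)) * b -
      b * ((s * D - D * s) * a - a * (s * D - D * s))) +
    ((D * (s * a - a * s) - (s * a - a * s) * D) * b -
      b * (D * (s * a - a * s) - (s * a - a * s) * D)) +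
    ((D * a - a * D) * (s * b - b * s) - (s * b - b * s) * (D * a - a * D)) := by
  noncomm_ring

variable {k : Type u} [Field k] {A : Type v} [Ring A] [Algebra k A]
  {𝒜 : ZMod 2 → Submodule k A} [GradedAlgebra 𝒜] (X : DGBV 𝒜)

theorem DGBV.br_mem (i j : ZMod 2) (a : A) (ha : a ∈ 𝒜 i) (b : A) (hb : b ∈ 𝒜 j) :
    X.br a b ∈ 𝒜 (i + j + 1) := by
  rw [X.br_apply]
  refine Submodule.sub_mem _ (Submodule.sub_mem _ ?_ ?_) ?_
  · exact X.Δ_odd _ _ (SetLike.mul_mem_graded (par_mem 𝒜 ha) hb)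
  · have := SetLike.mul_mem_graded (X.Δ_odd _ _ (par_mem 𝒜 ha)) hb
    rwa [show i + 1 + j = i + j + 1 by ring] at this
  · have := SetLike.mul_mem_graded ha (X.Δ_odd _ _ hb)
    rwa [← add_assoc] at this

variable (B : DGArtin k)

/-- The total differential `d + d_B` of `B ⊗ A`. -/
def totalD : Module.End k (B.carrier ⊗[k] A) :=
  oddExt B.toArtinSuperalgebra X.d + coeffDiff A B

theorem coeffDiff_oddExt {V W : Type v} [AddCommGroup V] [Module k V] [AddCommGroup W] [Module k W]
    (B : DGArtin k) (T : V →ₗ[k] W) (x : B.carrier ⊗[k] V) :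
    coeffDiff W B (oddExt B.toArtinSuperalgebra T x) =
      -oddExt B.toArtinSuperalgebra T (coeffDiff V B x) := by
  induction x using TensorProduct.induction_on with
  | zero => simp
  | add a b ha hb => simp only [map_add, ha, hb, neg_add]
  | tmul β x =>
    simp only [coeffDiff, oddExt, TensorProduct.map_tmul, LinearMap.rTensor_tmul]
    rw [par_comm B.gr B.gr B.diff 1 B.diff_odd β]
    simp [zmod2_val_one, TensorProduct.neg_tmul]

theorem coeffDiff_coeffDiff {V : Type v} [AddCommGroup V] [Module k V] (B : DGArtin k)
    (x : B.carrier ⊗[k] V) : coeffDiff V B (coeffDiff V B x) = 0 := by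
  rw [coeffDiff, ← LinearMap.comp_apply, ← LinearMap.rTensor_comp]
  have : B.diff ∘ₗ B.diff = 0 := by ext b; exact B.diff_sq b
  rw [this]; simp

theorem coeffDiff_lTensor {V W : Type v} [AddCommGroup V] [Module k V] [AddCommGroup W] [Module k W]
    (B : DGArtin k) (T : V →ₗ[k] W) (x : B.carrier ⊗[k] V) :
    coeffDiff W B (T.lTensor B.carrier x) = T.lTensor B.carrier (coeffDiff V B x) := by
  rw [coeffDiff, coeffDiff, ← LinearMap.comp_apply, ← LinearMap.comp_apply,
    LinearMap.rTensor_comp_lTensor, LinearMap.lTensor_comp_rTensor]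

theorem coeffDiff_mem_gpts {V : Type v} [AddCommGroup V] [Module k V] (B : DGArtin k)
    {𝒱 : ZMod 2 → Submodule k V} {I J : Submodule k B.carrier} (hI : ∀ b ∈ I, B.diff b ∈ J)
    {i j : ZMod 2} (hj : i + 1 = j)
    {x : B.carrier ⊗[k] V} (hx : x ∈ gpts 𝒱 B.toArtinSuperalgebra I i) :
    coeffDiff V B x ∈ gpts 𝒱 B.toArtinSuperalgebra J j :=
  rTensor_mem_gpts B.diff hj (fun p β h1 h2 => ⟨B.diff_odd p β h1, hI β h2⟩) hx

theorem lTensor_eq_zero {V W : Type*} [AddCommGroup V] [Module k V] [AddCommGroup W] [Module k W]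
    {N : Type*} [AddCommGroup N] [Module k N] {T : V →ₗ[k] W} (h : ∀ x, T x = 0) (x : N ⊗[k] V) :
    T.lTensor N x = 0 := by
  have : T = 0 := LinearMap.ext h
  rw [this]; simp

theorem totalD_totalD (x : B.carrier ⊗[k] A) : totalD X B (totalD X B x) = 0 := by
  simp only [totalD, LinearMap.add_apply, map_add, oddExt_oddExt, coeffDiff_oddExt,
    coeffDiff_coeffDiff]
  rw [lTensor_eq_zero (fun a => by simp [X.d_sq])]
  abel

theorem totalD_Δ (x : B.carrier ⊗[k] A) : totalD X B (oddExt B.toArtinSuperalgebra X.Δ x) =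
    -oddExt B.toArtinSuperalgebra X.Δ (totalD X B x) := by
  simp only [totalD, LinearMap.add_apply, map_add, oddExt_oddExt, coeffDiff_oddExt]
  have := lTensor_eq_zero (N := B.carrier) (T := X.d ∘ₗ X.Δ + X.Δ ∘ₗ X.d)
    (fun a => by simp [X.d_Δ]) x
  rw [LinearMap.lTensor_add, LinearMap.add_apply] at this
  rw [eq_neg_of_add_eq_zero_left this, neg_add]

theorem Δ_Δ (B : ArtinSuperalgebra k) (x : B.carrier ⊗[k] A) :
    oddExt B X.Δ (oddExt B X.Δ x) = 0 := by
  rw [oddExt_oddExt, lTensor_eq_zero (fun a => by simp [X.Δ_sq])]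

theorem totalD_comm_even {x : B.carrier ⊗[k] A} (hx : x ∈ gpts 𝒜 B.toArtinSuperalgebra ⊤ 0) :
    totalD X B * bmul 𝒜 B.toArtinSuperalgebra x - bmul 𝒜 B.toArtinSuperalgebra x * totalD X B =
      bmul 𝒜 B.toArtinSuperalgebra (totalD X B x) := by
  rw [totalD, LinearMap.add_apply, map_add, ← d_comm_even X hx, ← coeffDiff_comm_even hx]
  noncomm_ring

theorem totalD_comm_odd {x : B.carrier ⊗[k] A} (hx : x ∈ gpts 𝒜 B.toArtinSuperalgebra ⊤ 1) :
    totalD X B * bmul 𝒜 B.toArtinSuperalgebra x + bmul 𝒜 B.toArtinSuperalgebra x * totalD X B =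
      bmul 𝒜 B.toArtinSuperalgebra (totalD X B x) := by
  rw [totalD, LinearMap.add_apply, map_add, ← d_comm_odd X hx, ← coeffDiff_comm_odd hx]
  noncomm_ring

theorem totalD_mem {i j : ZMod 2} (hj : i + 1 = j) {x : B.carrier ⊗[k] A}
    (hx : x ∈ gpts 𝒜 B.toArtinSuperalgebra ⊤ i) :
    totalD X B x ∈ gpts 𝒜 B.toArtinSuperalgebra ⊤ j := by
  refine Submodule.add_mem _ ?_ (coeffDiff_mem_gpts B (fun _ _ => Submodule.mem_top) hj hx)
  exact oddExt_mem_gpts X.d hj X.d_odd hx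

variable {B}

theorem br_odd_derivation {B : ArtinSuperalgebra k} {g x y : B.carrier ⊗[k] A}
    (hg : g ∈ gpts 𝒜 B ⊤ 1) (hx : x ∈ gpts 𝒜 B ⊤ 0) (hy : y ∈ gpts 𝒜 B ⊤ 0) :
    oddExt₂ B 𝒜 X.br g (oddExt₂ B 𝒜 X.br x y) =
      oddExt₂ B 𝒜 X.br (oddExt₂ B 𝒜 X.br g x) y + oddExt₂ B 𝒜 X.br x (oddExt₂ B 𝒜 X.br g y) := by
  let D : Module.End k (B.carrier ⊗[k] A) := oddExt B X.Δ
  let L := bmul 𝒜 B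
  let ad : Module.End k (B.carrier ⊗[k] A) := oddExt₂ B 𝒜 X.br g
  have hDD : D * D = 0 := LinearMap.ext (Δ_Δ X B)
  have hΔg : oddExt B X.Δ g ∈ gpts 𝒜 B ⊤ 0 := oddExt_mem_gpts X.Δ (by decide) X.Δ_odd hg
  have had : ad = L (D g) - (D * L g + L g * D) := by
    refine LinearMap.ext fun z => ?_
    simp only [ad, br_odd X hg, D, L, LinearMap.sub_apply, LinearMap.add_apply,
      Module.End.mul_apply]
    abel
  have hcomm : ∀ z ∈ gpts 𝒜 B ⊤ 0, ad * L z - L z * ad = L (ad z) := by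
    intro z hz
    have h1 := Δ_comm_odd X hg hz
    have h2 : L (D g) * L z = L z * L (D g) := bmul_comm X hz _
    have h3 : ad z = -(D (L g z) - L (D g) z + L g (D z)) := by
      simp only [ad, br_odd X hg, D, L]; abel
    rw [h3, map_neg, ← h1, had, sub_mul, mul_sub, h2]
    abel
  have hM : ∀ x ∈ gpts 𝒜 B ⊤ 0, ∀ y ∈ gpts 𝒜 B ⊤ 0,
      (D * L x - L x * D) * L y - L y * (D * L x - L x * D) = L (oddExt₂ B 𝒜 X.br x y) := by
    intro x hx y hy
    rw [br_even X hx]; exact Δ_comm_even X hx hy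
  have hadD : ad * D - D * ad = L (D g) * D - D * L (D g) := by
    rw [had]
    have : ∀ e G : Module.End k (B.carrier ⊗[k] A), (e - (D * G + G * D)) * D -
        D * (e - (D * G + G * D)) = e * D - D * e - G * (D * D) + (D * D) * G := by
      intro e G
      simp only [sub_mul, mul_sub, add_mul, mul_add, mul_assoc]
      abel
    rw [this, hDD]; simp
  have hev : ∀ z ∈ gpts 𝒜 B ⊤ 0, ad z ∈ gpts 𝒜 B ⊤ 0 := fun z hz =>
    oddExt₂_mem_gpts 𝒜 X.br X.br_mem (by decide) hg hz
  have hbr : oddExt₂ B 𝒜 X.br x y ∈ gpts 𝒜 B ⊤ 1 :=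
    oddExt₂_mem_gpts 𝒜 X.br X.br_mem (by decide) hx hy
  have c1 := commutator_bracket ad D (L x) (L y)
  have c2 := commutator_bracket (L (D g)) D (L x) (L y)
  rw [hcomm x hx, hcomm y hy, hM _ (hev x hx) y hy, hM x hx _ (hev y hy), hadD,
    hM x hx y hy] at c1
  rw [hM x hx y hy, show L (D g) * L x = L x * L (D g) from bmul_comm X hx _,
    show L (D g) * L y = L y * L (D g) from bmul_comm X hy _,
    show L (D g) * L (oddExt₂ B 𝒜 X.br x y) = L (oddExt₂ B 𝒜 X.br x y) * L (D g) from
      (bmul_comm X hΔg _).symm] at c2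
  simp only [sub_self, mul_zero, zero_mul, add_zero] at c2
  rw [← c2, zero_add] at c1
  have h := LinearMap.congr_fun c1 (1 ⊗ₜ 1)
  have h1 : ad (1 ⊗ₜ 1) = 0 := by
    simp only [ad, br_odd X hg, bmul_one, Δ_unit, map_zero]; abel
  simpa only [LinearMap.sub_apply, LinearMap.add_apply, Module.End.mul_apply, L, bmul_one, h1,
    map_zero, sub_zero] using h

theorem totalD_br_odd {g : B.carrier ⊗[k] A} (hg : g ∈ gpts 𝒜 B.toArtinSuperalgebra ⊤ 1)
    (y : B.carrier ⊗[k] A) :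
    totalD X B (oddExt₂ B.toArtinSuperalgebra 𝒜 X.br g y) =
      oddExt₂ B.toArtinSuperalgebra 𝒜 X.br g (totalD X B y) +
        oddExt₂ B.toArtinSuperalgebra 𝒜 X.br (totalD X B g) y := by
  let D : Module.End k (B.carrier ⊗[k] A) := oddExt B.toArtinSuperalgebra X.Δ
  let L := bmul 𝒜 B.toArtinSuperalgebra
  have hΔg : oddExt B.toArtinSuperalgebra X.Δ g ∈ gpts 𝒜 B.toArtinSuperalgebra ⊤ 0 :=
    oddExt_mem_gpts X.Δ (by decide) X.Δ_odd hg
  have hg' := totalD_mem X B (j := 0) (by decide) hg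
  have e1 := LinearMap.congr_fun (totalD_comm_even X B hΔg) y
  have e2 := LinearMap.congr_fun (totalD_comm_odd X B hg) y
  have e3 := LinearMap.congr_fun (totalD_comm_odd X B hg) (D y)
  simp only [LinearMap.sub_apply, LinearMap.add_apply, Module.End.mul_apply, totalD_Δ, map_neg,
    LinearMap.neg_apply, D] at e1 e2 e3
  rw [br_odd X hg, br_odd X hg, br_even X hg']
  simp only [map_sub, totalD_Δ]
  rw [sub_eq_iff_eq_add.1 e1, eq_sub_of_add_eq e2, eq_sub_of_add_eq e3]
  simp only [map_sub]
  abel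

theorem br_symm_even {B : ArtinSuperalgebra k} {x y : B.carrier ⊗[k] A}
    (hx : x ∈ gpts 𝒜 B ⊤ 0) (hy : y ∈ gpts 𝒜 B ⊤ 0) :
    oddExt₂ B 𝒜 X.br x y = oddExt₂ B 𝒜 X.br y x := by
  rw [br_even X hx, br_even X hy, bmul_comm' X hy x, bmul_comm' X hy, ← bmul_comm' X hx]
  abel

theorem maxIdeal_mul_mem (B : ArtinSuperalgebra k) {a b : B.carrier} (ha : a ∈ B.maxIdeal) :
    a * b ∈ B.maxIdeal := by
  have : B.aug a = 0 := ha
  change B.aug (a * b) = 0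
  rw [map_mul, this, zero_mul]

theorem br_nilpotent [CharZero k] (B : ArtinSuperalgebra k) :
    ∃ N, ∀ g ∈ tens B.maxIdeal A,
      (oddExt₂ B 𝒜 X.br g : Module.End k (B.carrier ⊗[k] A)) ^ N = 0 := by
  obtain ⟨N, hN⟩ := B.nilpotent
  refine ⟨N + 1, fun g hg => ?_⟩
  have h : ∀ n y, ((oddExt₂ B 𝒜 X.br g : Module.End k (B.carrier ⊗[k] A)) ^ (n + 1)) y ∈
      tens (B.maxIdeal ^ (n + 1)) A := by
    intro n
    induction n with
    | zero =>
      intro y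
      rw [pow_one, zero_add, pow_one]
      refine oddExt₂_mem_tens 𝒜 X.br (J := ⊤) (homog_top B) ?_ hg (by rw [tens_top]; trivial)
      exact Submodule.mul_le.2 fun a ha b _ => maxIdeal_mul_mem B ha
    | succ n ih =>
      intro y
      rw [pow_succ' (oddExt₂ B 𝒜 X.br g : Module.End k (B.carrier ⊗[k] A)) (n + 1),
        Module.End.mul_apply]
      exact oddExt₂_mem_tens 𝒜 X.br (homog_pow B _) (by rw [pow_succ' _ (n + 1)]) hg (ih y)
  refine LinearMap.ext fun y => ?_
  have h1 := h N y
  rw [pow_succ, show B.maxIdeal ^ N = ⊥ from hN, Submodule.bot_mul, tens_bot] at h1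
  simpa using h1

theorem gaugeSum_eq (g γ : B.carrier ⊗[k] A) (N : ℕ) :
    gaugeSum 𝒜 X.d X.br B g γ N =
      affineExp (oddExt₂ B.toArtinSuperalgebra 𝒜 X.br g) (totalD X B g) γ N := rfl

theorem mc_iff (γ : B.carrier ⊗[k] A) :
    coeffDiff A B γ + curv 𝒜 X.d X.br B.toArtinSuperalgebra γ =
      totalD X B γ + (2 : k)⁻¹ • oddExt₂ B.toArtinSuperalgebra 𝒜 X.br γ γ := by
  rw [curv, totalD, LinearMap.add_apply]; abel

theorem diff_mem_maxIdeal (B : DGArtin k) (b : B.carrier) : B.diff b ∈ B.maxIdeal := B.diff_aug b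

theorem totalD_mem_pts [CharZero k] {i j : ZMod 2} (hj : i + 1 = j) {x : B.carrier ⊗[k] A}
    (hx : x ∈ pts 𝒜 B.toArtinSuperalgebra i) :
    totalD X B x ∈ pts 𝒜 B.toArtinSuperalgebra j := by
  refine Submodule.add_mem _ ?_
    (coeffDiff_mem_gpts B (fun b _ => diff_mem_maxIdeal B b) hj hx)
  exact oddExt_mem_gpts X.d hj X.d_odd hx

/-- A Maurer-Cartan element can be transformed by any gauge parameter. -/
theorem exists_gauge [CharZero k] (γ : MC 𝒜 X.d X.br B) (g : pts 𝒜 B.toArtinSuperalgebra 1) :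
    ∃ γ' : MC 𝒜 X.d X.br B, ∀ᶠ N in Filter.atTop,
      (γ'.1 : B.carrier ⊗[k] A) = gaugeSum 𝒜 X.d X.br B g γ.1 N := by
  obtain ⟨N, hN⟩ := br_nilpotent X B.toArtinSuperalgebra
  have hg : (g : B.carrier ⊗[k] A) ∈ gpts 𝒜 B.toArtinSuperalgebra ⊤ 1 := pts_le_even _ _ g.2
  have hnil := hN g (gpts_le_tens g.2)
  have hγm := γ.2
  rw [mc_iff] at hγm
  have hcurv := curvature_affineExp (gpts 𝒜 B.toArtinSuperalgebra ⊤ 0) (totalD X B)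
    (oddExt₂ B.toArtinSuperalgebra 𝒜 X.br g) (oddExt₂ B.toArtinSuperalgebra 𝒜 X.br)
    (totalD X B g) γ.1 (totalD_mem X B (by decide) hg) (pts_le_even _ _ γ.1.2)
    (fun a ha => oddExt₂_mem_gpts 𝒜 X.br X.br_mem (by decide) hg ha)
    (fun a ha b hb => br_symm_even X ha hb)
    (fun a ha b hb => br_odd_derivation X hg ha hb)
    (fun b _ => totalD_br_odd X hg b) (totalD_totalD X B _) hnil hγm
  have hpow : ∀ i, ∀ a ∈ tens B.maxIdeal A,
      ((oddExt₂ B.toArtinSuperalgebra 𝒜 X.br g : Module.End k (B.carrier ⊗[k] A)) ^ i) a ∈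
        tens B.maxIdeal A := by
    intro i
    induction i with
    | zero => intro a ha; simpa using ha
    | succ i ih =>
      intro a ha
      rw [pow_succ, Module.End.mul_apply]
      exact ih _ (oddExt₂_mem_tens 𝒜 X.br (homog_maxIdeal _)
        (Submodule.mul_le.2 fun a ha b _ => maxIdeal_mul_mem _ ha) (gpts_le_tens g.2) ha)
  have hm : affineExp (oddExt₂ B.toArtinSuperalgebra 𝒜 X.br g) (totalD X B g)
      (γ.1 : B.carrier ⊗[k] A) N ∈ pts 𝒜 B.toArtinSuperalgebra 0 := by
    refine gpts_of_tens (homog_maxIdeal _) ?_ hcurv.1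
    exact Submodule.sum_mem _ fun i _ => Submodule.sub_mem _
      (Submodule.smul_mem _ _ (hpow i _ (gpts_le_tens γ.1.2)))
      (Submodule.smul_mem _ _ (hpow i _ (gpts_le_tens (totalD_mem_pts X (j := 0) (by decide) g.2))))
  refine ⟨⟨⟨_, hm⟩, ?_⟩, ?_⟩
  · rw [mc_iff]; exact hcurv.2
  · filter_upwards [Filter.eventually_ge_atTop N] with n hn
    rw [gaugeSum_eq]
    exact (affineExp_eq_of_le _ _ _ hnil hn).symm

/-- Gauge equivalence is symmetric. -/
theorem GaugeRel.symm [CharZero k] {γ γ' : MC 𝒜 X.d X.br B} (h : GaugeRel 𝒜 X.d X.br B γ γ') :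
    GaugeRel 𝒜 X.d X.br B γ' γ := by
  obtain ⟨g, hg⟩ := h
  obtain ⟨N, hN⟩ := br_nilpotent X B.toArtinSuperalgebra
  have hnil := hN g (gpts_le_tens g.2)
  have hgo : (g : B.carrier ⊗[k] A) ∈ gpts 𝒜 B.toArtinSuperalgebra ⊤ 1 := pts_le_even _ _ g.2
  refine ⟨-g, ?_⟩
  filter_upwards [hg, Filter.eventually_ge_atTop N] with n h1 hn
  have hnil' := pow_eq_zero_of_le hn hnil
  rw [h1, gaugeSum_eq, gaugeSum_eq]
  have := affineExp_neg (gpts 𝒜 B.toArtinSuperalgebra ⊤ 0)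
    (oddExt₂ B.toArtinSuperalgebra 𝒜 X.br g) (totalD X B g) γ.1
    (totalD_mem X B (by decide) hgo) (pts_le_even _ _ γ.1.2)
    (fun a ha => oddExt₂_mem_gpts 𝒜 X.br X.br_mem (by decide) hgo ha) hnil'
  simp only [NegMemClass.coe_neg, map_neg]
  exact this.symm

end MaurerCartan

/-! ### Contractions of the complex `(A, d)` onto its cohomology -/

section Contraction

variable {k : Type u} [Field k] {A : Type v} [AddCommGroup A] [Module k A]
  (𝒜 : ZMod 2 → Submodule k A) [DirectSum.Decomposition 𝒜]

theorem zmod2_add_self (i : ZMod 2) : i + i = 0 := by revert i; decide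

theorem proj_comm {c : ZMod 2} (T : A →ₗ[k] A) (hT : ∀ i, ∀ x ∈ 𝒜 i, T x ∈ 𝒜 (i + c)) (i : ZMod 2)
    (x : A) : proj 𝒜 (i + c) (T x) = T (proj 𝒜 i x) := by
  conv_lhs => rw [← proj_add_proj 𝒜 x, map_add, map_add]
  rw [proj_of_mem 𝒜 (hT _ _ (proj_mem 𝒜 0 x)), proj_of_mem 𝒜 (hT _ _ (proj_mem 𝒜 1 x))]
  rcases zmod2_cases i with rfl | rfl <;> simp

/-- The part of parity `c` of a linear operator. -/
def parityPart (c : ZMod 2) (T : A →ₗ[k] A) : A →ₗ[k] A :=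
  proj 𝒜 c ∘ₗ T ∘ₗ proj 𝒜 0 + proj 𝒜 (1 + c) ∘ₗ T ∘ₗ proj 𝒜 1

theorem parityPart_apply (c : ZMod 2) (T : A →ₗ[k] A) {i : ZMod 2} {x : A} (hx : x ∈ 𝒜 i) :
    parityPart 𝒜 c T x = proj 𝒜 (i + c) (T x) := by
  rcases zmod2_cases i with rfl | rfl <;> simp [parityPart, proj_of_mem 𝒜 hx]

theorem parityPart_mem (c : ZMod 2) (T : A →ₗ[k] A) (i : ZMod 2) (x : A) (hx : x ∈ 𝒜 i) :
    parityPart 𝒜 c T x ∈ 𝒜 (i + c) := by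
  rw [parityPart_apply 𝒜 c T hx]; exact proj_mem _ _ _

theorem eq_of_homog {W : Type*} [AddCommGroup W] [Module k W] {f g : A →ₗ[k] W}
    (h : ∀ i, ∀ x ∈ 𝒜 i, f x = g x) : f = g := by
  refine LinearMap.ext fun x => ?_
  rw [← proj_add_proj 𝒜 x, map_add, map_add, h _ _ (proj_mem 𝒜 0 x), h _ _ (proj_mem 𝒜 1 x)]

/-- A homogeneous operator has a homogeneous generalized inverse. -/
theorem exists_genInverse {c : ZMod 2} (T : A →ₗ[k] A) (hT : ∀ i, ∀ x ∈ 𝒜 i, T x ∈ 𝒜 (i + c)) :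
    ∃ r : A →ₗ[k] A, (∀ i, ∀ x ∈ 𝒜 i, r x ∈ 𝒜 (i + c)) ∧ (∀ x, T (r (T x)) = T x) ∧
      ∀ x, r (T (r x)) = r x := by
  obtain ⟨r₀, hr₀⟩ := T.rangeRestrict.exists_rightInverse_of_surjective T.range_rangeRestrict
  obtain ⟨r₁, hr₁⟩ := LinearMap.exists_extend r₀
  have h1 : ∀ x, T (r₁ (T x)) = T x := by
    intro x
    have e1 : r₁ (T x) = r₀ (T.rangeRestrict x) := LinearMap.congr_fun hr₁ (T.rangeRestrict x)
    rw [e1]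
    exact congrArg Subtype.val (LinearMap.congr_fun hr₀ (T.rangeRestrict x))
  let r₂ := parityPart 𝒜 c r₁
  have hr₂ : ∀ i, ∀ x ∈ 𝒜 i, r₂ x ∈ 𝒜 (i + c) := parityPart_mem 𝒜 c r₁
  have h2 : ∀ x, T (r₂ (T x)) = T x := by
    have : T ∘ₗ r₂ ∘ₗ T = T := by
      refine eq_of_homog 𝒜 fun i x hx => ?_
      simp only [LinearMap.comp_apply, r₂]
      rw [parityPart_apply 𝒜 c r₁ (hT i x hx), ← proj_comm 𝒜 T hT, h1, proj_of_mem 𝒜 (hT i x hx)]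
      rw [if_pos]
      rw [add_assoc, add_assoc, zmod2_add_self, add_zero]
    exact fun x => LinearMap.congr_fun this x
  refine ⟨r₂ ∘ₗ T ∘ₗ r₂, fun i x hx => ?_, fun x => ?_, fun x => ?_⟩
  · have := hr₂ _ _ (hT _ _ (hr₂ i x hx))
    rwa [add_assoc i, zmod2_add_self, add_zero] at this
  · simp only [LinearMap.comp_apply, h2]
  · simp only [LinearMap.comp_apply, h2]

/-- A contraction of the complex `(A, d)` onto the super vector space `V` with zero
differential: an inclusion `s`, a projection `p` and an odd homotopy `h`. -/
structure Contraction {V : Type v} [AddCommGroup V] [Module k V] (𝒱 : ZMod 2 → Submodule k V)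
    (𝒜 : ZMod 2 → Submodule k A) (d : A →ₗ[k] A) where
  s : V →ₗ[k] A
  p : A →ₗ[k] V
  h : A →ₗ[k] A
  s_even : ∀ i, ∀ x ∈ 𝒱 i, s x ∈ 𝒜 i
  p_even : ∀ i, ∀ a ∈ 𝒜 i, p a ∈ 𝒱 i
  h_odd : ∀ i, ∀ a ∈ 𝒜 i, h a ∈ 𝒜 (i + 1)
  d_s : ∀ x, d (s x) = 0
  p_s : ∀ x, p (s x) = x
  p_d : ∀ a, p (d a) = 0
  h_s : ∀ x, h (s x) = 0
  homotopy : ∀ a, s (p a) + d (h a) + h (d a) = a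

variable {𝒜} {d : A →ₗ[k] A}

theorem Contraction.dhd {V : Type v} [AddCommGroup V] [Module k V] {𝒱 : ZMod 2 → Submodule k V}
    (C : Contraction 𝒱 𝒜 d) (hdd : ∀ a, d (d a) = 0) (a : A) : d (C.h (d a)) = d a := by
  have h := congrArg d (C.homotopy a)
  simpa [C.d_s, hdd] using h

theorem Coh.mk_eq_iff (d : A →ₗ[k] A) {x y : A} (hx : d x = 0) (hy : d y = 0) :
    Coh.mk d x hx = Coh.mk d y hy ↔ ∃ b, d b = x - y := by
  rw [Coh.mk, Coh.mk, Submodule.Quotient.eq]; rfl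

/-- The contraction onto the cohomology defined by a homotopy `h` for which `E = 1 - d h - h d` is
a projection with `E d = d E = h E = 0`. -/
def Contraction.ofHomotopy (E h : A →ₗ[k] A) (hE : ∀ i, ∀ a ∈ 𝒜 i, E a ∈ 𝒜 i)
    (hh : ∀ i, ∀ a ∈ 𝒜 i, h a ∈ 𝒜 (i + 1)) (hdE : ∀ a, d (E a) = 0) (hEd : ∀ a, E (d a) = 0)
    (hEE : ∀ a, E (E a) = E a) (hhE : ∀ a, h (E a) = 0)
    (hhom : ∀ a, E a + d (h a) + h (d a) = a) : Contraction (cohGr 𝒜 d) 𝒜 d where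
  s := Submodule.liftQ _ (E ∘ₗ (LinearMap.ker d).subtype) (by
    rintro ⟨z, hz⟩ ⟨b, hb⟩
    simp only [Submodule.subtype_apply] at hb
    simp [← hb, hEd])
  p := Submodule.mkQ _ ∘ₗ E.codRestrict (LinearMap.ker d) hdE
  h := h
  s_even := by
    rintro i _ ⟨z, hz, rfl⟩
    exact hE i _ hz
  p_even := fun i a ha => ⟨⟨E a, hdE a⟩, hE i a ha, rfl⟩
  h_odd := hh
  d_s := by
    intro x
    obtain ⟨z, rfl⟩ := Submodule.Quotient.mk_surjective _ x
    exact hdE _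
  p_s := by
    intro x
    obtain ⟨⟨z, hz⟩, rfl⟩ := Submodule.Quotient.mk_surjective _ x
    refine (Coh.mk_eq_iff d (hdE (E z)) hz).2 ⟨-h z, ?_⟩
    have := hhom z
    have hz : d z = 0 := hz
    rw [hz, map_zero, add_zero] at this
    rw [hEE, map_neg]
    nth_rewrite 3 [← this]
    abel
  p_d := fun a => (Coh.mk_eq_iff d (hdE (d a)) (map_zero d)).2 ⟨0, by simp [hEd]⟩
  h_s := by
    intro x
    obtain ⟨z, rfl⟩ := Submodule.Quotient.mk_surjective _ x
    exact hhE _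
  homotopy := by
    intro a
    have : E (E a) + d (h a) + h (d a) = a := by rw [hEE]; exact hhom a
    exact this

theorem Contraction.ofHomotopy_mk_s (C : Contraction (cohGr 𝒜 d) 𝒜 d)
    (hC : ∀ a (ha : d a = 0), C.p a = Coh.mk d a ha) (x : Coh d) :
    Coh.mk d (C.s x) (C.d_s x) = x := by
  rw [← hC, C.p_s]

/-- The complex `(A, d)` contracts onto its cohomology. -/
theorem exists_contraction (hd : ∀ i, ∀ a ∈ 𝒜 i, d a ∈ 𝒜 (i + 1)) (hdd : ∀ a, d (d a) = 0) :
    ∃ C : Contraction (cohGr 𝒜 d) 𝒜 d, ∀ a (ha : d a = 0), C.p a = Coh.mk d a ha := by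
  obtain ⟨r, hr, hdr, -⟩ := exists_genInverse 𝒜 d hd
  -- `E` is the projection onto the complement of `Im d` in `Ker d` cut out by `r`.
  let E : A →ₗ[k] A := LinearMap.id - r ∘ₗ d - d ∘ₗ r ∘ₗ (LinearMap.id - r ∘ₗ d)
  let h : A →ₗ[k] A := r ∘ₗ (LinearMap.id - r ∘ₗ d - E)
  have hEx : ∀ a, E a = a - r (d a) - d (r (a - r (d a))) := fun a => rfl
  have hhx : ∀ a, h a = r (a - r (d a) - E a) := fun a => rfl
  have hdE : ∀ a, d (E a) = 0 := by
    intro a; rw [hEx]; simp [hdd, hdr]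
  have hEd : ∀ a, E (d a) = 0 := by
    intro a; rw [hEx]; simp [hdd, hdr]
  have hh : ∀ a, d (h a) = a - r (d a) - E a := by
    intro a
    have : a - r (d a) - E a = d (r (a - r (d a))) := by rw [hEx]; abel
    rw [hhx, this, hdr]
  have hhd : ∀ a, h (d a) = r (d a) := by
    intro a; rw [hhx, hEd, hdd]; simp
  have hErd : ∀ a, E (r (d a)) = 0 := by
    intro a; rw [hEx, hdr]; simp
  have hEE : ∀ a, E (E a) = E a := by
    intro a
    have : E a = a - r (d a) - d (h a) := by rw [hh]; abel
    rw [this, map_sub, map_sub, hErd, hEd, ← this]; simp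
  have hhE : ∀ a, h (E a) = 0 := by
    intro a; rw [hhx, hdE, hEE]; simp
  have hhom : ∀ a, E a + d (h a) + h (d a) = a := by
    intro a; rw [hh, hhd]; abel
  have hp : ∀ i, ∀ a ∈ 𝒜 i, a - r (d a) ∈ 𝒜 i := by
    intro i a ha
    have := hr _ _ (hd i a ha)
    rw [add_assoc, zmod2_add_self, add_zero] at this
    exact Submodule.sub_mem _ ha this
  have hEm : ∀ i, ∀ a ∈ 𝒜 i, E a ∈ 𝒜 i := by
    intro i a ha
    have := hd _ _ (hr _ _ (hp i a ha))
    rw [add_assoc, zmod2_add_self, add_zero] at this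
    exact Submodule.sub_mem _ (hp i a ha) this
  refine ⟨Contraction.ofHomotopy E h hEm
    (fun i a ha => hr _ _ (Submodule.sub_mem _ (hp i a ha) (hEm i a ha)))
    hdE hEd hEE hhE hhom, fun a ha => ?_⟩
  refine (Coh.mk_eq_iff d (hdE a) ha).2 ⟨-h a, ?_⟩
  rw [map_neg, hh, ha, map_zero]; abel

/-- If moreover `Im d ∩ Im Δ = Im dΔ`, the contraction can be chosen compatible with `Δ`. The double
complex is then a sum of the squares spanned by `C`, `dC`, `ΔC`, `dΔC` and of a part on which
`d = Δ = 0`; the homotopy inverts `d` on each square. -/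
theorem exists_contraction_compat {Δ : A →ₗ[k] A} (hd : ∀ i, ∀ a ∈ 𝒜 i, d a ∈ 𝒜 (i + 1))
    (hdd : ∀ a, d (d a) = 0) (hΔ : ∀ i, ∀ a ∈ 𝒜 i, Δ a ∈ 𝒜 (i + 1)) (hΔΔ : ∀ a, Δ (Δ a) = 0)
    (hdΔ : ∀ a, d (Δ a) + Δ (d a) = 0)
    (h₁ : ∀ a, Δ (d a) = 0 → ∃ b, d (Δ b) = d a) (h₂ : ∀ a, d (Δ a) = 0 → ∃ b, d (Δ b) = Δ a) :
    ∃ C : Contraction (cohGr 𝒜 d) 𝒜 d, (∀ x, Δ (C.s x) = 0) ∧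
      ∀ a, C.h (Δ a) + Δ (C.h a) = 0 := by
  have hΔd : ∀ a, Δ (d a) = -d (Δ a) := fun a => eq_neg_of_add_eq_zero_right (hdΔ a)
  have hdΔd : ∀ a, d (Δ (d a)) = 0 := by intro a; rw [hΔd, map_neg, hdd, neg_zero]
  have h2 : ∀ i : ZMod 2, i + 1 + 1 = i := by decide
  obtain ⟨r, hr, hdr, hrr⟩ := exists_genInverse (c := 0) 𝒜 (d ∘ₗ Δ) (fun i a ha => by
    have := hd _ _ (hΔ i a ha)
    rwa [h2, ← add_zero i] at this)
  simp only [LinearMap.comp_apply, add_zero] at hr hdr hrr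
  have hfix : ∀ a, (∃ b, d (Δ b) = a) → d (Δ (r a)) = a := by
    rintro _ ⟨b, rfl⟩; exact hdr b
  -- The components of `a` in the squares `C`, `dC`, `ΔC`, `dΔC`, where `C = Im r`.
  let q : A →ₗ[k] A := LinearMap.id - r ∘ₗ d ∘ₗ Δ
  let c₁ : A →ₗ[k] A := -(r ∘ₗ Δ ∘ₗ q)
  let c₂ : A →ₗ[k] A := r ∘ₗ d ∘ₗ q
  let t : A →ₗ[k] A := q - d ∘ₗ c₁ - Δ ∘ₗ c₂
  let c₃ : A →ₗ[k] A := r ∘ₗ t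
  let h : A →ₗ[k] A := c₁ + Δ ∘ₗ c₃
  let E : A →ₗ[k] A := t - d ∘ₗ Δ ∘ₗ c₃
  have hq : ∀ a, q a = a - r (d (Δ a)) := fun a => rfl
  have hc₁ : ∀ a, c₁ a = -r (Δ (q a)) := fun a => rfl
  have hc₂ : ∀ a, c₂ a = r (d (q a)) := fun a => rfl
  have ht : ∀ a, t a = q a - d (c₁ a) - Δ (c₂ a) := fun a => rfl
  have hc₃ : ∀ a, c₃ a = r (t a) := fun a => rfl
  have hh : ∀ a, h a = c₁ a + Δ (c₃ a) := fun a => rfl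
  have hE : ∀ a, E a = t a - d (Δ (c₃ a)) := fun a => rfl
  have hdΔq : ∀ a, d (Δ (q a)) = 0 := by intro a; rw [hq]; simp [hdr]
  have hΔq : ∀ a, d (Δ (r (Δ (q a)))) = Δ (q a) := fun a => hfix _ (h₂ _ (hdΔq a))
  have hdq : ∀ a, d (Δ (r (d (q a)))) = d (q a) := fun a =>
    hfix _ (h₁ _ (by rw [hΔd, hdΔq, neg_zero]))
  have hdt : ∀ a, d (t a) = 0 := by
    intro a; rw [ht, hc₂, map_sub, map_sub, hdd, hdq]; simp
  have hΔt : ∀ a, Δ (t a) = 0 := by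
    intro a; rw [ht, hc₁, map_sub, map_sub, hΔΔ, hΔd]; simp [hΔq]
  have hdE : ∀ a, d (E a) = 0 := by intro a; rw [hE, map_sub, hdt, hdd, sub_zero]
  have hΔE : ∀ a, Δ (E a) = 0 := by
    intro a; rw [hE, map_sub, hΔt, hΔd, hΔΔ]; simp
  have hqd : ∀ a, q (d a) = d a := by intro a; rw [hq, hdΔd, map_zero, sub_zero]
  have hqΔ : ∀ a, q (Δ a) = Δ a := by intro a; rw [hq, hΔΔ, map_zero, map_zero, sub_zero]
  have hqr : ∀ a, q (r a) = 0 := by intro a; rw [hq, hrr, sub_self]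
  have hc₁d : ∀ a, c₁ (d a) = r (d (Δ a)) := by intro a; rw [hc₁, hqd, hΔd, map_neg, neg_neg]
  have hc₂d : ∀ a, c₂ (d a) = 0 := by intro a; rw [hc₂, hqd, hdd, map_zero]
  have htd : ∀ a, t (d a) = d (q a) := by
    intro a; rw [ht, hqd, hc₁d, hc₂d, hq]; simp
  have hhd : ∀ a, h (d a) = r (d (Δ a)) + Δ (c₂ a) := by
    intro a; rw [hh, hc₁d, hc₃, htd, ← hc₂]
  have hc₁Δ : ∀ a, c₁ (Δ a) = 0 := by intro a; rw [hc₁, hqΔ, hΔΔ]; simp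
  have hc₂Δ : ∀ a, c₂ (Δ a) = r (d (Δ a)) := by intro a; rw [hc₂, hqΔ]
  have htΔ : ∀ a, t (Δ a) = Δ (q a) := by
    intro a; rw [ht, hqΔ, hc₁Δ, hc₂Δ, hq]; simp
  have hhom : ∀ a, E a + d (h a) + h (d a) = a := by
    intro a
    rw [hhd, hh, hE, ht, hq, map_add]
    abel
  have hhΔ : ∀ a, h (Δ a) + Δ (h a) = 0 := by
    intro a
    rw [hh, hh, hc₁Δ, hc₃, htΔ, map_add, hΔΔ, hc₁, map_neg]
    simp
  have hEd : ∀ a, E (d a) = 0 := by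
    intro a; rw [hE, hc₃, htd, hdq, sub_self]
  have hEr : ∀ a, E (r a) = 0 := by
    intro a; rw [hE, hc₃, ht, hc₁, hc₂, hqr]; simp
  have hEΔr : ∀ a, E (Δ (r a)) = 0 := by
    intro a; rw [hE, hc₃, htΔ, hqr]; simp
  have hEE : ∀ a, E (E a) = E a := by
    intro a
    have e := congrArg E (hhom a)
    rw [map_add, map_add, hEd, hhd, map_add, hEr, hc₂, hEΔr] at e
    simpa using e
  have hhE : ∀ a, h (E a) = 0 := by
    intro a
    have h1 : q (E a) = E a := by rw [hq, hΔE]; simp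
    have h2 : c₁ (E a) = 0 := by rw [hc₁, h1, hΔE]; simp
    have h3 : c₂ (E a) = 0 := by rw [hc₂, h1, hdE]; simp
    have h4 : t (E a) = E a := by rw [ht, h1, h2, h3]; simp
    rw [hh, h2, hc₃, h4, hE, map_sub, hc₃, hrr]; simp
  have hqm : ∀ i, ∀ a ∈ 𝒜 i, q a ∈ 𝒜 i := by
    intro i a ha
    have := hr _ _ (hd _ _ (hΔ i a ha))
    rw [h2] at this
    exact Submodule.sub_mem _ ha this
  have hc₁m : ∀ i, ∀ a ∈ 𝒜 i, c₁ a ∈ 𝒜 (i + 1) := fun i a ha =>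
    Submodule.neg_mem _ (hr _ _ (hΔ _ _ (hqm i a ha)))
  have hc₂m : ∀ i, ∀ a ∈ 𝒜 i, c₂ a ∈ 𝒜 (i + 1) := fun i a ha => hr _ _ (hd _ _ (hqm i a ha))
  have htm : ∀ i, ∀ a ∈ 𝒜 i, t a ∈ 𝒜 i := by
    intro i a ha
    have e1 := hd _ _ (hc₁m i a ha)
    have e2 := hΔ _ _ (hc₂m i a ha)
    rw [h2] at e1 e2
    exact Submodule.sub_mem _ (Submodule.sub_mem _ (hqm i a ha) e1) e2
  have hhm : ∀ i, ∀ a ∈ 𝒜 i, h a ∈ 𝒜 (i + 1) := fun i a ha =>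
    Submodule.add_mem _ (hc₁m i a ha) (hΔ _ _ (hr _ _ (htm i a ha)))
  have hEm : ∀ i, ∀ a ∈ 𝒜 i, E a ∈ 𝒜 i := by
    intro i a ha
    have e1 := hd _ _ (hΔ _ _ (hr _ _ (htm i a ha)))
    rw [h2] at e1
    exact Submodule.sub_mem _ (htm i a ha) e1
  refine ⟨Contraction.ofHomotopy E h hEm hhm hdE hEd hEE hhE hhom, fun x => ?_, hhΔ⟩
  obtain ⟨z, rfl⟩ := Submodule.Quotient.mk_surjective _ x
  exact hΔE _

/-- Transport of a contraction along a quasi-isomorphism `s` from a complex with zero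
differential. -/
theorem Contraction.transport {M : Type v} [AddCommGroup M] [Module k M]
    (ℳ : ZMod 2 → Submodule k M) [DirectSum.Decomposition ℳ]
    (hd : ∀ i, ∀ a ∈ 𝒜 i, d a ∈ 𝒜 (i + 1)) (hdd : ∀ a, d (d a) = 0)
    (s : M →ₗ[k] A) (hs : ∀ x, d (s x) = 0) (hse : ∀ i, ∀ x ∈ ℳ i, s x ∈ 𝒜 i)
    (hbij : Function.Bijective (fun x => Coh.mk d (s x) (hs x))) :
    ∃ C : Contraction ℳ 𝒜 d, C.s = s := by
  obtain ⟨C, hC⟩ := exists_contraction (𝒜 := 𝒜) hd hdd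
  have hCs : ∀ x, Coh.mk d (C.s x) (C.d_s x) = x := C.ofHomotopy_mk_s hC
  let f : M ≃ₗ[k] Coh d := LinearEquiv.ofBijective
    (Submodule.mkQ _ ∘ₗ s.codRestrict (LinearMap.ker d) hs) hbij
  have hf : ∀ x, f x = Coh.mk d (s x) (hs x) := fun x => rfl
  have hps : ∀ x, C.p (s x) = f x := fun x => hC _ (hs x)
  have hex : ∀ y, ∃ b, d b = s (f.symm y) - C.s y := by
    intro y
    rw [← Coh.mk_eq_iff d (hs _) (C.d_s y), hCs, ← hf, f.apply_symm_apply]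
  have hdh : ∀ y, d (C.h (s (f.symm y) - C.s y)) = s (f.symm y) - C.s y := by
    intro y
    obtain ⟨b, hb⟩ := hex y
    rw [← hb, C.dhd hdd]
  let κ : Coh d →ₗ[k] A := C.h ∘ₗ (s ∘ₗ f.symm.toLinearMap - C.s)
  have hκ : ∀ y, κ y = C.h (s (f.symm y) - C.s y) := fun y => rfl
  have hfe : ∀ i, ∀ y ∈ cohGr 𝒜 d i, f.symm y ∈ ℳ i := by
    rintro i _ ⟨⟨z, hz⟩, hzi, rfl⟩
    obtain ⟨x, hx⟩ := f.surjective (Coh.mk d z hz)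
    have hx' : f.symm (Submodule.mkQ _ (⟨z, hz⟩ : LinearMap.ker d)) = x := by
      rw [← f.symm_apply_apply x, hx]; rfl
    rw [hx']
    have hz0 : d z = 0 := hz
    obtain ⟨b, hb⟩ := (Coh.mk_eq_iff d (hs x) hz0).1 hx
    -- The component of the wrong parity of `x` has a cohomologically trivial image.
    have h1 : d (proj 𝒜 i b) = s (proj ℳ (i + 1) x) := by
      have hz1 : proj 𝒜 (i + 1) z = 0 := by
        rw [proj_of_mem 𝒜 (show z ∈ 𝒜 i from hzi), if_neg]
        rcases zmod2_cases i with rfl | rfl <;> decide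
      rw [← proj_comm 𝒜 d hd, hb, map_sub, hz1, sub_zero]
      conv_lhs => rw [← proj_add_proj ℳ x, map_add, map_add]
      rw [proj_of_mem 𝒜 (hse _ _ (proj_mem ℳ 0 x)), proj_of_mem 𝒜 (hse _ _ (proj_mem ℳ 1 x))]
      rcases zmod2_cases i with rfl | rfl <;> simp [show (1 + 1 : ZMod 2) = 0 from rfl]
    have h2 : f (proj ℳ (i + 1) x) = f 0 := by
      rw [hf, hf, Coh.mk_eq_iff]
      exact ⟨_, by rw [h1, map_zero, sub_zero]⟩
    have h3 := f.injective h2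
    have h4 := proj_add_proj ℳ x
    have h5 : proj ℳ i x = x := by
      rcases zmod2_cases i with rfl | rfl
      · rw [zero_add] at h3; rwa [h3, add_zero] at h4
      · rw [show (1 + 1 : ZMod 2) = 0 from rfl] at h3; rwa [h3, zero_add] at h4
    rw [← h5]
    exact proj_mem _ _ _
  refine ⟨{
    s := s
    p := f.symm.toLinearMap ∘ₗ C.p
    h := C.h - κ ∘ₗ C.p
    s_even := hse
    p_even := fun i a ha => hfe i _ (C.p_even i a ha)
    h_odd := ?_
    d_s := hs
    p_s := ?_
    p_d := ?_
    h_s := ?_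
    homotopy := ?_ }, rfl⟩
  · intro i a ha
    refine Submodule.sub_mem _ (C.h_odd i a ha) (C.h_odd i _ (Submodule.sub_mem _ ?_ ?_))
    · exact hse _ _ (hfe _ _ (C.p_even i a ha))
    · exact C.s_even _ _ (C.p_even i a ha)
  · intro x
    simp [hps]
  · intro a
    simp [C.p_d]
  · intro x
    have h0 : C.h (C.s (f x)) = 0 := C.h_s _
    simp [hps, hκ, h0]
  · intro a
    have h1 : s (f.symm (C.p a)) + d (C.h a - κ (C.p a)) + (C.h (d a) - κ (C.p (d a))) =
        C.s (C.p a) + d (C.h a) + C.h (d a) := by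
      rw [C.p_d, map_zero, sub_zero, map_sub, hκ, hdh]
      abel
    exact h1.trans (C.homotopy a)

end Contraction

/-! ### Formal series in `ħ` and operators on them -/

section Series

variable {k : Type u} [Field k] {R : Type*} [AddCommGroup R] [Module k R]

/-- A space of formal series in `ħ`, `ħ⁻¹` which is stable under coefficientwise linear operators
and under multiplication by powers of `ħ`. -/
structure ShiftStable (L : Submodule k (ℤ → R)) : Prop where
  map_mem : ∀ T : Module.End k R, ∀ f ∈ L, (fun n => T (f n)) ∈ L
  shift_mem : ∀ c : ℤ, ∀ f ∈ L, (fun n => f (n - c)) ∈ L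

theorem shiftStable_top : ShiftStable (⊤ : Submodule k (ℤ → R)) :=
  ⟨fun _ _ _ => trivial, fun _ _ _ => trivial⟩

theorem shiftStable_laurent : ShiftStable (laurent k R) := by
  refine ⟨?_, ?_⟩
  · rintro T f ⟨N, hN⟩
    exact ⟨N, fun n hn => by simp [hN n hn]⟩
  · rintro c f ⟨N, hN⟩
    exact ⟨N + c, fun n hn => hN _ (by lia)⟩

namespace ShiftStable

variable {L : Submodule k (ℤ → R)} (hL : ShiftStable L)

/-- The coefficientwise action of a linear operator on formal series. -/
def op : Module.End k R →ₐ[k] Module.End k L :=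
  AlgHom.ofLinearMap
    { toFun := fun T =>
        { toFun := fun f => ⟨fun n => T (f.1 n), hL.map_mem T f.1 f.2⟩
          map_add' := fun f g => by ext n; simp
          map_smul' := fun c f => by ext n; simp }
      map_add' := fun S T => by ext f n; simp
      map_smul' := fun c T => by ext f n; simp }
    (by ext f n; simp) (fun S T => by ext f n; simp)

/-- Multiplication by `ħ ^ c`. -/
def sh (c : ℤ) : Module.End k L where
  toFun f := ⟨fun n => f.1 (n - c), hL.shift_mem c f.1 f.2⟩
  map_add' f g := by ext n; simp
  map_smul' c f := by ext n; simp

@[simp] theorem op_apply (T : Module.End k R) (f : L) (n : ℤ) : (hL.op T f).1 n = T (f.1 n) := rfl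

@[simp] theorem sh_apply (c : ℤ) (f : L) (n : ℤ) : (hL.sh c f).1 n = f.1 (n - c) := rfl

theorem sh_mul_sh (a b : ℤ) : hL.sh a * hL.sh b = hL.sh (a + b) := by
  ext f n
  simp only [Module.End.mul_apply, sh_apply]
  rw [sub_sub]

theorem sh_mul_op (c : ℤ) (T : Module.End k R) : hL.sh c * hL.op T = hL.op T * hL.sh c := by
  ext f n; simp

end ShiftStable

/-- An operator on Laurent series of the form `1 + Y`, where `Y` raises the order in `ħ`, is
invertible. Its inverse does not lower the order, and preserves the series with coefficients in `K`
if `Y` does. -/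
theorem exists_inverse_of_raising (Y : Module.End k (laurent k R))
    (hY : ∀ (f : laurent k R) (N : ℤ), (∀ n < N, f.1 n = 0) → ∀ n < N + 1, (Y f).1 n = 0) :
    ∃ Z : Module.End k (laurent k R), ((1 : Module.End k (laurent k R)) + Y) * Z = 1 ∧
      Z * ((1 : Module.End k (laurent k R)) + Y) = 1 ∧
      (∀ (f : laurent k R) (N : ℤ), (∀ n < N, f.1 n = 0) → ∀ n < N, (Z f).1 n = 0) ∧
      ∀ K : Submodule k R, (∀ f : laurent k R, (∀ n, f.1 n ∈ K) → ∀ n, (Y f).1 n ∈ K) →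
        ∀ f : laurent k R, (∀ n, f.1 n ∈ K) → ∀ n, (Z f).1 n ∈ K := by
  have hinj : Function.Injective ((1 : Module.End k (laurent k R)) + Y) := by
    rw [injective_iff_map_eq_zero]
    intro f hf
    obtain ⟨N, hN⟩ := f.2
    have hf' : f = -Y f := eq_neg_of_add_eq_zero_left hf
    have key : ∀ j : ℕ, ∀ n < N + j, f.1 n = 0 := by
      intro j
      induction j with
      | zero => simpa using hN
      | succ j ih =>
        intro n hn
        have := hY f (N + j) ih n (by push_cast at hn; lia)
        rw [hf']
        simp [this]
    ext n
    exact key (n - N + 1).toNat n (by lia)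
  have hsurj : ∀ g : laurent k R, ∃ f : laurent k R, ((1 : Module.End k (laurent k R)) + Y) f = g ∧
      (∀ N : ℤ, (∀ n < N, g.1 n = 0) → ∀ n < N, f.1 n = 0) ∧
      ∀ K : Submodule k R, (∀ f : laurent k R, (∀ n, f.1 n ∈ K) → ∀ n, (Y f).1 n ∈ K) →
        (∀ n, g.1 n ∈ K) → ∀ n, f.1 n ∈ K := by
    intro g
    obtain ⟨N, hN⟩ := g.2
    have hpow : ∀ (N : ℤ), (∀ n < N, g.1 n = 0) → ∀ (i : ℕ), ∀ n < N + i,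
        (((-Y) ^ i) g).1 n = 0 := by
      intro N hN i
      induction i with
      | zero => simpa using hN
      | succ i ih =>
        intro n hn
        rw [pow_succ', Module.End.mul_apply]
        have := hY (((-Y) ^ i) g) (N + i) ih n (by push_cast at hn; lia)
        simp [this]
    -- The geometric series `∑ (-Y)^i g`; its coefficient at `ħ ^ n` is a finite sum.
    let part : ℕ → laurent k R := fun M => ∑ i ∈ Finset.range M, ((-Y) ^ i) g
    have hpart : ∀ (M M' : ℕ) (n : ℤ), M ≤ M' → n < N + M → (part M').1 n = (part M).1 n := by
      intro M M' n hM hn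
      obtain ⟨c, rfl⟩ := Nat.exists_eq_add_of_le hM
      induction c with
      | zero => rfl
      | succ c ih =>
        have h1 : part (M + (c + 1)) = part (M + c) + ((-Y) ^ (M + c)) g := by
          simp only [part]; rw [← add_assoc, Finset.sum_range_succ]
        rw [h1, Submodule.coe_add, Pi.add_apply, ih (by lia), hpow N hN _ n (by push_cast; lia),
          add_zero]
    let f : laurent k R := ⟨fun n => (part (n - N + 1).toNat).1 n, N, fun n hn => by
      have h0 : (n - N + 1).toNat = 0 := Int.toNat_of_nonpos (by lia)
      simp [part, h0]⟩
    have hf : ∀ (M : ℕ) (n : ℤ), n < N + M → f.1 n = (part M).1 n := by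
      intro M n hn
      exact (hpart _ M n (by lia) (by lia)).symm
    refine ⟨f, ?_, ?_, ?_⟩
    · ext n
      obtain ⟨M, hM⟩ : ∃ M : ℕ, n < N + M := ⟨(n - N + 1).toNat, by lia⟩
      have h1 := hY (f - part M) (N + M) (fun m hm => by simp [hf M m hm]) n (by lia)
      have h2 : ((1 : Module.End k (laurent k R)) + Y) (part M) = g - ((-Y) ^ M) g := by
        have h3 := LinearMap.congr_fun (mul_neg_geom_sum (-Y) M) g
        simpa [part, LinearMap.sum_apply] using h3
      have h4 := congrArg (fun f : laurent k R => f.1 n) h2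
      simp only [LinearMap.add_apply, Module.End.one_apply, Submodule.coe_add, Pi.add_apply,
        Submodule.coe_sub, Pi.sub_apply, hpow N hN M n hM, sub_zero, map_sub] at h4 h1 ⊢
      rw [← h4, hf M n hM, sub_eq_zero.1 h1]
    · intro N' hN' n hn
      change (part _).1 n = 0
      simp only [part, Submodule.coe_sum, Finset.sum_apply]
      exact Finset.sum_eq_zero fun i _ => hpow N' hN' i n (by lia)
    · intro K hK hg n
      have : ∀ i : ℕ, ∀ n, (((-Y) ^ i) g).1 n ∈ K := by
        intro i
        induction i with
        | zero => simpa using hg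
        | succ i ih =>
          intro n
          rw [pow_succ', Module.End.mul_apply]
          simpa using hK _ ih n
      change (part _).1 n ∈ K
      simp only [part, Submodule.coe_sum, Finset.sum_apply]
      exact Submodule.sum_mem _ fun i _ => this i n
  let e := LinearEquiv.ofBijective ((1 : Module.End k (laurent k R)) + Y)
    ⟨hinj, fun g => (hsurj g).imp fun _ h => h.1⟩
  have he : ∀ f, e f = ((1 : Module.End k (laurent k R)) + Y) f := fun _ => rfl
  have hsymm : ∀ g f, ((1 : Module.End k (laurent k R)) + Y) f = g → e.symm g = f := by
    intro g f h; rw [← h, ← he, e.symm_apply_apply]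
  refine ⟨e.symm.toLinearMap, LinearMap.ext fun g => e.apply_symm_apply g,
    LinearMap.ext fun g => e.symm_apply_apply g, fun g N hN n hn => ?_, fun K hK g hg n => ?_⟩
  · obtain ⟨f, h1, h2, -⟩ := hsurj g
    rw [LinearEquiv.coe_coe, hsymm g f h1]
    exact h2 N hN n hn
  · obtain ⟨f, h1, -, h3⟩ := hsurj g
    rw [LinearEquiv.coe_coe, hsymm g f h1]
    exact h3 K hK hg n

end Series

/-! ### Conjugation by an exponential -/

section Conjugation

/-- If `[[X, N], N]` commutes with `N`, then `X e^N = e^N (X + [X, N] + ½ [[X, N], N])`. -/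
theorem mul_exp_eq {E : Type*} [Ring E] [Module ℚ E] {X N C₁ C₂ : E} (hN : IsNilpotent N)
    (h₁ : X * N = N * X + C₁) (h₂ : C₁ * N = N * C₁ + C₂ + C₂) (h₃ : C₂ * N = N * C₂) :
    X * IsNilpotent.exp N = IsNilpotent.exp N * (X + C₁ + C₂) := by
  obtain ⟨M, hM⟩ := hN
  let : Algebra ℚ E := Algebra.ofModule (fun r x y => by
    exact smul_mul_assoc r x y) (fun r x y => by exact mul_smul_comm r x y)
  have hC₂ : ∀ n : ℕ, C₂ * N ^ n = N ^ n * C₂ := fun n =>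
    ((show Commute C₂ N from h₃).pow_right n).eq
  have hC₁ : ∀ n : ℕ, C₁ * N ^ (n + 1) = N ^ (n + 1) * C₁ + (2 * (n + 1) : ℕ) • (N ^ n * C₂) := by
    intro n
    induction n with
    | zero => simp [h₂, two_smul]; abel
    | succ n ih =>
      rw [pow_succ, ← mul_assoc, ih, add_mul, mul_assoc, h₂, smul_mul_assoc, mul_assoc, h₃,
        ← mul_assoc _ N, ← pow_succ, mul_add, mul_add, ← mul_assoc, ← pow_succ]
      module
  have key : ∀ n : ℕ, X * N ^ (n + 2) = N ^ (n + 2) * X + (n + 2) • (N ^ (n + 1) * C₁) +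
      ((n + 2) * (n + 1)) • (N ^ n * C₂) := by
    intro n
    induction n with
    | zero =>
      have : X * N ^ 2 = N ^ 2 * X + 2 • (N * C₁) + 2 • C₂ := by
        rw [pow_two, ← mul_assoc, h₁, add_mul, mul_assoc, h₁, h₂, mul_add]
        simp only [mul_assoc]
        abel
      simpa using this
    | succ n ih =>
      rw [pow_succ, ← mul_assoc, ih]
      simp only [add_mul, smul_mul_assoc, mul_assoc]
      rw [h₁, h₂, h₃, mul_add, ← mul_assoc _ N X, ← pow_succ, mul_add, mul_add,
        ← mul_assoc _ N C₁, ← pow_succ, ← mul_assoc _ N C₂, ← pow_succ]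
      module
  have hfac : ∀ n : ℕ, ((n + 1).factorial : ℚ)⁻¹ * (n + 1) = (n.factorial : ℚ)⁻¹ := by
    intro n
    rw [Nat.factorial_succ]; push_cast
    have : (n.factorial : ℚ) ≠ 0 := by positivity
    have : (n + 1 : ℚ) ≠ 0 := by positivity
    field_simp
  have hM1 : N ^ (M + 1) = 0 := by rw [pow_succ, hM, zero_mul]
  have hM2 : N ^ (M + 2) = 0 := by rw [pow_succ, hM1, zero_mul]
  have e0 := IsNilpotent.exp_eq_sum hM
  have e1 := IsNilpotent.exp_eq_sum hM1
  have e2 := IsNilpotent.exp_eq_sum hM2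
  have e1' : IsNilpotent.exp N =
      ∑ i ∈ Finset.range M, ((i + 1).factorial : ℚ)⁻¹ • N ^ (i + 1) + 1 := by
    rw [e1, Finset.sum_range_succ']; simp
  have e2' : IsNilpotent.exp N =
      ∑ i ∈ Finset.range M, ((i + 2).factorial : ℚ)⁻¹ • N ^ (i + 2) + N + 1 := by
    rw [e2, Finset.sum_range_succ', Finset.sum_range_succ']; simp
  have hterm : ∀ i : ℕ, X * (((i + 2).factorial : ℚ)⁻¹ • N ^ (i + 2)) =
      (((i + 2).factorial : ℚ)⁻¹ • N ^ (i + 2)) * X +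
      (((i + 1).factorial : ℚ)⁻¹ • N ^ (i + 1)) * C₁ + ((i.factorial : ℚ)⁻¹ • N ^ i) * C₂ := by
    intro i
    have f1 : ((i + 1).factorial : ℚ)⁻¹ = ((i + 2).factorial : ℚ)⁻¹ * (i + 2) := by
      rw [← hfac (i + 1)]; push_cast; ring
    have f0 : (i.factorial : ℚ)⁻¹ = ((i + 2).factorial : ℚ)⁻¹ * ((i + 2) * (i + 1)) := by
      rw [← hfac i, f1]; ring
    rw [mul_smul_comm, key, f0, f1]
    simp only [smul_add, smul_mul_assoc, ← Nat.cast_smul_eq_nsmul ℚ, smul_smul]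
    push_cast
    rfl
  have expand : IsNilpotent.exp N * (X + C₁ + C₂) = IsNilpotent.exp N * X +
      IsNilpotent.exp N * C₁ + IsNilpotent.exp N * C₂ := by rw [mul_add, mul_add]
  have lhs : X * IsNilpotent.exp N = X *
    (∑ i ∈ Finset.range M, ((i + 2).factorial : ℚ)⁻¹ • N ^ (i + 2) + N + 1) := by rw [← e2']
  have r0 : IsNilpotent.exp N * X =
    (∑ i ∈ Finset.range M, ((i + 2).factorial : ℚ)⁻¹ • N ^ (i + 2) + N + 1) * X := by rw [← e2']
  have r1 : IsNilpotent.exp N * C₁ =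
    (∑ i ∈ Finset.range M, ((i + 1).factorial : ℚ)⁻¹ • N ^ (i + 1) + 1) * C₁ := by rw [← e1']
  rw [lhs, expand, r0, r1, e0]
  simp only [mul_add, add_mul, Finset.mul_sum, Finset.sum_mul, hterm, Finset.sum_add_distrib,
    mul_one, one_mul, h₁]
  abel

variable {k : Type*} [Field k] [CharZero k] {E : Type*} [Ring E] [Algebra k E]

variable (k) in
/-- The exponential of a nilpotent element of an algebra over a field of characteristic zero. -/
def nexp (N : E) : E :=
  let : Module ℚ E := Module.compHom E (algebraMap ℚ k)
  IsNilpotent.exp N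

theorem nexp_eq_sum {N : E} (hN : IsNilpotent N) : ∃ (M : ℕ) (c : ℕ → k),
    nexp k N = 1 + ∑ i ∈ Finset.range M, c i • N ^ (i + 1) := by
  let : Module ℚ E := Module.compHom E (algebraMap ℚ k)
  obtain ⟨M, hM⟩ := hN
  refine ⟨M, fun i => algebraMap ℚ k ((i + 1).factorial : ℚ)⁻¹, ?_⟩
  have h1 : N ^ (M + 1) = 0 := by rw [pow_succ, hM, zero_mul]
  have h2 := IsNilpotent.exp_eq_sum h1
  rw [Finset.sum_range_succ'] at h2
  simp only [Nat.factorial_zero, Nat.cast_one, inv_one, one_smul, pow_zero] at h2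
  rw [add_comm]
  exact h2

theorem nexp_neg_mul {N : E} (hN : IsNilpotent N) : nexp k (-N) * nexp k N = 1 :=
  let : Module ℚ E := Module.compHom E (algebraMap ℚ k)
  IsNilpotent.exp_neg_mul_exp_self hN

theorem mul_nexp_neg {N : E} (hN : IsNilpotent N) : nexp k N * nexp k (-N) = 1 :=
  let : Module ℚ E := Module.compHom E (algebraMap ℚ k)
  IsNilpotent.exp_mul_exp_neg_self hN

theorem nexp_commute {N W : E} (hN : IsNilpotent N) (hW : Commute N W) :
    Commute (nexp k N) W := by
  obtain ⟨M, c, h⟩ := nexp_eq_sum (k := k) hN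
  rw [h]
  exact (Commute.one_left W).add_left (Commute.sum_left _ _ _ fun i _ =>
    (hW.pow_left _).smul_left _)

theorem mul_nexp {X N C₁ C₂ : E} (hN : IsNilpotent N)
    (h₁ : X * N = N * X + C₁) (h₂ : C₁ * N = N * C₁ + C₂ + C₂) (h₃ : C₂ * N = N * C₂) :
    X * nexp k N = nexp k N * (X + C₁ + C₂) :=
  let : Module ℚ E := Module.compHom E (algebraMap ℚ k)
  mul_exp_eq hN h₁ h₂ h₃

end Conjugation

/-! ### Trivialization of the deformation `d + ħ Δ` of `d` -/

section Intertwiner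

/-- Perturbation of a contraction with homotopy `h` and projection `e`, where `t` stands for `ħ`.
If `Δ - d h Δ` factors through `d Δ`, then the perturbed inclusion `T e = (1 + ħ h Δ)⁻¹ e` takes
values in the kernel of `D = d + ħ Δ`, and `Φ = T e + h d + D h` intertwines `d` and `D`. It is
congruent to `e + h d + d h = 1` modulo `ħ`. -/
theorem perturbation {E : Type*} [Ring E] {d Δ h e ρ t T : E} (td : t * d = d * t)
    (tΔ : t * Δ = Δ * t)
    (dd : d * d = 0) (ΔΔ : Δ * Δ = 0) (dΔ : d * Δ = -(Δ * d)) (hom : e + d * h + h * d = 1)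
    (de : d * e = 0) (ed : e * d = 0) (hρ : Δ - d * h * Δ = ρ * (d * Δ))
    (hT : (1 + t * (h * Δ)) * T = 1) (hu : ∀ z, (1 + t * (ρ * Δ)) * z = 0 → z = 0) :
    (d + t * Δ) * (T * e + h * d + (d + t * Δ) * h) =
        (T * e + h * d + (d + t * Δ) * h) * d ∧
      T * e + h * d + (d + t * Δ) * h = 1 + t * (Δ * h - h * Δ * T * e) := by
  have hT' : T = 1 - t * (h * Δ) * T := by
    rw [add_mul, one_mul] at hT; exact eq_sub_of_add_eq hT
  have hTe : T * e = e - t * (h * Δ * T * e) := by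
    conv_lhs => rw [hT']
    noncomm_ring
  have htt : (t * Δ) * (t * Δ) = 0 := by
    rw [tΔ, mul_assoc, ← mul_assoc t, tΔ]
    rw [← mul_assoc, ← mul_assoc, ΔΔ, zero_mul, zero_mul]
  have hdt : d * (t * Δ) = -(t * Δ * d) := by
    rw [← mul_assoc, ← td, mul_assoc, dΔ, mul_neg, mul_assoc]
  have hDD : (d + t * Δ) * (d + t * Δ) = 0 := by
    rw [add_mul, mul_add, mul_add, dd, htt, hdt]; abel
  -- `z = D T e` satisfies `z = -ħ ρ Δ z`, hence vanishes.
  have h1 : d * (T * e) = -(t * (d * h * Δ * T * e)) := by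
    rw [hTe, mul_sub, de, zero_sub, ← mul_assoc d, ← td]
    noncomm_ring
  have hz : (d + t * Δ) * (T * e) = 0 := by
    apply hu
    have h2 : (d + t * Δ) * (T * e) = t * (ρ * (d * Δ)) * (T * e) := by
      rw [add_mul, h1, ← hρ]
      noncomm_ring
    have h3 : Δ * ((d + t * Δ) * (T * e)) = -(d * Δ * (T * e)) := by
      rw [dΔ, ← mul_assoc, mul_add, ← mul_assoc Δ t, ← tΔ, mul_assoc t, ΔΔ]
      noncomm_ring
    rw [add_mul, one_mul, mul_assoc t, mul_assoc ρ, h3, h2]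
    noncomm_ring
  refine ⟨?_, ?_⟩
  · have l : (d + t * Δ) * (T * e + h * d + (d + t * Δ) * h) =
        (d + t * Δ) * (T * e) + (d + t * Δ) * (h * d) + (d + t * Δ) * (d + t * Δ) * h := by
      noncomm_ring
    have r : (T * e + h * d + (d + t * Δ) * h) * d =
        T * (e * d) + h * (d * d) + (d + t * Δ) * (h * d) := by
      noncomm_ring
    rw [l, r, hz, hDD, ed, dd]
    simp
  · rw [hTe, ← hom]
    noncomm_ring

variable {k : Type u} [Field k]

/-- Formal series with coefficients in `K`. -/
def valuedIn {R : Type*} [AddCommGroup R] [Module k R] (L : Submodule k (ℤ → R))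
    (K : Submodule k R) : Submodule k L where
  carrier := {f | ∀ n, f.1 n ∈ K}
  add_mem' := fun ha hb n => K.add_mem (ha n) (hb n)
  zero_mem' := fun _ => K.zero_mem
  smul_mem' := fun c _ ha n => K.smul_mem c (ha n)

/-- Formal series of order at least `N` in `ħ`. -/
def orderGE {R : Type*} [AddCommGroup R] [Module k R] (L : Submodule k (ℤ → R)) (N : ℤ) :
    Submodule k L where
  carrier := {f | ∀ n < N, f.1 n = 0}
  add_mem' := fun ha hb n hn => by simp [ha n hn, hb n hn]
  zero_mem' := fun _ _ => rfl
  smul_mem' := fun c _ ha n hn => by simp [ha n hn]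

theorem op_valuedIn {R : Type*} [AddCommGroup R] [Module k R] {L : Submodule k (ℤ → R)}
    (hL : ShiftStable L) {K K' : Submodule k R} {T : Module.End k R} (hT : ∀ x ∈ K, T x ∈ K')
    {f : L} (hf : f ∈ valuedIn L K) : hL.op T f ∈ valuedIn L K' := fun n => hT _ (hf n)

theorem sh_valuedIn {R : Type*} [AddCommGroup R] [Module k R] {L : Submodule k (ℤ → R)}
    (hL : ShiftStable L) {K : Submodule k R} (c : ℤ)
    {f : L} (hf : f ∈ valuedIn L K) : hL.sh c f ∈ valuedIn L K := fun n => hf (n - c)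

theorem op_orderGE {R : Type*} [AddCommGroup R] [Module k R] {L : Submodule k (ℤ → R)}
    (hL : ShiftStable L) {N : ℤ} (T : Module.End k R)
    {f : L} (hf : f ∈ orderGE L N) : hL.op T f ∈ orderGE L N := fun n hn => by
  rw [hL.op_apply, hf n hn, map_zero]

theorem sh_orderGE {R : Type*} [AddCommGroup R] [Module k R] {L : Submodule k (ℤ → R)}
    (hL : ShiftStable L) {N M : ℤ} (c : ℤ) (hM : M = N + c)
    {f : L} (hf : f ∈ orderGE L N) : hL.sh c f ∈ orderGE L M := fun n hn =>
  hf (n - c) (by lia)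

variable {A : Type v} [Ring A] [Algebra k A] {𝒜 : ZMod 2 → Submodule k A} [GradedAlgebra 𝒜]
  (X : DGBV 𝒜)

theorem exists_factor {V W U : Type*} [AddCommGroup V] [Module k V] [AddCommGroup W] [Module k W]
    [AddCommGroup U] [Module k U] (S : V →ₗ[k] W) (T : V →ₗ[k] U) (h : ∀ x, S x = 0 → T x = 0) :
    ∃ ρ : W →ₗ[k] U, ∀ x, T x = ρ (S x) := by
  obtain ⟨r₀, hr₀⟩ := S.rangeRestrict.exists_rightInverse_of_surjective S.range_rangeRestrict
  obtain ⟨ρ, hρ⟩ := LinearMap.exists_extend (T ∘ₗ r₀)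
  refine ⟨ρ, fun x => ?_⟩
  have e1 : ρ (S x) = T (r₀ (S.rangeRestrict x)) := LinearMap.congr_fun hρ (S.rangeRestrict x)
  have e2 : S (r₀ (S.rangeRestrict x)) = S x :=
    congrArg Subtype.val (LinearMap.congr_fun hr₀ (S.rangeRestrict x))
  rw [e1, ← sub_eq_zero, ← map_sub]
  exact h _ (by rw [map_sub, e2, sub_self])

theorem commute_of_inverse {E : Type*} [Ring E] {P Q W : E} (h1 : P * Q = 1) (h2 : Q * P = 1)
    (hc : Commute P W) : Commute Q W :=
  calc Q * W = Q * (W * P) * Q := by rw [mul_assoc, mul_assoc, h1, mul_one]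
    _ = W * Q := by rw [← hc.eq, ← mul_assoc, h2, one_mul]

theorem commute_perturbation {E : Type*} [Ring E] {t a b T e Z W : E} (ht : Commute t W)
    (ha : Commute a W) (hb : Commute b W) (he : Commute e W) (hT1 : (1 + t * b) * T = 1)
    (hT2 : T * (1 + t * b) = 1) (hZ1 : (1 + t * (a - b * T * e)) * Z = 1)
    (hZ2 : Z * (1 + t * (a - b * T * e)) = 1) : Commute Z W := by
  have hT := commute_of_inverse hT1 hT2 ((Commute.one_left W).add_left (ht.mul_left hb))
  exact commute_of_inverse hZ1 hZ2 ((Commute.one_left W).add_left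
    (ht.mul_left (ha.sub_left ((hb.mul_left hT).mul_left he))))

/-- The deformation `d + ħ Δ` of the differential `d` on Laurent series with coefficients in
`B ⊗ A` is isomorphic to the trivial one, by operators `Φ`, `Ψ = Φ⁻¹` congruent to `1` modulo `ħ`
and commuting with all operators which commute with `ħ` and with the even operators of `A`. -/
theorem exists_intertwiner {V : Type v} [AddCommGroup V] [Module k V] {𝒱 : ZMod 2 → Submodule k V}
    (C : Contraction 𝒱 𝒜 X.d) (hex : ∀ a, X.d (X.Δ a) = 0 → ∃ b, X.d b = X.Δ a)
    (B : ArtinSuperalgebra k) :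
    ∃ Φ Ψ : Module.End k (laurent k (B.carrier ⊗[k] A)), Φ * Ψ = 1 ∧ Ψ * Φ = 1 ∧
      (shiftStable_laurent.op (oddExt B X.d) +
          shiftStable_laurent.sh 1 * shiftStable_laurent.op (oddExt B X.Δ)) * Φ =
        Φ * shiftStable_laurent.op (oddExt B X.d) ∧
      (∀ N, ∀ f ∈ orderGE _ N, Φ f - f ∈ orderGE _ (N + 1)) ∧
      (∀ N, ∀ f ∈ orderGE _ N, Ψ f - f ∈ orderGE _ (N + 1)) ∧
      (∀ I, Homog B I → ∀ f ∈ valuedIn _ (tens I A), Φ f ∈ valuedIn _ (tens I A)) ∧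
      (∀ I, Homog B I → ∀ f ∈ valuedIn _ (tens I A), Ψ f ∈ valuedIn _ (tens I A)) ∧
      ∀ W : Module.End k (laurent k (B.carrier ⊗[k] A)),
        (shiftStable_laurent.sh 1 * W = W * shiftStable_laurent.sh 1) →
        (∀ S : A →ₗ[k] A, (∀ i, ∀ a ∈ 𝒜 i, S a ∈ 𝒜 i) →
          shiftStable_laurent.op (S.lTensor B.carrier) * W =
            W * shiftStable_laurent.op (S.lTensor B.carrier)) → Ψ * W = W * Ψ := by
  have hL : ShiftStable (laurent k (B.carrier ⊗[k] A)) := shiftStable_laurent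
  have hdd : X.d ∘ₗ X.d = 0 := LinearMap.ext X.d_sq
  obtain ⟨ρ, hρ⟩ := exists_factor (X.d ∘ₗ X.Δ) (X.Δ - X.d ∘ₗ C.h ∘ₗ X.Δ) (by
    intro a ha
    obtain ⟨b, hb⟩ := hex a ha
    simp only [LinearMap.sub_apply, LinearMap.comp_apply, ← hb, C.dhd X.d_sq, sub_self])
  set t := hL.sh 1 with ht
  set d := hL.op (oddExt B X.d) with hd
  set Δ := hL.op (oddExt B X.Δ) with hΔ
  set h := hL.op (oddExt B C.h) with hh
  set e := hL.op ((C.s ∘ₗ C.p).lTensor B.carrier) with he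
  set r := hL.op (oddExt B ρ) with hr
  have raise : ∀ Y : Module.End k (laurent k (B.carrier ⊗[k] A)),
      (∀ N, ∀ f ∈ orderGE _ N, Y f ∈ orderGE _ N) → ∀ (f : laurent k (B.carrier ⊗[k] A)) (N : ℤ),
      (∀ n < N, f.1 n = 0) → ∀ n < N + 1, ((t * Y) f).1 n = 0 := by
    intro Y hY f N hf n hn
    exact sh_orderGE hL 1 rfl (hY N f hf) n hn
  obtain ⟨T, hT1, hT2, hT3, hT4⟩ := exists_inverse_of_raising (t * (h * Δ))
    (raise _ fun N f hf => op_orderGE hL _ (op_orderGE hL _ hf))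
  obtain ⟨T', -, hT'2, -, -⟩ := exists_inverse_of_raising (t * (r * Δ))
    (raise _ fun N f hf => op_orderGE hL _ (op_orderGE hL _ hf))
  have mulop : ∀ P Q P' : Module.End k (B.carrier ⊗[k] A), (∀ x, P (Q x) = P' x) →
      hL.op P * hL.op Q = hL.op P' := by
    intro P Q P' hP
    rw [← map_mul]
    exact congrArg _ (LinearMap.ext hP)
  have odd2 : ∀ S S' : A →ₗ[k] A, hL.op (oddExt B S) * hL.op (oddExt B S') =
      hL.op ((S ∘ₗ S').lTensor B.carrier) := fun S S' => mulop _ _ _ (oddExt_oddExt B S S')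
  have odd3 : ∀ S S' : A →ₗ[k] A, hL.op (oddExt B S) * hL.op (S'.lTensor B.carrier) =
      hL.op (oddExt B (S ∘ₗ S')) := fun S S' => mulop _ _ _ (oddExt_lTensor B S S')
  have odd4 : ∀ S S' : A →ₗ[k] A, hL.op (S.lTensor B.carrier) * hL.op (oddExt B S') =
      hL.op (oddExt B (S ∘ₗ S')) := fun S S' => mulop _ _ _ (lTensor_oddExt B S S')
  have oddadd : ∀ S S' : A →ₗ[k] A, oddExt B S - oddExt B S' = oddExt B (S - S') := by
    intro S S'
    refine TensorProduct.ext' fun b a => ?_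
    simp [oddExt, TensorProduct.tmul_sub]
  have hpert := perturbation (d := d) (Δ := Δ) (h := h) (e := e) (ρ := r) (t := t) (T := T)
    (hL.sh_mul_op 1 _) (hL.sh_mul_op 1 _)
    (by rw [odd2, hdd, LinearMap.lTensor_zero, map_zero])
    (by rw [odd2, show X.Δ ∘ₗ X.Δ = 0 from LinearMap.ext X.Δ_sq, LinearMap.lTensor_zero, map_zero])
    (by
      rw [odd2, odd2, show X.d ∘ₗ X.Δ = -(X.Δ ∘ₗ X.d) from
        LinearMap.ext fun a => eq_neg_of_add_eq_zero_left (X.d_Δ a), LinearMap.lTensor_neg,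
        map_neg])
    (by
      rw [odd2, odd2, ← map_add, ← map_add, ← LinearMap.lTensor_add, ← LinearMap.lTensor_add,
        show C.s ∘ₗ C.p + X.d ∘ₗ C.h + C.h ∘ₗ X.d = LinearMap.id from LinearMap.ext C.homotopy,
        LinearMap.lTensor_id]
      exact map_one _)
    (by
      rw [odd3, show X.d ∘ₗ C.s ∘ₗ C.p = 0 from LinearMap.ext fun a => C.d_s _]
      simp [oddExt])
    (by
      rw [odd4, show (C.s ∘ₗ C.p) ∘ₗ X.d = 0 from LinearMap.ext fun a => by simp [C.p_d]]
      simp [oddExt])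
    (by
      rw [mul_assoc, odd2, odd3, odd2, odd3, hΔ]
      refine (map_sub hL.op (oddExt B X.Δ) (oddExt B (X.d ∘ₗ C.h ∘ₗ X.Δ))).symm.trans ?_
      refine congrArg hL.op ((oddadd _ _).trans ?_)
      exact congrArg (oddExt B) (LinearMap.ext hρ))
    hT1
    (by
      intro z hz
      rw [← one_mul z, ← hT'2, mul_assoc, hz, mul_zero])
  obtain ⟨hΦ1, hΦ2⟩ := hpert
  set Φ := T * e + h * d + (d + t * Δ) * h with hΦ
  set Y := Δ * h - h * Δ * T * e with hY
  have hYord : ∀ N, ∀ f ∈ orderGE _ N, Y f ∈ orderGE _ N := by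
    intro N f hf
    refine Submodule.sub_mem _ (op_orderGE hL _ (op_orderGE hL _ hf)) ?_
    exact op_orderGE hL _ (op_orderGE hL _ (hT3 _ _ (op_orderGE hL _ hf)))
  have hprd : ∀ (S : A →ₗ[k] A) {I}, Homog B I → ∀ f ∈ valuedIn _ (tens I A),
      hL.op (oddExt B S) f ∈ valuedIn _ (tens I A) := fun S I hI f hf =>
    op_valuedIn hL (fun x hx => oddExt_mem_tens hI S hx) hf
  have hTv : ∀ I, Homog B I → ∀ f ∈ valuedIn _ (tens I A), T f ∈ valuedIn _ (tens I A) :=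
    fun I hI f hf => hT4 _ (fun f hf => sh_valuedIn hL 1 (hprd _ hI _ (hprd _ hI _ hf))) f hf
  have hYv : ∀ I, Homog B I → ∀ f ∈ valuedIn _ (tens I A), Y f ∈ valuedIn _ (tens I A) := by
    intro I hI f hf
    refine Submodule.sub_mem _ (hprd _ hI _ (hprd _ hI _ hf)) ?_
    exact hprd _ hI _ (hprd _ hI _ (hTv I hI _
      (op_valuedIn hL (fun x hx => lTensor_mem_tens _ hx) hf)))
  obtain ⟨Ψ, hΨ1, hΨ2, hΨ3, hΨ4⟩ := exists_inverse_of_raising (t * Y) (raise Y hYord)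
  rw [← hΦ2] at hΨ1 hΨ2
  refine ⟨Φ, Ψ, hΨ1, hΨ2, hΦ1, ?_, ?_, ?_, ?_, ?_⟩
  · intro N f hf
    rw [hΦ2, LinearMap.add_apply, Module.End.one_apply, add_sub_cancel_left]
    exact raise Y hYord f N hf
  · intro N f hf
    have h1 : Ψ f - f = -((t * Y) (Ψ f)) := by
      have := LinearMap.congr_fun hΨ1 f
      rw [hΦ2, Module.End.mul_apply, LinearMap.add_apply, Module.End.one_apply,
        Module.End.one_apply] at this
      nth_rewrite 2 [← this]
      abel
    rw [h1]
    exact Submodule.neg_mem _ (raise Y hYord _ N (hΨ3 f N hf))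
  · intro I hI f hf
    rw [hΦ2]
    exact Submodule.add_mem _ hf (sh_valuedIn hL 1 (hYv I hI f hf))
  · intro I hI f hf
    exact hΨ4 _ (fun f hf => sh_valuedIn hL 1 (hYv I hI f hf)) f hf
  · intro W hW1 hW2
    have hev : ∀ S S' : A →ₗ[k] A, (∀ i, ∀ a ∈ 𝒜 i, S a ∈ 𝒜 (i + 1)) →
        (∀ i, ∀ a ∈ 𝒜 i, S' a ∈ 𝒜 (i + 1)) →
        Commute (hL.op (oddExt B S) * hL.op (oddExt B S')) W := by
      intro S S' hS hS'
      rw [odd2]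
      refine hW2 _ fun i a ha => ?_
      have := hS _ _ (hS' i a ha)
      rwa [add_assoc, zmod2_add_self, add_zero] at this
    have ce : Commute e W := hW2 _ fun i a ha => C.s_even _ _ (C.p_even _ _ ha)
    rw [hΦ2] at hΨ1 hΨ2
    clear_value Y
    subst hY
    have ct : Commute t W := hW1
    exact (commute_perturbation (E := Module.End k (laurent k (B.carrier ⊗[k] A))) (t := t)
      (T := T) (e := e) ct (hev _ _ X.Δ_odd C.h_odd)
      (hev _ _ C.h_odd X.Δ_odd) ce hT1 hT2 hΨ1 hΨ2).eq

end Intertwiner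

/-! ### Obstructions vanish -/

section Obstruction

variable {k : Type u} [Field k] [CharZero k]
variable {A : Type v} [Ring A] [Algebra k A] {𝒜 : ZMod 2 → Submodule k A} [GradedAlgebra 𝒜]
  (X : DGBV 𝒜) {B : ArtinSuperalgebra k}

theorem bmul_maxIdeal_mem {γ : B.carrier ⊗[k] A} (hγ : γ ∈ tens B.maxIdeal A) {n : ℕ}
    {x : B.carrier ⊗[k] A} (hx : x ∈ tens (B.maxIdeal ^ n) A) :
    bmul 𝒜 B γ x ∈ tens (B.maxIdeal ^ (n + 1)) A :=
  bmul_mem_tens 𝒜 (homog_pow B n) (by rw [pow_succ' B.maxIdeal n]) hγ hx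

theorem tens_pow_eq_bot {N : ℕ} (hN : B.maxIdeal ^ N = ⊥) {m : ℕ} (hm : N ≤ m) :
    tens (B.maxIdeal ^ m) A = ⊥ := by
  obtain ⟨c, rfl⟩ := Nat.exists_eq_add_of_le hm
  rw [pow_add, hN, Submodule.bot_mul, tens_bot]

theorem pow_maxIdeal_anti {a b : ℕ} (h : a ≤ b) (ha : 1 ≤ a) :
    B.maxIdeal ^ b ≤ B.maxIdeal ^ a := by
  have hm : B.maxIdeal * B.maxIdeal ≤ B.maxIdeal :=
    Submodule.mul_le.2 fun x hx y _ => maxIdeal_mul_mem B hx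
  induction b, h using Nat.le_induction with
  | base => exact le_rfl
  | succ b hb ih =>
    refine le_trans ?_ ih
    obtain ⟨c, rfl⟩ := Nat.exists_eq_add_of_le' (le_trans ha hb)
    rw [pow_succ B.maxIdeal (c + 1), pow_succ B.maxIdeal c, mul_assoc]
    exact mul_le_mul' le_rfl hm

theorem tens_pow_anti {a b : ℕ} (h : a ≤ b) (ha : 1 ≤ a) :
    tens (B.maxIdeal ^ b) A ≤ tens (B.maxIdeal ^ a) A := tens_mono (pow_maxIdeal_anti h ha)

theorem bmul_nilpotent {γ : B.carrier ⊗[k] A} (hγ : γ ∈ tens B.maxIdeal A) :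
    IsNilpotent (bmul 𝒜 B γ) := by
  obtain ⟨N, hN⟩ := B.nilpotent
  have h : ∀ n y, ((bmul 𝒜 B γ) ^ (n + 1)) y ∈ tens (B.maxIdeal ^ (n + 1)) A := by
    intro n
    induction n with
    | zero =>
      intro y
      rw [pow_one, zero_add, pow_one]
      refine bmul_mem_tens 𝒜 (J := ⊤) (homog_top B) ?_ hγ (by rw [tens_top]; trivial)
      exact Submodule.mul_le.2 fun a ha b _ => maxIdeal_mul_mem B ha
    | succ n ih =>
      intro y
      rw [pow_succ' (bmul 𝒜 B γ) (n + 1), Module.End.mul_apply]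
      exact bmul_maxIdeal_mem hγ (ih y)
  refine ⟨N + 1, LinearMap.ext fun y => ?_⟩
  have h1 := h N y
  rw [tens_pow_eq_bot hN (Nat.le_succ N)] at h1
  simpa using h1

/-- The commutator `[Δ, γ]`: the action `γ •` of an even element. -/
def actOp (γ : B.carrier ⊗[k] A) : Module.End k (B.carrier ⊗[k] A) :=
  oddExt B X.Δ * bmul 𝒜 B γ - bmul 𝒜 B γ * oddExt B X.Δ

theorem actOp_apply (γ y : B.carrier ⊗[k] A) : actOp X γ y =
    oddExt B X.Δ (bmul 𝒜 B γ y) - bmul 𝒜 B γ (oddExt B X.Δ y) := rfl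

/-- Multiplication by `ħ⁻¹ γ`. -/
def hinv {L : Submodule k (ℤ → B.carrier ⊗[k] A)} (hL : ShiftStable L) (γ : B.carrier ⊗[k] A) :
    Module.End k L := hL.sh (-1) * hL.op (bmul 𝒜 B γ)

theorem hinv_nilpotent {L : Submodule k (ℤ → B.carrier ⊗[k] A)} (hL : ShiftStable L)
    {γ : B.carrier ⊗[k] A} (hγ : γ ∈ tens B.maxIdeal A) :
    IsNilpotent (hinv (𝒜 := 𝒜) hL γ) :=
  Commute.isNilpotent_mul_left (hL.sh_mul_op _ _) ((bmul_nilpotent hγ).map hL.op)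

variable {L : Submodule k (ℤ → B.carrier ⊗[k] A)} (hL : ShiftStable L) {γ : B.carrier ⊗[k] A}

/-- The operator `d + ħ Δ` on formal series. -/
def hdiff : Module.End k L :=
  hL.op (oddExt B X.d) + hL.sh 1 * hL.op (oddExt B X.Δ)

/-- Conjugation of `d + ħ Δ` by `e^{γ / ħ}` gives `d + ħ Δ + γ • + ħ⁻¹ F`, where `F` is the
curvature of `γ`. -/
theorem hdiff_nexp (hγ : γ ∈ pts 𝒜 B 0) :
    hdiff X hL * nexp k (hinv (𝒜 := 𝒜) hL γ) = nexp k (hinv (𝒜 := 𝒜) hL γ) * (hdiff X hL +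
      hL.op (actOp X γ) + hL.sh (-1) * hL.op (bmul 𝒜 B (curv 𝒜 X.d X.br B γ))) := by
  have hev := pts_le_even B 0 hγ
  have h1 : ∀ y, oddExt B X.d (bmul 𝒜 B γ y) =
      bmul 𝒜 B γ (oddExt B X.d y) + bmul 𝒜 B (oddExt B X.d γ) y := by
    intro y
    have := LinearMap.congr_fun (d_comm_even X hev) y
    exact sub_eq_iff_eq_add'.1 this
  have h2 : ∀ y, actOp X γ (bmul 𝒜 B γ y) = bmul 𝒜 B γ (actOp X γ y) +
      bmul 𝒜 B (oddExt₂ B 𝒜 X.br γ γ) y := by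
    intro y
    have := LinearMap.congr_fun (Δ_comm_even X hev hev) y
    rw [← br_even X hev] at this
    exact sub_eq_iff_eq_add'.1 this
  have h3 : ∀ x y, bmul 𝒜 B x (bmul 𝒜 B γ y) = bmul 𝒜 B γ (bmul 𝒜 B x y) := fun x y =>
    LinearMap.congr_fun (bmul_comm X hev x) y
  have key := mul_nexp (k := k) (E := Module.End k L) (X := hdiff X hL) (N := hinv (𝒜 := 𝒜) hL γ)
    (C₁ := hL.op (actOp X γ) + hL.sh (-1) * hL.op (bmul 𝒜 B (oddExt B X.d γ)))
    (C₂ := (2 : k)⁻¹ • (hL.sh (-1) * hL.op (bmul 𝒜 B (oddExt₂ B 𝒜 X.br γ γ))))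
    (hinv_nilpotent hL (gpts_le_tens hγ))
    (by
      ext f n
      simp only [hdiff, hinv, Module.End.mul_apply, LinearMap.add_apply, Submodule.coe_add,
        Pi.add_apply, ShiftStable.op_apply, ShiftStable.sh_apply, map_add, sub_neg_eq_add,
        sub_add_cancel, add_sub_cancel_right, h1, actOp_apply]
      abel)
    (by
      ext f n
      have h4 : ∀ x : B.carrier ⊗[k] A, (2 : k)⁻¹ • x + (2 : k)⁻¹ • x = x := fun x => by
        rw [← two_smul k, smul_smul, mul_inv_cancel₀ two_ne_zero, one_smul]
      simp only [hinv, Module.End.mul_apply, LinearMap.add_apply, Submodule.coe_add,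
        Pi.add_apply, ShiftStable.op_apply, ShiftStable.sh_apply, map_add, h2, h3,
        LinearMap.smul_apply, Submodule.coe_smul, Pi.smul_apply, add_assoc, h4]
      abel)
    (by
      ext f n
      simp only [hinv, Module.End.mul_apply, ShiftStable.op_apply, ShiftStable.sh_apply, h3,
        LinearMap.smul_apply, Submodule.coe_smul, Pi.smul_apply, map_smul])
  refine key.trans (congrArg (nexp k (hinv (𝒜 := 𝒜) hL γ) * ·) ?_)
  ext f n
  simp only [hdiff, curv, Module.End.mul_apply, LinearMap.add_apply, Submodule.coe_add,
    Pi.add_apply, ShiftStable.op_apply, ShiftStable.sh_apply, map_add, map_smul,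
    LinearMap.smul_apply, Submodule.coe_smul, Pi.smul_apply]
  abel

/-- Multiplication by `e^{γ / ħ}` is the identity on the graded pieces of the `m_B`-adic
filtration. -/
theorem nexp_hinv_sub_mem (hγ : γ ∈ tens B.maxIdeal A) {n : ℕ} {f : L}
    (hf : f ∈ valuedIn L (tens (B.maxIdeal ^ n) A)) :
    nexp k (hinv (𝒜 := 𝒜) hL γ) f - f ∈ valuedIn L (tens (B.maxIdeal ^ (n + 1)) A) := by
  obtain ⟨M, c, h⟩ := nexp_eq_sum (k := k) (E := Module.End k L) (hinv_nilpotent (𝒜 := 𝒜) hL hγ)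
  have hpow : ∀ i, ((hinv (𝒜 := 𝒜) hL γ) ^ (i + 1)) f ∈
      valuedIn L (tens (B.maxIdeal ^ (n + i + 1)) A) := by
    intro i
    induction i with
    | zero =>
      rw [zero_add, pow_one]
      exact sh_valuedIn hL _ (op_valuedIn hL (fun x hx => bmul_maxIdeal_mem hγ hx) hf)
    | succ i ih =>
      rw [pow_succ' (hinv (𝒜 := 𝒜) hL γ) (i + 1), Module.End.mul_apply]
      exact sh_valuedIn hL _ (op_valuedIn hL (fun x hx => bmul_maxIdeal_mem hγ hx) ih)
  rw [h, LinearMap.add_apply, Module.End.one_apply, add_sub_cancel_left, LinearMap.sum_apply]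
  exact Submodule.sum_mem _ fun i _ => Submodule.smul_mem _ _ fun m =>
    tens_pow_anti (by lia) (by lia) (hpow i m)

/-- The constant series. -/
def constSeries (x : B.carrier ⊗[k] A) : laurent k (B.carrier ⊗[k] A) :=
  ⟨Pi.single 0 x, 0, fun n hn => by simp [hn.ne]⟩

theorem op_constSeries (T : Module.End k (B.carrier ⊗[k] A)) (x : B.carrier ⊗[k] A) :
    shiftStable_laurent.op T (constSeries x) = constSeries (T x) := by
  ext n
  change T ((Pi.single 0 x : ℤ → B.carrier ⊗[k] A) n) = (Pi.single 0 (T x) : ℤ → _) n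
  rcases eq_or_ne n 0 with rfl | hn
  · simp
  · simp [hn]

theorem constSeries_orderGE (x : B.carrier ⊗[k] A) :
    constSeries x ∈ orderGE (laurent k (B.carrier ⊗[k] A)) 0 := fun n hn => by
  simp [constSeries, hn.ne]

theorem constSeries_valuedIn {K : Submodule k (B.carrier ⊗[k] A)} {x : B.carrier ⊗[k] A}
    (hx : x ∈ K) : constSeries x ∈ valuedIn (laurent k (B.carrier ⊗[k] A)) K := fun n => by
  change (Pi.single 0 x : ℤ → B.carrier ⊗[k] A) n ∈ K
  rcases eq_or_ne n 0 with rfl | hn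
  · simpa using hx
  · simp [hn]

theorem valuedIn_mono {K K' : Submodule k (B.carrier ⊗[k] A)} (h : K ≤ K') :
    valuedIn L K ≤ valuedIn L K' := fun _ hf n => h (hf n)

theorem orderGE_mono {N M : ℤ} (h : N ≤ M) : orderGE L M ≤ orderGE L N :=
  fun _ hf n hn => hf n (hn.trans_le h)

set_option maxHeartbeats 1000000 in
/-- The lowest order term of the curvature `F = dγ + ½ [γ • γ]` is `d`-exact. The proof deforms `1`
to a series `v` without poles in `ħ` which is flat to the same order for `d + ħ Δ + γ •`; then
`(d + ħ Δ) (e^{γ / ħ} v)` is, to lowest order, `F / ħ` plus terms without poles, and the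
trivialization of `d + ħ Δ` shows that its polar part is exact. -/
theorem exists_curv_sub_mem {V : Type v} [AddCommGroup V] [Module k V]
    {𝒱 : ZMod 2 → Submodule k V} (C : Contraction 𝒱 𝒜 X.d)
    (hex : ∀ a, X.d (X.Δ a) = 0 → ∃ b, X.d b = X.Δ a)
    (hγ : γ ∈ pts 𝒜 B 0) {n : ℕ} (hn : 1 ≤ n)
    (hF : curv 𝒜 X.d X.br B γ ∈ tens (B.maxIdeal ^ n) A) :
    ∃ r, curv 𝒜 X.d X.br B γ - oddExt B X.d r ∈ tens (B.maxIdeal ^ (n + 1)) A := by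
  obtain ⟨Φ, Ψ, hΦΨ, hΨΦ, hD, hΦ1, hΨ1, hΦv, hΨv, -⟩ := exists_intertwiner X C hex B
  have hL : ShiftStable (laurent k (B.carrier ⊗[k] A)) := shiftStable_laurent
  have hγm : γ ∈ tens B.maxIdeal A := gpts_le_tens hγ
  set F := curv 𝒜 X.d X.br B γ with hFdef
  let K : ℕ → Submodule k (laurent k (B.carrier ⊗[k] A)) := fun j =>
    valuedIn _ (tens (B.maxIdeal ^ j) A)
  have hKmono : ∀ {a b : ℕ}, a ≤ b → 1 ≤ a → K b ≤ K a := fun h ha =>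
    valuedIn_mono (tens_pow_anti h ha)
  set d := hL.op (oddExt B X.d) with hd
  set D := hdiff X hL with hDdef
  set e := nexp k (hinv (𝒜 := 𝒜) hL γ) with he
  let tw : Module.End k (laurent k (B.carrier ⊗[k] A)) := D + hL.op (actOp X γ)
  let φ : Module.End k (laurent k (B.carrier ⊗[k] A)) := hL.sh (-1) * hL.op (bmul 𝒜 B F)
  have hexp : ∀ v, D (e v) = e (tw v + φ v) := fun v => LinearMap.congr_fun
    (hdiff_nexp X hL hγ) v
  have hDΦ : ∀ v, D (Φ v) = Φ (d v) := fun v => LinearMap.congr_fun hD v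
  have hΦΨ' : ∀ v, Φ (Ψ v) = v := fun v => LinearMap.congr_fun hΦΨ v
  have hΨΦ' : ∀ v, Ψ (Φ v) = v := fun v => LinearMap.congr_fun hΨΦ v
  have hΨD : ∀ v, Ψ (D v) = d (Ψ v) := by
    intro v
    conv_lhs => rw [← hΦΨ' v, hDΦ, hΨΦ']
  have heK : ∀ {j f}, f ∈ K j → e f - f ∈ K (j + 1) := fun hf => nexp_hinv_sub_mem hL hγm hf
  have hΦK : ∀ {j f}, f ∈ K j → Φ f ∈ K j := fun hf => hΦv _ (homog_pow B _) _ hf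
  have hΨK : ∀ {j f}, f ∈ K j → Ψ f ∈ K j := fun hf => hΨv _ (homog_pow B _) _ hf
  have hoddK : ∀ (T : A →ₗ[k] A) {j f}, f ∈ K j → hL.op (oddExt B T) f ∈ K j := fun T _ _ hf =>
    op_valuedIn hL (fun x hx => oddExt_mem_tens (homog_pow B _) T hx) hf
  have hactK : ∀ {j f}, f ∈ K j → hL.op (actOp X γ) f ∈ K (j + 1) := fun hf =>
    op_valuedIn hL (fun x hx => Submodule.sub_mem _
      (oddExt_mem_tens (homog_pow B _) _ (bmul_maxIdeal_mem hγm hx))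
      (bmul_maxIdeal_mem hγm (oddExt_mem_tens (homog_pow B _) _ hx))) hf
  have hord : ∀ (Z : Module.End k (laurent k (B.carrier ⊗[k] A))),
      (∀ N, ∀ f ∈ orderGE _ N, Z f - f ∈ orderGE _ (N + 1)) → ∀ {N f}, f ∈ orderGE _ N →
        Z f ∈ orderGE _ N := fun Z hZ N f hf => by
    have := Submodule.add_mem _ (orderGE_mono (by lia) (hZ N f hf)) hf
    rwa [sub_add_cancel] at this
  have htwO : ∀ {f}, f ∈ orderGE _ 0 → tw f ∈ orderGE _ 0 := fun {f} hf =>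
    Submodule.add_mem _ (Submodule.add_mem _ (op_orderGE hL _ hf)
      (orderGE_mono (by decide) (sh_orderGE hL 1 rfl (op_orderGE hL _ hf)))) (op_orderGE hL _ hf)
  -- Multiplication by the curvature raises the filtration by `n`.
  have hφK : ∀ f, f ∈ K 1 → φ f ∈ K (n + 1) := fun f hf =>
    sh_valuedIn hL _ (op_valuedIn hL (fun x hx => bmul_mem_tens 𝒜 (homog_pow B 1)
      (by rw [← pow_add]) hF hx) hf)
  let one : laurent k (B.carrier ⊗[k] A) := constSeries (1 ⊗ₜ 1)
  have hφone : φ one = hL.sh (-1) (constSeries F) := by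
    change hL.sh (-1) (hL.op (bmul 𝒜 B F) one) = _
    rw [op_constSeries, bmul_one]
  have hφone' : φ one ∈ K n := by
    rw [hφone]; exact sh_valuedIn hL _ (constSeries_valuedIn hF)
  have htw1 : tw one ∈ K 1 := by
    change (hL.op (oddExt B X.d) one + hL.sh 1 (hL.op (oddExt B X.Δ) one)) +
      hL.op (actOp X γ) one ∈ K 1
    rw [op_constSeries, op_constSeries, op_constSeries, d_unit, Δ_unit, actOp_apply, bmul_one,
      Δ_unit, map_zero, sub_zero]
    have hz : (constSeries 0 : laurent k (B.carrier ⊗[k] A)) = 0 := by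
      ext n; simp [constSeries]
    rw [hz, map_zero, add_zero, zero_add]
    exact constSeries_valuedIn (oddExt_mem_tens (homog_pow B 1) _ (by rwa [pow_one]))
  have hdh : ∀ f, d (hL.op (oddExt B C.h) (d f)) = d f := by
    intro f
    ext m
    change oddExt B X.d (oddExt B C.h (oddExt B X.d (f.1 m))) = oddExt B X.d (f.1 m)
    rw [oddExt_oddExt, lTensor_oddExt]
    exact congrArg (fun T => oddExt B T (f.1 m)) (LinearMap.ext fun a => C.dhd X.d_sq a)
  have htw : ∀ f, tw f = D f + hL.op (actOp X γ) f := fun f => rfl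
  have hone : one ∈ orderGE _ 0 := constSeries_orderGE _
  have hhO : ∀ {f N}, f ∈ orderGE _ N → hL.op (oddExt B C.h) f ∈ orderGE _ N :=
    op_orderGE hL _
  have hφone2 : φ one ∈ orderGE _ (-1) := by
    rw [hφone]; exact sh_orderGE hL _ (by decide) (constSeries_orderGE _)
  have hφone3 : (φ one).1 (-1) = F := by
    rw [hφone]; simp [constSeries]
  have hhK := @hoddK C.h
  have hdK : ∀ {j f}, f ∈ K j → d f ∈ K j := @hoddK X.d
  have hdval : ∀ f n, (d f).1 n = oddExt B X.d (f.1 n) := fun f n => rfl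
  clear_value d D e tw φ one
  generalize hL.op (oddExt B C.h) = h at *
  generalize hL.op (actOp X γ) = a at *
  -- `1` is deformed to a flat series one order at a time: the error `w` is exact to lowest order,
  -- since `w` is the lowest order term of `D (e v)`, and its primitive `u` has no poles
  have hflat : ∀ j, 1 ≤ j → j ≤ n → ∃ v, v ∈ orderGE _ 0 ∧ v - one ∈ K 1 ∧ tw v ∈ K j := by
    intro j hj
    induction j, hj using Nat.le_induction with
    | base =>
      intro _
      refine ⟨one, hone, by rw [sub_self]; exact Submodule.zero_mem _, htw1⟩
    | succ j hj ih =>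
      intro hjn
      obtain ⟨v, hv0, hv1, hv⟩ := ih (by lia)
      set w := tw v with hw
      have hφv : φ v ∈ K (j + 1) := by
        have h1 := Submodule.add_mem _ (hKmono (by lia) (by lia) (hφK _ hv1))
          (hKmono hjn (by lia) hφone')
        rwa [map_sub, sub_add_cancel] at h1
      have h1 : D (e v) - w ∈ K (j + 1) := by
        rw [hexp, map_add]
        have h2 := Submodule.add_mem _ (heK hv)
          (Submodule.add_mem _ (hKmono (by lia) (by lia) (heK hφv)) hφv)
        rw [sub_add_cancel] at h2
        convert h2 using 1
        abel
      have h2 : d (Ψ (e v)) - Ψ w ∈ K (j + 1) := by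
        rw [← hΨD, ← map_sub]; exact hΨK h1
      let u := Φ (h (Ψ w))
      have hDu : D u - w ∈ K (j + 1) := by
        have h3 : D u - w = Φ (d (h (Ψ w)) - Ψ w) := by
          rw [map_sub, hΦΨ', ← hDΦ]
        have h4 : d (h (Ψ w)) - Ψ w = (d (Ψ (e v)) - Ψ w) -
            d (h (d (Ψ (e v)) - Ψ w)) := by
          rw [map_sub, map_sub, hdh]; abel
        rw [h3, h4]
        exact hΦK (Submodule.sub_mem _ h2 (hdK (hhK h2)))
      have huK : u ∈ K j := hΦK (hhK (hΨK hv))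
      refine ⟨v - u, Submodule.sub_mem _ hv0 (hord Φ hΦ1 (hhO
        (hord Ψ hΨ1 (htwO hv0)))), ?_, ?_⟩
      · have := Submodule.sub_mem _ hv1 (hKmono hj le_rfl huK)
        convert this using 1
        abel
      · have h3 : tw (v - u) = -(D u - w) - a u := by
          rw [map_sub, ← hw]
          rw [htw]
          abel
        rw [h3]
        exact Submodule.sub_mem _ (Submodule.neg_mem _ hDu) (hactK huK)
  obtain ⟨v, hv0, hv1, hv⟩ := hflat n hn le_rfl
  have h1 : D (e v) - tw v - φ one ∈ K (n + 1) := by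
    have hφv : φ v ∈ K n := by
      have h1 := Submodule.add_mem _ (hKmono (by lia) (by lia) (hφK _ hv1)) hφone'
      rwa [map_sub, sub_add_cancel] at h1
    have h2 := Submodule.add_mem _ (heK (Submodule.add_mem _ hv hφv)) (hφK _ hv1)
    rw [← hexp, map_sub φ] at h2
    convert h2 using 1
    abel
  -- the coefficient at `ħ⁻¹` of `Ψ (D (e v)) = d (Ψ (e v))` is the curvature to lowest order
  have h2 := hΨK h1 (-1)
  rw [map_sub, map_sub, hΨD] at h2
  have h3 : (Ψ (tw v)).1 (-1) = 0 := hord Ψ hΨ1 (htwO hv0) (-1) (by decide)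
  have h4 : (Ψ (φ one)).1 (-1) = F := by
    have h6 := hΨ1 _ _ hφone2 (-1) (by decide)
    rw [Submodule.coe_sub, Pi.sub_apply, hφone3] at h6
    exact sub_eq_zero.1 h6
  rw [Submodule.coe_sub, Submodule.coe_sub, Pi.sub_apply, Pi.sub_apply, h3, h4, sub_zero,
    hdval] at h2
  refine ⟨(Ψ (e v)).1 (-1), ?_⟩
  have := Submodule.neg_mem _ h2
  rwa [neg_sub] at this

end Obstruction

/-! ### The mini-versal family -/

section Family

variable {k : Type u} [Field k] [CharZero k]
variable {A : Type v} [Ring A] [Algebra k A] {𝒜 : ZMod 2 → Submodule k A} [GradedAlgebra 𝒜]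
  (X : DGBV 𝒜) {B : ArtinSuperalgebra k}

/-- An element of `m_B ⊗ V` lying in every step of the `m_B`-adic filtration vanishes. -/
theorem eq_zero_of_pow {V : Type v} [AddCommGroup V] [Module k V] {F : B.carrier ⊗[k] V}
    (h1 : F ∈ tens B.maxIdeal V)
    (h : ∀ n, 1 ≤ n → F ∈ tens (B.maxIdeal ^ n) V → F ∈ tens (B.maxIdeal ^ (n + 1)) V) : F = 0 := by
  have h2 : ∀ n, F ∈ tens (B.maxIdeal ^ (n + 1)) V := by
    intro n
    induction n with
    | zero => simpa using h1
    | succ n ih => exact h _ (by lia) ih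
  obtain ⟨N, hN⟩ := B.nilpotent
  have h3 := h2 N
  rw [pow_succ, show B.maxIdeal ^ N = ⊥ from hN, Submodule.bot_mul, tens_bot] at h3
  simpa using h3

variable {V : Type v} [AddCommGroup V] [Module k V] {𝒱 : ZMod 2 → Submodule k V}
  (C : Contraction 𝒱 𝒜 X.d)

/-- The operator `γ ↦ s x - ½ h [γ • γ]` whose fixed point is the value at `x` of the mini-versal
family. -/
def kuranishiStep (x : B.carrier ⊗[k] V) (γ : B.carrier ⊗[k] A) : B.carrier ⊗[k] A :=
  C.s.lTensor B.carrier x - oddExt B C.h ((2 : k)⁻¹ • oddExt₂ B 𝒜 X.br γ γ)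

/-- The `n`-th approximation to the value at `x` of the mini-versal family. -/
def kuranishi (x : B.carrier ⊗[k] V) (n : ℕ) : B.carrier ⊗[k] A :=
  (kuranishiStep X C x)^[n] 0

theorem kuranishi_succ (x : B.carrier ⊗[k] V) (n : ℕ) :
    kuranishi X C x (n + 1) = kuranishiStep X C x (kuranishi X C x n) :=
  Function.iterate_succ_apply' _ _ _

theorem baseMap_lTensor {W : Type v} [AddCommGroup W] [Module k W] {B B' : ArtinSuperalgebra k}
    (f : B.Hom B') (T : V →ₗ[k] W) (x : B.carrier ⊗[k] V) :
    baseMap W f (T.lTensor B.carrier x) = T.lTensor B'.carrier (baseMap V f x) := by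
  induction x using TensorProduct.induction_on with
  | zero => simp
  | tmul β x => simp [baseMap]
  | add a b ha hb => simp only [map_add, ha, hb]

theorem baseMap_kuranishi {B' : ArtinSuperalgebra k} (f : B.Hom B') (x : B.carrier ⊗[k] V)
    (n : ℕ) : baseMap A f (kuranishi X C x n) = kuranishi X C (baseMap V f x) n := by
  induction n with
  | zero => exact map_zero _
  | succ n ih =>
    rw [kuranishi_succ, kuranishi_succ, kuranishiStep, kuranishiStep, map_sub, baseMap_lTensor,
      baseMap_oddExt, map_smul, baseMap_oddExt₂, ih]

theorem kuranishi_mem {x : B.carrier ⊗[k] V} (hx : x ∈ pts 𝒱 B 0) (n : ℕ) :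
    kuranishi X C x n ∈ pts 𝒜 B 0 := by
  induction n with
  | zero => exact Submodule.zero_mem _
  | succ n ih =>
    rw [kuranishi_succ, kuranishiStep]
    refine Submodule.sub_mem _ (lTensor_mem_gpts C.s C.s_even hx) ?_
    refine oddExt_mem_gpts (i := 1) C.h (by decide) C.h_odd (Submodule.smul_mem _ _ ?_)
    refine gpts_of_tens (J := ⊤) (homog_maxIdeal B) ?_ ?_
    · exact oddExt₂_mem_tens 𝒜 X.br (homog_maxIdeal B)
        (Submodule.mul_le.2 fun a ha b _ => maxIdeal_mul_mem B ha) (gpts_le_tens ih)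
        (gpts_le_tens ih)
    · exact oddExt₂_mem_gpts 𝒜 X.br X.br_mem (by decide) (pts_le_even B 0 ih) (pts_le_even B 0 ih)

theorem br_maxIdeal_mem {n : ℕ} {γ γ' : B.carrier ⊗[k] A} (hγ : γ ∈ tens B.maxIdeal A)
    (hγ' : γ' ∈ tens (B.maxIdeal ^ n) A) :
    oddExt₂ B 𝒜 X.br γ γ' ∈ tens (B.maxIdeal ^ (n + 1)) A :=
  oddExt₂_mem_tens 𝒜 X.br (homog_pow B n) (by rw [pow_succ' B.maxIdeal n]) hγ hγ'

theorem br_maxIdeal_mem' {n : ℕ} {γ γ' : B.carrier ⊗[k] A} (hγ : γ ∈ tens (B.maxIdeal ^ n) A)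
    (hγ' : γ' ∈ tens B.maxIdeal A) :
    oddExt₂ B 𝒜 X.br γ γ' ∈ tens (B.maxIdeal ^ (n + 1)) A :=
  oddExt₂_mem_tens 𝒜 X.br (homog_maxIdeal B) (by rw [pow_succ B.maxIdeal n]) hγ hγ'

theorem kuranishi_sub_mem {x : B.carrier ⊗[k] V} (hx : x ∈ pts 𝒱 B 0) (n : ℕ) :
    kuranishi X C x (n + 1) - kuranishi X C x n ∈ tens (B.maxIdeal ^ (n + 1)) A := by
  have hm := fun n => gpts_le_tens (kuranishi_mem X C hx n)
  induction n with
  | zero =>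
    rw [zero_add, pow_one]
    exact Submodule.sub_mem _ (hm 1) (hm 0)
  | succ n ih =>
    rw [kuranishi_succ X C x (n + 1)]
    nth_rewrite 2 [kuranishi_succ X C x n]
    rw [kuranishiStep, kuranishiStep, sub_sub_sub_cancel_left, ← map_sub, ← smul_sub]
    refine oddExt_mem_tens (homog_pow B _) _ (Submodule.smul_mem _ _ ?_)
    have h : ∀ a b : B.carrier ⊗[k] A, oddExt₂ B 𝒜 X.br a a - oddExt₂ B 𝒜 X.br b b =
        -(oddExt₂ B 𝒜 X.br (b - a) a + oddExt₂ B 𝒜 X.br b (b - a)) := by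
      intro a b
      simp only [map_sub, LinearMap.sub_apply]
      abel
    rw [h]
    exact Submodule.neg_mem _ (Submodule.add_mem _ (br_maxIdeal_mem' X ih (hm n))
      (br_maxIdeal_mem X (hm (n + 1)) ih))

theorem kuranishi_stable {x : B.carrier ⊗[k] V} (hx : x ∈ pts 𝒱 B 0) {N n : ℕ}
    (hN : B.maxIdeal ^ N = ⊥) (hn : N ≤ n) : kuranishi X C x n = kuranishi X C x N := by
  induction n, hn using Nat.le_induction with
  | base => rfl
  | succ n hn ih =>
    have h := kuranishi_sub_mem X C hx n
    rw [tens_pow_eq_bot hN (hn.trans (Nat.le_succ n))] at h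
    rw [← ih]
    exact sub_eq_zero.1 h

/-- The fixed points of the Kuranishi iteration, as a morphism of formal supermanifolds. -/
def kuranishiMap : FormalMap 𝒱 𝒜 0 where
  app B x := ⟨kuranishi X C x.1 (Classical.choose B.nilpotent), kuranishi_mem X C x.2 _⟩
  natural B B' f x := by
    apply Subtype.ext
    have hB := Classical.choose_spec B.nilpotent
    have hB' := Classical.choose_spec B'.nilpotent
    have h := baseMap_kuranishi X C f x.1
      (max (Classical.choose B.nilpotent) (Classical.choose B'.nilpotent))
    rw [kuranishi_stable X C x.2 hB (le_max_left _ _),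
      kuranishi_stable X C (baseMap_mem_pts 𝒱 f 0 x.2) hB' (le_max_right _ _)] at h
    exact h.symm

theorem kuranishiMap_eq (B : ArtinSuperalgebra k) (x : pts 𝒱 B 0) :
    kuranishiStep X C x.1 ((kuranishiMap X C).app B x).1 = ((kuranishiMap X C).app B x).1 := by
  have hB := Classical.choose_spec B.nilpotent
  exact (kuranishi_succ X C x.1 _).symm.trans (kuranishi_stable X C x.2 hB (Nat.le_succ _))

theorem curv_mem_maxIdeal {γ : B.carrier ⊗[k] A} (hγ : γ ∈ tens B.maxIdeal A) :
    curv 𝒜 X.d X.br B γ ∈ tens B.maxIdeal A :=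
  Submodule.add_mem _ (oddExt_mem_tens (homog_maxIdeal B) _ hγ)
    (Submodule.smul_mem _ _ (oddExt₂_mem_tens 𝒜 X.br (homog_maxIdeal B)
      (Submodule.mul_le.2 fun _ ha _ _ => maxIdeal_mul_mem B ha) hγ hγ))

/-- The fixed points of the Kuranishi iteration solve the Maurer-Cartan equation: obstructions
vanish. -/
theorem curv_kuranishiMap (hex : ∀ a, X.d (X.Δ a) = 0 → ∃ b, X.d b = X.Δ a) (x : pts 𝒱 B 0) :
    curv 𝒜 X.d X.br B ((kuranishiMap X C).app B x).1 = 0 := by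
  have hstep := kuranishiMap_eq X C B x
  have hγ := ((kuranishiMap X C).app B x).2
  set γ := ((kuranishiMap X C).app B x).1 with hγdef
  have hdhd : ∀ y, oddExt B X.d (oddExt B C.h (oddExt B X.d y)) = oddExt B X.d y := by
    intro y
    rw [oddExt_oddExt, lTensor_oddExt]
    exact congrArg (fun T => oddExt B T y) (LinearMap.ext fun a => C.dhd X.d_sq a)
  set β := (2 : k)⁻¹ • oddExt₂ B 𝒜 X.br γ γ with hβ
  have hF : curv 𝒜 X.d X.br B γ = β - oddExt B X.d (oddExt B C.h β) := by
    have h1 : oddExt B X.d γ = -oddExt B X.d (oddExt B C.h β) := by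
      conv_lhs => rw [← hstep, kuranishiStep, map_sub, oddExt_lTensor,
        show X.d ∘ₗ C.s = 0 from LinearMap.ext C.d_s]
      simp [oddExt, hβ]
    rw [curv, h1, ← hβ]; abel
  set F := curv 𝒜 X.d X.br B γ with hFdef
  have hF' : F - oddExt B X.d (oddExt B C.h F) = F := by
    rw [hF]
    simp only [map_sub, hdhd]
    abel
  refine eq_zero_of_pow (curv_mem_maxIdeal X (gpts_le_tens hγ)) fun n hn hFn => ?_
  obtain ⟨r, hr⟩ := exists_curv_sub_mem X C hex hγ hn hFn
  rw [← hFdef] at hr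
  have h2 : F = (F - oddExt B X.d r) - oddExt B X.d (oddExt B C.h (F - oddExt B X.d r)) := by
    rw [map_sub, map_sub, hdhd]
    conv_lhs => rw [← hF']
    abel
  rw [h2]
  exact Submodule.sub_mem _ hr (oddExt_mem_tens (homog_pow B _) _
    (oddExt_mem_tens (homog_pow B _) _ hr))

theorem isMiniVersal_kuranishiMap (hex : ∀ a, X.d (X.Δ a) = 0 → ∃ b, X.d b = X.Δ a)
    (C : Contraction (cohGr 𝒜 X.d) 𝒜 X.d) (hC : ∀ a (ha : X.d a = 0), C.p a = Coh.mk X.d a ha) :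
    IsMiniVersal (cohGr 𝒜 X.d) 𝒜 X.d X.br (FormalMap.zero _ _ 1) (kuranishiMap X C) := by
  refine ⟨fun B η _ x y _ => rfl, fun B η _ x y hxy => ?_, C.s, C.d_s, fun B hB x => ?_, ?_⟩
  · have : y = x := Subtype.ext (by simpa [FormalMap.zero] using hxy)
    rw [this, curv_kuranishiMap X C hex, map_zero, add_zero]
  · have h := kuranishiMap_eq X C B x
    have hγ := gpts_le_tens ((kuranishiMap X C).app B x).2
    have h0 := br_maxIdeal_mem (n := 1) X hγ (by rwa [pow_one])
    rw [show B.maxIdeal ^ (1 + 1) = ⊥ from hB, tens_bot, Submodule.mem_bot] at h0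
    rw [← h, kuranishiStep, h0, smul_zero, map_zero, sub_zero]
  · have hid := C.ofHomotopy_mk_s hC
    exact ⟨fun x y hxy => by simpa [hid] using hxy, fun y => ⟨y, hid y⟩⟩

end Family

/-! ### Superalgebras from an involution -/

section Involution

variable {k : Type u} [Field k]

/-- The eigenspaces of a linear involution, for the eigenvalues `1` and `-1`. -/
def eigen {R : Type*} [AddCommGroup R] [Module k R] (σ : R →ₗ[k] R) (i : ZMod 2) : Submodule k R :=
  LinearMap.ker (σ - (-1 : k) ^ i.val • LinearMap.id)

theorem mem_eigen {R : Type*} [AddCommGroup R] [Module k R] {σ : R →ₗ[k] R} {i : ZMod 2} {x : R} :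
    x ∈ eigen σ i ↔ σ x = (-1 : k) ^ i.val • x := by
  rw [eigen, LinearMap.mem_ker, LinearMap.sub_apply, sub_eq_zero]; rfl

variable [CharZero k]

theorem half_add_half {R : Type*} [AddCommGroup R] [Module k R] (x : R) :
    (2 : k)⁻¹ • x + (2 : k)⁻¹ • x = x := by
  rw [← two_smul k, smul_smul, mul_inv_cancel₀ two_ne_zero, one_smul]

/-- The projections onto the eigenspaces of an involution. -/
def eigenProj {R : Type*} [AddCommGroup R] [Module k R] (σ : R →ₗ[k] R) (hσ : ∀ x, σ (σ x) = x)
    (i : ZMod 2) : R →ₗ[k] eigen σ i :=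
  LinearMap.codRestrict _ ((2 : k)⁻¹ • (LinearMap.id + (-1 : k) ^ i.val • σ)) fun x => by
    rw [mem_eigen]
    rcases zmod2_cases i with rfl | rfl <;>
    simp [zmod2_val_one, hσ, add_comm]

theorem eigenProj_coe {R : Type*} [AddCommGroup R] [Module k R] (σ : R →ₗ[k] R)
    (hσ : ∀ x, σ (σ x) = x) (i : ZMod 2) (x : R) :
    (eigenProj σ hσ i x : R) = (2 : k)⁻¹ • (x + (-1 : k) ^ i.val • σ x) := rfl

/-- The decomposition of a vector space into the eigenspaces of an involution. -/
@[reducible]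
def eigenDecomposition {R : Type*} [AddCommGroup R] [Module k R] (σ : R →ₗ[k] R)
    (hσ : ∀ x, σ (σ x) = x) : DirectSum.Decomposition (eigen σ) :=
  DirectSum.Decomposition.ofLinearMap _
    (DirectSum.lof k (ZMod 2) (fun i => eigen σ i) 0 ∘ₗ eigenProj σ hσ 0 +
      DirectSum.lof k (ZMod 2) (fun i => eigen σ i) 1 ∘ₗ eigenProj σ hσ 1)
    (by
      ext x
      simp only [LinearMap.comp_apply, LinearMap.add_apply, map_add,
        DirectSum.coeLinearMap_lof, eigenProj_coe, LinearMap.id_apply]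
      simp only [ZMod.val_zero, pow_zero, one_smul, zmod2_val_one, pow_one, neg_smul, smul_add,
        smul_neg]
      nth_rewrite 5 [← half_add_half (k := k) x]
      abel)
    (by
      ext i x : 2
      have hx := mem_eigen.1 x.2
      have h : ∀ j, eigenProj σ hσ j (x : R) = if h : i = j then h ▸ x else 0 := by
        intro j
        split_ifs with h
        · subst h
          apply Subtype.ext
          rw [eigenProj_coe, hx, smul_smul, ← pow_add, ← two_mul, pow_mul, neg_one_sq, one_pow,
            one_smul, smul_add, half_add_half]
        · apply Subtype.ext
          have : (-1 : k) ^ j.val * (-1) ^ i.val = -1 := by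
            rcases zmod2_cases i with rfl | rfl <;> rcases zmod2_cases j with rfl | rfl <;>
            simp_all [zmod2_val_one]
          rw [eigenProj_coe, hx, smul_smul, this]
          simp
      simp only [LinearMap.comp_apply, LinearMap.add_apply, DirectSum.coeLinearMap_lof, h,
        LinearMap.id_apply]
      rcases zmod2_cases i with rfl | rfl <;> simp)

theorem neg_one_pow_add (i j : ZMod 2) :
    (-1 : k) ^ (i + j).val = (-1) ^ i.val * (-1) ^ j.val := by
  rcases zmod2_cases i with rfl | rfl <;> rcases zmod2_cases j with rfl | rfl <;>
  simp [zmod2_val_one, show (1 + 1 : ZMod 2) = 0 from rfl]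

/-- The grading of an algebra by the eigenspaces of an involution. -/
@[reducible]
def eigenGraded {R : Type*} [Ring R] [Algebra k R] (σ : R →ₐ[k] R) (hσ : ∀ x, σ (σ x) = x) :
    GradedAlgebra (eigen σ.toLinearMap) :=
  { eigenDecomposition σ.toLinearMap hσ with
    one_mem := mem_eigen.2 (by simp)
    mul_mem := fun i j a b ha hb => mem_eigen.2 (by
      have ha' : σ a = _ := mem_eigen.1 ha
      have hb' : σ b = _ := mem_eigen.1 hb
      rw [AlgHom.toLinearMap_apply, map_mul, ha', hb', neg_one_pow_add, smul_mul_smul_comm]) }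

/-- The Artin superalgebra defined by an algebra with an involution. -/
def ArtinSuperalgebra.ofInvolution (R : Type u) [Ring R] [Algebra k R] [FiniteDimensional k R]
    (σ : R →ₐ[k] R) (hσ : ∀ x, σ (σ x) = x)
    (hcomm : ∀ (i j : ZMod 2) (a b : R), σ a = (-1 : k) ^ i.val • a → σ b = (-1 : k) ^ j.val • b →
      a * b = (-1 : k) ^ (i.val * j.val) • (b * a))
    (aug : R →ₐ[k] k) (hnil : ∃ n : ℕ, (LinearMap.ker aug.toLinearMap) ^ n = ⊥) :
    ArtinSuperalgebra k :=
  letI := eigenGraded σ hσ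
  { carrier := R
    gr := eigen σ.toLinearMap
    supercomm := fun i j a ha b hb => hcomm i j a b (mem_eigen.1 ha) (mem_eigen.1 hb)
    aug := aug
    nilpotent := hnil }

theorem par_eigen {R : Type*} [AddCommGroup R] [Module k R] (σ : R →ₗ[k] R)
    [DirectSum.Decomposition (eigen σ)] (x : R) : par (eigen σ) x = σ x := by
  conv_rhs => rw [← proj_add_proj (eigen σ) x, map_add, mem_eigen.1 (proj_mem (eigen σ) 0 x),
    mem_eigen.1 (proj_mem (eigen σ) 1 x)]
  simp [par, zmod2_val_one, sub_eq_add_neg]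

theorem par_ofInvolution (R : Type u) [Ring R] [Algebra k R] [FiniteDimensional k R]
    (σ : R →ₐ[k] R) (hσ : ∀ x, σ (σ x) = x) (hcomm aug hnil) (x : R) :
    par (ArtinSuperalgebra.ofInvolution R σ hσ hcomm aug hnil).gr x = σ x :=
  letI := (eigenGraded σ hσ).toDecomposition
  par_eigen σ.toLinearMap x

/-- The parity involution of a superalgebra as an algebra homomorphism. -/
def parHom {R : Type*} [Ring R] [Algebra k R] (𝒢 : ZMod 2 → Submodule k R) [GradedAlgebra 𝒢] :
    R →ₐ[k] R :=
  AlgHom.ofLinearMap (par 𝒢) (by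
      rw [par_of_mem 𝒢 (SetLike.GradedOne.one_mem (A := 𝒢))]; simp)
    (fun a b => by
      rw [← proj_add_proj 𝒢 a, ← proj_add_proj 𝒢 b]
      have h : ∀ (i j : ZMod 2) (a b : R), a ∈ 𝒢 i → b ∈ 𝒢 j →
          par 𝒢 (a * b) = par 𝒢 a * par 𝒢 b := by
        intro i j a b ha hb
        rw [par_of_mem 𝒢 (SetLike.mul_mem_graded ha hb), par_of_mem 𝒢 ha, par_of_mem 𝒢 hb,
          neg_one_pow_add, smul_mul_smul_comm]
      simp only [add_mul, mul_add, map_add, h _ _ _ _ (proj_mem 𝒢 _ _) (proj_mem 𝒢 _ _)])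

theorem mem_gr_iff {V : Type*} [AddCommGroup V] [Module k V] (𝒱 : ZMod 2 → Submodule k V)
    [DirectSum.Decomposition 𝒱] {i : ZMod 2} {x : V} :
    x ∈ 𝒱 i ↔ par 𝒱 x = (-1 : k) ^ i.val • x := ⟨par_of_mem 𝒱, mem_of_par 𝒱⟩

end Involution

/-! ### An odd variable -/

section Eta

variable {k : Type u} [Field k] [CharZero k] (B : ArtinSuperalgebra k)

variable {B} in
theorem par_mul (a b : B.carrier) : par B.gr (a * b) = par B.gr a * par B.gr b :=
  map_mul (parHom B.gr) a b

variable {B} in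
theorem par_one : par B.gr 1 = 1 := map_one (parHom B.gr)

/-- The underlying space of `B[η]`, for an odd variable `η`: the pair `(a, b)` is `a + η b`. -/
def EtaAlg : Type u := B.carrier × B.carrier

instance : AddCommGroup (EtaAlg B) := inferInstanceAs (AddCommGroup (B.carrier × B.carrier))
instance : Module k (EtaAlg B) := inferInstanceAs (Module k (B.carrier × B.carrier))
instance : FiniteDimensional k (EtaAlg B) :=
  inferInstanceAs (FiniteDimensional k (B.carrier × B.carrier))

instance : Ring (EtaAlg B) :=
  { (inferInstance : AddCommGroup (EtaAlg B)) with
    mul := fun x y => (x.1 * y.1, par B.gr x.1 * y.2 + x.2 * y.1)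
    one := (1, 0)
    mul_assoc := fun x y z => Prod.ext (mul_assoc x.1 y.1 z.1) (by
      change par B.gr (x.1 * y.1) * z.2 + (par B.gr x.1 * y.2 + x.2 * y.1) * z.1 =
        par B.gr x.1 * (par B.gr y.1 * z.2 + y.2 * z.1) + x.2 * (y.1 * z.1)
      rw [par_mul]
      noncomm_ring)
    one_mul := fun x => Prod.ext (one_mul x.1) (by
      change par B.gr 1 * x.2 + 0 * x.1 = x.2
      rw [par_one, one_mul, zero_mul, add_zero])
    mul_one := fun x => Prod.ext (mul_one x.1) (by
      change par B.gr x.1 * 0 + x.2 * 1 = x.2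
      rw [mul_zero, mul_one, zero_add])
    zero_mul := fun x => Prod.ext (zero_mul x.1) (by
      change par B.gr 0 * x.2 + 0 * x.1 = 0
      rw [map_zero, zero_mul, zero_mul, add_zero])
    mul_zero := fun x => Prod.ext (mul_zero x.1) (by
      change par B.gr x.1 * 0 + x.2 * 0 = 0
      rw [mul_zero, mul_zero, add_zero])
    left_distrib := fun x y z => Prod.ext (mul_add x.1 y.1 z.1) (by
      change par B.gr x.1 * (y.2 + z.2) + x.2 * (y.1 + z.1) =
        (par B.gr x.1 * y.2 + x.2 * y.1) + (par B.gr x.1 * z.2 + x.2 * z.1)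
      noncomm_ring)
    right_distrib := fun x y z => Prod.ext (add_mul x.1 y.1 z.1) (by
      change par B.gr (x.1 + y.1) * z.2 + (x.2 + y.2) * z.1 =
        (par B.gr x.1 * z.2 + x.2 * z.1) + (par B.gr y.1 * z.2 + y.2 * z.1)
      rw [map_add]
      noncomm_ring) }

instance : Algebra k (EtaAlg B) :=
  Algebra.ofModule
    (fun c x y => Prod.ext (smul_mul_assoc c x.1 y.1) (by
      change par B.gr (c • x.1) * y.2 + (c • x.2) * y.1 = c • (par B.gr x.1 * y.2 + x.2 * y.1)
      rw [map_smul, smul_mul_assoc, smul_mul_assoc, smul_add]))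
    (fun c x y => Prod.ext (mul_smul_comm c x.1 y.1) (by
      change par B.gr x.1 * (c • y.2) + x.2 * (c • y.1) = c • (par B.gr x.1 * y.2 + x.2 * y.1)
      rw [mul_smul_comm, mul_smul_comm, smul_add]))

/-- The parity involution of `B[η]`. -/
def etaInv : EtaAlg B →ₐ[k] EtaAlg B :=
  AlgHom.ofLinearMap
    (LinearMap.prodMap (par B.gr) (-par B.gr) :
      B.carrier × B.carrier →ₗ[k] B.carrier × B.carrier)
    (Prod.ext par_one (by
      change -(par B.gr 0) = 0
      rw [map_zero, neg_zero]))
    (fun x y => Prod.ext (par_mul x.1 y.1) (by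
      change -(par B.gr (par B.gr x.1 * y.2 + x.2 * y.1)) =
        par B.gr (par B.gr x.1) * -(par B.gr y.2) + -(par B.gr x.2) * par B.gr y.1
      rw [map_add, par_mul, par_mul]
      noncomm_ring))

theorem mem_gr_succ {i : ZMod 2} {b : B.carrier} (h : -(par B.gr b) = (-1 : k) ^ i.val • b) :
    b ∈ B.gr (i + 1) := by
  rw [mem_gr_iff B.gr, neg_one_pow_add, neg_eq_iff_eq_neg.1 h]
  simp [zmod2_val_one]

/-- The superalgebra `B[η]` with an odd variable `η` adjoined. -/
def ArtinSuperalgebra.eta : ArtinSuperalgebra k :=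
  ArtinSuperalgebra.ofInvolution (EtaAlg B) (etaInv B)
    (fun x => Prod.ext (par_par B.gr x.1) (by
      change -(par B.gr (-(par B.gr x.2))) = x.2
      rw [map_neg, neg_neg, par_par]))
    (fun i j x y hx hy => by
      have hx1 : par B.gr x.1 = (-1 : k) ^ i.val • x.1 := congrArg Prod.fst hx
      have hx2 : x.2 ∈ B.gr (i + 1) := mem_gr_succ B (congrArg Prod.snd hx)
      have hy1 : par B.gr y.1 = (-1 : k) ^ j.val • y.1 := congrArg Prod.fst hy
      have hy2 : y.2 ∈ B.gr (j + 1) := mem_gr_succ B (congrArg Prod.snd hy)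
      have hx1' := mem_of_par B.gr hx1
      have hy1' := mem_of_par B.gr hy1
      refine Prod.ext (B.supercomm i j _ hx1' _ hy1') ?_
      change par B.gr x.1 * y.2 + x.2 * y.1 =
        (-1 : k) ^ (i.val * j.val) • (par B.gr y.1 * x.2 + y.2 * x.1)
      rw [hx1, hy1, B.supercomm _ _ _ hx2 _ hy1', smul_mul_assoc, smul_mul_assoc,
        B.supercomm _ _ _ hx1' _ hy2, smul_add, smul_smul, smul_smul, add_comm]
      congr 2 <;>
      rcases zmod2_cases i with rfl | rfl <;> rcases zmod2_cases j with rfl | rfl <;>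
      simp [zmod2_val_one, show (1 + 1 : ZMod 2) = 0 from rfl])
    (B.aug.comp (AlgHom.ofLinearMap
      (LinearMap.fst k B.carrier B.carrier : EtaAlg B →ₗ[k] B.carrier) rfl fun _ _ => rfl))
    (by
      obtain ⟨N, hN⟩ := B.nilpotent
      set f : EtaAlg B →ₐ[k] B.carrier := AlgHom.ofLinearMap
        (LinearMap.fst k B.carrier B.carrier : EtaAlg B →ₗ[k] B.carrier) rfl fun _ _ => rfl with hf
      set I := LinearMap.ker (B.aug.comp f).toLinearMap with hI
      have h0 : ∀ x ∈ I ^ N, x.1 = 0 := by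
        intro x hx
        have h1 : (I ^ N).map f.toLinearMap ≤ B.maxIdeal ^ N := by
          rw [Submodule.map_pow]
          refine pow_le_pow_left' ?_ N
          rintro _ ⟨y, hy, rfl⟩
          exact hy
        have h2 := h1 ⟨x, hx, rfl⟩
        rw [show B.maxIdeal ^ N = ⊥ from hN] at h2
        exact h2
      refine ⟨N + N, ?_⟩
      rw [pow_add, eq_bot_iff, Submodule.mul_le]
      intro x hx y hy
      rw [Submodule.mem_bot]
      refine Prod.ext ?_ ?_
      · change x.1 * y.1 = 0
        rw [h0 x hx, zero_mul]
      · change par B.gr x.1 * y.2 + x.2 * y.1 = 0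
        rw [h0 x hx, h0 y hy, map_zero, zero_mul, mul_zero, add_zero])

variable {B} in
/-- The element `a + η b` of `B[η]`. -/
def etaMk (a b : B.carrier) : B.eta.carrier := ((a, b) : B.carrier × B.carrier)

/-- The coefficient of `1` of an element of `B[η]`. -/
def etaFst : B.eta.carrier →ₗ[k] B.carrier := LinearMap.fst k B.carrier B.carrier

/-- The coefficient of `η` of an element of `B[η]`. -/
def etaSnd : B.eta.carrier →ₗ[k] B.carrier := LinearMap.snd k B.carrier B.carrier

/-- The map `b ↦ η b`. -/
def etaInr : B.carrier →ₗ[k] B.eta.carrier := LinearMap.inr k B.carrier B.carrier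

variable {B}

theorem etaMk_eta (x : B.eta.carrier) : etaMk (etaFst B x) (etaSnd B x) = x := rfl

theorem etaMk_add (a b a' b' : B.carrier) :
    etaMk a b + etaMk a' b' = etaMk (a + a') (b + b') := rfl

theorem etaMk_mul (a b a' b' : B.carrier) :
    etaMk a b * etaMk a' b' = etaMk (a * a') (par B.gr a * b' + b * a') := rfl

theorem etaFst_etaMk (a b : B.carrier) : etaFst B (etaMk a b) = a := rfl

theorem etaSnd_etaMk (a b : B.carrier) : etaSnd B (etaMk a b) = b := rfl

theorem etaInr_apply (b : B.carrier) : etaInr B b = etaMk 0 b := rfl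

theorem etaMk_mem_gr {i : ZMod 2} {a b : B.carrier} :
    etaMk a b ∈ B.eta.gr i ↔ a ∈ B.gr i ∧ b ∈ B.gr (i + 1) := by
  refine Iff.trans (mem_eigen (σ := (etaInv B).toLinearMap) (i := i)) ⟨fun h => ?_, fun h => ?_⟩
  · exact ⟨mem_of_par B.gr (congrArg Prod.fst h), mem_gr_succ B (congrArg Prod.snd h)⟩
  · refine Prod.ext (par_of_mem B.gr h.1) ?_
    change -(par B.gr b) = (-1 : k) ^ i.val • b
    rw [par_of_mem B.gr h.2, neg_one_pow_add]
    simp [zmod2_val_one]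

theorem par_etaMk (a b : B.carrier) :
    par B.eta.gr (etaMk a b) = etaMk (par B.gr a) (-par B.gr b) :=
  par_ofInvolution _ _ _ _ _ _ _

variable (B)

/-- The inclusion of `B` in `B[η]`. -/
def etaInl : B.Hom B.eta where
  toAlgHom := AlgHom.ofLinearMap (LinearMap.inl k B.carrier B.carrier) rfl (fun a b => by
    change etaMk (a * b) 0 = etaMk a 0 * etaMk b 0
    rw [etaMk_mul, mul_zero, zero_mul, add_zero])
  map_gr i b hb := etaMk_mem_gr.2 ⟨hb, Submodule.zero_mem _⟩
  map_aug _ := rfl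

/-- The homomorphism `b ↦ b + η D b` defined by an odd derivation `D`. -/
def etaDer (D : B.carrier →ₗ[k] B.carrier) (hD : ∀ i, ∀ b ∈ B.gr i, D b ∈ B.gr (i + 1))
    (hmul : ∀ a b, D (a * b) = D a * b + par B.gr a * D b) : B.Hom B.eta where
  toAlgHom := AlgHom.ofLinearMap (LinearMap.prod LinearMap.id D) (by
      have h := hmul 1 1
      rw [par_one, one_mul, one_mul, mul_one] at h
      change etaMk 1 (D 1) = etaMk 1 0
      rw [left_eq_add.1 h]) (fun a b => by
    change etaMk (a * b) (D (a * b)) = etaMk a (D a) * etaMk b (D b)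
    rw [etaMk_mul, hmul, add_comm])
  map_gr i b hb := etaMk_mem_gr.2 ⟨hb, hD i b hb⟩
  map_aug _ := rfl

end Eta

/-! ### First order extensions of the ground field -/

section Tangent

variable {k : Type u} [Field k] [CharZero k]

/-- The underlying space of the extension of `k` by a square zero ideal `V`. -/
def TangentAlg (k : Type u) [Field k] (V : Type u) [AddCommGroup V] [Module k V] : Type u := k × V

variable {V : Type u} [AddCommGroup V] [Module k V]

instance : AddCommGroup (TangentAlg k V) := inferInstanceAs (AddCommGroup (k × V))
instance : Module k (TangentAlg k V) := inferInstanceAs (Module k (k × V))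
instance [FiniteDimensional k V] : FiniteDimensional k (TangentAlg k V) :=
  inferInstanceAs (FiniteDimensional k (k × V))

instance : Ring (TangentAlg k V) :=
  { (inferInstance : AddCommGroup (TangentAlg k V)) with
    mul := fun x y => (x.1 * y.1, x.1 • y.2 + y.1 • x.2)
    one := (1, 0)
    mul_assoc := fun x y z => Prod.ext (mul_assoc x.1 y.1 z.1) (by
      change (x.1 * y.1) • z.2 + z.1 • (x.1 • y.2 + y.1 • x.2) =
        x.1 • (y.1 • z.2 + z.1 • y.2) + (y.1 * z.1) • x.2
      module)
    one_mul := fun x => Prod.ext (one_mul x.1) (by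
      change (1 : k) • x.2 + x.1 • (0 : V) = x.2
      module)
    mul_one := fun x => Prod.ext (mul_one x.1) (by
      change x.1 • (0 : V) + (1 : k) • x.2 = x.2
      module)
    zero_mul := fun x => Prod.ext (zero_mul x.1) (by
      change (0 : k) • x.2 + x.1 • (0 : V) = 0
      module)
    mul_zero := fun x => Prod.ext (mul_zero x.1) (by
      change x.1 • (0 : V) + (0 : k) • x.2 = 0
      module)
    left_distrib := fun x y z => Prod.ext (mul_add x.1 y.1 z.1) (by
      change x.1 • (y.2 + z.2) + (y.1 + z.1) • x.2 =
        (x.1 • y.2 + y.1 • x.2) + (x.1 • z.2 + z.1 • x.2)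
      module)
    right_distrib := fun x y z => Prod.ext (add_mul x.1 y.1 z.1) (by
      change (x.1 + y.1) • z.2 + z.1 • (x.2 + y.2) =
        (x.1 • z.2 + z.1 • x.2) + (y.1 • z.2 + z.1 • y.2)
      module) }

instance : Algebra k (TangentAlg k V) :=
  Algebra.ofModule
    (fun c x y => Prod.ext (smul_mul_assoc c x.1 y.1) (by
      change (c * x.1) • y.2 + y.1 • (c • x.2) = c • (x.1 • y.2 + y.1 • x.2)
      module))
    (fun c x y => Prod.ext (mul_smul_comm c x.1 y.1) (by
      change x.1 • (c • y.2) + (c * y.1) • x.2 = c • (x.1 • y.2 + y.1 • x.2)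
      module))

/-- The extension of the ground field by a square zero ideal `V`, with involution `τ`. -/
def ArtinSuperalgebra.tangent [FiniteDimensional k V] (τ : V →ₗ[k] V) (hτ : ∀ x, τ (τ x) = x) :
    ArtinSuperalgebra k :=
  ArtinSuperalgebra.ofInvolution (TangentAlg k V)
    (AlgHom.ofLinearMap (LinearMap.prodMap LinearMap.id τ : k × V →ₗ[k] k × V)
      (Prod.ext rfl (map_zero τ))
      (fun x y => Prod.ext rfl (by
        change τ (x.1 • y.2 + y.1 • x.2) = x.1 • τ y.2 + y.1 • τ x.2
        rw [map_add, map_smul, map_smul])))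
    (fun x => Prod.ext rfl (hτ x.2))
    (fun i j x y hx hy => by
      have hc : x * y = y * x := Prod.ext (mul_comm x.1 y.1) (add_comm _ _)
      by_cases hij : i = 1 ∧ j = 1
      · obtain ⟨rfl, rfl⟩ := hij
        have h : ∀ z : k, z = (-1 : k) ^ (1 : ZMod 2).val • z → z = 0 := by
          intro z hz
          simpa [zmod2_val_one, self_eq_neg] using hz
        have hx1 : x.1 = 0 := h _ (congrArg Prod.fst hx)
        have hy1 : y.1 = 0 := h _ (congrArg Prod.fst hy)
        have hz : y * x = 0 := Prod.ext (by change y.1 * x.1 = 0; rw [hx1, mul_zero]) (by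
          change y.1 • x.2 + x.1 • y.2 = 0
          rw [hx1, hy1, zero_smul, zero_smul, add_zero])
        rw [hc, hz, smul_zero]
      · have h : i.val * j.val = 0 := by
          rcases zmod2_cases i with rfl | rfl <;> rcases zmod2_cases j with rfl | rfl <;>
          simp_all
        rw [h, pow_zero, one_smul, hc])
    (AlgHom.ofLinearMap (LinearMap.fst k k V : TangentAlg k V →ₗ[k] k) rfl fun _ _ => rfl)
    ⟨2, by
      rw [pow_two, eq_bot_iff, Submodule.mul_le]
      intro x hx y hy
      have hx1 : x.1 = 0 := hx
      have hy1 : y.1 = 0 := hy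
      exact Prod.ext (by change x.1 * y.1 = 0; rw [hx1, zero_mul]) (by
        change x.1 • y.2 + y.1 • x.2 = 0
        rw [hx1, hy1, zero_smul, zero_smul, add_zero])⟩

theorem tangent_sq [FiniteDimensional k V] (τ : V →ₗ[k] V) (hτ : ∀ x, τ (τ x) = x) :
    (ArtinSuperalgebra.tangent τ hτ).maxIdeal ^ 2 = ⊥ := by
  rw [pow_two, eq_bot_iff, Submodule.mul_le]
  intro x hx y hy
  have hx1 : Prod.fst (α := k) (β := V) x = 0 := hx
  have hy1 : Prod.fst (α := k) (β := V) y = 0 := hy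
  exact Prod.ext (by
      change Prod.fst (α := k) (β := V) x * Prod.fst (α := k) (β := V) y = 0
      rw [hx1, zero_mul]) (by
    change Prod.fst (α := k) (β := V) x • Prod.snd (α := k) (β := V) y +
      Prod.fst (α := k) (β := V) y • Prod.snd (α := k) (β := V) x = 0
    rw [hx1, hy1, zero_smul, zero_smul, add_zero])

variable (B : ArtinSuperalgebra k)

/-- The cotangent space `B / m²`, which contains `m / m²`. -/
abbrev Cotangent : Type u := B.carrier ⧸ B.maxIdeal ^ 2

/-- The parity involution of `B / m²`. -/
def cotangentInv : Cotangent B →ₗ[k] Cotangent B :=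
  Submodule.mapQ _ _ (par B.gr) fun _ hb => (homog_pow B 2).par_mem hb

theorem cotangentInv_mk (b : B.carrier) :
    cotangentInv B ((B.maxIdeal ^ 2).mkQ b) = (B.maxIdeal ^ 2).mkQ (par B.gr b) := rfl

theorem cotangentInv_inv (x : Cotangent B) : cotangentInv B (cotangentInv B x) = x := by
  obtain ⟨b, rfl⟩ := (B.maxIdeal ^ 2).mkQ_surjective x
  rw [cotangentInv_mk, cotangentInv_mk, par_par]

/-- The homomorphism from `B` to the extension of the ground field by `B / m²`. -/
def toTangent : B.Hom (ArtinSuperalgebra.tangent (cotangentInv B) (cotangentInv_inv B)) where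
  toAlgHom := AlgHom.ofLinearMap
    (LinearMap.prod B.aug.toLinearMap
      ((B.maxIdeal ^ 2).mkQ ∘ₗ (LinearMap.id - (Algebra.linearMap k B.carrier) ∘ₗ
        B.aug.toLinearMap)) : B.carrier →ₗ[k] k × Cotangent B)
    (Prod.ext (map_one B.aug) (by
      change (B.maxIdeal ^ 2).mkQ (1 - algebraMap k B.carrier (B.aug 1)) = 0
      rw [map_one, map_one, sub_self, map_zero]))
    (fun a b => Prod.ext (map_mul B.aug a b) (by
      change (B.maxIdeal ^ 2).mkQ (a * b - algebraMap k B.carrier (B.aug (a * b))) =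
        B.aug a • (B.maxIdeal ^ 2).mkQ (b - algebraMap k B.carrier (B.aug b)) +
        B.aug b • (B.maxIdeal ^ 2).mkQ (a - algebraMap k B.carrier (B.aug a))
      rw [← map_smul, ← map_smul, ← map_add, ← sub_eq_zero, ← map_sub, Submodule.mkQ_apply,
        Submodule.Quotient.mk_eq_zero]
      have h : ∀ a : B.carrier, a - algebraMap k B.carrier (B.aug a) ∈ B.maxIdeal := by
        intro a
        change B.aug (a - algebraMap k B.carrier (B.aug a)) = 0
        rw [map_sub, AlgHom.commutes, Algebra.algebraMap_self_apply, sub_self]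
      rw [pow_two]
      convert Submodule.mul_mem_mul (h a) (h b) using 1
      rw [map_mul, map_mul, Algebra.smul_def, Algebra.smul_def, sub_mul, mul_sub, mul_sub, mul_sub,
        Algebra.commutes (B.aug b) a,
        Algebra.commutes (B.aug b) (algebraMap k B.carrier (B.aug a))]
      abel))
  map_gr i b hb := (mem_eigen (i := i)).2 (Prod.ext (by
      change B.aug b = (-1 : k) ^ i.val * B.aug b
      rcases zmod2_cases i with rfl | rfl
      · simp
      · rw [aug_odd B hb, mul_zero]) (by
    change cotangentInv B ((B.maxIdeal ^ 2).mkQ (b - algebraMap k B.carrier (B.aug b))) =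
      (-1 : k) ^ i.val • (B.maxIdeal ^ 2).mkQ (b - algebraMap k B.carrier (B.aug b))
    rw [cotangentInv_mk, ← map_smul]
    congr 1
    rw [map_sub, par_of_mem B.gr hb, Algebra.algebraMap_eq_smul_one, map_smul, par_one]
    rcases zmod2_cases i with rfl | rfl
    · simp
    · rw [aug_odd B hb]; simp))
  map_aug _ := rfl

/-- The projection of the extension of the ground field by `B / m²` onto `B / m²`. -/
def tangentSnd : (ArtinSuperalgebra.tangent (cotangentInv B) (cotangentInv_inv B)).carrier →ₗ[k]
    Cotangent B := LinearMap.snd k k (Cotangent B)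

theorem tangentSnd_toTangent {b : B.carrier} (hb : b ∈ B.maxIdeal) :
    tangentSnd B ((toTangent B).toAlgHom b) = (B.maxIdeal ^ 2).mkQ b := by
  change (B.maxIdeal ^ 2).mkQ (b - algebraMap k B.carrier (B.aug b)) = _
  rw [show B.aug b = 0 from hb, map_zero, sub_zero]

end Tangent

/-! ### Superalgebras inside an algebra with involution -/

section Pair

variable {k : Type u} [Field k] [CharZero k]

/-- The Artin superalgebra defined by a stable subalgebra of an algebra with involution. -/
def ArtinSuperalgebra.ofSubalgebra {R : Type u} [Ring R] [Algebra k R]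
    (σ : R →ₐ[k] R) (hσ : ∀ x, σ (σ x) = x)
    (hcomm : ∀ (i j : ZMod 2) (a b : R), σ a = (-1 : k) ^ i.val • a → σ b = (-1 : k) ^ j.val • b →
      a * b = (-1 : k) ^ (i.val * j.val) • (b * a))
    (S : Subalgebra k R) (hS : ∀ x ∈ S, σ x ∈ S) (hfin : FiniteDimensional k S) (aug : R →ₐ[k] k)
    (hnil : ∃ n : ℕ, (LinearMap.ker aug.toLinearMap ⊓ Subalgebra.toSubmodule S) ^ n = ⊥) :
    ArtinSuperalgebra k :=
  ArtinSuperalgebra.ofInvolution S ((σ.comp S.val).codRestrict S fun x => hS x x.2)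
    (fun x => Subtype.ext (hσ x))
    (fun i j a b ha hb => Subtype.ext
      (hcomm i j a b (congrArg Subtype.val ha) (congrArg Subtype.val hb)))
    (aug.comp S.val)
    (by
      obtain ⟨n, hn⟩ := hnil
      refine ⟨n, ?_⟩
      refine Submodule.map_injective_of_injective (f := S.val.toLinearMap)
        Subtype.val_injective ?_
      rw [Submodule.map_pow, Submodule.map_bot, eq_bot_iff, ← hn]
      refine pow_le_pow_left' ?_ n
      rintro _ ⟨y, hy, rfl⟩
      exact ⟨hy, y.2⟩)

theorem mem_ofSubalgebra_gr {R : Type u} [Ring R] [Algebra k R]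
    {σ : R →ₐ[k] R} {hσ : ∀ x, σ (σ x) = x} {hcomm} {S : Subalgebra k R} {hS hfin aug hnil}
    {i : ZMod 2} (x : S) :
    x ∈ (ArtinSuperalgebra.ofSubalgebra σ hσ hcomm S hS hfin aug hnil).gr i ↔
      σ x = (-1 : k) ^ i.val • (x : R) :=
  Iff.trans (mem_eigen (σ := ((σ.comp S.val).codRestrict S fun x => hS x x.2).toLinearMap))
    Subtype.ext_iff

theorem par_ofSubalgebra {R : Type u} [Ring R] [Algebra k R]
    {σ : R →ₐ[k] R} {hσ : ∀ x, σ (σ x) = x} {hcomm} {S : Subalgebra k R} {hS hfin aug hnil}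
    (x : S) :
    par (ArtinSuperalgebra.ofSubalgebra σ hσ hcomm S hS hfin aug hnil).gr x = ⟨σ x, hS x x.2⟩ :=
  par_ofInvolution _ _ _ _ _ _ _

/-- Homogeneous two-sided ideals contained in the maximal ideal. -/
structure IsSuperIdeal (B : ArtinSuperalgebra k) (J : Submodule k B.carrier) : Prop where
  homog : Homog B J
  le_max : J ≤ B.maxIdeal
  mul_left : ∀ a, ∀ b ∈ J, a * b ∈ J
  mul_right : ∀ a ∈ J, ∀ b, a * b ∈ J

theorem IsSuperIdeal.par_mem {B : ArtinSuperalgebra k} {J : Submodule k B.carrier}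
    (hJ : IsSuperIdeal B J) {b : B.carrier} (hb : b ∈ J) : par B.gr b ∈ J := hJ.homog.par_mem hb

/-- The algebra of pairs which are congruent modulo `J`. -/
def pairSub (B : ArtinSuperalgebra k) {J : Submodule k B.carrier} (hJ : IsSuperIdeal B J) :
    Subalgebra k (B.carrier × B.carrier) where
  carrier := {x | x.2 - x.1 ∈ J}
  mul_mem' := by
    intro x y hx hy
    have h : (x * y).2 - (x * y).1 = (x.2 - x.1) * y.2 + x.1 * (y.2 - y.1) := by
      simp only [Prod.fst_mul, Prod.snd_mul]
      noncomm_ring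
    change (_ : B.carrier) ∈ J
    rw [h]
    exact J.add_mem (hJ.mul_right _ hx _) (hJ.mul_left _ _ hy)
  add_mem' := by
    intro x y hx hy
    have h : (x + y).2 - (x + y).1 = (x.2 - x.1) + (y.2 - y.1) := by
      simp only [Prod.fst_add, Prod.snd_add]
      abel
    change (_ : B.carrier) ∈ J
    rw [h]
    exact J.add_mem hx hy
  algebraMap_mem' := by
    intro c
    change (_ : B.carrier) ∈ J
    simp [Prod.algebraMap_apply]

/-- The Artin superalgebra of pairs which are congruent modulo `J`. -/
def ArtinSuperalgebra.pair (B : ArtinSuperalgebra k) {J : Submodule k B.carrier}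
    (hJ : IsSuperIdeal B J) : ArtinSuperalgebra k :=
  ArtinSuperalgebra.ofSubalgebra ((parHom B.gr).prodMap (parHom B.gr))
    (fun x => Prod.ext (par_par B.gr x.1) (par_par B.gr x.2))
    (fun i j a b ha hb => Prod.ext
      (B.supercomm i j _ (mem_of_par B.gr (congrArg Prod.fst ha)) _
        (mem_of_par B.gr (congrArg Prod.fst hb)))
      (B.supercomm i j _ (mem_of_par B.gr (congrArg Prod.snd ha)) _
        (mem_of_par B.gr (congrArg Prod.snd hb))))
    (pairSub B hJ)
    (fun x hx => by
      have h : par B.gr (x.2 - x.1) ∈ J := hJ.par_mem hx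
      rw [map_sub] at h
      exact h)
    (FiniteDimensional.finiteDimensional_submodule (Subalgebra.toSubmodule (pairSub B hJ)))
    (B.aug.comp (AlgHom.fst k B.carrier B.carrier))
    (by
      obtain ⟨N, hN⟩ := B.nilpotent
      refine ⟨N, ?_⟩
      set I := LinearMap.ker (B.aug.comp (AlgHom.fst k B.carrier B.carrier)).toLinearMap ⊓
        Subalgebra.toSubmodule (pairSub B hJ) with hI
      have h1 : (I ^ N).map (AlgHom.fst k B.carrier B.carrier).toLinearMap ≤ B.maxIdeal ^ N := by
        rw [Submodule.map_pow]
        refine pow_le_pow_left' ?_ N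
        rintro _ ⟨y, hy, rfl⟩
        exact hy.1
      have h2 : (I ^ N).map (AlgHom.snd k B.carrier B.carrier).toLinearMap ≤ B.maxIdeal ^ N := by
        rw [Submodule.map_pow]
        refine pow_le_pow_left' ?_ N
        rintro _ ⟨y, hy, rfl⟩
        have h : y.2 = (y.2 - y.1) + y.1 := (sub_add_cancel _ _).symm
        change y.2 ∈ B.maxIdeal
        rw [h]
        exact Submodule.add_mem _ (hJ.le_max hy.2) hy.1
      rw [show B.maxIdeal ^ N = ⊥ from hN] at h1 h2
      rw [eq_bot_iff]
      intro x hx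
      exact Prod.ext (h1 ⟨x, hx, rfl⟩) (h2 ⟨x, hx, rfl⟩))

variable {B : ArtinSuperalgebra k} {J : Submodule k B.carrier} (hJ : IsSuperIdeal B J)

theorem mem_pair_gr {i : ZMod 2} (x : pairSub B hJ) :
    x ∈ (B.pair hJ).gr i ↔ x.1.1 ∈ B.gr i ∧ x.1.2 ∈ B.gr i := by
  refine (mem_ofSubalgebra_gr x).trans ⟨fun h => ?_, fun h => ?_⟩
  · exact ⟨mem_of_par B.gr (congrArg Prod.fst h), mem_of_par B.gr (congrArg Prod.snd h)⟩
  · exact Prod.ext (par_of_mem B.gr h.1) (par_of_mem B.gr h.2)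

/-- The first projection of the algebra of pairs. -/
def pairFst : (B.pair hJ).Hom B where
  toAlgHom := (AlgHom.fst k B.carrier B.carrier).comp (pairSub B hJ).val
  map_gr _ b hb := ((mem_pair_gr hJ b).1 hb).1
  map_aug _ := rfl

/-- The second projection of the algebra of pairs. -/
def pairSnd : (B.pair hJ).Hom B where
  toAlgHom := (AlgHom.snd k B.carrier B.carrier).comp (pairSub B hJ).val
  map_gr _ b hb := ((mem_pair_gr hJ b).1 hb).2
  map_aug b := by
    have h : B.aug (b.1.2 - b.1.1) = 0 := hJ.le_max b.2
    rw [map_sub, sub_eq_zero] at h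
    exact h

/-- The diagonal of the algebra of pairs. -/
def pairDiag : B.Hom (B.pair hJ) where
  toAlgHom := ((AlgHom.id k B.carrier).prod (AlgHom.id k B.carrier)).codRestrict (pairSub B hJ)
    fun x => by
      change x - x ∈ J
      rw [sub_self]
      exact J.zero_mem
  map_gr _ b hb := (mem_pair_gr hJ _).2 ⟨hb, hb⟩
  map_aug _ := rfl

variable {V : Type v} [AddCommGroup V] [Module k V] {𝒱 : ZMod 2 → Submodule k V}

/-- Two points of a supermanifold which are congruent modulo `J` define a point over pairs. -/
theorem exists_pair {x y : B.carrier ⊗[k] V} {i : ZMod 2} (hx : x ∈ pts 𝒱 B i)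
    (hxy : y - x ∈ gpts 𝒱 B J i) : ∃ z ∈ pts 𝒱 (B.pair hJ) i,
      baseMap V (pairFst hJ) z = x ∧ baseMap V (pairSnd hJ) z = y := by
  have h : gpts 𝒱 B J i ≤ (pts 𝒱 (B.pair hJ) i ⊓ LinearMap.ker (baseMap V (pairFst hJ))).map
      (baseMap V (pairSnd hJ)) := by
    refine gpts_le fun p q hpq β hβ hβJ v hv => ?_
    let b : (B.pair hJ).carrier := (⟨(0, β), by
      change β - 0 ∈ J
      rwa [sub_zero]⟩ : pairSub B hJ)
    refine ⟨b ⊗ₜ v, ⟨?_, ?_⟩, rfl⟩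
    · refine tmul_mem_gpts hpq ((mem_pair_gr hJ _).2 ⟨Submodule.zero_mem _, hβ⟩) ?_ hv
      exact map_zero B.aug
    · exact TensorProduct.zero_tmul _ _
  obtain ⟨z, ⟨hz1, hz2⟩, hz3⟩ := h hxy
  have hd : ∀ (f : (B.pair hJ).Hom B), (∀ b, f.toAlgHom ((pairDiag hJ).toAlgHom b) = b) →
      baseMap V f (baseMap V (pairDiag hJ) x) = x := by
    intro f hf
    rw [baseMap, baseMap, ← LinearMap.rTensor_comp_apply]
    have : f.toAlgHom.toLinearMap ∘ₗ (pairDiag hJ).toAlgHom.toLinearMap = LinearMap.id :=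
      LinearMap.ext hf
    rw [this, LinearMap.rTensor_id_apply]
  refine ⟨baseMap V (pairDiag hJ) x + z,
    Submodule.add_mem _ (baseMap_mem_pts 𝒱 (pairDiag hJ) i hx) hz1, ?_, ?_⟩
  · rw [map_add, hd _ fun _ => rfl, LinearMap.mem_ker.1 hz2, add_zero]
  · rw [map_add, hd _ fun _ => rfl, hz3, add_sub_cancel]

end Pair

/-! ### Formal maps to first order -/

section FirstOrder

variable {k : Type u} [Field k] [CharZero k]
variable {V : Type v} [AddCommGroup V] [Module k V] {𝒱 : ZMod 2 → Submodule k V}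
variable {W : Type v} [AddCommGroup W] [Module k W] {𝒲 : ZMod 2 → Submodule k W}

theorem rTensor_congr {N N' : Type*} [AddCommGroup N] [Module k N] [AddCommGroup N'] [Module k N']
    {I : Submodule k N} {f g : N →ₗ[k] N'} (h : ∀ x ∈ I, f x = g x) {x : N ⊗[k] V}
    (hx : x ∈ tens I V) : f.rTensor V x = g.rTensor V x := by
  have : tens I V ≤ LinearMap.eqLocus (f.rTensor V) (g.rTensor V) := by
    refine tens_le fun β hβ x => ?_
    rw [LinearMap.mem_eqLocus, LinearMap.rTensor_tmul, LinearMap.rTensor_tmul, h β hβ]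
  exact this hx

/-- `s` is the differential at the base point of a formal map. -/
def HasLinearPart (Γ : FormalMap 𝒱 𝒲 0) (s : V →ₗ[k] W) : Prop :=
  ∀ B : ArtinSuperalgebra k, B.maxIdeal ^ 2 = ⊥ → ∀ x : pts 𝒱 B 0,
    (Γ.app B x : B.carrier ⊗[k] W) = LinearMap.lTensor B.carrier s x

theorem HasLinearPart.sub_mem_sq {Γ : FormalMap 𝒱 𝒲 0} {s : V →ₗ[k] W} (hs : HasLinearPart Γ s)
    (B : ArtinSuperalgebra k) (x : pts 𝒱 B 0) :
    (Γ.app B x : B.carrier ⊗[k] W) - s.lTensor B.carrier x ∈ tens (B.maxIdeal ^ 2) W := by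
  rw [mem_tens_iff_mkQ, map_sub, sub_eq_zero]
  have h1 : ∀ (U : Type v) [AddCommGroup U] [Module k U] (y : B.carrier ⊗[k] U),
      y ∈ tens B.maxIdeal U → (B.maxIdeal ^ 2).mkQ.rTensor U y =
        (tangentSnd B).rTensor U (baseMap U (toTangent B) y) := by
    intro U _ _ y hy
    rw [baseMap, ← LinearMap.rTensor_comp_apply]
    exact rTensor_congr (fun b hb => (tangentSnd_toTangent B hb).symm) hy
  have h2 := hs _ (tangent_sq _ (cotangentInv_inv B)) (ptsMap 𝒱 (toTangent B) 0 x)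
  rw [Γ.natural] at h2
  have h3 : baseMap W (toTangent B) (Γ.app B x) = s.lTensor _ (baseMap V (toTangent B) x) := h2
  rw [h1 W _ (gpts_le_tens (Γ.app B x).2), h3,
    h1 W _ (lTensor_mem_tens s (gpts_le_tens x.2)), baseMap_lTensor]

/-- A formal map is additive to first order: `Γ(y) ≡ Γ(x) + s (y - x)` modulo `m J + J m` if
`y ≡ x` modulo `J`. -/
theorem HasLinearPart.sub_mem {Γ : FormalMap 𝒱 𝒲 0} {s : V →ₗ[k] W} (hs : HasLinearPart Γ s)
    {B : ArtinSuperalgebra k} {J J' : Submodule k B.carrier} (hJ : IsSuperIdeal B J)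
    (h1 : B.maxIdeal * J ≤ J') (h2 : J * B.maxIdeal ≤ J') (x y : pts 𝒱 B 0)
    (hxy : (y : B.carrier ⊗[k] V) - x ∈ gpts 𝒱 B J 0) :
    (Γ.app B y : B.carrier ⊗[k] W) - Γ.app B x - s.lTensor B.carrier (y - x) ∈ tens J' W := by
  obtain ⟨z, hz, hzx, hzy⟩ := exists_pair hJ x.2 hxy
  have hsq := hs.sub_mem_sq (B.pair hJ) ⟨z, hz⟩
  have hx : baseMap W (pairFst hJ) (Γ.app (B.pair hJ) ⟨z, hz⟩) = Γ.app B x := by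
    rw [show x = ptsMap 𝒱 (pairFst hJ) 0 ⟨z, hz⟩ from Subtype.ext hzx.symm, Γ.natural]
    rfl
  have hy : baseMap W (pairSnd hJ) (Γ.app (B.pair hJ) ⟨z, hz⟩) = Γ.app B y := by
    rw [show y = ptsMap 𝒱 (pairSnd hJ) 0 ⟨z, hz⟩ from Subtype.ext hzy.symm, Γ.natural]
    rfl
  have hf : ∀ β ∈ (B.pair hJ).maxIdeal ^ 2, ((pairSnd hJ).toAlgHom.toLinearMap -
      (pairFst hJ).toAlgHom.toLinearMap) β ∈ J' := by
    have : (B.pair hJ).maxIdeal ^ 2 ≤ J'.comap ((pairSnd hJ).toAlgHom.toLinearMap -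
      (pairFst hJ).toAlgHom.toLinearMap) := by
      rw [pow_two, Submodule.mul_le]
      intro a ha b hb
      have e1 : ∀ c ∈ (B.pair hJ).maxIdeal, (pairFst hJ).toAlgHom c ∈ B.maxIdeal := fun c hc =>
        ((pairFst hJ).map_aug c).trans hc
      have e2 : ∀ c ∈ (B.pair hJ).maxIdeal, (pairSnd hJ).toAlgHom c ∈ B.maxIdeal := fun c hc =>
        ((pairSnd hJ).map_aug c).trans hc
      have e3 : ∀ c, (pairSnd hJ).toAlgHom c - (pairFst hJ).toAlgHom c ∈ J := fun c =>
        Subtype.property (p := fun x => x ∈ pairSub B hJ) c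
      rw [Submodule.mem_comap]
      have e : ((pairSnd hJ).toAlgHom.toLinearMap - (pairFst hJ).toAlgHom.toLinearMap) (a * b) =
          ((pairSnd hJ).toAlgHom a - (pairFst hJ).toAlgHom a) * (pairSnd hJ).toAlgHom b +
          (pairFst hJ).toAlgHom a * ((pairSnd hJ).toAlgHom b - (pairFst hJ).toAlgHom b) := by
        rw [LinearMap.sub_apply, AlgHom.toLinearMap_apply, AlgHom.toLinearMap_apply, map_mul,
          map_mul, sub_mul, mul_sub]
        abel
      rw [e]
      exact Submodule.add_mem _ (h2 (Submodule.mul_mem_mul (e3 a) (e2 b hb)))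
        (h1 (Submodule.mul_mem_mul (e1 a ha) (e3 b)))
    exact fun β hβ => this hβ
  have h := rTensor_mem_tens _ hf hsq
  rw [LinearMap.rTensor_sub, LinearMap.sub_apply, map_sub, map_sub] at h
  change baseMap W (pairSnd hJ) _ - baseMap W (pairSnd hJ) _ -
    (baseMap W (pairFst hJ) _ - baseMap W (pairFst hJ) _) ∈ _ at h
  rw [baseMap_lTensor, baseMap_lTensor, hx, hy, hzx, hzy] at h
  rw [map_sub]
  convert h using 1
  abel

end FirstOrder

/-! ### Ideals and first order extensions by an odd variable -/

section OddVariable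

variable {k : Type u} [Field k] [CharZero k]

theorem Homog.mul_comm {B : ArtinSuperalgebra k} {I J : Submodule k B.carrier} (hI : Homog B I)
    (hJ : Homog B J) : I * J = J * I := by
  have key : ∀ {I J : Submodule k B.carrier}, Homog B I → Homog B J → I * J ≤ J * I := by
    intro I J hI hJ
    rw [Submodule.mul_le]
    intro a ha b hb
    have h : ∀ i j, proj B.gr i a * proj B.gr j b ∈ J * I := fun i j => by
      rw [B.supercomm i j _ (proj_mem _ _ _) _ (proj_mem _ _ _)]
      exact Submodule.smul_mem _ _ (Submodule.mul_mem_mul (hJ _ hb j) (hI _ ha i))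
    rw [← proj_add_proj B.gr a, ← proj_add_proj B.gr b, add_mul, mul_add, mul_add]
    exact Submodule.add_mem _ (Submodule.add_mem _ (h _ _) (h _ _))
      (Submodule.add_mem _ (h _ _) (h _ _))
  exact le_antisymm (key hI hJ) (key hJ hI)

variable {B : ArtinSuperalgebra k}

theorem IsSuperIdeal.of_homog {J : Submodule k B.carrier} (h : Homog B J)
    (hm : J ≤ B.maxIdeal) (hl : B.maxIdeal * J ≤ J) : IsSuperIdeal B J := by
  have hd : ∀ a : B.carrier, a = algebraMap k B.carrier (B.aug a) +
      (a - algebraMap k B.carrier (B.aug a)) := fun a => (add_sub_cancel _ _).symm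
  have hd' : ∀ a : B.carrier, a - algebraMap k B.carrier (B.aug a) ∈ B.maxIdeal := by
    intro a
    change B.aug (a - algebraMap k B.carrier (B.aug a)) = 0
    rw [map_sub, AlgHom.commutes, Algebra.algebraMap_self_apply, sub_self]
  refine ⟨h, hm, fun a b hb => ?_, fun b hb a => ?_⟩
  · rw [hd a, add_mul, ← Algebra.smul_def]
    exact J.add_mem (J.smul_mem _ hb) (hl (Submodule.mul_mem_mul (hd' a) hb))
  · rw [hd a, mul_add, ← Algebra.commutes, ← Algebra.smul_def]
    refine J.add_mem (J.smul_mem _ hb) (hl ?_)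
    rw [(homog_maxIdeal B).mul_comm h]
    exact Submodule.mul_mem_mul hb (hd' a)

theorem maxIdeal_mul_le (J : Submodule k B.carrier) : B.maxIdeal * J ≤ B.maxIdeal := by
  rw [Submodule.mul_le]
  exact fun a ha b _ => maxIdeal_mul_mem B ha

theorem isSuperIdeal_maxIdeal (B : ArtinSuperalgebra k) : IsSuperIdeal B B.maxIdeal :=
  .of_homog (homog_maxIdeal B) le_rfl (maxIdeal_mul_le _)

theorem IsSuperIdeal.maxIdeal_mul_le {J : Submodule k B.carrier} (hJ : IsSuperIdeal B J) :
    B.maxIdeal * J ≤ J := Submodule.mul_le.2 fun a _ b hb => hJ.mul_left a b hb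

theorem IsSuperIdeal.maxIdeal_mul {J : Submodule k B.carrier} (hJ : IsSuperIdeal B J) :
    IsSuperIdeal B (B.maxIdeal * J) :=
  .of_homog ((homog_maxIdeal B).mul hJ.homog) (SemiInf.maxIdeal_mul_le _)
    (mul_le_mul' le_rfl hJ.maxIdeal_mul_le)

theorem IsSuperIdeal.pow_mul {J : Submodule k B.carrier} (hJ : IsSuperIdeal B J) (n : ℕ) :
    IsSuperIdeal B (B.maxIdeal ^ n * J) := by
  induction n with
  | zero => rwa [pow_zero, one_mul]
  | succ n ih =>
    rw [pow_succ', mul_assoc]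
    exact ih.maxIdeal_mul

theorem isSuperIdeal_pow (B : ArtinSuperalgebra k) {n : ℕ} (hn : 1 ≤ n) :
    IsSuperIdeal B (B.maxIdeal ^ n) := by
  obtain ⟨n, rfl⟩ := Nat.exists_eq_add_of_le' hn
  exact (isSuperIdeal_maxIdeal B).pow_mul n

theorem isSuperIdeal_bot (B : ArtinSuperalgebra k) : IsSuperIdeal B ⊥ :=
  .of_homog (fun b hb i => by
    rw [(Submodule.mem_bot k).1 hb, map_zero]; exact Submodule.zero_mem _) bot_le (by simp)

theorem etaInr_le {J J' : Submodule k B.carrier} (h : B.maxIdeal * J ≤ J') :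
    B.eta.maxIdeal * J.map (etaInr B) ≤ J'.map (etaInr B) := by
  rw [Submodule.mul_le]
  rintro a ha _ ⟨b, hb, rfl⟩
  have ha' : B.aug (etaFst B a) = 0 := ha
  refine ⟨par B.gr (etaFst B a) * b,
    h (Submodule.mul_mem_mul ((homog_maxIdeal B).par_mem ha') hb), ?_⟩
  rw [← etaMk_eta a, etaInr_apply, etaInr_apply, etaMk_mul, mul_zero, mul_zero, add_zero]
  rfl

theorem Homog.etaInr {J : Submodule k B.carrier} (h : Homog B J) :
    Homog B.eta (J.map (etaInr B)) := by
  rintro _ ⟨b, hb, rfl⟩ i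
  have hh : ∀ j, etaMk 0 (proj B.gr j b) ∈ B.eta.gr (j + 1) := fun j =>
    etaMk_mem_gr.2 ⟨Submodule.zero_mem _, by
      rw [add_assoc, show (1 : ZMod 2) + 1 = 0 from rfl, add_zero]
      exact proj_mem _ _ _⟩
  have e : SemiInf.etaInr B b = etaMk 0 (proj B.gr 0 b) + etaMk 0 (proj B.gr 1 b) := by
    rw [etaMk_add, add_zero, proj_add_proj]; rfl
  rw [e, map_add, proj_of_mem _ (hh 0), proj_of_mem _ (hh 1)]
  refine Submodule.add_mem _ ?_ ?_ <;> split_ifs <;>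
  first
  | exact Submodule.zero_mem _
  | exact ⟨_, h b hb _, rfl⟩

theorem IsSuperIdeal.etaInr {J : Submodule k B.carrier} (hJ : IsSuperIdeal B J) :
    IsSuperIdeal B.eta (J.map (etaInr B)) :=
  .of_homog hJ.homog.etaInr (by
    rintro _ ⟨b, _, rfl⟩
    exact map_zero B.aug) (etaInr_le hJ.maxIdeal_mul_le)

variable {V : Type v} [AddCommGroup V] [Module k V] {𝒱 : ZMod 2 → Submodule k V}
variable {W : Type v} [AddCommGroup W] [Module k W] {𝒲 : ZMod 2 → Submodule k W}

theorem lmul_eta (x : B.carrier ⊗[k] V) :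
    lmul V B.eta (etaMk 0 1) (baseMap V (etaInl B) x) = (etaInr B).rTensor V x := by
  rw [lmul, baseMap, ← LinearMap.rTensor_comp_apply]
  congr 2
  ext b
  change etaMk 0 1 * etaMk b 0 = etaMk 0 b
  rw [etaMk_mul, zero_mul, mul_zero, zero_add, one_mul]

theorem eta_odd : etaMk (B := B) 0 1 ∈ B.eta.gr 1 :=
  etaMk_mem_gr.2 ⟨Submodule.zero_mem _, SetLike.GradedOne.one_mem (A := B.gr)⟩

theorem etaInr_mem_gpts {J : Submodule k B.carrier} {i j : ZMod 2} (hij : i + 1 = j)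
    {x : B.carrier ⊗[k] V} (hx : x ∈ gpts 𝒱 B J i) :
    (etaInr B).rTensor V x ∈ gpts 𝒱 B.eta (J.map (etaInr B)) j :=
  rTensor_mem_gpts _ hij (fun p β hβ hJ => ⟨etaMk_mem_gr.2 ⟨Submodule.zero_mem _, by
    rw [add_assoc, show (1 : ZMod 2) + 1 = 0 from rfl, add_zero]
    exact hβ⟩, Submodule.mem_map_of_mem hJ⟩) hx

theorem tens_of_etaInr {J : Submodule k B.carrier} {x : B.carrier ⊗[k] V}
    (hx : (etaInr B).rTensor V x ∈ tens (J.map (etaInr B)) V) : x ∈ tens J V :=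
  mem_tens_of_rTensor (etaInr B) (by
    rintro β ⟨b, hb, h⟩
    rwa [← show b = β from congrArg (etaSnd B) h]) hx

/-- The derivative of a formal map along an odd tangent vector `q` at `x` is `s q` to first
order. -/
theorem HasLinearPart.eta_sub_mem {Γ : FormalMap 𝒱 𝒲 0} {s : V →ₗ[k] W} (hs : HasLinearPart Γ s)
    {J J' : Submodule k B.carrier} (hJ : IsSuperIdeal B J) (h1 : B.maxIdeal * J ≤ J')
    (x : pts 𝒱 B 0) {q : B.carrier ⊗[k] V} (hq : q ∈ gpts 𝒱 B J 1) (y : pts 𝒱 B.eta 0)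
    (hy : (y : B.eta.carrier ⊗[k] V) = baseMap V (etaInl B) x + (etaInr B).rTensor V q)
    {r : B.carrier ⊗[k] W} (hr : (Γ.app B.eta y : B.eta.carrier ⊗[k] W) =
      baseMap W (etaInl B) (Γ.app B x) + (etaInr B).rTensor W r) :
    r - s.lTensor B.carrier q ∈ tens J' W := by
  have hyx : (y : B.eta.carrier ⊗[k] V) - (ptsMap 𝒱 (etaInl B) 0 x).1 =
      (etaInr B).rTensor V q := by
    rw [hy]; exact add_sub_cancel_left _ _
  have h := hs.sub_mem hJ.etaInr (etaInr_le h1) (by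
      rw [hJ.etaInr.homog.mul_comm (homog_maxIdeal _)]
      exact etaInr_le h1) (ptsMap 𝒱 (etaInl B) 0 x) y (by
    rw [hyx]
    exact etaInr_mem_gpts (by decide) hq)
  have e : (Γ.app B.eta y : B.eta.carrier ⊗[k] W) - Γ.app B.eta (ptsMap 𝒱 (etaInl B) 0 x) =
      (etaInr B).rTensor W r := by
    rw [hr, Γ.natural]; exact add_sub_cancel_left _ _
  rw [e, hyx] at h
  refine tens_of_etaInr ?_
  rw [map_sub]
  have e2 : s.lTensor B.eta.carrier ((etaInr B).rTensor V q) =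
      (etaInr B).rTensor W (s.lTensor B.carrier q) := by
    rw [← LinearMap.comp_apply, ← LinearMap.comp_apply, LinearMap.lTensor_comp_rTensor,
      LinearMap.rTensor_comp_lTensor]
  rwa [e2] at h

/-- The differential at the base point of an even formal map is even. -/
theorem HasLinearPart.even [DirectSum.Decomposition 𝒲] {Γ : FormalMap 𝒱 𝒲 0} {s : V →ₗ[k] W}
    (hs : HasLinearPart Γ s) (i : ZMod 2) (x : V) (hx : x ∈ 𝒱 i) : s x ∈ 𝒲 i := by
  -- evaluate at the point `v ⊗ x`, for a vector `v` of parity `i` spanning a square zero ideal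
  have hτ : ∀ x : k, ((-1 : k) ^ i.val • (LinearMap.id : k →ₗ[k] k))
      (((-1 : k) ^ i.val • (LinearMap.id : k →ₗ[k] k)) x) = x := by
    intro x
    rcases zmod2_cases i with rfl | rfl <;> simp [zmod2_val_one]
  let T := ArtinSuperalgebra.tangent ((-1 : k) ^ i.val • (LinearMap.id : k →ₗ[k] k)) hτ
  let v : T.carrier := ((0, 1) : k × k)
  have hv : v ∈ T.gr i := (mem_eigen (i := i)).2 (Prod.ext
    (by change (0 : k) = (-1 : k) ^ i.val * 0; rw [mul_zero]) rfl)
  have hvx : v ⊗ₜ[k] x ∈ pts 𝒱 T 0 := tmul_mem_gpts (zmod2_add_self i) hv rfl hx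
  have h := hs T (tangent_sq _ hτ) ⟨_, hvx⟩
  have h2 := parT_of_mem (Γ.app T ⟨_, hvx⟩).2
  rw [h, ZMod.val_zero, pow_zero, one_smul] at h2
  have h3 : par T.gr v ⊗ₜ[k] par 𝒲 (s x) = v ⊗ₜ[k] s x := h2
  rw [par_of_mem T.gr hv] at h3
  have h4 := congrArg (fun z => TensorProduct.lid k W
    ((LinearMap.snd k k k : T.carrier →ₗ[k] k).rTensor W z)) h3
  have h5 : ((-1 : k) ^ i.val * 1) • par 𝒲 (s x) = (1 : k) • s x := h4
  rw [mul_one, one_smul] at h5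
  apply mem_of_par
  rw [← h5, smul_smul, ← pow_add, ← two_mul, pow_mul, neg_one_sq, one_pow, one_smul, h5]

end OddVariable

/-! ### The homological vector field of a mini-versal family vanishes -/

section Vanishing

variable {k : Type u} [Field k] [CharZero k]
variable {A : Type v} [Ring A] [Algebra k A] {𝒜 : ZMod 2 → Submodule k A} [GradedAlgebra 𝒜]
  (X : DGBV 𝒜) {B : ArtinSuperalgebra k}
variable {M : Type v} [AddCommGroup M] [Module k M] {ℳ : ZMod 2 → Submodule k M}
  [DirectSum.Decomposition ℳ]

theorem baseMap_curv {B' : ArtinSuperalgebra k} (f : B.Hom B') (γ : B.carrier ⊗[k] A) :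
    baseMap A f (curv 𝒜 X.d X.br B γ) = curv 𝒜 X.d X.br B' (baseMap A f γ) := by
  simp only [curv, map_add, map_smul, baseMap_oddExt, baseMap_oddExt₂]

/-- The dg map property of `Γ` at the point `x + η Q(x)` with values in `B[η]`, for the odd constant
`η`. -/
theorem curv_eq_of_isDGMap {Q : FormalMap ℳ ℳ 1} {Γ : FormalMap ℳ 𝒜 0}
    (h : IsDGMap ℳ 𝒜 X.d X.br Q Γ) (x : pts ℳ B 0) : ∃ y : pts ℳ B.eta 0,
      (y : B.eta.carrier ⊗[k] M) =
        baseMap M (etaInl B) x + (etaInr B).rTensor M (Q.app B x) ∧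
      (Γ.app B.eta y : B.eta.carrier ⊗[k] A) = baseMap A (etaInl B) (Γ.app B x) +
        (etaInr B).rTensor A (curv 𝒜 X.d X.br B (Γ.app B x)) := by
  have hm : baseMap M (etaInl B) x + (etaInr B).rTensor M (Q.app B x) ∈ pts ℳ B.eta 0 := by
    refine Submodule.add_mem _ (baseMap_mem_pts ℳ _ _ x.2) ?_
    exact gpts_mono (isSuperIdeal_maxIdeal B).etaInr.le_max 0
      (etaInr_mem_gpts (by decide) (Q.app B x).2)
  refine ⟨⟨_, hm⟩, rfl, ?_⟩
  have h2 := h B.eta (etaMk 0 1) eta_odd (ptsMap ℳ (etaInl B) 0 x) ⟨_, hm⟩ (by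
    rw [Q.natural]
    change _ = baseMap M (etaInl B) x + lmul M B.eta (etaMk 0 1) (baseMap M (etaInl B) (Q.app B x))
    rw [lmul_eta])
  rw [h2, Γ.natural]
  change baseMap A (etaInl B) (Γ.app B x) + lmul A B.eta (etaMk 0 1) (curv 𝒜 X.d X.br B.eta
    (baseMap A (etaInl B) (Γ.app B x))) = _
  rw [← baseMap_curv, lmul_eta]

/-- The vector field of a mini-versal family vanishes: its lowest order term is the class of the
lowest order term of the obstruction `dΓ + ½[Γ • Γ]`, which is exact. -/
theorem vectorField_eq_zero (hex : ∀ a, X.d (X.Δ a) = 0 → ∃ b, X.d b = X.Δ a)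
    {Q : FormalMap ℳ ℳ 1} {Γ : FormalMap ℳ 𝒜 0} (C : Contraction ℳ 𝒜 X.d)
    (h : IsDGMap ℳ 𝒜 X.d X.br Q Γ) (hs : HasLinearPart Γ C.s) (x : pts ℳ B 0) :
    (Q.app B x : B.carrier ⊗[k] M) = 0 := by
  refine eq_zero_of_pow (gpts_le_tens (Q.app B x).2) fun n hn hQ => ?_
  obtain ⟨y, hy, hΓ⟩ := curv_eq_of_isDGMap X h x
  have h1 := hs.eta_sub_mem (isSuperIdeal_pow B hn) le_rfl x
    (gpts_of_tens (homog_pow B n) hQ (Q.app B x).2) y hy hΓ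
  rw [← pow_succ'] at h1
  have h2 : curv 𝒜 X.d X.br B (Γ.app B x) ∈ tens (B.maxIdeal ^ n) A := by
    rw [← sub_add_cancel (curv 𝒜 X.d X.br B (Γ.app B x))
      (C.s.lTensor B.carrier (Q.app B x).1)]
    exact Submodule.add_mem _ (tens_pow_anti n.le_succ hn h1) (lTensor_mem_tens _ hQ)
  obtain ⟨r, hr⟩ := exists_curv_sub_mem X C hex (Γ.app B x).2 hn h2
  have h3 := lTensor_mem_tens C.p (Submodule.sub_mem _ hr h1)
  have h4 : C.p.lTensor B.carrier (C.s.lTensor B.carrier (Q.app B x).1) = (Q.app B x).1 := by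
    rw [← LinearMap.lTensor_comp_apply,
      show C.p ∘ₗ C.s = LinearMap.id from LinearMap.ext C.p_s, LinearMap.lTensor_id_apply]
  have h5 : C.p.lTensor B.carrier (oddExt B X.d r) = 0 := by
    rw [lTensor_oddExt, show C.p ∘ₗ X.d = 0 from LinearMap.ext C.p_d, oddExt,
      TensorProduct.map_zero_right, LinearMap.zero_apply]
  rw [sub_sub_sub_cancel_left, map_sub, h4, h5, sub_zero] at h3
  exact h3

/-- A mini-versal family with vanishing vector field consists of Maurer-Cartan elements. -/
theorem curv_eq_zero {Γ : FormalMap ℳ 𝒜 0} {Q : FormalMap ℳ ℳ 1}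
    (h : IsDGMap ℳ 𝒜 X.d X.br Q Γ) (hQ : ∀ x : pts ℳ B 0, (Q.app B x : B.carrier ⊗[k] M) = 0)
    (x : pts ℳ B 0) : curv 𝒜 X.d X.br B (Γ.app B x) = 0 := by
  obtain ⟨y, hy, hΓ⟩ := curv_eq_of_isDGMap X h x
  rw [hQ, map_zero, add_zero] at hy
  rw [show y = ptsMap ℳ (etaInl B) 0 x from Subtype.ext hy, Γ.natural] at hΓ
  have h1 : (etaInr B).rTensor A (curv 𝒜 X.d X.br B (Γ.app B x)) = 0 := left_eq_add.1 hΓ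
  have h2 : curv 𝒜 X.d X.br B (Γ.app B x) ∈ tens ⊥ A := tens_of_etaInr (by
    rw [h1]; exact Submodule.zero_mem _)
  rwa [tens_bot] at h2

end Vanishing

/-! ### The fibres of the local system -/

section Fibre

variable {k : Type u} [Field k] [CharZero k]
variable {A : Type v} [Ring A] [Algebra k A] {𝒜 : ZMod 2 → Submodule k A} [GradedAlgebra 𝒜]
  (X : DGBV 𝒜) {B : ArtinSuperalgebra k} {γ : B.carrier ⊗[k] A}

theorem Contraction.lTensor_homotopy {V : Type v} [AddCommGroup V] [Module k V]
    {𝒱 : ZMod 2 → Submodule k V} (C : Contraction 𝒱 𝒜 X.d) (B : ArtinSuperalgebra k)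
    (x : B.carrier ⊗[k] A) :
    C.s.lTensor B.carrier (C.p.lTensor B.carrier x) + oddExt B X.d (oddExt B C.h x) +
      oddExt B C.h (oddExt B X.d x) = x := by
  rw [oddExt_oddExt, oddExt_oddExt, ← LinearMap.lTensor_comp_apply, ← LinearMap.add_apply,
    ← LinearMap.lTensor_add, ← LinearMap.add_apply, ← LinearMap.lTensor_add,
    show C.s ∘ₗ C.p + X.d ∘ₗ C.h + C.h ∘ₗ X.d = LinearMap.id from LinearMap.ext C.homotopy,
    LinearMap.lTensor_id_apply]

theorem Contraction.lTensor_p_d {V : Type v} [AddCommGroup V] [Module k V]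
    {𝒱 : ZMod 2 → Submodule k V} (C : Contraction 𝒱 𝒜 X.d) (B : ArtinSuperalgebra k)
    (x : B.carrier ⊗[k] A) : C.p.lTensor B.carrier (oddExt B X.d x) = 0 := by
  rw [lTensor_oddExt, show C.p ∘ₗ X.d = 0 from LinearMap.ext C.p_d, oddExt,
    TensorProduct.map_zero_right, LinearMap.zero_apply]

theorem Contraction.lTensor_d_s {V : Type v} [AddCommGroup V] [Module k V]
    {𝒱 : ZMod 2 → Submodule k V} (C : Contraction 𝒱 𝒜 X.d) (B : ArtinSuperalgebra k)
    (x : B.carrier ⊗[k] V) : oddExt B X.d (C.s.lTensor B.carrier x) = 0 := by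
  rw [oddExt_lTensor, show X.d ∘ₗ C.s = 0 from LinearMap.ext C.d_s, oddExt,
    TensorProduct.map_zero_right, LinearMap.zero_apply]

theorem Contraction.lTensor_p_s {V : Type v} [AddCommGroup V] [Module k V]
    {𝒱 : ZMod 2 → Submodule k V} (C : Contraction 𝒱 𝒜 X.d) (B : ArtinSuperalgebra k)
    (x : B.carrier ⊗[k] V) : C.p.lTensor B.carrier (C.s.lTensor B.carrier x) = x := by
  rw [← LinearMap.lTensor_comp_apply,
    show C.p ∘ₗ C.s = LinearMap.id from LinearMap.ext C.p_s, LinearMap.lTensor_id_apply]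

variable {L : Submodule k (ℤ → B.carrier ⊗[k] A)} (hL : ShiftStable L)
  {L' : Submodule k (ℤ → B.carrier ⊗[k] Coh X.d)}

/-- The coefficientwise action of a linear map between spaces of series. -/
def coeffwise {P Q : Type*} [AddCommGroup P] [Module k P] [AddCommGroup Q] [Module k Q]
    (L : Submodule k (ℤ → P)) (L' : Submodule k (ℤ → Q)) (T : P →ₗ[k] Q)
    (hT : ∀ f ∈ L, (fun n => T (f n)) ∈ L') : L →ₗ[k] L' where
  toFun f := ⟨fun n => T (f.1 n), hT f.1 f.2⟩
  map_add' f g := by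
    apply Subtype.ext
    funext n
    exact map_add T _ _
  map_smul' c f := by
    apply Subtype.ext
    funext n
    exact map_smul T _ _

/-- The operator `G` which conjugates the differential `D` to `d` identifies the `D`-exact series
with the `D`-closed ones whose image under `p G` vanishes. -/
theorem mem_range_of_conjugation (C : Contraction (cohGr 𝒜 X.d) 𝒜 X.d)
    (D G G' : Module.End k L)
    (h1 : ∀ f, G (G' f) = f) (h2 : ∀ f, G' (G f) = f)
    (hG : ∀ f, G (D f) = hL.op (oddExt B X.d) (G f)) (z : L) (hz : D z = 0) :
    (∀ n, C.p.lTensor B.carrier ((G z).1 n) = 0) ↔ ∃ f, D f = z := by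
  constructor
  · intro hpw
    have hdw : ∀ n, oddExt B X.d ((G z).1 n) = 0 := by
      intro n
      have := hG z
      rw [hz, map_zero] at this
      exact (congrFun (congrArg Subtype.val this) n).symm
    have hw2 : G z = hL.op (oddExt B X.d) (hL.op (oddExt B C.h) (G z)) := by
      apply Subtype.ext
      funext n
      have := C.lTensor_homotopy X B ((G z).1 n)
      rw [hdw, hpw, map_zero, map_zero, add_zero, zero_add] at this
      exact this.symm
    refine ⟨G' (hL.op (oddExt B C.h) (G z)), ?_⟩
    rw [← h2 (D _), hG, h1, ← hw2, h2]
  · rintro ⟨f, rfl⟩ n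
    rw [hG]
    exact C.lTensor_p_d X B _

theorem exists_quotientEquiv {P Q : Type*} [AddCommGroup P] [Module k P] [AddCommGroup Q]
    [Module k Q] (F : P →ₗ[k] Q) (hF : Function.Surjective F) {K : Submodule k P}
    (hK : LinearMap.ker F = K) :
    ∃ e : (P ⧸ K) ≃ₗ[k] Q, ∀ z, e (Submodule.Quotient.mk z) = F z := by
  subst hK
  exact ⟨F.quotKerEquivOfSurjective hF, fun _ => rfl⟩

/-- If `G` conjugates the differential `D` to `d`, then `p G` identifies the cohomology of `D` with
the series with coefficients in `B ⊗ H(A, d)`. -/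
theorem exists_equiv_of_conjugation (C : Contraction (cohGr 𝒜 X.d) 𝒜 X.d)
    (hLL' : ∀ (T : B.carrier ⊗[k] A →ₗ[k] B.carrier ⊗[k] Coh X.d), ∀ f ∈ L,
      (fun n => T (f n)) ∈ L')
    (hL'L : ∀ (T : B.carrier ⊗[k] Coh X.d →ₗ[k] B.carrier ⊗[k] A), ∀ f ∈ L',
      (fun n => T (f n)) ∈ L)
    (E : (ℤ → B.carrier ⊗[k] A) →ₗ[k] (ℤ → B.carrier ⊗[k] A))
    (D G G' : Module.End k L) (hD : ∀ f : L, (D f).1 = E f.1)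
    (h1 : ∀ f, G (G' f) = f) (h2 : ∀ f, G' (G f) = f)
    (hG : ∀ f, G (D f) = hL.op (oddExt B X.d) (G f)) :
    ∃ e : CohOn L E ≃ₗ[k] L',
      ∀ (z : (LinearMap.ker E ⊓ L : Submodule k (ℤ → B.carrier ⊗[k] A))) (n : ℤ),
        (e (Submodule.Quotient.mk z)).1 n =
          C.p.lTensor B.carrier ((G ⟨z.1, z.2.2⟩).1 n) := by
  let F : (LinearMap.ker E ⊓ L : Submodule k (ℤ → B.carrier ⊗[k] A)) →ₗ[k] L' :=
    coeffwise L L' (C.p.lTensor B.carrier) (hLL' _) ∘ₗ G ∘ₗ Submodule.inclusion inf_le_right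
  have hker : LinearMap.ker F = (L.map E).comap
      (LinearMap.ker E ⊓ L : Submodule k (ℤ → B.carrier ⊗[k] A)).subtype := by
    refine Submodule.ext fun z => ?_
    have hz : D ⟨z.1, z.2.2⟩ = 0 := Subtype.ext ((hD _).trans z.2.1)
    refine Iff.trans ⟨fun h n => congrFun (congrArg Subtype.val h) n,
      fun h => Subtype.ext (funext h)⟩
      ((mem_range_of_conjugation X hL C D G G' h1 h2 hG ⟨z.1, z.2.2⟩ hz).trans
        ⟨?_, ?_⟩)
    · rintro ⟨f, hf⟩
      exact ⟨f.1, f.2, (hD f).symm.trans (congrArg Subtype.val hf)⟩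
    · rintro ⟨f, hf, hfz⟩
      exact ⟨⟨f, hf⟩, Subtype.ext ((hD ⟨f, hf⟩).trans hfz)⟩
  have hsurj : Function.Surjective F := by
    intro y
    obtain ⟨w, hw⟩ : ∃ w : L, ∀ n, w.1 n = C.s.lTensor B.carrier (y.1 n) :=
      ⟨⟨fun n => C.s.lTensor B.carrier (y.1 n), hL'L _ _ y.2⟩, fun _ => rfl⟩
    have hDw : D (G' w) = 0 := by
      have h3 : hL.op (oddExt B X.d) w = 0 := Subtype.ext (funext fun n => by
        rw [ShiftStable.op_apply, hw, C.lTensor_d_s]; rfl)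
      rw [← h2 (D _), hG, h1, h3, map_zero]
    refine ⟨⟨(G' w).1, (hD _).symm.trans (congrArg Subtype.val hDw), (G' w).2⟩,
      Subtype.ext (funext fun n => ?_)⟩
    have h3 : C.p.lTensor B.carrier ((G (G' w)).1 n) = y.1 n := by
      rw [h1, hw, C.lTensor_p_s]
    exact h3
  have hF : ∀ z n, (F z).1 n = C.p.lTensor B.carrier ((G ⟨z.1, z.2.2⟩).1 n) := fun z n => rfl
  clear_value F
  obtain ⟨e, he⟩ := exists_quotientEquiv (k := k)
    (P := (LinearMap.ker E ⊓ L : Submodule k (ℤ → B.carrier ⊗[k] A))) (Q := L') F hsurj hker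
  exact ⟨e, fun z n => by rw [he, hF]⟩

/-- The fibre is trivialized by an operator `G` which conjugates `d + ħ Δ + γ •` to `d` and commutes
with `ħ`, with the coefficients `B` and with the parity involution. -/
theorem fibreIso_of_conjugation (C : Contraction (cohGr 𝒜 X.d) 𝒜 X.d)
    (hLL' : ∀ (T : B.carrier ⊗[k] A →ₗ[k] B.carrier ⊗[k] Coh X.d), ∀ f ∈ L,
      (fun n => T (f n)) ∈ L')
    (hL'L : ∀ (T : B.carrier ⊗[k] Coh X.d →ₗ[k] B.carrier ⊗[k] A), ∀ f ∈ L',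
      (fun n => T (f n)) ∈ L)
    (D G G' : Module.End k L) (hD : ∀ f : L, (D f).1 = X.twisted B γ f.1)
    (h1 : ∀ f, G (G' f) = f) (h2 : ∀ f, G' (G f) = f)
    (hG : ∀ f, G (D f) = hL.op (oddExt B X.d) (G f))
    (hsh : ∀ f, G (hL.sh 1 f) = hL.sh 1 (G f))
    (hlmul : ∀ β f, G (hL.op (lmul A B β) f) = hL.op (lmul A B β) (G f))
    (hpar : ∀ f, G (hL.op (parT 𝒜 B) f) = hL.op (parT 𝒜 B) (G f)) :
    X.FibreIso B γ L L' := by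
  obtain ⟨e, he⟩ := exists_equiv_of_conjugation X hL C hLL' hL'L (X.twisted B γ) D G G' hD h1 h2 hG
  refine ⟨e, ?_, ?_, ?_⟩
  · intro z z' hzz' n
    rw [he, he]
    have : (⟨z'.1, z'.2.2⟩ : L) = hL.sh 1 ⟨z.1, z.2.2⟩ := Subtype.ext (funext hzz')
    rw [this, hsh, ShiftStable.sh_apply]
  · intro β z z' hzz' n
    rw [he, he]
    have : (⟨z'.1, z'.2.2⟩ : L) = hL.op (lmul A B β) ⟨z.1, z.2.2⟩ := Subtype.ext (funext hzz')
    rw [this, hlmul, ShiftStable.op_apply, lmul, lmul, ← LinearMap.comp_apply,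
      ← LinearMap.comp_apply, LinearMap.lTensor_comp_rTensor, LinearMap.rTensor_comp_lTensor]
  · intro i z hz n
    rw [he, tensorGr_eq_gpts]
    refine lTensor_mem_gpts C.p C.p_even (mem_gpts_of_parT (𝒱 := 𝒜) (homog_top B) ?_ ?_)
    · rw [tens_top]; trivial
    · have hz' : ∀ m, parT 𝒜 B (z.1 m) = (-1 : k) ^ i.val • z.1 m := fun m => by
        have := hz m
        rw [tensorGr_eq_gpts] at this
        exact parT_of_mem this
      have h4 := hpar ⟨z.1, z.2.2⟩
      have h3 : hL.op (parT 𝒜 B) ⟨z.1, z.2.2⟩ = (-1 : k) ^ i.val • (⟨z.1, z.2.2⟩ : L) :=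
        Subtype.ext (funext hz')
      rw [h3, map_smul] at h4
      exact (congrFun (congrArg Subtype.val h4) n).symm

theorem bmul_lmul (x : B.carrier ⊗[k] A) (hx : x ∈ gpts 𝒜 B ⊤ 0) (β : B.carrier)
    (y : B.carrier ⊗[k] A) :
    bmul 𝒜 B x (lmul A B β y) = lmul A B β (bmul 𝒜 B x y) := by
  have h : ∀ j, ∀ β ∈ B.gr j, (bmul 𝒜 B).flip (lmul A B β y) x =
      (lmul A B β ∘ₗ (bmul 𝒜 B).flip y) x := by
    intro j β hβ
    refine gpts_eq _ _ (fun p q hpq b hb a ha => ?_) hx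
    obtain rfl := zmod2_eq_of_add hpq
    have := LinearMap.congr_fun (ext_homog 𝒜 B (f := bmul 𝒜 B (b ⊗ₜ a) ∘ₗ lmul A B β)
      (g := lmul A B β ∘ₗ bmul 𝒜 B (b ⊗ₜ a)) fun p' q' b' hb' a' ha' => by
        change bmul 𝒜 B (b ⊗ₜ a) ((β * b') ⊗ₜ a') = lmul A B β (bmul 𝒜 B (b ⊗ₜ a) (b' ⊗ₜ a'))
        rw [bmul_tmul 𝒜 ha (SetLike.mul_mem_graded hβ hb'), bmul_tmul 𝒜 ha hb', map_smul]
        change _ = _ • ((β * (b * b')) ⊗ₜ[k] (a * a'))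
        rw [← mul_assoc, ← mul_assoc, B.supercomm _ _ β hβ b hb, smul_mul_assoc,
          ← TensorProduct.smul_tmul', smul_smul]
        congr 1
        rcases zmod2_cases p with rfl | rfl <;> rcases zmod2_cases j with rfl | rfl <;>
        rcases zmod2_cases p' with rfl | rfl <;>
        simp [zmod2_val_one, show (1 + 1 : ZMod 2) = 0 from rfl]) y
    exact this
  have h0 := h 0 _ (proj_mem B.gr 0 β)
  have h1 := h 1 _ (proj_mem B.gr 1 β)
  have e : lmul A B β = lmul A B (proj B.gr 0 β) + lmul A B (proj B.gr 1 β) := by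
    conv_lhs => rw [← proj_add_proj B.gr β]
    simp only [lmul]
    rw [← LinearMap.rTensor_add]
    congr 1
    ext b
    simp [add_mul]
  rw [e, LinearMap.add_apply, map_add, LinearMap.add_apply]
  exact congrArg₂ (· + ·) h0 h1

theorem bmul_parT (x : B.carrier ⊗[k] A) (hx : x ∈ gpts 𝒜 B ⊤ 0) (y : B.carrier ⊗[k] A) :
    bmul 𝒜 B x (parT 𝒜 B y) = parT 𝒜 B (bmul 𝒜 B x y) := by
  refine LinearMap.congr_fun (ext_homog 𝒜 B (f := bmul 𝒜 B x ∘ₗ parT 𝒜 B)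
    (g := parT 𝒜 B ∘ₗ bmul 𝒜 B x) fun p q b hb a ha => ?_) y
  have hba : b ⊗ₜ[k] a ∈ gpts 𝒜 B ⊤ (p + q) := tmul_mem_gpts rfl hb trivial ha
  rw [LinearMap.comp_apply, LinearMap.comp_apply, parT_of_mem hba, map_smul,
    parT_of_mem (bmul_mem_gpts 𝒜 (zero_add _) hx hba)]

/-- At a Maurer-Cartan element, `d + ħ Δ + γ •` is conjugate to `d + ħ Δ` by `e^{γ / ħ}`, hence to
`d` if `Φ` conjugates `d + ħ Δ` to `d`. -/
theorem fibreIso_of_intertwiner (C : Contraction (cohGr 𝒜 X.d) 𝒜 X.d)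
    (hLL' : ∀ (T : B.carrier ⊗[k] A →ₗ[k] B.carrier ⊗[k] Coh X.d), ∀ f ∈ L,
      (fun n => T (f n)) ∈ L')
    (hL'L : ∀ (T : B.carrier ⊗[k] Coh X.d →ₗ[k] B.carrier ⊗[k] A), ∀ f ∈ L',
      (fun n => T (f n)) ∈ L)
    (hγ : γ ∈ pts 𝒜 B 0) (hcurv : curv 𝒜 X.d X.br B γ = 0)
    (Φ Ψ : Module.End k L) (h1 : Φ * Ψ = 1) (h2 : Ψ * Φ = 1)
    (hΦ : hdiff X hL * Φ = Φ * hL.op (oddExt B X.d))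
    (hW : ∀ W : Module.End k L, (hL.sh 1 * W = W * hL.sh 1) →
        (∀ S : A →ₗ[k] A, (∀ i, ∀ a ∈ 𝒜 i, S a ∈ 𝒜 i) →
          hL.op (S.lTensor B.carrier) * W = W * hL.op (S.lTensor B.carrier)) → Ψ * W = W * Ψ) :
    X.FibreIso B γ L L' := by
  have hev := pts_le_even B 0 hγ
  have hnil := hinv_nilpotent (𝒜 := 𝒜) hL (gpts_le_tens hγ)
  have hN := hdiff_nexp X hL hγ
  rw [hcurv, map_zero, map_zero] at hN
  have hcomm : ∀ W : Module.End k L, (hL.sh (-1) * W = W * hL.sh (-1)) →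
      (hL.op (bmul 𝒜 B γ) * W = W * hL.op (bmul 𝒜 B γ)) →
      nexp k (hinv (𝒜 := 𝒜) hL γ) * W = W * nexp k (hinv (𝒜 := 𝒜) hL γ) := by
    intro W ha hb
    exact nexp_commute (E := Module.End k L) hnil (Commute.mul_left ha hb)
  have e1 := mul_nexp_neg (k := k) (E := Module.End k L) hnil
  have e2 := nexp_neg_mul (k := k) (E := Module.End k L) hnil
  set P := nexp k (hinv (𝒜 := 𝒜) hL γ) with hP
  set P' := nexp k (-hinv (𝒜 := 𝒜) hL γ) with hP'
  clear_value P P'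
  have f1 : ∀ f, Φ (Ψ f) = f := fun f => LinearMap.congr_fun h1 f
  have f2 : ∀ f, Ψ (Φ f) = f := fun f => LinearMap.congr_fun h2 f
  have g1 : ∀ f, P (P' f) = f := fun f => LinearMap.congr_fun e1 f
  have g2 : ∀ f, P' (P f) = f := fun f => LinearMap.congr_fun e2 f
  have hΨ : ∀ f, Ψ (hdiff X hL f) = hL.op (oddExt B X.d) (Ψ f) := by
    intro f
    have := LinearMap.congr_fun hΦ (Ψ f)
    rw [Module.End.mul_apply, Module.End.mul_apply, f1] at this
    rw [this, f2]
  refine fibreIso_of_conjugation X hL C hLL' hL'L (hdiff X hL + hL.op (actOp X γ)) (Ψ * P) (P' * Φ)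
    ?_ ?_ ?_ ?_ ?_ ?_ ?_
  · intro f
    funext n
    change oddExt B X.d (f.1 n) + oddExt B X.Δ (f.1 (n - 1)) + actOp X γ (f.1 n) =
      oddExt B X.d (f.1 n) + oddExt B X.Δ (f.1 (n - 1)) + oddExt₂ B 𝒜 X.act γ (f.1 n)
    rw [act_even X hev, actOp_apply]
  · intro f
    rw [Module.End.mul_apply, Module.End.mul_apply, g1, f2]
  · intro f
    rw [Module.End.mul_apply, Module.End.mul_apply, f1, g2]
  · intro f
    have h3 := LinearMap.congr_fun hN f
    have h4 : hdiff X hL (P f) = P ((hdiff X hL + hL.op (actOp X γ)) f) := by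
      refine h3.trans ?_
      change P (_ + _) = P _
      congr 1
      exact (congrArg _ (map_zero (hL.sh (-1)))).trans (add_zero _)
    rw [Module.End.mul_apply, Module.End.mul_apply, ← h4, hΨ]
  · intro f
    have h3 := LinearMap.congr_fun (hcomm (hL.sh 1) (by
      rw [hL.sh_mul_sh, hL.sh_mul_sh]; rfl) (hL.sh_mul_op _ _).symm) f
    have h4 := LinearMap.congr_fun (hW (hL.sh 1) rfl fun S _ => (hL.sh_mul_op _ _).symm) (P f)
    exact (congrArg Ψ h3).trans h4
  · intro β f
    have h3 := LinearMap.congr_fun (hcomm (hL.op (lmul A B β)) (hL.sh_mul_op _ _) (by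
      ext f n
      exact bmul_lmul γ hev β (f.1 n))) f
    have h4 := LinearMap.congr_fun (hW (hL.op (lmul A B β)) (hL.sh_mul_op _ _) fun S _ => by
      ext f n
      change S.lTensor B.carrier (LinearMap.rTensor A (LinearMap.mulLeft k β) (f.1 n)) =
        LinearMap.rTensor A (LinearMap.mulLeft k β) (S.lTensor B.carrier (f.1 n))
      rw [← LinearMap.comp_apply, ← LinearMap.comp_apply, LinearMap.lTensor_comp_rTensor,
        LinearMap.rTensor_comp_lTensor]) (P f)
    exact (congrArg Ψ h3).trans h4
  · intro f
    have h3 := LinearMap.congr_fun (hcomm (hL.op (parT 𝒜 B)) (hL.sh_mul_op _ _) (by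
      ext f n
      exact bmul_parT γ hev (f.1 n))) f
    have h4 := LinearMap.congr_fun (hW (hL.op (parT 𝒜 B)) (hL.sh_mul_op _ _) fun S hS => by
      ext f n
      refine LinearMap.congr_fun (ext_homog 𝒜 B (f := S.lTensor B.carrier ∘ₗ parT 𝒜 B)
        (g := parT 𝒜 B ∘ₗ S.lTensor B.carrier) fun p q b hb a ha => ?_) (f.1 n)
      have h5 : b ⊗ₜ[k] a ∈ gpts 𝒜 B ⊤ (p + q) := tmul_mem_gpts rfl hb trivial ha
      rw [LinearMap.comp_apply, LinearMap.comp_apply, parT_of_mem h5, map_smul,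
        parT_of_mem (lTensor_mem_gpts (𝒲 := 𝒜) S hS h5)]) (P f)
    exact (congrArg Ψ h3).trans h4

/-- The fibres of the local system for Laurent series in `ħ`. -/
theorem fibreIso_laurent (hex : ∀ a, X.d (X.Δ a) = 0 → ∃ b, X.d b = X.Δ a)
    (hγ : γ ∈ pts 𝒜 B 0) (hcurv : curv 𝒜 X.d X.br B γ = 0) :
    X.FibreIso B γ (laurent k _) (laurent k _) := by
  obtain ⟨C, -⟩ := exists_contraction (𝒜 := 𝒜) X.d_odd X.d_sq
  obtain ⟨Φ, Ψ, h1, h2, h3, -, -, -, -, hW⟩ := exists_intertwiner X C hex B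
  have hm : ∀ {P Q : Type _} [AddCommGroup P] [Module k P] [AddCommGroup Q] [Module k Q]
      (T : P →ₗ[k] Q), ∀ f ∈ laurent k P, (fun n => T (f n)) ∈ laurent k Q := by
    rintro P Q _ _ _ _ T f ⟨N, hN⟩
    exact ⟨N, fun n hn => by simp [hN n hn]⟩
  exact fibreIso_of_intertwiner X shiftStable_laurent C hm hm hγ hcurv Φ Ψ h1 h2 h3 hW

/-- The fibres of the local system for series in `ħ` infinite in both directions. -/
theorem fibreIso_top (h₁ : ∀ a, X.Δ (X.d a) = 0 → ∃ b, X.d (X.Δ b) = X.d a)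
    (h₂ : ∀ a, X.d (X.Δ a) = 0 → ∃ b, X.d (X.Δ b) = X.Δ a)
    (hγ : γ ∈ pts 𝒜 B 0) (hcurv : curv 𝒜 X.d X.br B γ = 0) :
    X.FibreIso B γ ⊤ ⊤ := by
  obtain ⟨C, hCs, hCh⟩ := exists_contraction_compat (𝒜 := 𝒜) X.d_odd X.d_sq X.Δ_odd X.Δ_sq X.d_Δ
    h₁ h₂
  have hL : ShiftStable (⊤ : Submodule k (ℤ → B.carrier ⊗[k] A)) := shiftStable_top
  -- `ħ Δ h` has square zero, and `1 - ħ Δ h` conjugates `d + ħ Δ` to `d`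
  set N : Module.End k A := X.Δ ∘ₗ C.h with hN
  have hNN : ∀ a, N (N a) = 0 := by
    intro a
    change X.Δ (C.h (X.Δ (C.h a))) = 0
    rw [eq_neg_of_add_eq_zero_left (hCh (C.h a)), map_neg, X.Δ_sq, neg_zero]
  have hNΔ : ∀ a, N (X.Δ a) = 0 := by
    intro a
    change X.Δ (C.h (X.Δ a)) = 0
    rw [eq_neg_of_add_eq_zero_left (hCh a), map_neg, X.Δ_sq, neg_zero]
  have hΔN : ∀ a, X.Δ (N a) = 0 := fun a => X.Δ_sq _
  have hdN : ∀ a, X.d (N a) = N (X.d a) - X.Δ a := by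
    intro a
    change X.d (X.Δ (C.h a)) = X.Δ (C.h (X.d a)) - X.Δ a
    have h3 : X.Δ a = X.Δ (X.d (C.h a)) + X.Δ (C.h (X.d a)) := by
      conv_lhs => rw [← C.homotopy a, map_add, map_add, hCs, zero_add]
    rw [eq_neg_of_add_eq_zero_left (X.d_Δ (C.h a)), h3]
    abel
  set T : Module.End k (⊤ : Submodule k (ℤ → B.carrier ⊗[k] A)) :=
    hL.sh 1 * hL.op (N.lTensor B.carrier) with hT
  have hTT : T * T = 0 := by
    ext f n
    change N.lTensor B.carrier (N.lTensor B.carrier (f.1 (n - 1 - 1))) = 0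
    rw [← LinearMap.lTensor_comp_apply]
    exact lTensor_eq_zero hNN _
  have hTapp : ∀ (f : (⊤ : Submodule k (ℤ → B.carrier ⊗[k] A))) n,
      (T f).1 n = N.lTensor B.carrier (f.1 (n - 1)) := fun _ _ => rfl
  have habs : ∀ {E : Type (max u v)} [Ring E] (T : E), T * T = 0 →
      (1 + T) * (1 - T) = 1 ∧ (1 - T) * (1 + T) = 1 := by
    intro E _ T h
    constructor
    · rw [add_mul, one_mul, mul_sub, mul_one, h]; abel
    · rw [sub_mul, one_mul, mul_add, mul_one, h]; abel
  obtain ⟨i1, i2⟩ := habs T hTT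
  refine fibreIso_of_intertwiner X hL C (fun _ _ _ => trivial) (fun _ _ _ => trivial) hγ hcurv
    (1 + T) (1 - T) i1 i2 ?_ ?_
  · ext f n
    change oddExt B X.d (f.1 n + N.lTensor B.carrier (f.1 (n - 1))) +
      oddExt B X.Δ (f.1 (n - 1) + N.lTensor B.carrier (f.1 (n - 1 - 1))) =
      oddExt B X.d (f.1 n) + N.lTensor B.carrier (oddExt B X.d (f.1 (n - 1)))
    rw [map_add, map_add, oddExt_lTensor, oddExt_lTensor, lTensor_oddExt,
      show X.Δ ∘ₗ N = 0 from LinearMap.ext hΔN,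
      show X.d ∘ₗ N = N ∘ₗ X.d - X.Δ from LinearMap.ext hdN]
    have hsub : ∀ (S T : A →ₗ[k] A), oddExt B (S - T) = oddExt B S - oddExt B T := fun S T =>
      TensorProduct.ext' fun b a => by simp [oddExt, TensorProduct.tmul_sub]
    rw [hsub, oddExt, oddExt, oddExt, oddExt, TensorProduct.map_zero_right, LinearMap.zero_apply,
      LinearMap.sub_apply]
    abel
  · intro W hW1 hW2
    have h3 := hW2 N (fun i a ha => by
      have := X.Δ_odd _ _ (C.h_odd i a ha)
      rwa [add_assoc, show (1 : ZMod 2) + 1 = 0 from rfl, add_zero] at this)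
    have h4 : Commute T W := Commute.mul_left hW1 h3
    have hsub : ∀ {E : Type (max u v)} [Ring E] (T W : E), T * W = W * T →
        (1 - T) * W = W * (1 - T) := by
      intro E _ T W h
      rw [sub_mul, mul_sub, h, one_mul, mul_one]
    exact hsub T W h4

end Fibre

/-! ### Maurer-Cartan elements up to gauge -/

section Approximation

variable {k : Type u} [Field k] [CharZero k]
variable {A : Type v} [Ring A] [Algebra k A] {𝒜 : ZMod 2 → Submodule k A} [GradedAlgebra 𝒜]
  (X : DGBV 𝒜)
variable {M : Type v} [AddCommGroup M] [Module k M] {ℳ : ZMod 2 → Submodule k M}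
  [DirectSum.Decomposition ℳ]
variable {B : DGArtin k}

/-- The homomorphism `b ↦ b + η d b` of a dg Artin superalgebra. -/
def etaDiff (B : DGArtin k) : B.toArtinSuperalgebra.Hom B.toArtinSuperalgebra.eta :=
  etaDer B.toArtinSuperalgebra B.diff B.diff_odd B.leibniz

theorem baseMap_etaDiff {V : Type v} [AddCommGroup V] [Module k V] (x : B.carrier ⊗[k] V) :
    baseMap V (etaDiff B) x = baseMap V (etaInl B.toArtinSuperalgebra) x +
      (etaInr B.toArtinSuperalgebra).rTensor V (coeffDiff V B x) := by
  have h : (etaDiff B).toAlgHom.toLinearMap = (etaInl B.toArtinSuperalgebra).toAlgHom.toLinearMap +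
      etaInr B.toArtinSuperalgebra ∘ₗ B.diff := by
    ext b
    change etaMk b (B.diff b) = etaMk b 0 + etaMk 0 (B.diff b)
    rw [etaMk_add, add_zero, zero_add]
  rw [baseMap, h, LinearMap.rTensor_add, LinearMap.add_apply, LinearMap.rTensor_comp,
    LinearMap.comp_apply]
  rfl

variable {Γ : FormalMap ℳ 𝒜 0} {s : M →ₗ[k] A}

theorem HasLinearPart.coeffDiff_sub_mem (hs : HasLinearPart Γ s) {J J' : Submodule k B.carrier}
    (hJ : IsSuperIdeal B.toArtinSuperalgebra J) (h1 : B.maxIdeal * J ≤ J')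
    (x : pts ℳ B.toArtinSuperalgebra 0) (hx : coeffDiff M B x ∈ tens J M) :
    coeffDiff A B (Γ.app B.toArtinSuperalgebra x) - s.lTensor B.carrier (coeffDiff M B x) ∈
      tens J' A := by
  refine hs.eta_sub_mem hJ h1 x (gpts_of_tens (i := 1) hJ.homog hx (coeffDiff_mem_gpts B
    (J := ⊤) (fun _ _ => trivial) (by decide) x.2)) (ptsMap ℳ (etaDiff B) 0 x)
    (baseMap_etaDiff x.1) ?_
  rw [Γ.natural]
  exact baseMap_etaDiff _

theorem HasLinearPart.coeffDiff_eq_zero (hs : HasLinearPart Γ s)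
    (x : pts ℳ B.toArtinSuperalgebra 0) (hx : coeffDiff M B x = 0) :
    coeffDiff A B (Γ.app B.toArtinSuperalgebra x) = 0 := by
  have h := hs.coeffDiff_sub_mem (isSuperIdeal_bot _) (J' := ⊥) (by simp) x (by
    rw [hx]; exact Submodule.zero_mem _)
  rwa [hx, map_zero, sub_zero, tens_bot] at h

/-- The Maurer-Cartan element defined by a closed point. -/
def mcPoint (hs : HasLinearPart Γ s)
    (hcurv : ∀ (B : ArtinSuperalgebra k) (x : pts ℳ B 0), curv 𝒜 X.d X.br B (Γ.app B x) = 0)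
    (x : pts ℳ B.toArtinSuperalgebra 0) (hx : coeffDiff M B x = 0) : MC 𝒜 X.d X.br B :=
  ⟨Γ.app B.toArtinSuperalgebra x, by rw [hs.coeffDiff_eq_zero x hx, hcurv, add_zero]⟩

theorem oddExt_zero {V W : Type v} [AddCommGroup V] [Module k V] [AddCommGroup W] [Module k W]
    (B : ArtinSuperalgebra k) {T : V →ₗ[k] W} (hT : ∀ x, T x = 0) (x : B.carrier ⊗[k] V) :
    oddExt B T x = 0 := by
  rw [oddExt, show T = 0 from LinearMap.ext hT, TensorProduct.map_zero_right,
    LinearMap.zero_apply]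

/-- To first order, the gauge transformation by `g` is subtraction of `(d + d_B) g`. -/
theorem exists_gauge_sub_mem {J J' : Submodule k B.carrier}
    (hJ : IsSuperIdeal B.toArtinSuperalgebra J) (hJ' : IsSuperIdeal B.toArtinSuperalgebra J')
    (h1 : B.maxIdeal * J ≤ J') (γ : MC 𝒜 X.d X.br B) {g : B.carrier ⊗[k] A}
    (hg : g ∈ gpts 𝒜 B.toArtinSuperalgebra J 1) :
    ∃ γ' : MC 𝒜 X.d X.br B,
      (∀ᶠ N in Filter.atTop, (γ'.1 : B.carrier ⊗[k] A) = gaugeSum 𝒜 X.d X.br B g γ.1 N) ∧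
      (γ'.1 : B.carrier ⊗[k] A) - (γ.1 - totalD X B g) ∈ tens J' A := by
  have h2 : J * B.maxIdeal ≤ J' := by
    rwa [hJ.homog.mul_comm (homog_maxIdeal _)]
  have hgm : g ∈ pts 𝒜 B.toArtinSuperalgebra 1 := gpts_mono hJ.le_max 1 hg
  obtain ⟨γ', hγ'⟩ := exists_gauge X γ ⟨g, hgm⟩
  refine ⟨γ', hγ', ?_⟩
  obtain ⟨N, hN⟩ := Filter.eventually_atTop.1 hγ'
  rw [hN (N + 1) N.le_succ, gaugeSum_eq]
  have had : ∀ y ∈ tens B.maxIdeal A,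
      oddExt₂ B.toArtinSuperalgebra 𝒜 X.br g y ∈ tens J' A := fun y hy =>
    oddExt₂_mem_tens 𝒜 X.br (homog_maxIdeal _) h2 (gpts_le_tens hg) hy
  refine affineExp_sub_mem (tens J' A) _ _ _ (fun a ha => had a (tens_mono hJ'.le_max ha))
    (had _ (gpts_le_tens γ.1.2))
    (had _ (gpts_le_tens (totalD_mem_pts X (j := 0) (by decide) hgm))) N

variable (C : Contraction ℳ 𝒜 X.d)

/-- One step of the approximation of a Maurer-Cartan element by a point of the mini-versal
family. -/
theorem approximation_step (hs : HasLinearPart Γ C.s)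
    (hcurv : ∀ (B : ArtinSuperalgebra k) (x : pts ℳ B 0), curv 𝒜 X.d X.br B (Γ.app B x) = 0)
    {J : Submodule k B.carrier} (hJ : IsSuperIdeal B.toArtinSuperalgebra J)
    (γ : MC 𝒜 X.d X.br B) (x : pts ℳ B.toArtinSuperalgebra 0)
    (hγ : (γ.1 : B.carrier ⊗[k] A) - Γ.app B.toArtinSuperalgebra x ∈ tens J A)
    (hx : coeffDiff M B x ∈ tens J M) :
    ∃ (γ' : MC 𝒜 X.d X.br B) (x' : pts ℳ B.toArtinSuperalgebra 0),
      GaugeRel 𝒜 X.d X.br B γ γ' ∧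
      (γ'.1 : B.carrier ⊗[k] A) - Γ.app B.toArtinSuperalgebra x' ∈ tens (B.maxIdeal * J) A ∧
      coeffDiff M B x' ∈ tens (B.maxIdeal * J) M ∧
      (x' : B.carrier ⊗[k] M) - x ∈ tens J M := by
  set J' := B.maxIdeal * J with hJ'
  have h2 : J * B.maxIdeal ≤ J' := by rw [hJ.homog.mul_comm (homog_maxIdeal _)]
  have hJi : IsSuperIdeal B.toArtinSuperalgebra J' := hJ.maxIdeal_mul
  set γx := Γ.app B.toArtinSuperalgebra x with hγx
  set δ := (γ.1 : B.carrier ⊗[k] A) - γx with hδ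
  have hδJ : δ ∈ gpts 𝒜 B.toArtinSuperalgebra J 0 :=
    gpts_of_tens hJ.homog hγ (Submodule.sub_mem _ γ.1.2 γx.2)
  have hδm : δ ∈ tens B.maxIdeal A := tens_mono hJ.le_max hγ
  -- the Maurer-Cartan equations of `γ` and `Γ(x)`, modulo `J'`
  have hMC : coeffDiff A B δ + oddExt B.toArtinSuperalgebra X.d δ +
      C.s.lTensor B.carrier (coeffDiff M B x) ∈ tens J' A := by
    have e1 := hs.coeffDiff_sub_mem hJ le_rfl x hx
    have e2 := γ.2
    have e3 := hcurv _ x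
    rw [← hγx] at e1 e3
    rw [curv] at e2 e3
    have e4 : oddExt₂ B.toArtinSuperalgebra 𝒜 X.br γ.1 γ.1 -
        oddExt₂ B.toArtinSuperalgebra 𝒜 X.br γx γx ∈ tens J' A := by
      have e5 : oddExt₂ B.toArtinSuperalgebra 𝒜 X.br γ.1.1 γ.1 -
          oddExt₂ B.toArtinSuperalgebra 𝒜 X.br γx.1 γx =
          oddExt₂ B.toArtinSuperalgebra 𝒜 X.br δ γ.1 +
          oddExt₂ B.toArtinSuperalgebra 𝒜 X.br γx.1 δ := by
        rw [hδ, map_sub, map_sub, LinearMap.sub_apply]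
        abel
      rw [e5]
      exact Submodule.add_mem _
        (oddExt₂_mem_tens 𝒜 X.br (homog_maxIdeal _) h2 hγ (gpts_le_tens γ.1.2))
        (oddExt₂_mem_tens 𝒜 X.br hJ.homog le_rfl (gpts_le_tens γx.2) hγ)
    have e6 : coeffDiff A B δ + oddExt B.toArtinSuperalgebra X.d δ +
        C.s.lTensor B.carrier (coeffDiff M B x) =
        -(coeffDiff A B γx.1 - C.s.lTensor B.carrier (coeffDiff M B x)) -
        (2 : k)⁻¹ • (oddExt₂ B.toArtinSuperalgebra 𝒜 X.br γ.1.1 γ.1 -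
          oddExt₂ B.toArtinSuperalgebra 𝒜 X.br γx.1 γx) := by
      have e7 : coeffDiff A B δ = coeffDiff A B γ.1.1 - coeffDiff A B γx.1 := map_sub _ _ _
      have e8 : oddExt B.toArtinSuperalgebra X.d δ = oddExt B.toArtinSuperalgebra X.d γ.1.1 -
          oddExt B.toArtinSuperalgebra X.d γx.1 := map_sub _ _ _
      rw [e7, e8, eq_neg_of_add_eq_zero_left e2, eq_neg_of_add_eq_zero_left e3, smul_sub]
      abel
    rw [e6]
    exact Submodule.sub_mem _ (Submodule.neg_mem _ e1) (Submodule.smul_mem _ _ e4)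
  have hpm : C.p.lTensor B.carrier δ ∈ gpts ℳ B.toArtinSuperalgebra J 0 :=
    lTensor_mem_gpts C.p C.p_even hδJ
  let x' : pts ℳ B.toArtinSuperalgebra 0 :=
    ⟨x + C.p.lTensor B.carrier δ, Submodule.add_mem _ x.2 (gpts_mono hJ.le_max 0 hpm)⟩
  have hx'x : (x' : B.carrier ⊗[k] M) - x = C.p.lTensor B.carrier δ := add_sub_cancel_left _ _
  -- the gauge transformation by `h δ` removes the part of `δ` outside the image of `s`
  have hg : oddExt B.toArtinSuperalgebra C.h δ ∈ gpts 𝒜 B.toArtinSuperalgebra J 1 :=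
    oddExt_mem_gpts C.h (by decide) C.h_odd hδJ
  obtain ⟨γ', hγγ', hγ'⟩ := exists_gauge_sub_mem X hJ hJi le_rfl γ hg
  refine ⟨γ', x', ⟨⟨_, gpts_mono hJ.le_max 1 hg⟩, hγγ'⟩, ?_, ?_, ?_⟩
  · have e1 := hs.sub_mem hJ le_rfl h2 x x' (by rw [hx'x]; exact hpm)
    rw [hx'x, ← hγx] at e1
    have e2 := oddExt_mem_tens (B := B.toArtinSuperalgebra) hJi.homog C.h hMC
    rw [map_add, map_add, oddExt_lTensor, oddExt_zero (T := C.h ∘ₗ C.s) _ C.h_s, add_zero] at e2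
    have e3 : totalD X B (oddExt B.toArtinSuperalgebra C.h δ) =
        δ - C.s.lTensor B.carrier (C.p.lTensor B.carrier δ) -
        (oddExt B.toArtinSuperalgebra C.h (coeffDiff A B δ) +
          oddExt B.toArtinSuperalgebra C.h (oddExt B.toArtinSuperalgebra X.d δ)) := by
      have e4 := C.lTensor_homotopy X B.toArtinSuperalgebra δ
      have e5 : totalD X B (oddExt B.toArtinSuperalgebra C.h δ) =
        oddExt B.toArtinSuperalgebra X.d (oddExt B.toArtinSuperalgebra C.h δ) +
        coeffDiff A B (oddExt B.toArtinSuperalgebra C.h δ) := rfl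
      rw [e5, coeffDiff_oddExt]
      nth_rewrite 3 [← e4]
      abel
    have e6 : (γ'.1 : B.carrier ⊗[k] A) - Γ.app B.toArtinSuperalgebra x' =
        ((γ'.1 : B.carrier ⊗[k] A) - (γ.1 - totalD X B (oddExt B.toArtinSuperalgebra C.h δ))) -
        ((Γ.app B.toArtinSuperalgebra x' : B.carrier ⊗[k] A) - γx -
          C.s.lTensor B.carrier (C.p.lTensor B.carrier δ)) +
        (oddExt B.toArtinSuperalgebra C.h (coeffDiff A B δ) +
          oddExt B.toArtinSuperalgebra C.h (oddExt B.toArtinSuperalgebra X.d δ)) := by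
      rw [e3, hδ]
      abel
    rw [e6]
    exact Submodule.add_mem _ (Submodule.sub_mem _ hγ' e1) e2
  · have e1 := lTensor_mem_tens C.p hMC
    rw [map_add, map_add, C.lTensor_p_d, add_zero, C.lTensor_p_s X B.toArtinSuperalgebra,
      ← coeffDiff_lTensor, ← map_add, add_comm] at e1
    exact e1
  · rw [hx'x]
    exact gpts_le_tens hpm

/-- A Maurer-Cartan element which is congruent modulo `J` to the value of the mini-versal family
at a point `x`, closed modulo `J`, is gauge equivalent to its value at a closed point congruent
to `x`. -/
theorem exists_closed_point (hs : HasLinearPart Γ C.s)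
    (hcurv : ∀ (B : ArtinSuperalgebra k) (x : pts ℳ B 0), curv 𝒜 X.d X.br B (Γ.app B x) = 0)
    {J : Submodule k B.carrier} (hJ : IsSuperIdeal B.toArtinSuperalgebra J)
    (γ : MC 𝒜 X.d X.br B) (x : pts ℳ B.toArtinSuperalgebra 0)
    (hγ : (γ.1 : B.carrier ⊗[k] A) - Γ.app B.toArtinSuperalgebra x ∈ tens J A)
    (hx : coeffDiff M B x ∈ tens J M) :
    ∃ (x' : pts ℳ B.toArtinSuperalgebra 0) (hx' : coeffDiff M B x' = 0),
      (x' : B.carrier ⊗[k] M) - x ∈ tens J M ∧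
      (Quot.mk _ γ : Def 𝒜 X.d X.br B) = Quot.mk _ (mcPoint X hs hcurv x' hx') := by
  have key : ∀ n : ℕ, ∃ (γ' : MC 𝒜 X.d X.br B) (x' : pts ℳ B.toArtinSuperalgebra 0),
      (Quot.mk _ γ : Def 𝒜 X.d X.br B) = Quot.mk _ γ' ∧
      (γ'.1 : B.carrier ⊗[k] A) - Γ.app B.toArtinSuperalgebra x' ∈
        tens (B.maxIdeal ^ n * J) A ∧
      coeffDiff M B x' ∈ tens (B.maxIdeal ^ n * J) M ∧
      (x' : B.carrier ⊗[k] M) - x ∈ tens J M := by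
    intro n
    induction n with
    | zero =>
      rw [pow_zero, one_mul]
      exact ⟨γ, x, rfl, hγ, hx, by rw [sub_self]; exact Submodule.zero_mem _⟩
    | succ n ih =>
      obtain ⟨γ', x', h1, h2, h3, h4⟩ := ih
      obtain ⟨γ'', x'', h5, h6, h7, h8⟩ :=
        approximation_step X C hs hcurv (hJ.pow_mul n) γ' x' h2 h3
      rw [← mul_assoc, ← pow_succ'] at h6 h7
      refine ⟨γ'', x'', h1.trans (Quot.sound h5), h6, h7, ?_⟩
      rw [← sub_add_sub_cancel _ (x' : B.carrier ⊗[k] M)]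
      refine Submodule.add_mem _ (tens_mono ?_ h8) h4
      clear h2 h3 h6 h7 h8
      induction n with
      | zero => rw [pow_zero, one_mul]
      | succ n ih =>
        rw [pow_succ', mul_assoc]
        exact (hJ.pow_mul n).maxIdeal_mul_le.trans ih
  obtain ⟨N, hN⟩ := B.nilpotent
  obtain ⟨γ', x', h1, h2, h3, h4⟩ := key N
  rw [show B.maxIdeal ^ N = ⊥ from hN, Submodule.bot_mul, tens_bot] at h2 h3
  have h3' : coeffDiff M B x' = 0 := h3
  refine ⟨x', h3', h4, h1.trans (congrArg _ ?_)⟩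
  exact Subtype.ext (Subtype.ext (sub_eq_zero.1 h2))

end Approximation

/-! ### Powers of the maximal ideal -/

section Powers

variable {k : Type u} [Field k] [CharZero k] (B : ArtinSuperalgebra k)

/-- The powers of the maximal ideal, the zeroth power being the whole algebra. -/
def powIdeal (n : ℕ) : Submodule k B.carrier := B.maxIdeal ^ n * ⊤

variable {B}

theorem powIdeal_zero : powIdeal B 0 = ⊤ := by
  rw [powIdeal, pow_zero, one_mul]

theorem powIdeal_succ (n : ℕ) : powIdeal B (n + 1) = B.maxIdeal * powIdeal B n := by
  rw [powIdeal, powIdeal, pow_succ', mul_assoc]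

theorem powIdeal_one : powIdeal B 1 = B.maxIdeal := by
  rw [powIdeal_succ, powIdeal_zero]
  refine le_antisymm (maxIdeal_mul_le _) fun a ha => ?_
  rw [← mul_one a]
  exact Submodule.mul_mem_mul ha trivial

theorem homog_powIdeal (n : ℕ) : Homog B (powIdeal B n) := (homog_pow B n).mul (homog_top B)

theorem powIdeal_anti (n : ℕ) : powIdeal B (n + 1) ≤ powIdeal B n := by
  rw [powIdeal, powIdeal, pow_succ, mul_assoc]
  exact mul_le_mul' le_rfl le_top

theorem mul_mem_powIdeal {i j : ℕ} {a b : B.carrier} (ha : a ∈ powIdeal B i)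
    (hb : b ∈ powIdeal B j) : a * b ∈ powIdeal B (i + j) := by
  have h : powIdeal B i * powIdeal B j ≤ powIdeal B (i + j) := by
    rw [powIdeal, powIdeal, powIdeal, pow_add, mul_assoc, ← mul_assoc ⊤,
      (homog_top B).mul_comm (homog_pow B j), mul_assoc, mul_assoc]
    exact mul_le_mul' le_rfl (mul_le_mul' le_rfl le_top)
  exact h (Submodule.mul_mem_mul ha hb)

theorem powIdeal_le (n : ℕ) : powIdeal B (n + 1) ≤ B.maxIdeal := by
  rw [powIdeal_succ]
  exact maxIdeal_mul_le _

theorem exists_powIdeal_eq_bot (B : ArtinSuperalgebra k) : ∃ N, ∀ n, N ≤ n → powIdeal B n = ⊥ := by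
  obtain ⟨N, hN⟩ := B.nilpotent
  refine ⟨N, fun n hn => ?_⟩
  obtain ⟨m, rfl⟩ := Nat.exists_eq_add_of_le hn
  rw [powIdeal, pow_add, show B.maxIdeal ^ N = ⊥ from hN, Submodule.bot_mul, Submodule.bot_mul]

theorem diff_mem_powIdeal (B : DGArtin k) (n : ℕ) :
    ∀ b ∈ powIdeal B.toArtinSuperalgebra n, B.diff b ∈ powIdeal B.toArtinSuperalgebra n := by
  induction n with
  | zero => intro b _; rw [powIdeal_zero]; trivial
  | succ n ih =>
    have : powIdeal B.toArtinSuperalgebra (n + 1) ≤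
        (powIdeal B.toArtinSuperalgebra (n + 1)).comap B.diff := by
      conv_lhs => rw [powIdeal_succ]
      rw [Submodule.mul_le]
      intro a ha b hb
      rw [Submodule.mem_comap, B.leibniz, powIdeal_succ]
      exact Submodule.add_mem _ (Submodule.mul_mem_mul (diff_mem_maxIdeal B a) hb)
        (Submodule.mul_mem_mul ((homog_maxIdeal _).par_mem ha) (ih b hb))
    exact this

end Powers

/-! ### The path algebra of a dg Artin superalgebra -/

section PathAlgebra

open Polynomial

variable {k : Type u} [Field k]

theorem coeff_sum_monomial {R : Type*} [Ring R] [Algebra k R] (T : ℕ → R →ₗ[k] R) (f : R[X])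
    (n : ℕ) : (∑ i ∈ f.support, monomial i (T i (f.coeff i))).coeff n = T n (f.coeff n) := by
  simp only [finsetSum_coeff, coeff_monomial]
  simp +contextual

/-- The coefficientwise action of linear maps on polynomials. -/
def coeffMap {R : Type*} [Ring R] [Algebra k R] (T : ℕ → R →ₗ[k] R) : R[X] →ₗ[k] R[X] where
  toFun f := ∑ i ∈ f.support, monomial i (T i (f.coeff i))
  map_add' f g := by
    ext n
    rw [coeff_add, coeff_sum_monomial, coeff_sum_monomial, coeff_sum_monomial, coeff_add, map_add]
  map_smul' c f := by
    ext n
    rw [RingHom.id_apply, coeff_smul, coeff_sum_monomial, coeff_sum_monomial, coeff_smul, map_smul]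

theorem coeff_coeffMap {R : Type*} [Ring R] [Algebra k R] (T : ℕ → R →ₗ[k] R) (f : R[X]) (n : ℕ) :
    (coeffMap T f).coeff n = T n (f.coeff n) := coeff_sum_monomial T f n

theorem coeff_mul_mem {R : Type*} [Ring R] [Algebra k R] {S T U : ℕ → Submodule k R}
    (h : ∀ i j, ∀ a ∈ S i, ∀ b ∈ T j, a * b ∈ U (i + j)) {f g : R[X]} (hf : ∀ i, f.coeff i ∈ S i)
    (hg : ∀ i, g.coeff i ∈ T i) (n : ℕ) : (f * g).coeff n ∈ U n := by
  rw [coeff_mul]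
  refine Submodule.sum_mem _ fun p hp => ?_
  rw [← Finset.HasAntidiagonal.mem_antidiagonal.1 hp]
  exact h _ _ _ (hf _) _ (hg _)

variable [CharZero k] {B : ArtinSuperalgebra k}

theorem etaFst_mul (x y : B.eta.carrier) : etaFst B (x * y) = etaFst B x * etaFst B y := rfl

theorem etaSnd_mul (x y : B.eta.carrier) :
    etaSnd B (x * y) = par B.gr (etaFst B x) * etaSnd B y + etaSnd B x * etaFst B y := rfl

theorem eta_ext {x y : B.eta.carrier} (h1 : etaFst B x = etaFst B y)
    (h2 : etaSnd B x = etaSnd B y) : x = y := Prod.ext h1 h2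

theorem etaFst_par (x : B.eta.carrier) : etaFst B (par B.eta.gr x) = par B.gr (etaFst B x) := by
  rw [← etaMk_eta x, par_etaMk]; rfl

theorem etaSnd_par (x : B.eta.carrier) : etaSnd B (par B.eta.gr x) = -par B.gr (etaSnd B x) := by
  rw [← etaMk_eta x, par_etaMk]; rfl

variable (B) in
/-- The elements `a + η b` of `B[η]` with `a ∈ m ^ i` and `b ∈ m ^ j`. -/
def etaPow (i j : ℕ) : Submodule k B.eta.carrier :=
  (powIdeal B i).comap (etaFst B) ⊓ (powIdeal B j).comap (etaSnd B)

theorem mem_etaPow {i j : ℕ} {x : B.eta.carrier} :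
    x ∈ etaPow B i j ↔ etaFst B x ∈ powIdeal B i ∧ etaSnd B x ∈ powIdeal B j := Iff.rfl

theorem mul_mem_etaPow {i j i' j' : ℕ} (h : i + j' = j + i') {a b : B.eta.carrier}
    (ha : a ∈ etaPow B i j) (hb : b ∈ etaPow B i' j') : a * b ∈ etaPow B (i + i') (i + j') := by
  refine ⟨?_, ?_⟩
  · exact mul_mem_powIdeal ha.1 hb.1
  · refine Submodule.add_mem _ (mul_mem_powIdeal ((homog_powIdeal _).par_mem ha.1) hb.2) ?_
    rw [h]
    exact mul_mem_powIdeal ha.2 hb.1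

theorem par_mem_etaPow {i j : ℕ} {a : B.eta.carrier} (ha : a ∈ etaPow B i j) :
    par B.eta.gr a ∈ etaPow B i j := by
  rw [mem_etaPow, etaFst_par, etaSnd_par]
  exact ⟨(homog_powIdeal _).par_mem ha.1,
    Submodule.neg_mem _ ((homog_powIdeal _).par_mem ha.2)⟩

theorem coeff_mul_mem_etaPow {f g : B.eta.carrier[X]} (hf : ∀ i, f.coeff i ∈ etaPow B i (i + 1))
    (hg : ∀ i, g.coeff i ∈ etaPow B i (i + 1)) (n : ℕ) : (f * g).coeff n ∈ etaPow B n (n + 1) := by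
  refine coeff_mul_mem (k := k) (S := fun i => etaPow B i (i + 1))
    (T := fun i => etaPow B i (i + 1)) (U := fun i => etaPow B i (i + 1)) ?_ hf hg n
  intro i j a ha b hb
  have h := mul_mem_etaPow (by lia) ha hb
  rwa [← add_assoc] at h

variable (B) in
/-- The polynomials `∑ (aᵢ + η bᵢ) tⁱ` with `aᵢ ∈ m ^ i` and `bᵢ ∈ m ^ (i + 1)`. -/
def pathSub : Subalgebra k B.eta.carrier[X] where
  carrier := {f | ∀ i, f.coeff i ∈ etaPow B i (i + 1)}
  mul_mem' hf hg := coeff_mul_mem_etaPow hf hg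
  add_mem' := by
    intro f g hf hg i
    rw [coeff_add]
    exact Submodule.add_mem _ (hf i) (hg i)
  algebraMap_mem' := by
    intro c i
    rw [Polynomial.algebraMap_apply, coeff_C]
    split_ifs with h
    · subst h
      rw [mem_etaPow]
      refine ⟨?_, ?_⟩
      · rw [powIdeal_zero]; trivial
      · rw [Algebra.algebraMap_eq_smul_one]
        exact Submodule.smul_mem _ _ (Submodule.zero_mem _)
    · exact Submodule.zero_mem _

variable (B) in
/-- The parity involution on polynomials with coefficients in `B[η]`. -/
def polyPar : B.eta.carrier[X] →ₐ[k] B.eta.carrier[X] := mapAlgHom (parHom B.eta.gr)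

theorem coeff_polyPar (f : B.eta.carrier[X]) (n : ℕ) :
    (polyPar B f).coeff n = par B.eta.gr (f.coeff n) := by
  rw [polyPar, coe_mapAlgHom, coeff_map]
  rfl

variable (B) in
/-- The augmentation on polynomials with coefficients in `B[η]`. -/
def polyAug : B.eta.carrier[X] →ₐ[k] k :=
  AlgHom.ofLinearMap
    { toFun := fun f => B.eta.aug (f.coeff 0)
      map_add' := fun f g => by rw [coeff_add, map_add]
      map_smul' := fun c f => by rw [coeff_smul, map_smul, RingHom.id_apply] }
    (by
      change B.eta.aug ((1 : B.eta.carrier[X]).coeff 0) = 1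
      rw [coeff_one_zero, map_one])
    (fun f g => by
      change B.eta.aug ((f * g).coeff 0) = B.eta.aug (f.coeff 0) * B.eta.aug (g.coeff 0)
      rw [mul_coeff_zero, map_mul])

theorem coeff_mem_of_polyAug {f : B.eta.carrier[X]} (hf : f ∈ pathSub B) (h : polyAug B f = 0)
    (i : ℕ) : f.coeff i ∈ etaPow B 1 1 := by
  have hf := hf i
  rw [mem_etaPow, powIdeal_one]
  cases i with
  | zero => exact ⟨h, powIdeal_le _ hf.2⟩
  | succ i => exact ⟨powIdeal_le i hf.1, powIdeal_le _ hf.2⟩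

theorem etaPow_eq_bot {i j : ℕ} (hi : powIdeal B i = ⊥) (hj : powIdeal B j = ⊥) :
    etaPow B i j = ⊥ := by
  rw [eq_bot_iff]
  intro x hx
  rw [mem_etaPow, hi, hj] at hx
  exact eta_ext hx.1 hx.2

variable (B) in
theorem finite_pathSub : FiniteDimensional k (pathSub B) := by
  obtain ⟨N, hN⟩ := exists_powIdeal_eq_bot B
  let φ : pathSub B →ₗ[k] (Fin N → B.eta.carrier) :=
    { toFun := fun f i => f.1.coeff i
      map_add' := fun f g => funext fun i => coeff_add _ _ _
      map_smul' := fun c f => funext fun i => coeff_smul _ _ _ }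
  refine FiniteDimensional.of_injective φ fun f g h => Subtype.ext (Polynomial.ext fun i => ?_)
  by_cases hi : i < N
  · exact congrFun h ⟨i, hi⟩
  · have hi' : N ≤ i := not_lt.1 hi
    have h0 := etaPow_eq_bot (hN i hi') (hN (i + 1) (by lia))
    have hf := f.2 i
    have hg := g.2 i
    rw [h0, Submodule.mem_bot] at hf hg
    rw [hf, hg]

theorem coeff_mem_pow (n : ℕ) {f : B.eta.carrier[X]}
    (hf : f ∈ (LinearMap.ker (polyAug B).toLinearMap ⊓ Subalgebra.toSubmodule (pathSub B)) ^ n)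
    (i : ℕ) : f.coeff i ∈ etaPow B n n := by
  induction n generalizing f i with
  | zero =>
    rw [mem_etaPow, powIdeal_zero]
    exact ⟨trivial, trivial⟩
  | succ n ih =>
    rw [pow_succ'] at hf
    induction hf using Submodule.mul_induction_on' with
    | mem_mul_mem a ha b hb =>
      rw [add_comm]
      exact coeff_mul_mem (S := fun _ => etaPow B 1 1) (T := fun _ => etaPow B n n)
        (U := fun _ => etaPow B (1 + n) (1 + n))
        (fun i j a ha b hb => mul_mem_etaPow rfl ha hb)
        (coeff_mem_of_polyAug ha.2 ha.1) (fun i => ih hb i) i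
    | add x _ y _ hx hy =>
      rw [coeff_add]
      exact Submodule.add_mem _ hx hy

variable (B) in
/-- The underlying Artin superalgebra of the path algebra of `B`. It is a subalgebra of the
algebra of polynomial differential forms on the line with values in `B`, the variable `η`
standing for `dt`; the condition on the coefficients makes it finite-dimensional and local. -/
def ArtinSuperalgebra.path : ArtinSuperalgebra k :=
  ArtinSuperalgebra.ofSubalgebra (polyPar B)
    (fun f => by
      ext n : 1
      rw [coeff_polyPar, coeff_polyPar, par_par])
    (fun i j f g hf hg => by
      have h : ∀ {i : ZMod 2} {f : B.eta.carrier[X]}, polyPar B f = (-1 : k) ^ i.val • f →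
          ∀ n, f.coeff n ∈ B.eta.gr i := by
        intro i f hf n
        apply mem_of_par
        rw [← coeff_polyPar, hf, coeff_smul]
      ext n : 1
      rw [coeff_smul, coeff_mul, coeff_mul, ← Finset.Nat.sum_antidiagonal_swap, Finset.smul_sum]
      exact Finset.sum_congr rfl fun p _ => B.eta.supercomm i j _ (h hf _) _ (h hg _))
    (pathSub B)
    (fun f hf n => by
      rw [coeff_polyPar]
      exact par_mem_etaPow (hf n))
    (finite_pathSub B) (polyAug B)
    (by
      obtain ⟨N, hN⟩ := exists_powIdeal_eq_bot B
      refine ⟨N, ?_⟩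
      rw [eq_bot_iff]
      intro f hf
      refine Polynomial.ext fun i => ?_
      have := coeff_mem_pow N hf i
      rwa [etaPow_eq_bot (hN N le_rfl) (hN N le_rfl)] at this)

theorem mem_path_gr {i : ZMod 2} (f : pathSub B) :
    f ∈ B.path.gr i ↔ ∀ n, f.1.coeff n ∈ B.eta.gr i := by
  refine (mem_ofSubalgebra_gr f).trans ⟨fun h n => ?_, fun h => ?_⟩
  · apply mem_of_par
    rw [← coeff_polyPar, h, coeff_smul]
  · ext n : 1
    rw [coeff_polyPar, coeff_smul, par_of_mem _ (h n)]

theorem par_path (f : pathSub B) : (par B.path.gr f : pathSub B).1 = polyPar B f.1 :=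
  congrArg Subtype.val (par_ofSubalgebra f)

end PathAlgebra

/-! ### The differential of the path algebra -/

section PathDG

open Polynomial

variable {k : Type u} [Field k] [CharZero k] {B : DGArtin k}

/-- The differential `a + η b ↦ d a - η d b` of `B[η]`. -/
def etaD (B : DGArtin k) : B.toArtinSuperalgebra.eta.carrier →ₗ[k]
    B.toArtinSuperalgebra.eta.carrier :=
  (LinearMap.prodMap B.diff (-B.diff) : B.carrier × B.carrier →ₗ[k] B.carrier × B.carrier)

theorem etaFst_etaD (x : B.toArtinSuperalgebra.eta.carrier) :
    etaFst _ (etaD B x) = B.diff (etaFst _ x) := rfl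

theorem etaSnd_etaD (x : B.toArtinSuperalgebra.eta.carrier) :
    etaSnd _ (etaD B x) = -B.diff (etaSnd _ x) := rfl

theorem par_diff (B : DGArtin k) (b : B.carrier) :
    par B.gr (B.diff b) = -B.diff (par B.gr b) := by
  rw [par_comm B.gr B.gr B.diff 1 B.diff_odd, zmod2_val_one, pow_one, neg_one_smul]

theorem etaD_mul (x y : B.toArtinSuperalgebra.eta.carrier) :
    etaD B (x * y) = etaD B x * y + par (B.toArtinSuperalgebra.eta).gr x * etaD B y := by
  apply eta_ext
  · rw [map_add, etaFst_etaD, etaFst_mul, etaFst_mul, etaFst_mul, etaFst_par, etaFst_etaD,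
      etaFst_etaD, B.leibniz]
  · rw [map_add, etaSnd_etaD, etaSnd_mul, etaSnd_mul, etaSnd_mul, etaFst_par, etaSnd_par,
      etaFst_etaD, etaFst_etaD, etaSnd_etaD, etaSnd_etaD, map_add, B.leibniz, B.leibniz,
      par_diff, par_par]
    noncomm_ring

theorem etaD_mem_gr {i : ZMod 2} {x : B.toArtinSuperalgebra.eta.carrier}
    (hx : x ∈ (B.toArtinSuperalgebra.eta).gr i) :
    etaD B x ∈ (B.toArtinSuperalgebra.eta).gr (i + 1) := by
  have h := etaMk_mem_gr.1 hx
  exact etaMk_mem_gr.2 ⟨B.diff_odd _ _ h.1, Submodule.neg_mem _ (B.diff_odd _ _ h.2)⟩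

/-- The odd variable `η`. -/
def etaVar (B : ArtinSuperalgebra k) : B.eta.carrier := etaMk 0 1

theorem etaVar_mul {B : ArtinSuperalgebra k} (x : B.eta.carrier) :
    etaVar B * x = etaMk 0 (etaFst B x) := by
  apply eta_ext
  · rw [etaFst_mul]; exact zero_mul _
  · rw [etaSnd_mul]
    change par B.gr 0 * etaSnd B x + 1 * etaFst B x = etaFst B x
    rw [map_zero, zero_mul, zero_add, one_mul]

theorem par_mul_etaVar {B : ArtinSuperalgebra k} (x : B.eta.carrier) :
    par B.eta.gr x * etaVar B = etaVar B * x := by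
  rw [etaVar_mul]
  apply eta_ext
  · rw [etaFst_mul]; exact mul_zero _
  · rw [etaSnd_mul, etaFst_par, par_par]
    change etaFst B x * 1 + _ * 0 = etaFst B x
    rw [mul_one, mul_zero, add_zero]

/-- The differential `d + dt ∂/∂t` of the polynomials with coefficients in `B[η]`, where `η`
stands for `dt`. -/
def pathD (B : DGArtin k) : B.toArtinSuperalgebra.eta.carrier[X] →ₗ[k]
    B.toArtinSuperalgebra.eta.carrier[X] where
  toFun f := coeffMap (fun _ => etaD B) f + C (etaVar B.toArtinSuperalgebra) * derivative f
  map_add' f g := by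
    rw [map_add, map_add, mul_add]
    abel
  map_smul' c f := by
    rw [map_smul, derivative_smul, RingHom.id_apply, smul_add, mul_smul_comm]

theorem pathD_apply (f : B.toArtinSuperalgebra.eta.carrier[X]) :
    pathD B f =
      coeffMap (fun _ => etaD B) f + C (etaVar B.toArtinSuperalgebra) * derivative f := rfl

theorem coeff_pathD (f : B.toArtinSuperalgebra.eta.carrier[X]) (n : ℕ) : (pathD B f).coeff n =
    etaD B (f.coeff n) + ((n + 1 : ℕ) : k) • etaMk 0 (etaFst _ (f.coeff (n + 1))) := by
  rw [pathD_apply, coeff_add, coeff_coeffMap, coeff_C_mul, coeff_derivative,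
    ← Nat.cast_succ, ← nsmul_eq_mul', ← Nat.cast_smul_eq_nsmul k, mul_smul_comm, etaVar_mul]

theorem etaFst_coeff_pathD (f : B.toArtinSuperalgebra.eta.carrier[X]) (n : ℕ) :
    etaFst _ ((pathD B f).coeff n) = B.diff (etaFst _ (f.coeff n)) := by
  rw [coeff_pathD, map_add, map_smul, etaFst_etaD, etaFst_etaMk, smul_zero, add_zero]

theorem etaSnd_coeff_pathD (f : B.toArtinSuperalgebra.eta.carrier[X]) (n : ℕ) :
    etaSnd _ ((pathD B f).coeff n) =
    -B.diff (etaSnd _ (f.coeff n)) + ((n + 1 : ℕ) : k) • etaFst _ (f.coeff (n + 1)) := by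
  rw [coeff_pathD, map_add, map_smul, etaSnd_etaD, etaSnd_etaMk]

theorem poly_ext {B : ArtinSuperalgebra k} {f g : B.eta.carrier[X]}
    (h1 : ∀ n, etaFst B (f.coeff n) = etaFst B (g.coeff n))
    (h2 : ∀ n, etaSnd B (f.coeff n) = etaSnd B (g.coeff n)) : f = g :=
  Polynomial.ext fun n => eta_ext (h1 n) (h2 n)

theorem pathD_pathD (f : B.toArtinSuperalgebra.eta.carrier[X]) : pathD B (pathD B f) = 0 := by
  apply poly_ext
  · intro n
    rw [etaFst_coeff_pathD, etaFst_coeff_pathD, B.diff_sq, coeff_zero, map_zero]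
  · intro n
    rw [etaSnd_coeff_pathD, etaSnd_coeff_pathD, etaFst_coeff_pathD, map_add, map_neg, B.diff_sq,
      map_smul, coeff_zero, map_zero]
    abel

theorem coeffMap_etaD_mul (f g : B.toArtinSuperalgebra.eta.carrier[X]) :
    coeffMap (fun _ => etaD B) (f * g) =
    coeffMap (fun _ => etaD B) f * g + polyPar _ f * coeffMap (fun _ => etaD B) g := by
  ext n : 1
  rw [coeff_coeffMap, coeff_mul, map_sum, coeff_add, coeff_mul, coeff_mul,
    ← Finset.sum_add_distrib]
  refine Finset.sum_congr rfl fun p _ => ?_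
  rw [etaD_mul, coeff_coeffMap, coeff_polyPar, coeff_coeffMap]

theorem polyPar_mul_etaVar {B : ArtinSuperalgebra k} (f : B.eta.carrier[X]) :
    polyPar B f * C (etaVar B) = C (etaVar B) * f := by
  ext n : 1
  rw [coeff_mul_C, coeff_C_mul, coeff_polyPar, par_mul_etaVar]

theorem pathD_mul (f g : B.toArtinSuperalgebra.eta.carrier[X]) :
    pathD B (f * g) = pathD B f * g + polyPar _ f * pathD B g := by
  rw [pathD_apply, pathD_apply, pathD_apply, coeffMap_etaD_mul, derivative_mul, mul_add, mul_add,
    add_mul, ← mul_assoc (polyPar _ f) (C _), polyPar_mul_etaVar]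
  noncomm_ring

theorem pathD_mem {f : B.toArtinSuperalgebra.eta.carrier[X]}
    (hf : f ∈ pathSub B.toArtinSuperalgebra) :
    pathD B f ∈ pathSub B.toArtinSuperalgebra := by
  intro n
  rw [mem_etaPow, etaFst_coeff_pathD, etaSnd_coeff_pathD]
  exact ⟨diff_mem_powIdeal B _ _ (hf n).1, Submodule.add_mem _
    (Submodule.neg_mem _ (diff_mem_powIdeal B _ _ (hf n).2))
    (Submodule.smul_mem _ _ (hf (n + 1)).1)⟩

theorem coeff_pathD_mem_gr {i : ZMod 2} {f : B.toArtinSuperalgebra.eta.carrier[X]}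
    (h : ∀ n, f.coeff n ∈ B.toArtinSuperalgebra.eta.gr i) (n : ℕ) :
    (pathD B f).coeff n ∈ B.toArtinSuperalgebra.eta.gr (i + 1) := by
  rw [coeff_pathD]
  refine Submodule.add_mem _ (etaD_mem_gr (h n)) (Submodule.smul_mem _ _ ?_)
  refine etaMk_mem_gr.2 ⟨Submodule.zero_mem _, ?_⟩
  rw [add_assoc, show (1 : ZMod 2) + 1 = 0 from rfl, add_zero]
  exact (etaMk_mem_gr.1 (h (n + 1))).1

/-- The differential of the path algebra. -/
def pathDiff (B : DGArtin k) :
    B.toArtinSuperalgebra.path.carrier →ₗ[k] B.toArtinSuperalgebra.path.carrier :=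
  (pathD B).restrict (p := Subalgebra.toSubmodule (pathSub B.toArtinSuperalgebra))
    (q := Subalgebra.toSubmodule (pathSub B.toArtinSuperalgebra)) fun _ hf => pathD_mem hf

theorem pathDiff_odd (i : ZMod 2) (f : B.toArtinSuperalgebra.path.carrier)
    (hf : f ∈ B.toArtinSuperalgebra.path.gr i) :
    pathDiff B f ∈ B.toArtinSuperalgebra.path.gr (i + 1) :=
  (mem_path_gr (pathDiff B f)).2 (coeff_pathD_mem_gr ((mem_path_gr f).1 hf))

theorem pathDiff_sq (f : B.toArtinSuperalgebra.path.carrier) : pathDiff B (pathDiff B f) = 0 :=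
  Subtype.ext (pathD_pathD (show pathSub B.toArtinSuperalgebra from f).1)

theorem pathDiff_leibniz (f g : B.toArtinSuperalgebra.path.carrier) : pathDiff B (f * g) =
    pathDiff B f * g + par B.toArtinSuperalgebra.path.gr f * pathDiff B g := by
  have h := pathD_mul (show pathSub B.toArtinSuperalgebra from f).1
    (show pathSub B.toArtinSuperalgebra from g).1
  rw [← par_path] at h
  exact Subtype.ext h

theorem aug_pathDiff (f : B.toArtinSuperalgebra.path.carrier) :
    B.toArtinSuperalgebra.path.aug (pathDiff B f) = 0 := by
  change B.aug (etaFst _ ((pathD B (show pathSub B.toArtinSuperalgebra from f).1).coeff 0)) = 0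
  rw [etaFst_coeff_pathD, B.diff_aug]

/-- The path algebra of a dg Artin superalgebra. -/
def DGArtin.path (B : DGArtin k) : DGArtin k where
  toArtinSuperalgebra := B.toArtinSuperalgebra.path
  diff := pathDiff B
  diff_odd := pathDiff_odd
  diff_sq := pathDiff_sq
  leibniz := pathDiff_leibniz
  diff_aug := aug_pathDiff

/-! ### Evaluation and integration of paths -/

/-- Evaluation of a polynomial with coefficients in `B[η]` at `t = c`, `η = 0`. -/
def polyEval (B : ArtinSuperalgebra k) (c : k) : B.eta.carrier[X] →ₐ[k] B.carrier :=
  { eval₂RingHom' (AlgHom.ofLinearMap (etaFst B) rfl etaFst_mul).toRingHom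
      (algebraMap k B.carrier c) fun _ => (Algebra.commutes _ _).symm with
    commutes' := fun r => (eval₂_C _ _).trans
      (AlgHom.commutes (AlgHom.ofLinearMap (etaFst B) rfl etaFst_mul) r) }

theorem polyEval_monomial {B : ArtinSuperalgebra k} (c : k) (n : ℕ) (x : B.eta.carrier) :
    polyEval B c (monomial n x) = c ^ n • etaFst B x := by
  change eval₂ _ _ (monomial n x) = _
  rw [eval₂_monomial, ← map_pow, ← Algebra.commutes, ← Algebra.smul_def]
  rfl

theorem poly_induction {B : ArtinSuperalgebra k} {p : B.eta.carrier[X] → Prop}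
    (f : B.eta.carrier[X])
    (h1 : ∀ f g, p f → p g → p (f + g)) (h2 : ∀ n x, p (monomial n x)) : p f :=
  Polynomial.induction_on' f (fun f g => h1 f g) h2

theorem polyEval_zero {B : ArtinSuperalgebra k} (f : B.eta.carrier[X]) :
    polyEval B 0 f = etaFst B (f.coeff 0) := by
  induction f using poly_induction with
  | h1 f g hf hg => rw [map_add, hf, hg, coeff_add, map_add]
  | h2 n x =>
    rw [polyEval_monomial, coeff_monomial]
    cases n with
    | zero => rw [pow_zero, one_smul, if_pos rfl]
    | succ n => rw [zero_pow n.succ_ne_zero, zero_smul, if_neg n.succ_ne_zero, map_zero]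

theorem polyEval_mem {B : ArtinSuperalgebra k} (c : k) {f : B.eta.carrier[X]}
    {K : Submodule k B.carrier} (h : ∀ n, etaFst B (f.coeff n) ∈ K) : polyEval B c f ∈ K := by
  rw [f.as_sum_support, map_sum]
  refine Submodule.sum_mem _ fun n _ => ?_
  rw [polyEval_monomial]
  exact Submodule.smul_mem _ _ (h n)

theorem polyEval_pathD (c : k) (f : B.toArtinSuperalgebra.eta.carrier[X]) :
    polyEval _ c (pathD B f) = B.diff (polyEval _ c f) := by
  rw [pathD_apply, map_add, map_mul]
  have h : polyEval B.toArtinSuperalgebra c (C (etaVar _)) = 0 := by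
    rw [← monomial_zero_left, polyEval_monomial, pow_zero, one_smul]
    rfl
  rw [h, zero_mul, add_zero]
  induction f using poly_induction with
  | h1 f g hf hg => rw [map_add, map_add, hf, hg, map_add, map_add]
  | h2 n x =>
    have : coeffMap (fun _ => etaD B) (monomial n x) = monomial n (etaD B x) := by
      ext m : 1
      rw [coeff_coeffMap, coeff_monomial, coeff_monomial]
      split_ifs
      · rfl
      · rw [map_zero]
    rw [this, polyEval_monomial, polyEval_monomial, map_smul, etaFst_etaD]

/-- Evaluation of paths at `t = c`. -/
def pathEval (B : DGArtin k) (c : k) : B.path.Hom B where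
  toAlgHom := (polyEval B.toArtinSuperalgebra c).comp (pathSub B.toArtinSuperalgebra).val
  map_gr i f hf := polyEval_mem c fun n => (etaMk_mem_gr.1 ((mem_path_gr _).1 hf n)).1
  map_aug f := by
    change B.aug (polyEval _ c f.1) = B.aug (etaFst _ (f.1.coeff 0))
    have h : polyEval B.toArtinSuperalgebra c (f.1 - C (f.1.coeff 0)) ∈ B.maxIdeal := by
      refine polyEval_mem c fun n => ?_
      rw [coeff_sub, coeff_C]
      split_ifs with hn
      · subst hn
        rw [sub_self, map_zero]
        exact Submodule.zero_mem _
      · rw [sub_zero]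
        obtain ⟨m, rfl⟩ := Nat.exists_eq_succ_of_ne_zero hn
        exact powIdeal_le m (f.2 (m + 1)).1
    rw [map_sub, ← monomial_zero_left, polyEval_monomial, pow_zero, one_smul] at h
    have h' : B.aug (_ - _) = 0 := h
    rwa [map_sub, sub_eq_zero] at h'
  map_diff f := polyEval_pathD c f.1

/-- Constant paths. -/
def pathConst (B : DGArtin k) : B.Hom B.path where
  toAlgHom := ((CAlgHom (R := k) (A := B.toArtinSuperalgebra.eta.carrier)).comp
    (etaInl B.toArtinSuperalgebra).toAlgHom).codRestrict (pathSub B.toArtinSuperalgebra)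
    fun b n => by
      change (C (etaMk b 0)).coeff n ∈ _
      rw [coeff_C]
      split_ifs with h
      · subst h
        rw [mem_etaPow, powIdeal_zero]
        exact ⟨trivial, Submodule.zero_mem _⟩
      · exact Submodule.zero_mem _
  map_gr i b hb := (mem_path_gr _).2 fun n => by
    change (C (etaMk b 0)).coeff n ∈ _
    rw [coeff_C]
    split_ifs with h
    · exact etaMk_mem_gr.2 ⟨hb, Submodule.zero_mem _⟩
    · exact Submodule.zero_mem _
  map_aug b := by
    change B.aug (etaFst _ ((C (etaMk b 0)).coeff 0)) = B.aug b
    rw [coeff_C_zero]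
    rfl
  map_diff b := Subtype.ext (by
    change C (etaMk (B.diff b) 0) = pathD B (C (etaMk b 0))
    rw [pathD_apply, derivative_C, mul_zero, add_zero]
    ext n : 1
    rw [coeff_coeffMap, coeff_C, coeff_C]
    split_ifs
    · change _ = etaMk (B.diff b) (-B.diff 0)
      rw [map_zero, neg_zero]
    · rw [map_zero])

theorem pathEval_pathConst (c : k) (b : B.carrier) :
    (pathEval B c).toAlgHom ((pathConst B).toAlgHom b) = b := by
  change polyEval _ c (C (etaMk b 0)) = b
  rw [← monomial_zero_left, polyEval_monomial, pow_zero, one_smul]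
  rfl

/-- The path `t b` from `0` to `b`, for `b` in the maximal ideal. -/
def pathLine (B : DGArtin k) : B.carrier →ₗ[k] B.path.carrier :=
  LinearMap.codRestrict (Subalgebra.toSubmodule (pathSub B.toArtinSuperalgebra))
    ((((monomial 1 : B.toArtinSuperalgebra.eta.carrier →ₗ[_] _).restrictScalars k) ∘ₗ
      (etaInl B.toArtinSuperalgebra).toAlgHom.toLinearMap) ∘ₗ
      (LinearMap.id - Algebra.linearMap k B.carrier ∘ₗ B.aug.toLinearMap))
    fun b n => by
      change (monomial 1 (etaMk (b - algebraMap k B.carrier (B.aug b)) 0)).coeff n ∈ _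
      rw [coeff_monomial]
      split_ifs with h
      · subst h
        rw [mem_etaPow, powIdeal_one]
        refine ⟨?_, Submodule.zero_mem _⟩
        change B.aug (b - algebraMap k B.carrier (B.aug b)) = 0
        rw [map_sub, AlgHom.commutes, Algebra.algebraMap_self_apply, sub_self]
      · exact Submodule.zero_mem _

theorem pathLine_coe {b : B.carrier} (hb : b ∈ B.maxIdeal) :
    (show pathSub B.toArtinSuperalgebra from pathLine B b).1 = monomial 1 (etaMk b 0) := by
  change monomial 1 (etaMk (b - algebraMap k B.carrier (B.aug b)) 0) = _
  rw [show B.aug b = 0 from hb, map_zero, sub_zero]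

theorem pathEval_pathLine (c : k) {b : B.carrier} (hb : b ∈ B.maxIdeal) :
    (pathEval B c).toAlgHom (pathLine B b) = c • b := by
  change polyEval _ c (show pathSub B.toArtinSuperalgebra from pathLine B b).1 = _
  rw [pathLine_coe hb, polyEval_monomial, pow_one]
  rfl

theorem pathLine_mem {i : ZMod 2} {b : B.carrier} (hb : b ∈ B.gr i) (hm : b ∈ B.maxIdeal) :
    pathLine B b ∈ B.path.gr i ∧ pathLine B b ∈ B.path.maxIdeal := by
  constructor
  · refine (mem_path_gr _).2 fun n => ?_
    rw [pathLine_coe hm, coeff_monomial]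
    split_ifs
    · exact etaMk_mem_gr.2 ⟨hb, Submodule.zero_mem _⟩
    · exact Submodule.zero_mem _
  · change B.aug (etaFst _ ((show pathSub B.toArtinSuperalgebra from pathLine B b).1.coeff 0)) = 0
    rw [pathLine_coe hm, coeff_monomial, if_neg one_ne_zero, map_zero, map_zero]

/-- Integration `a + η b ↦ ∫₀ᵗ b dt` of polynomials with coefficients in `B[η]`. -/
def polyInt (B : ArtinSuperalgebra k) : B.eta.carrier[X] →ₗ[k] B.eta.carrier[X] :=
  coeffMap (fun i => ((i : ℕ) : k)⁻¹ • ((etaInl B).toAlgHom.toLinearMap ∘ₗ etaSnd B)) ∘ₗ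
    LinearMap.mulRight k X

theorem polyInt_apply {B : ArtinSuperalgebra k} (f : B.eta.carrier[X]) : polyInt B f =
    coeffMap (fun i => ((i : ℕ) : k)⁻¹ • ((etaInl B).toAlgHom.toLinearMap ∘ₗ etaSnd B))
      (f * X) := rfl

theorem coeff_polyInt_zero {B : ArtinSuperalgebra k} (f : B.eta.carrier[X]) :
    (polyInt B f).coeff 0 = 0 := by
  rw [polyInt_apply, coeff_coeffMap, coeff_mul_X_zero, map_zero]

theorem coeff_polyInt_succ {B : ArtinSuperalgebra k} (f : B.eta.carrier[X]) (n : ℕ) :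
    (polyInt B f).coeff (n + 1) = ((n + 1 : ℕ) : k)⁻¹ • etaMk (etaSnd B (f.coeff n)) 0 := by
  rw [polyInt_apply, coeff_coeffMap, coeff_mul_X]
  rfl

/-- The fundamental theorem of calculus. The differential of `B` cancels, as integration is odd. -/
theorem polyInt_homotopy (f : B.toArtinSuperalgebra.eta.carrier[X]) :
    pathD B (polyInt _ f) + polyInt _ (pathD B f) = f - C (etaMk (etaFst _ (f.coeff 0)) 0) := by
  have hn : ∀ n : ℕ, ((n + 1 : ℕ) : k) ≠ 0 := fun n => Nat.cast_ne_zero.2 n.succ_ne_zero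
  apply poly_ext
  · intro n
    rw [coeff_add, coeff_sub, map_add, map_sub, etaFst_coeff_pathD]
    cases n with
    | zero =>
      rw [coeff_polyInt_zero, coeff_polyInt_zero, map_zero, map_zero, coeff_C_zero, etaFst_etaMk,
        sub_self, add_zero]
    | succ n =>
      rw [coeff_polyInt_succ, coeff_polyInt_succ, coeff_C_succ, map_zero, sub_zero,
        etaSnd_coeff_pathD, map_smul, etaFst_etaMk, map_smul, map_smul, etaFst_etaMk, smul_add,
        smul_neg, smul_smul, inv_mul_cancel₀ (hn n), one_smul]
      abel
  · intro n
    rw [coeff_add, coeff_sub, map_add, map_sub, etaSnd_coeff_pathD, coeff_polyInt_succ, map_smul,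
      etaFst_etaMk, smul_smul, mul_inv_cancel₀ (hn n), one_smul, coeff_C]
    have h1 : ∀ g : B.toArtinSuperalgebra.eta.carrier[X], etaSnd _ ((polyInt _ g).coeff n) = 0 := by
      intro g
      cases n with
      | zero => rw [coeff_polyInt_zero, map_zero]
      | succ n => rw [coeff_polyInt_succ, map_smul, etaSnd_etaMk, smul_zero]
    have h2 : etaSnd _ (if n = 0 then etaMk (etaFst _ (f.coeff 0)) 0 else 0) =
        (0 : B.carrier) := by
      split_ifs
      · rfl
      · rw [map_zero]
    rw [h1, h1, h2, map_zero]
    abel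

theorem polyInt_mem {f : B.toArtinSuperalgebra.eta.carrier[X]}
    (hf : f ∈ pathSub B.toArtinSuperalgebra) :
    polyInt _ f ∈ pathSub B.toArtinSuperalgebra := by
  intro n
  cases n with
  | zero => rw [coeff_polyInt_zero]; exact Submodule.zero_mem _
  | succ n =>
    rw [coeff_polyInt_succ, mem_etaPow, map_smul, map_smul]
    exact ⟨Submodule.smul_mem _ _ (hf n).2, Submodule.smul_mem _ _ (Submodule.zero_mem _)⟩

/-- Integration of paths, a homotopy between the identity and the restriction to `t = 0`. -/
def pathInt (B : DGArtin k) : B.path.carrier →ₗ[k] B.path.carrier :=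
  (polyInt B.toArtinSuperalgebra).restrict
    (p := Subalgebra.toSubmodule (pathSub B.toArtinSuperalgebra))
    (q := Subalgebra.toSubmodule (pathSub B.toArtinSuperalgebra)) fun _ hf => polyInt_mem hf

theorem pathInt_homotopy (f : B.path.carrier) :
    B.path.diff (pathInt B f) + pathInt B (B.path.diff f) =
      f - (pathConst B).toAlgHom ((pathEval B 0).toAlgHom f) :=
  Subtype.ext (by
    have h := polyInt_homotopy (B := B) (show pathSub B.toArtinSuperalgebra from f).1
    rw [← polyEval_zero] at h
    exact h)

variable (B) in
/-- The paths whose coefficients lie in `m ^ n`, a filtration stable under integration. -/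
def pathPow (n : ℕ) : Submodule k B.path.carrier where
  carrier := {f | ∀ i, (show pathSub B.toArtinSuperalgebra from f).1.coeff i ∈ etaPow _ n n}
  add_mem' := by
    intro f g hf hg i
    have h := Submodule.add_mem _ (hf i) (hg i)
    rw [← coeff_add] at h
    exact h
  zero_mem' := fun i => Submodule.zero_mem (etaPow B.toArtinSuperalgebra n n)
  smul_mem' := by
    intro c f hf i
    have h := Submodule.smul_mem _ c (hf i)
    rw [← coeff_smul] at h
    exact h

theorem pathPow_one : pathPow B 1 = B.path.maxIdeal := by
  refine le_antisymm (fun f hf => ?_) fun f hf => ?_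
  · have h := (mem_etaPow.1 (hf 0)).1
    rw [powIdeal_one] at h
    exact h
  · exact coeff_mem_of_polyAug (show pathSub B.toArtinSuperalgebra from f).2 hf

theorem mul_mem_pathPow {i j : ℕ} {f g : B.path.carrier} (hf : f ∈ pathPow B i)
    (hg : g ∈ pathPow B j) : f * g ∈ pathPow B (i + j) := fun n =>
  coeff_mul_mem (k := k) (S := fun _ => etaPow B.toArtinSuperalgebra i i)
    (T := fun _ => etaPow B.toArtinSuperalgebra j j)
    (U := fun _ => etaPow B.toArtinSuperalgebra (i + j) (i + j))
    (fun _ _ _ ha _ hb => mul_mem_etaPow rfl ha hb) hf hg n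

theorem maxIdeal_mul_pathPow (n : ℕ) : B.path.maxIdeal * pathPow B n ≤ pathPow B (n + 1) := by
  rw [← pathPow_one, Submodule.mul_le]
  intro f hf g hg
  rw [add_comm]
  exact mul_mem_pathPow hf hg

theorem pathPow_anti (n : ℕ) : pathPow B (n + 1) ≤ pathPow B n := fun _ hf i =>
  mem_etaPow.2 ⟨powIdeal_anti n (hf i).1, powIdeal_anti n (hf i).2⟩

theorem homog_pathPow (n : ℕ) : Homog B.path.toArtinSuperalgebra (pathPow B n) := by
  intro f hf i
  have hp : par B.path.gr f ∈ pathPow B n := fun m => by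
    have h := par_mem_etaPow (hf m)
    rw [← coeff_polyPar, ← par_path] at h
    exact h
  have h := par_eq_smul B.path.gr f i
  have h2 : proj B.path.gr i f = (2 : k)⁻¹ • (f + (-1 : k) ^ i.val • par B.path.gr f) := by
    rw [← h, smul_add, half_add_half]
  rw [h2]
  exact Submodule.smul_mem _ _ (Submodule.add_mem _ hf (Submodule.smul_mem _ _ hp))

theorem isSuperIdeal_pathPow (n : ℕ) :
    IsSuperIdeal B.path.toArtinSuperalgebra (pathPow B (n + 1)) := by
  refine .of_homog (homog_pathPow _) ?_ ((maxIdeal_mul_pathPow _).trans (pathPow_anti _))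
  rw [show B.path.maxIdeal = _ from pathPow_one.symm]
  induction n with
  | zero => exact le_rfl
  | succ n ih => exact (pathPow_anti _).trans ih

theorem exists_pathPow_eq_bot : ∃ N, pathPow B (N + 1) = ⊥ := by
  obtain ⟨N, hN⟩ := exists_powIdeal_eq_bot B.toArtinSuperalgebra
  refine ⟨N, ?_⟩
  rw [eq_bot_iff]
  intro f hf
  refine Subtype.ext (Polynomial.ext fun i => ?_)
  have := hf i
  rwa [etaPow_eq_bot (hN _ N.le_succ) (hN _ N.le_succ)] at this

theorem pathInt_mem_pathPow {n : ℕ} {f : B.path.carrier} (hf : f ∈ pathPow B n) :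
    pathInt B f ∈ pathPow B n := by
  intro i
  change (polyInt _ (show pathSub B.toArtinSuperalgebra from f).1).coeff i ∈ _
  cases i with
  | zero => rw [coeff_polyInt_zero]; exact Submodule.zero_mem _
  | succ i =>
    rw [coeff_polyInt_succ, mem_etaPow, map_smul, map_smul]
    exact ⟨Submodule.smul_mem _ _ (hf i).2, Submodule.smul_mem _ _ (Submodule.zero_mem _)⟩

theorem pathInt_mem_gr {i : ZMod 2} {f : B.path.carrier} (hf : f ∈ B.path.gr i) :
    pathInt B f ∈ B.path.gr (i + 1) := by
  refine (mem_path_gr _).2 fun n => ?_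
  have h := (mem_path_gr _).1 hf
  change (polyInt _ (show pathSub B.toArtinSuperalgebra from f).1).coeff n ∈ _
  cases n with
  | zero => rw [coeff_polyInt_zero]; exact Submodule.zero_mem _
  | succ n =>
    rw [coeff_polyInt_succ]
    exact Submodule.smul_mem _ _ (etaMk_mem_gr.2
      ⟨(etaMk_mem_gr.1 (h n)).2, Submodule.zero_mem _⟩)

theorem pathEval_zero_pathInt (f : B.path.carrier) :
    (pathEval B 0).toAlgHom (pathInt B f) = 0 := by
  change polyEval _ 0 (polyInt _ (show pathSub B.toArtinSuperalgebra from f).1) = 0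
  rw [polyEval_zero, coeff_polyInt_zero, map_zero]

end PathDG

/-! ### Homotopies of Maurer-Cartan elements -/

section Homotopy

variable {k : Type u} [Field k] [CharZero k]
variable {A : Type v} [Ring A] [Algebra k A] {𝒜 : ZMod 2 → Submodule k A} [GradedAlgebra 𝒜]
  (X : DGBV 𝒜) {B : DGArtin k}

theorem baseMap_pathEval_pathConst {V : Type v} [AddCommGroup V] [Module k V] (c : k)
    (x : B.carrier ⊗[k] V) :
    baseMap V (pathEval B c).toHom (baseMap V (pathConst B).toHom x) = x := by
  have h : (pathEval B c).toAlgHom.toLinearMap ∘ₗ (pathConst B).toAlgHom.toLinearMap =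
      LinearMap.id := LinearMap.ext (pathEval_pathConst c)
  rw [baseMap, baseMap, ← LinearMap.comp_apply, ← LinearMap.rTensor_comp, h,
    LinearMap.rTensor_id, LinearMap.id_apply]

theorem baseMap_pathEval_pathLine {V : Type v} [AddCommGroup V] [Module k V] (c : k)
    {x : B.carrier ⊗[k] V} (hx : x ∈ tens B.maxIdeal V) :
    baseMap V (pathEval B c).toHom ((pathLine B).rTensor V x) = c • x := by
  rw [baseMap, ← LinearMap.comp_apply, ← LinearMap.rTensor_comp]
  refine (rTensor_congr (g := c • LinearMap.id) (fun b hb => pathEval_pathLine c hb) hx).trans ?_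
  rw [LinearMap.rTensor_smul, LinearMap.rTensor_id]
  rfl

theorem pathLine_mem_pts {V : Type v} [AddCommGroup V] [Module k V] {𝒱 : ZMod 2 → Submodule k V}
    {i : ZMod 2} {x : B.carrier ⊗[k] V} (hx : x ∈ pts 𝒱 B.toArtinSuperalgebra i) :
    (pathLine B).rTensor V x ∈ pts 𝒱 B.path.toArtinSuperalgebra i :=
  rTensor_mem_gpts (B := B.toArtinSuperalgebra) (C := B.path.toArtinSuperalgebra) (pathLine B)
    (c := 0) (add_zero i) (fun p b hb hm => by
      rw [add_zero]
      exact pathLine_mem hb hm) hx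

theorem baseMap_pathEval_zero_pathInt {V : Type v} [AddCommGroup V] [Module k V]
    (x : B.path.carrier ⊗[k] V) :
    baseMap V (pathEval B 0).toHom ((pathInt B).rTensor V x) = 0 := by
  have h : (pathEval B 0).toAlgHom.toLinearMap ∘ₗ pathInt B = 0 :=
    LinearMap.ext pathEval_zero_pathInt
  rw [baseMap, ← LinearMap.comp_apply, ← LinearMap.rTensor_comp, h, LinearMap.rTensor_zero,
    LinearMap.zero_apply]

theorem coeffDiff_pathInt {V : Type v} [AddCommGroup V] [Module k V]
    (x : B.path.carrier ⊗[k] V) :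
    coeffDiff V B.path ((pathInt B).rTensor V x) +
      (pathInt B).rTensor V (coeffDiff V B.path x) =
    x - baseMap V (pathConst B).toHom (baseMap V (pathEval B 0).toHom x) := by
  have h : B.path.diff ∘ₗ pathInt B + pathInt B ∘ₗ B.path.diff =
      LinearMap.id - (pathConst B).toAlgHom.toLinearMap ∘ₗ
        (pathEval B 0).toAlgHom.toLinearMap := LinearMap.ext pathInt_homotopy
  have h2 := LinearMap.congr_fun (congrArg (LinearMap.rTensor V) h) x
  rw [LinearMap.rTensor_add, LinearMap.rTensor_sub, LinearMap.rTensor_id, LinearMap.rTensor_comp,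
    LinearMap.rTensor_comp, LinearMap.rTensor_comp] at h2
  exact h2

theorem oddExt_pathInt {V W : Type v} [AddCommGroup V] [Module k V] [AddCommGroup W] [Module k W]
    (T : V →ₗ[k] W) (x : B.path.carrier ⊗[k] V) :
    oddExt B.path.toArtinSuperalgebra T ((pathInt B).rTensor V x) =
      -(pathInt B).rTensor W (oddExt B.path.toArtinSuperalgebra T x) := by
  induction x using TensorProduct.induction_on with
  | zero => simp
  | add a b ha hb => rw [map_add, map_add, ha, hb, map_add, map_add, neg_add]
  | tmul b x =>
    have h := par_comm B.path.gr B.path.gr (pathInt B) 1 (fun i f hf => pathInt_mem_gr hf) b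
    rw [zmod2_val_one, pow_one, neg_one_smul] at h
    rw [LinearMap.rTensor_tmul, oddExt, TensorProduct.map_tmul, TensorProduct.map_tmul,
      LinearMap.rTensor_tmul, h, TensorProduct.neg_tmul]

/-- Integration is a homotopy for the total differential as well, as it anticommutes with `d`. -/
theorem totalD_pathInt {δ : B.path.carrier ⊗[k] A}
    (hδ : baseMap A (pathEval B 0).toHom δ = 0) :
    totalD X B.path ((pathInt B).rTensor A δ) =
      δ - (pathInt B).rTensor A (totalD X B.path δ) := by
  have h := coeffDiff_pathInt δ
  rw [hδ, map_zero, sub_zero] at h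
  have h1 : ∀ y, totalD X B.path y = oddExt B.path.toArtinSuperalgebra X.d y +
    coeffDiff A B.path y := fun _ => rfl
  rw [h1, h1, oddExt_pathInt, map_add]
  nth_rewrite 3 [← h]
  abel

theorem gaugeSum_zero (γ : B.carrier ⊗[k] A) (N : ℕ) :
    gaugeSum 𝒜 X.d X.br B 0 γ (N + 1) = γ := by
  rw [gaugeSum, Finset.sum_range_succ']
  simp

/-- A gauge transformation whose parameter vanishes after a base change does not change the image of
the Maurer-Cartan element. -/
theorem MC.map_eq_of_gauge_zero {C : DGArtin k} (f : B.Hom C) {γ γ' : MC 𝒜 X.d X.br B}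
    {g : B.carrier ⊗[k] A}
    (h : ∀ᶠ N in Filter.atTop, (γ'.1 : B.carrier ⊗[k] A) = gaugeSum 𝒜 X.d X.br B g γ.1 N)
    (hg : baseMap A f.toHom g = 0) :
    MC.map 𝒜 X.d X.br f γ' = MC.map 𝒜 X.d X.br f γ := by
  obtain ⟨N, hN⟩ := Filter.eventually_atTop.1 h
  refine Subtype.ext (Subtype.ext ?_)
  change baseMap A f.toHom γ'.1 = baseMap A f.toHom γ.1
  rw [hN (N + 1) N.le_succ, baseMap_gaugeSum, hg, gaugeSum_zero]

theorem MC.map_pathEval_pathConst (c : k) (γ : MC 𝒜 X.d X.br B) :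
    MC.map 𝒜 X.d X.br (pathEval B c) (MC.map 𝒜 X.d X.br (pathConst B) γ) = γ :=
  Subtype.ext (Subtype.ext (baseMap_pathEval_pathConst c _))

/-- Homotopy of Maurer-Cartan elements: they are the ends of a Maurer-Cartan element over the
path algebra. -/
def MC.Homotopic (γ γ' : MC 𝒜 X.d X.br B) : Prop :=
  ∃ μ : MC 𝒜 X.d X.br B.path, MC.map 𝒜 X.d X.br (pathEval B 0) μ = γ ∧
    MC.map 𝒜 X.d X.br (pathEval B 1) μ = γ'

/-- The gauge transformations by `t g` extend a path by a gauge transformation of its end. -/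
theorem MC.Homotopic.gauge {γ γ' γ'' : MC 𝒜 X.d X.br B} (h : MC.Homotopic X γ γ')
    (hg : GaugeRel 𝒜 X.d X.br B γ' γ'') : MC.Homotopic X γ γ'' := by
  obtain ⟨μ, h0, h1⟩ := h
  obtain ⟨g, hg⟩ := hg
  obtain ⟨μ', hμ'⟩ := exists_gauge X μ ⟨_, pathLine_mem_pts g.2⟩
  refine ⟨μ', ?_, ?_⟩
  · rw [← h0]
    refine MC.map_eq_of_gauge_zero X _ hμ' ?_
    exact (baseMap_pathEval_pathLine 0 (gpts_le_tens g.2)).trans (zero_smul _ _)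
  · obtain ⟨N, hN, hN'⟩ := (hg.and hμ').exists
    refine Subtype.ext (Subtype.ext ?_)
    change baseMap A (pathEval B 1).toHom μ'.1 = γ''.1
    rw [hN, hN', baseMap_gaugeSum, baseMap_pathEval_pathLine 1 (gpts_le_tens g.2), one_smul, ← h1]
    rfl

/-- Gauge equivalent Maurer-Cartan elements are homotopic. -/
theorem MC.homotopic_of_eq {γ γ' : MC 𝒜 X.d X.br B}
    (h : (Quot.mk _ γ : Def 𝒜 X.d X.br B) = Quot.mk _ γ') : MC.Homotopic X γ γ' := by
  have key : ∀ δ, MC.Homotopic X δ γ ↔ MC.Homotopic X δ γ' := by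
    have h' := Quot.eqvGen_exact h
    induction h' with
    | rel a b hab => exact fun δ => ⟨fun h => h.gauge X hab, fun h => h.gauge X (hab.symm X)⟩
    | refl a => exact fun δ => Iff.rfl
    | symm a b _ ih => exact fun δ => (ih (Quot.eqvGen_sound ‹_›) δ).symm
    | trans a b c _ _ ih1 ih2 =>
      exact fun δ => (ih1 (Quot.eqvGen_sound ‹_›) δ).trans (ih2 (Quot.eqvGen_sound ‹_›) δ)
  exact (key γ).1 ⟨MC.map 𝒜 X.d X.br (pathConst B) γ, MC.map_pathEval_pathConst X 0 γ,
    MC.map_pathEval_pathConst X 1 γ⟩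

/-- If two Maurer-Cartan elements are congruent modulo `J`, their difference is closed modulo
`m J`. -/
theorem totalD_sub_mem {ν μ : MC 𝒜 X.d X.br B} {J J' : Submodule k B.carrier}
    (hJ : IsSuperIdeal B.toArtinSuperalgebra J) (h1 : B.maxIdeal * J ≤ J')
    (h : (μ.1 : B.carrier ⊗[k] A) - ν.1 ∈ tens J A) :
    totalD X B ((μ.1 : B.carrier ⊗[k] A) - ν.1) ∈ tens J' A := by
  have h2 : J * B.maxIdeal ≤ J' := by rwa [hJ.homog.mul_comm (homog_maxIdeal _)]
  have e1 := μ.2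
  have e2 := ν.2
  rw [mc_iff] at e1 e2
  have e3 : totalD X B ((μ.1 : B.carrier ⊗[k] A) - ν.1) = -(2 : k)⁻¹ •
      (oddExt₂ B.toArtinSuperalgebra 𝒜 X.br ((μ.1 : B.carrier ⊗[k] A) - ν.1) μ.1 +
        oddExt₂ B.toArtinSuperalgebra 𝒜 X.br ν.1.1 ((μ.1 : B.carrier ⊗[k] A) - ν.1)) := by
    rw [map_sub, eq_neg_of_add_eq_zero_left e1, eq_neg_of_add_eq_zero_left e2, map_sub, map_sub,
      LinearMap.sub_apply]
    module
  rw [e3]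
  exact Submodule.smul_mem _ _ (Submodule.add_mem _
    (oddExt₂_mem_tens 𝒜 X.br (homog_maxIdeal _) h2 h (gpts_le_tens μ.1.2))
    (oddExt₂_mem_tens 𝒜 X.br hJ.homog h1 (gpts_le_tens ν.1.2) h))

/-- A path of Maurer-Cartan elements is gauge equivalent to the constant path at its origin:
the gauge transformations by `∫₀ᵗ` remove, one order at a time, the difference of the two. -/
theorem MC.mk_eq_const (μ : MC 𝒜 X.d X.br B.path) :
    (Quot.mk _ μ : Def 𝒜 X.d X.br B.path) = Quot.mk _ (MC.map 𝒜 X.d X.br (pathConst B)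
      (MC.map 𝒜 X.d X.br (pathEval B 0) μ)) := by
  set ν := MC.map 𝒜 X.d X.br (pathConst B) (MC.map 𝒜 X.d X.br (pathEval B 0) μ) with hν
  have hν0 : MC.map 𝒜 X.d X.br (pathEval B 0) ν = MC.map 𝒜 X.d X.br (pathEval B 0) μ :=
    MC.map_pathEval_pathConst X 0 _
  have key : ∀ n : ℕ, ∃ μ' : MC 𝒜 X.d X.br B.path,
      (Quot.mk _ μ : Def 𝒜 X.d X.br B.path) = Quot.mk _ μ' ∧
      MC.map 𝒜 X.d X.br (pathEval B 0) μ' = MC.map 𝒜 X.d X.br (pathEval B 0) μ ∧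
      (μ'.1 : B.path.carrier ⊗[k] A) - ν.1 ∈ tens (pathPow B (n + 1)) A := by
    intro n
    induction n with
    | zero =>
      refine ⟨μ, rfl, rfl, ?_⟩
      rw [pathPow_one]
      exact gpts_le_tens (Submodule.sub_mem _ μ.1.2 ν.1.2)
    | succ n ih =>
      obtain ⟨μ', h1, h2, h3⟩ := ih
      have hJ := isSuperIdeal_pathPow (B := B) n
      have hJ' := isSuperIdeal_pathPow (B := B) (n + 1)
      have hJJ' := maxIdeal_mul_pathPow (B := B) (n + 1)
      have hδ0 : baseMap A (pathEval B 0).toHom ((μ'.1 : B.path.carrier ⊗[k] A) - ν.1) = 0 := by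
        rw [map_sub, sub_eq_zero]
        exact congrArg (fun γ : MC 𝒜 X.d X.br B => (γ.1 : B.carrier ⊗[k] A)) (h2.trans hν0.symm)
      have hg : (pathInt B).rTensor A ((μ'.1 : B.path.carrier ⊗[k] A) - ν.1) ∈
          gpts 𝒜 B.path.toArtinSuperalgebra (pathPow B (n + 1)) 1 :=
        rTensor_mem_gpts (B := B.path.toArtinSuperalgebra) (C := B.path.toArtinSuperalgebra)
          (pathInt B) (i := 0) (c := 1) (by decide)
          (fun p b hb hm => ⟨pathInt_mem_gr hb, pathInt_mem_pathPow hm⟩)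
          (gpts_of_tens hJ.homog h3 (Submodule.sub_mem _ μ'.1.2 ν.1.2))
      obtain ⟨μ'', h4, h5⟩ := exists_gauge_sub_mem X hJ hJ' hJJ' μ' hg
      refine ⟨μ'', h1.trans (Quot.sound ⟨⟨_, gpts_mono hJ.le_max 1 hg⟩, h4⟩), ?_, ?_⟩
      · rw [← h2]
        exact MC.map_eq_of_gauge_zero X _ h4 (baseMap_pathEval_zero_pathInt _)
      · have h6 := totalD_sub_mem X hJ hJJ' h3
        have h7 := rTensor_mem_tens (J := pathPow B (n + 1 + 1)) (pathInt B)
          (fun b hb => pathInt_mem_pathPow hb) h6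
        have h8 := totalD_pathInt X hδ0
        rw [h8] at h5
        have h9 := Submodule.add_mem _ h5 h7
        have h10 : (μ''.1 : B.path.carrier ⊗[k] A) - ν.1 = (μ''.1 : B.path.carrier ⊗[k] A) -
            (μ'.1 - ((μ'.1 : B.path.carrier ⊗[k] A) - ν.1 - (pathInt B).rTensor A
              (totalD X B.path ((μ'.1 : B.path.carrier ⊗[k] A) - ν.1)))) +
            (pathInt B).rTensor A
              (totalD X B.path ((μ'.1 : B.path.carrier ⊗[k] A) - ν.1)) := by
          abel
        rw [h10]
        exact h9
  obtain ⟨N, hN⟩ := exists_pathPow_eq_bot (B := B)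
  obtain ⟨μ', h1, -, h3⟩ := key N
  rw [hN, tens_bot] at h3
  exact h1.trans (congrArg _ (Subtype.ext (Subtype.ext (sub_eq_zero.1 h3))))

/-- Homotopic Maurer-Cartan elements are gauge equivalent. -/
theorem MC.Homotopic.mk_eq {γ γ' : MC 𝒜 X.d X.br B} (h : MC.Homotopic X γ γ') :
    (Quot.mk _ γ : Def 𝒜 X.d X.br B) = Quot.mk _ γ' := by
  obtain ⟨μ, rfl, rfl⟩ := h
  have h := congrArg (Def.map 𝒜 X.d X.br (pathEval B 1)) (MC.mk_eq_const X μ)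
  refine Eq.trans ?_ h.symm
  exact congrArg (Quot.mk _) (MC.map_pathEval_pathConst X 1 _).symm

end Homotopy

/-! ### Classification by the mini-versal family -/

section Classification

variable {k : Type u} [Field k] [CharZero k]
variable {A : Type v} [Ring A] [Algebra k A] {𝒜 : ZMod 2 → Submodule k A} [GradedAlgebra 𝒜]
  (X : DGBV 𝒜)
variable {M : Type v} [AddCommGroup M] [Module k M] {ℳ : ZMod 2 → Submodule k M}
  [DirectSum.Decomposition ℳ]
variable {B : DGArtin k}

variable (B) in
/-- The ideal of paths vanishing at both ends. -/
def loopIdeal : Submodule k B.path.carrier :=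
  LinearMap.ker (pathEval B 0).toAlgHom.toLinearMap ⊓
    LinearMap.ker (pathEval B 1).toAlgHom.toLinearMap

theorem pathEval_mem_maxIdeal (c : k) {f : B.path.carrier} :
    (pathEval B c).toAlgHom f ∈ B.maxIdeal ↔ f ∈ B.path.maxIdeal := by
  change B.aug _ = 0 ↔ B.path.aug f = 0
  rw [(pathEval B c).map_aug]

theorem isSuperIdeal_loopIdeal : IsSuperIdeal B.path.toArtinSuperalgebra (loopIdeal B) := by
  refine .of_homog (fun f hf i => ⟨?_, ?_⟩) (fun f hf => ?_)
    (Submodule.mul_le.2 fun f _ g hg => ⟨?_, ?_⟩)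
  · change (pathEval B 0).toAlgHom (proj _ i f) = 0
    rw [map_proj (pathEval B 0).toHom, show (pathEval B 0).toAlgHom f = 0 from hf.1, map_zero]
  · change (pathEval B 1).toAlgHom (proj _ i f) = 0
    rw [map_proj (pathEval B 1).toHom, show (pathEval B 1).toAlgHom f = 0 from hf.2, map_zero]
  · rw [← pathEval_mem_maxIdeal 0, show (pathEval B 0).toAlgHom f = 0 from hf.1]
    exact Submodule.zero_mem _
  · change (pathEval B 0).toAlgHom (f * g) = 0
    rw [map_mul, show (pathEval B 0).toAlgHom g = 0 from hg.1, mul_zero]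
  · change (pathEval B 1).toAlgHom (f * g) = 0
    rw [map_mul, show (pathEval B 1).toAlgHom g = 0 from hg.2, mul_zero]

theorem mem_tens_loopIdeal {V : Type v} [AddCommGroup V] [Module k V] {x : B.path.carrier ⊗[k] V} :
    x ∈ tens (loopIdeal B) V ↔
      baseMap V (pathEval B 0).toHom x = 0 ∧ baseMap V (pathEval B 1).toHom x = 0 := by
  constructor
  · intro h
    have h0 := rTensor_mem_tens (I := loopIdeal B) (J := ⊥)
      (pathEval B 0).toAlgHom.toLinearMap (fun b hb => hb.1) h
    have h1 := rTensor_mem_tens (I := loopIdeal B) (J := ⊥)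
      (pathEval B 1).toAlgHom.toLinearMap (fun b hb => hb.2) h
    rw [tens_bot] at h0 h1
    exact ⟨h0, h1⟩
  · rintro ⟨h0, h1⟩
    refine mem_tens_of_rTensor (J := ⊥)
      (LinearMap.inl k B.carrier B.carrier ∘ₗ (pathEval B 0).toAlgHom.toLinearMap +
        LinearMap.inr k B.carrier B.carrier ∘ₗ (pathEval B 1).toAlgHom.toLinearMap)
      (fun f hf => ?_) ?_
    · have h : ((pathEval B 0).toAlgHom f + 0, 0 + (pathEval B 1).toAlgHom f) =
        ((0, 0) : B.carrier × B.carrier) := hf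
      rw [add_zero, zero_add, Prod.mk.injEq] at h
      exact h
    · rw [LinearMap.rTensor_add, LinearMap.rTensor_comp, LinearMap.rTensor_comp, tens_bot]
      change LinearMap.rTensor V _ (baseMap V (pathEval B 0).toHom x) +
        LinearMap.rTensor V _ (baseMap V (pathEval B 1).toHom x) = 0
      rw [h0, h1, map_zero, map_zero, add_zero]

variable {Γ : FormalMap ℳ 𝒜 0} {s : M →ₗ[k] A} (hs : HasLinearPart Γ s)
  (hcurv : ∀ (B : ArtinSuperalgebra k) (x : pts ℳ B 0), curv 𝒜 X.d X.br B (Γ.app B x) = 0)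

theorem map_mcPoint {C : DGArtin k} (f : B.Hom C) (x : pts ℳ B.toArtinSuperalgebra 0)
    (hx : coeffDiff M B x = 0) (y : pts ℳ C.toArtinSuperalgebra 0) (hy : coeffDiff M C y = 0)
    (h : y = ptsMap ℳ f.toHom 0 x) :
    MC.map 𝒜 X.d X.br f (mcPoint X hs hcurv x hx) = mcPoint X hs hcurv y hy := by
  subst h
  exact Subtype.ext (Γ.natural _ _ f.toHom x).symm

/-- Closed points with exact difference have gauge equivalent values, being joined by the closed
path `y + D (t h)`, where `D` is the differential of the path algebra. -/
theorem mk_mcPoint_eq (x y : pts ℳ B.toArtinSuperalgebra 0) (hx : coeffDiff M B x = 0)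
    (hy : coeffDiff M B y = 0) (h : pts ℳ B.toArtinSuperalgebra 1)
    (hxy : (x : B.carrier ⊗[k] M) - y = coeffDiff M B h) :
    (Quot.mk _ (mcPoint X hs hcurv x hx) : Def 𝒜 X.d X.br B) =
      Quot.mk _ (mcPoint X hs hcurv y hy) := by
  have hH := pathLine_mem_pts h.2
  have hdH : coeffDiff M B.path ((pathLine B).rTensor M h) ∈
      pts ℳ B.path.toArtinSuperalgebra 0 :=
    coeffDiff_mem_gpts B.path (fun b _ => diff_mem_maxIdeal B.path b) (by decide) hH
  let z : pts ℳ B.path.toArtinSuperalgebra 0 :=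
    ptsMap ℳ (pathConst B).toHom 0 y + ⟨_, hdH⟩
  have hzc : (z : B.path.carrier ⊗[k] M) = baseMap M (pathConst B).toHom y +
    coeffDiff M B.path ((pathLine B).rTensor M h) := rfl
  have hz : coeffDiff M B.path z = 0 := by
    rw [hzc, map_add, coeffDiff_coeffDiff, add_zero, ← baseMap_coeffDiff, hy, map_zero]
  have hev : ∀ c : k, baseMap M (pathEval B c).toHom z = y + c • coeffDiff M B h := by
    intro c
    rw [hzc, map_add, baseMap_pathEval_pathConst, baseMap_coeffDiff,
      baseMap_pathEval_pathLine c (gpts_le_tens h.2), map_smul]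
  refine (MC.Homotopic.mk_eq X ⟨mcPoint X hs hcurv z hz, ?_, ?_⟩).symm
  · refine map_mcPoint X hs hcurv _ z hz y hy (Subtype.ext ?_)
    exact ((hev 0).trans (by rw [zero_smul, add_zero])).symm
  · refine map_mcPoint X hs hcurv _ z hz x hx (Subtype.ext ?_)
    exact ((hev 1).trans (by rw [one_smul, ← hxy, add_sub_cancel])).symm

end Classification

section Injectivity

variable {k : Type u} [Field k] [CharZero k]
variable {A : Type v} [Ring A] [Algebra k A] {𝒜 : ZMod 2 → Submodule k A} [GradedAlgebra 𝒜]
  (X : DGBV 𝒜)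
variable {M : Type v} [AddCommGroup M] [Module k M] {ℳ : ZMod 2 → Submodule k M}
  [DirectSum.Decomposition ℳ]
variable {B : DGArtin k} {Γ : FormalMap ℳ 𝒜 0} (C : Contraction ℳ 𝒜 X.d)
  (hs : HasLinearPart Γ C.s)
  (hcurv : ∀ (B : ArtinSuperalgebra k) (x : pts ℳ B 0), curv 𝒜 X.d X.br B (Γ.app B x) = 0)

/-- The difference of the ends of a closed path is exact, with primitive the integral of the
path. -/
theorem exists_primitive (z : pts ℳ B.path.toArtinSuperalgebra 0)
    (hz : coeffDiff M B.path z = 0) : ∃ h : pts ℳ B.toArtinSuperalgebra 1,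
      baseMap M (pathEval B 1).toHom z.1 - baseMap M (pathEval B 0).toHom z.1 =
        coeffDiff M B h := by
  have hm : baseMap M (pathEval B 1).toHom ((pathInt B).rTensor M z.1) ∈
      pts ℳ B.toArtinSuperalgebra 1 := by
    refine baseMap_mem_pts ℳ (pathEval B 1).toHom 1 ?_
    refine rTensor_mem_gpts (B := B.path.toArtinSuperalgebra) (C := B.path.toArtinSuperalgebra)
      (pathInt B) (i := 0) (c := 1) (by decide) (fun p b hb hm => ⟨pathInt_mem_gr hb, ?_⟩) z.2
    rw [show B.path.maxIdeal = _ from pathPow_one.symm] at hm ⊢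
    exact pathInt_mem_pathPow hm
  refine ⟨⟨_, hm⟩, ?_⟩
  have h := coeffDiff_pathInt z.1
  rw [show coeffDiff M B.path z.1 = 0 from hz, map_zero, add_zero] at h
  change _ = coeffDiff M B (baseMap M (pathEval B 1).toHom ((pathInt B).rTensor M z.1))
  rw [← baseMap_coeffDiff, h, map_sub, baseMap_pathEval_pathConst]

/-- Closed points with gauge equivalent values differ by an exact point: a homotopy of the values is
equivalent, relative to its ends, to the value at a closed path. -/
theorem exists_sub_eq_coeffDiff (x y : pts ℳ B.toArtinSuperalgebra 0)
    (hx : coeffDiff M B x = 0) (hy : coeffDiff M B y = 0)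
    (hxy : (Quot.mk _ (mcPoint X hs hcurv x hx) : Def 𝒜 X.d X.br B) =
      Quot.mk _ (mcPoint X hs hcurv y hy)) :
    ∃ h : pts ℳ B.toArtinSuperalgebra 1, (x : B.carrier ⊗[k] M) - y = coeffDiff M B h := by
  obtain ⟨μ, h0, h1⟩ := MC.homotopic_of_eq X hxy.symm
  have hL : (pathLine B).rTensor M ((x : B.carrier ⊗[k] M) - y) ∈
      pts ℳ B.path.toArtinSuperalgebra 0 := pathLine_mem_pts (Submodule.sub_mem _ x.2 y.2)
  -- the straight path from `y` to `x`
  let l : pts ℳ B.path.toArtinSuperalgebra 0 := ptsMap ℳ (pathConst B).toHom 0 y + ⟨_, hL⟩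
  have hlc : (l : B.path.carrier ⊗[k] M) = baseMap M (pathConst B).toHom y +
    (pathLine B).rTensor M ((x : B.carrier ⊗[k] M) - y) := rfl
  have hev : ∀ c : k, baseMap M (pathEval B c).toHom l = y + c • ((x : B.carrier ⊗[k] M) - y) := by
    intro c
    rw [hlc, map_add, baseMap_pathEval_pathConst,
      baseMap_pathEval_pathLine c (gpts_le_tens (Submodule.sub_mem _ x.2 y.2))]
  have hl0 : baseMap M (pathEval B 0).toHom l = y := by rw [hev, zero_smul, add_zero]
  have hl1 : baseMap M (pathEval B 1).toHom l = x := by rw [hev, one_smul, add_sub_cancel]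
  have hΓ : ∀ (c : k) (w : pts ℳ B.toArtinSuperalgebra 0),
      baseMap M (pathEval B c).toHom l = w →
      baseMap A (pathEval B c).toHom (Γ.app B.path.toArtinSuperalgebra l) =
        Γ.app B.toArtinSuperalgebra w := by
    intro c w hw
    have h := Γ.natural _ _ (pathEval B c).toHom l
    rw [show ptsMap ℳ (pathEval B c).toHom 0 l = w from Subtype.ext hw] at h
    exact (congrArg Subtype.val h).symm
  have hμ : ∀ (c : k) (w : MC 𝒜 X.d X.br B), MC.map 𝒜 X.d X.br (pathEval B c) μ = w →
      baseMap A (pathEval B c).toHom μ.1.1 = w.1.1 := by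
    rintro c w rfl
    rfl
  obtain ⟨z, hz, hzl, -⟩ := exists_closed_point X C hs hcurv isSuperIdeal_loopIdeal μ l
    (by
      rw [mem_tens_loopIdeal, map_sub, map_sub, hμ 0 _ h0, hμ 1 _ h1, hΓ 0 y hl0, hΓ 1 x hl1]
      exact ⟨sub_self _, sub_self _⟩)
    (by
      rw [mem_tens_loopIdeal, baseMap_coeffDiff, baseMap_coeffDiff, hl0, hl1]
      exact ⟨hy, hx⟩)
  rw [mem_tens_loopIdeal, map_sub, map_sub, hl0, hl1, sub_eq_zero, sub_eq_zero] at hzl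
  obtain ⟨h, hh⟩ := exists_primitive z hz
  refine ⟨h, ?_⟩
  rw [← hh, hzl.1, hzl.2]

/-- A family of Maurer-Cartan elements whose differential at the base point is the inclusion `s` of
a contraction represents the deformation functor. -/
theorem classifies_of_contraction (hs : HasLinearPart Γ C.s)
    (hcurv : ∀ (B : ArtinSuperalgebra k) (x : pts ℳ B 0), curv 𝒜 X.d X.br B (Γ.app B x) = 0) :
    Classifies ℳ 𝒜 X.d X.br Γ := by
  refine ⟨fun B x => Quot.mk _ (mcPoint X hs hcurv x.1 x.2), fun B x => ⟨_, rfl, rfl⟩,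
    fun B C f x y h => congrArg (Quot.mk _) (map_mcPoint X hs hcurv f x.1 x.2 y.1 y.2 h),
    fun B => ?_, fun B x y => ⟨fun h => exists_sub_eq_coeffDiff X C hs hcurv x.1 y.1 x.2 y.2 h,
      fun ⟨h, hh⟩ => mk_mcPoint_eq X hs hcurv x.1 y.1 x.2 y.2 h hh⟩⟩
  rintro ⟨γ⟩
  obtain ⟨x, hx, -, h⟩ := exists_closed_point X C hs hcurv
    (isSuperIdeal_maxIdeal B.toArtinSuperalgebra) γ 0
    (gpts_le_tens (Submodule.sub_mem _ γ.1.2 (Γ.app B.toArtinSuperalgebra 0).2))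
    (by rw [ZeroMemClass.coe_zero, map_zero]; exact Submodule.zero_mem _)
  exact ⟨⟨x, hx⟩, h.symm⟩

end Injectivity

end SemiInf

end

theorem proposition6p4p1 {k : Type u} [Field k] [CharZero k] {A : Type v} [Ring A] [Algebra k A]
    (𝒜 : ZMod 2 → Submodule k A) [GradedAlgebra 𝒜] (X : SemiInf.DGBV 𝒜)
    (h₁ : LinearMap.range X.d ⊓ LinearMap.ker X.Δ = LinearMap.range X.Δ ⊓ LinearMap.ker X.d)
    (h₂ : LinearMap.range X.Δ ⊓ LinearMap.ker X.d = LinearMap.range X.d ⊓ LinearMap.range X.Δ) :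
    -- there is a mini-versal family over `(H(A, d), 0)` with vanishing vector field
    (∃ Γ : SemiInf.FormalMap (SemiInf.cohGr 𝒜 X.d) 𝒜 0,
      SemiInf.IsMiniVersal (SemiInf.cohGr 𝒜 X.d) 𝒜 X.d X.br
        (SemiInf.FormalMap.zero _ _ 1) Γ) ∧
    ∀ (M : Type v) [AddCommGroup M] [Module k M] (ℳ : ZMod 2 → Submodule k M)
      [DirectSum.Decomposition ℳ] (Q : SemiInf.FormalMap ℳ ℳ 1) (Γ : SemiInf.FormalMap ℳ 𝒜 0),
      SemiInf.IsMiniVersal ℳ 𝒜 X.d X.br Q Γ →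
        -- every mini-versal dg manifold has vanishing vector field
        Q = SemiInf.FormalMap.zero ℳ ℳ 1 ∧
        -- and represents the deformation functor
        SemiInf.Classifies ℳ 𝒜 X.d X.br Γ ∧
        ∀ (B : SemiInf.ArtinSuperalgebra k) (x : SemiInf.pts ℳ B 0),
          -- the fibres of the local system, for Laurent series in `ħ`
          X.FibreIso B (Γ.app B x) (SemiInf.laurent k _) (SemiInf.laurent k _) ∧
          -- the fibres of the local system, for series infinite in both directions
          (LinearMap.range X.d ⊓ LinearMap.range X.Δ ≤ LinearMap.range (X.d ∘ₗ X.Δ) →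
            X.FibreIso B (Γ.app B x) ⊤ ⊤) := by
  have hΔ : ∀ a, X.d (X.Δ a) = 0 →
      X.Δ a ∈ LinearMap.range X.d ⊓ LinearMap.range X.Δ := fun a ha => by
    rw [← h₂]
    exact ⟨⟨a, rfl⟩, ha⟩
  have hd : ∀ a, X.Δ (X.d a) = 0 →
      X.d a ∈ LinearMap.range X.d ⊓ LinearMap.range X.Δ := fun a ha => by
    rw [← h₂, ← h₁]
    exact ⟨⟨a, rfl⟩, ha⟩
  have hex : ∀ a, X.d (X.Δ a) = 0 → ∃ b, X.d b = X.Δ a := fun a ha => (hΔ a ha).1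
  constructor
  · obtain ⟨C, hC⟩ := SemiInf.exists_contraction (𝒜 := 𝒜) X.d_odd X.d_sq
    exact ⟨_, SemiInf.isMiniVersal_kuranishiMap X hex C hC⟩
  · intro M _ _ ℳ _ Q Γ hΓ
    obtain ⟨-, hdg, s, hds, hlin, hbij⟩ := hΓ
    have hs : SemiInf.HasLinearPart Γ s := hlin
    obtain ⟨C, rfl⟩ := SemiInf.Contraction.transport ℳ X.d_odd X.d_sq s hds hs.even hbij
    have hQ : ∀ (B : SemiInf.ArtinSuperalgebra k) (x : SemiInf.pts ℳ B 0),
        (Q.app B x : B.carrier ⊗[k] M) = 0 :=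
      fun B x => SemiInf.vectorField_eq_zero X hex C hdg hs x
    have hcurv : ∀ (B : SemiInf.ArtinSuperalgebra k) (x : SemiInf.pts ℳ B 0),
        SemiInf.curv 𝒜 X.d X.br B (Γ.app B x) = 0 :=
      fun B => SemiInf.curv_eq_zero X hdg (hQ B)
    refine ⟨?_, SemiInf.classifies_of_contraction X C hs hcurv, fun B x =>
      ⟨SemiInf.fibreIso_laurent X hex (Γ.app B x).2 (hcurv B x), fun h => ?_⟩⟩
    · have : Q.app = (SemiInf.FormalMap.zero ℳ ℳ 1).app :=
        funext fun B => funext fun x => Subtype.ext (hQ B x)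
      cases Q
      cases this
      rfl
    · exact SemiInf.fibreIso_top X (fun a ha => h (hd a ha)) (fun a ha => h (hΔ a ha))
        (Γ.app B x).2 (hcurv B x)
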